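/- **Setting.** Let $k$ be a field and write $\Delta(h)=h_1\otimes h_2$. A coquasitriangular (CQT) Hopf algebra $(H,\sigma)$ over $k$ is a Hopf algebra $H$ (antipode $S$) with a convolution-invertible bilinear form $\sigma:H\otimes H\to k$ such that for all $h,h',g\in H$ $$\sigma(hh',g)=\sigma(h,g_1)\sigma(h',g_2),\quad \sigma(g,hh')=\sigma(g_2,h)\sigma(g_1,h'),\quad \sigma(1,h)=\sigma(h,1)=\varepsilon(h),\quad \sigma(h_1,h'_1)h_2h'_2=h'_1h_1\sigma(h_2,h'_2).$$ Then $S$ is bijective. Let $A,X\subseteq H$ be sub-Hopf algebras. For $x\in X$, $a\in A$ let $l_x=\sigma(-,x)$, $r_a=\sigma(a,-)$ in the convolution algebra $H^*$, and let $H_{X,A}\subseteq H^*$ be the subalgebra generated by all $l_x$ and $r_a$, with comultiplication $f\mapsto f_1\otimes f_2$, $f(hh')=f_1(h)f_2(h')$, and counit $f\mapsto f(1)$. It is a Hopf algebra, and its co-opposite $K:=H_{X,A}^{\rm cop}$ (same algebra, comultiplication $f\mapsto f_2\otimes f_1$) is a Hopf algebra with antipode $f\mapsto f\circ S^{-1}$.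 *Right comodules.* $\mathcal M^X$ is the category of right $X$-comodules, $m\mapsto m_{(0)}\otimes m_{(1)}$, with $M\otimes N$ coacted on by $m\otimes n\mapsto m_{(0)}\otimes n_{(0)}\otimes m_{(1)}n_{(1)}$, and braiding $c(m\otimes n)=\sigma(m_{(1)},n_{(1)})\,n_{(0)}\otimes m_{(0)}$. *Yetter–Drinfeld modules.* ${}^K_K\mathcal{YD}$ is the category of left $K$-modules and left $K$-comodules with $\kappa_1m_{-1}\otimes\kappa_2\cdot m_0=(\kappa_1\cdot m)_{-1}\kappa_2\otimes(\kappa_1\cdot m)_0$ (indices refer to the comultiplication of $K$), with tensor product $\kappa\cdot(m\otimes n)=\kappa_1\cdot m\otimes\kappa_2\cdot n$, $m\otimes n\mapsto m_{-1}n_{-1}\otimes m_0\otimes n_0$, and braiding $\mathbf c(m\otimes n)=m_{-1}\cdot n\otimes m_0$. *The braided Hopf algebra $\underline{\underline X}$.* This is $X$ with coaction $x\mapsto x_2\otimes S(x_1)x_3$, product $x\cdot y=\sigma(S(x_1)x_3,S(y_1))\,x_2y_2$, the unit, comultiplication and counit of $X$, and antipode $x\mapsto\sigma(S^2(x_3)S(x_1),x_4)\,S(x_2)$.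 *The braided Hopf algebra $\underline X$.* Let $D=D(K,X)$ be the generalized quantum double for the pairing $\langle f,x\rangle=f(x)$: the coalgebra is $K\otimes X$, the unit is $1\otimes1$, the product is $$(f\otimes h)(g\otimes y)=\langle g_1,h_1\rangle\langle S_K(g_3),h_3\rangle\, fg_2\otimes h_2y,$$ and the antipode is $S_D(f\otimes h)=(1\otimes S(h))(S_K(f)\otimes1)$. Put $i(f)=f\otimes1$, $\gamma(y)=l_{S^{-1}(y)}$, $\pi(f\otimes y)=f\gamma(y)$, $\Pi(d)=d_1\,i(S_K(\pi(d_2)))$, and $B=\{d\in D: d_1\otimes\pi(d_2)=d\otimes1\}$. The braided Hopf algebra $B$ in ${}^K_K\mathcal{YD}$ from Radford's biproduct decomposition $D\cong B\times K$ has action $\kappa\triangleright b=i(\kappa_1)\,b\,i(S_K(\kappa_2))$, coaction $b\mapsto\pi(b_1)\otimes b_2$, the product, unit and counit of $D$, comultiplication $\Pi(d)\mapsto\Pi(d_1)\otimes\Pi(d_2)$ and antipode $b\mapsto i(\pi(b_1))S_D(b_2)$. The map $\theta:X\to D$, $\theta(y)=l_{S^{-2}(y_2)}\otimes y_1$, is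 injective with image $B$, and $\underline X$ is the space $X$ with the structure of $B$ transported along $\theta$. **Theorem.** Let $(H,\sigma)$ be a CQT Hopf algebra and $A,X$ sub-Hopf algebras of $H$. Then: 1. $H_{X,A}=H_{l_X}H_{r_A}=H_{r_A}H_{l_X}$, where $H_{l_X}=\{l_x:x\in X\}$ and $H_{r_A}=\{r_a:a\in A\}$. 2. With the tensor products and braidings above, $\mathcal M^X$ and ${}^K_K\mathcal{YD}$ are braided monoidal categories. 3. There is a braided monoidal functor $\mathbf F:\mathcal M^X\to{}^K_K\mathcal{YD}$ with $\mathbf F(M)=M$ as a vector space, with $$f\triangleright m=f(S^{-2}(m_{(1)}))\,m_{(0)},\qquad \lambda(m)=l_{S^{-2}(m_{(1)})}\otimes m_{(0)},$$ and with $\mathbf F(g)=g$ on morphisms. Its monoidal structure is given by $\varphi_0=\mathrm{id}_k$ and the isomorphisms $$\varphi_2(m\otimes n)=\sigma^{-1}(m_{(1)},n_{(1)})\,m_{(0)}\otimes n_{(0)},$$ where $\sigma^{-1}$ is the convolution inverse of $\sigma$. 4. $\underline{\underline X}$ is a Hopf algebra in $\mathcal M^X$. Hence $\mathbf F(\underline{\underline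 X})$ is a Hopf algebra in ${}^K_K\mathcal{YD}$, with product $\mathbf F(m)\circ\varphi_2$, unit $\mathbf F(\eta)\circ\varphi_0$, comultiplication $\varphi_2^{-1}\circ\mathbf F(\Delta)$, counit $\varphi_0^{-1}\circ\mathbf F(\varepsilon)$ and antipode $\mathbf F(\underline{\underline S})$, where $m,\eta,\Delta,\varepsilon,\underline{\underline S}$ are the structure maps of $\underline{\underline X}$. 5. The map $\theta$ is a bijection from $X$ onto $B$, and $\mathbf F(\underline{\underline X})=\underline X$ as braided Hopf algebras: $\theta$ carries the action, coaction, product, unit, comultiplication, counit and antipode of $\mathbf F(\underline{\underline X})$ to those of $B$. -/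

import Mathlib

open Coalgebra HopfAlgebra TensorProduct
open scoped TensorProduct

/-- A coquasitriangular structure on a bialgebra `H`: a convolution invertible bilinear form `σ`
with `σ(hh', g) = σ(h, g₁) σ(h', g₂)`, `σ(g, hh') = σ(g₂, h) σ(g₁, h')`,
`σ(1, h) = σ(h, 1) = ε(h)` and `σ(h₁, h'₁) h₂ h'₂ = h'₁ h₁ σ(h₂, h'₂)`. The field `inv` is the
convolution inverse of `σ`. -/
structure CQTStructure (k H : Type*) [Field k] [Ring H] [Bialgebra k H] where
  form : H →ₗ[k] H →ₗ[k] k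
  inv : H →ₗ[k] H →ₗ[k] k
  form_conv_inv : WithConv.toConv (TensorProduct.lift form) *
    WithConv.toConv (TensorProduct.lift inv) = 1
  inv_conv_form : WithConv.toConv (TensorProduct.lift inv) *
    WithConv.toConv (TensorProduct.lift form) = 1
  form_mul_left : ∀ h h' : H, WithConv.toConv (form (h * h')) =
    WithConv.toConv (form h) * WithConv.toConv (form h')
  form_mul_right : ∀ h h' : H, WithConv.toConv (form.flip (h * h')) =
    WithConv.toConv (form.flip h') * WithConv.toConv (form.flip h)
  form_one_left : form 1 = counit
  form_one_right : form.flip 1 = counit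
  comm : WithConv.toConv (Algebra.linearMap k H ∘ₗ TensorProduct.lift form) *
      WithConv.toConv (LinearMap.mul' k H) =
    WithConv.toConv (LinearMap.mul' k H ∘ₗ (TensorProduct.comm k H H).toLinearMap) *
      WithConv.toConv (Algebra.linearMap k H ∘ₗ TensorProduct.lift form)

section tree
variable {k : Type*} [Field k] {H : Type*} [Ring H] [HopfAlgebra k H]

/-- middle form of four-fold comultiplication -/
lemma comul_comul_mid {V : Type*} [AddCommGroup V] [Module k V]
    (Q : (H ⊗[k] H) ⊗[k] (H ⊗[k] H) →ₗ[k] V) (Q' : H ⊗[k] (H ⊗[k] H) →ₗ[k] V)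
    (hQ : ∀ a x d, Q ((TensorProduct.assoc k H H (H ⊗[k] H)).symm
      (a ⊗ₜ (TensorProduct.assoc k H H H (comul x ⊗ₜ d)))) = Q' (a ⊗ₜ (x ⊗ₜ d))) (h : H) :
    Q (TensorProduct.map comul comul (comul (R := k) h)) =
      Q' (TensorProduct.map LinearMap.id comul (comul (R := k) h)) := by
  have e : (TensorProduct.map comul comul ∘ₗ (comul : H →ₗ[k] H ⊗[k] H)) =
   (TensorProduct.assoc k H H (H ⊗[k] H)).symm.toLinearMap ∘ₗ TensorProduct.map LinearMap.id
     ((TensorProduct.assoc k H H H).toLinearMap ∘ₗ TensorProduct.map comul LinearMap.id) ∘ₗ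
      TensorProduct.map LinearMap.id comul ∘ₗ comul := by
    simp only [coassoc_simps]
  have e' : Q ∘ₗ (TensorProduct.assoc k H H (H ⊗[k] H)).symm.toLinearMap ∘ₗ
      TensorProduct.map LinearMap.id ((TensorProduct.assoc k H H H).toLinearMap ∘ₗ
        TensorProduct.map comul LinearMap.id) = Q' := by
    ext a x d
    exact hQ a x d
  have := LinearMap.congr_fun e h
  simp only [LinearMap.comp_apply] at this
  rw [this, ← e']
  rfl

lemma map_comul_left {V : Type*} [AddCommGroup V] [Module k V]
    (Q : (H ⊗[k] H) ⊗[k] H →ₗ[k] V) (h : H) :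
    Q (TensorProduct.map comul LinearMap.id (comul (R := k) h)) =
      Q ((TensorProduct.assoc k H H H).symm
        (TensorProduct.map LinearMap.id comul (comul (R := k) h))) := by
  congr 1
  rw [LinearEquiv.eq_symm_apply]
  exact Coalgebra.coassoc_apply h

lemma comul_antipode' (h : H) : comul (R := k) (antipode k h) =
    TensorProduct.map (antipode k) (antipode k) (TensorProduct.comm k H H (comul (R := k) h)) := by
  have h1 : WithConv.toConv ((comul : H →ₗ[k] H ⊗[k] H) ∘ₗ antipode k) *
      WithConv.toConv (comul : H →ₗ[k] H ⊗[k] H) = 1 := by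
    have := LinearMap.algHom_comp_convMul_distrib (Bialgebra.comulAlgHom k H)
      (WithConv.toConv (antipode k)) (WithConv.toConv LinearMap.id)
    rw [LinearMap.antipode_mul_id] at this
    have h2 := congrArg WithConv.toConv this
    refine Eq.trans h2.symm ?_
    ext x
    simp [Algebra.TensorProduct.algebraMap_apply]
  let i1 : H →ₐ[k] H ⊗[k] H := Algebra.TensorProduct.includeLeft
  let i2 : H →ₐ[k] H ⊗[k] H := Algebra.TensorProduct.includeRight
  have ei (i : H →ₐ[k] H ⊗[k] H) : WithConv.toConv i.toLinearMap *
      WithConv.toConv (i.toLinearMap ∘ₗ antipode k) = 1 := by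
    have := LinearMap.algHom_comp_convMul_distrib i
      (WithConv.toConv LinearMap.id) (WithConv.toConv (antipode k))
    rw [LinearMap.id_mul_antipode] at this
    have h2 := congrArg WithConv.toConv this
    refine Eq.trans h2.symm ?_
    ext x
    simp
  have hΔ : WithConv.toConv (comul : H →ₗ[k] H ⊗[k] H) =
      WithConv.toConv i1.toLinearMap * WithConv.toConv i2.toLinearMap := by
    ext x
    rw [LinearMap.convMul_apply]
    have e : (LinearMap.id : H ⊗[k] H →ₗ[k] H ⊗[k] H) =
        LinearMap.mul' k (H ⊗[k] H) ∘ₗ TensorProduct.map i1.toLinearMap i2.toLinearMap := by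
      ext a b
      simp [i1, i2]
    exact LinearMap.congr_fun e (comul x)
  have hΔ' : WithConv.toConv (TensorProduct.map (antipode k) (antipode k) ∘ₗ
        (TensorProduct.comm k H H).toLinearMap ∘ₗ (comul : H →ₗ[k] H ⊗[k] H)) =
      WithConv.toConv (i2.toLinearMap ∘ₗ antipode k) *
        WithConv.toConv (i1.toLinearMap ∘ₗ antipode k) := by
    ext x
    rw [LinearMap.convMul_apply]
    have e : (TensorProduct.map (antipode k) (antipode k) ∘ₗ
        (TensorProduct.comm k H H).toLinearMap : H ⊗[k] H →ₗ[k] H ⊗[k] H) =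
        LinearMap.mul' k (H ⊗[k] H) ∘ₗ TensorProduct.map (i2.toLinearMap ∘ₗ antipode k)
          (i1.toLinearMap ∘ₗ antipode k) := by
      ext a b
      simp [i1, i2]
    exact LinearMap.congr_fun e (comul x)
  have h2 : WithConv.toConv (comul : H →ₗ[k] H ⊗[k] H) *
      WithConv.toConv (TensorProduct.map (antipode k) (antipode k) ∘ₗ
        (TensorProduct.comm k H H).toLinearMap ∘ₗ (comul : H →ₗ[k] H ⊗[k] H)) = 1 := by
    rw [hΔ, hΔ', mul_assoc, ← mul_assoc (WithConv.toConv i2.toLinearMap), ei, one_mul, ei]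
  exact LinearMap.congr_fun (congrArg WithConv.ofConv (left_inv_eq_right_inv h1 h2)) h
end tree

namespace CQTStructure
variable {k : Type*} [Field k] {H : Type*} [Ring H] [HopfAlgebra k H] (s : CQTStructure k H)

lemma comm_apply (t : (H ⊗[k] H)) :
    (TensorProduct.lid k H) (TensorProduct.map (TensorProduct.lift s.form) (LinearMap.mul' k H)
      (comul (R := k) t)) =
    (TensorProduct.rid k H) (TensorProduct.map (LinearMap.mul' k H ∘ₗ (TensorProduct.comm k H H).toLinearMap)
      (TensorProduct.lift s.form) (comul (R := k) t)) := by
  have := LinearMap.congr_fun (congrArg WithConv.ofConv s.comm) t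
  have e1 : (TensorProduct.lid k H).toLinearMap ∘ₗ TensorProduct.map (TensorProduct.lift s.form) (LinearMap.mul' k H) = LinearMap.mul' k H ∘ₗ TensorProduct.map (Algebra.linearMap k H ∘ₗ TensorProduct.lift s.form) (LinearMap.mul' k H) := by
    ext a b c d; simp [Algebra.smul_def]
  have e2 : (TensorProduct.rid k H).toLinearMap ∘ₗ TensorProduct.map (LinearMap.mul' k H ∘ₗ (TensorProduct.comm k H H).toLinearMap) (TensorProduct.lift s.form) = LinearMap.mul' k H ∘ₗ TensorProduct.map (LinearMap.mul' k H ∘ₗ (TensorProduct.comm k H H).toLinearMap) (Algebra.linearMap k H ∘ₗ TensorProduct.lift s.form)  := by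
    ext a b c d; simp [Algebra.smul_def, Algebra.commutes]
  have h1 := LinearMap.congr_fun e1 (comul t)
  have h2 := LinearMap.congr_fun e2 (comul t)
  simp only [LinearMap.comp_apply] at h1 h2
  exact h1.trans (Eq.trans this h2.symm)

/-- `v(h) = σ(h₁, S(h₂))`. -/
noncomputable def dv : H →ₗ[k] k := TensorProduct.lift s.form ∘ₗ TensorProduct.map LinearMap.id (antipode k) ∘ₗ comul

lemma form_mul_right' (g h h' : H) : s.form g (h * h') =
    LinearMap.mul' k k (TensorProduct.map (s.form.flip h') (s.form.flip h) (comul g)) :=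
  LinearMap.congr_fun (congrArg WithConv.ofConv (s.form_mul_right h h')) g

lemma form_mul_left' (h h' g : H) : s.form (h * h') g =
    LinearMap.mul' k k (TensorProduct.map (s.form h) (s.form h') (comul g)) :=
  LinearMap.congr_fun (congrArg WithConv.ofConv (s.form_mul_left h h')) g

lemma form_one_left' (g : H) : s.form 1 g = counit g := LinearMap.congr_fun s.form_one_left g
lemma form_one_right' (g : H) : s.form g 1 = counit g := LinearMap.congr_fun s.form_one_right g

/-- `v(h) 1 = v(h₂) S(h₃) h₁`. -/
lemma dv_smul_one (h : H) : s.dv h • (1 : H) =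
    (TensorProduct.lift ((LinearMap.mul k H).flip) ∘ₗ TensorProduct.map LinearMap.id
      (TensorProduct.lid k H ∘ₗ TensorProduct.map s.dv (antipode k)))
      (TensorProduct.map LinearMap.id comul (comul (R := k) h)) := by
  have key := s.comm_apply (TensorProduct.map LinearMap.id (antipode k) (comul (R := k) h))
  have e0 : ∀ t : H ⊗[k] H, comul (R := k) (TensorProduct.map LinearMap.id (antipode k) t) =
      TensorProduct.tensorTensorTensorComm k H H H H (TensorProduct.map LinearMap.id
        (TensorProduct.map (antipode k) (antipode k) ∘ₗ (TensorProduct.comm k H H).toLinearMap)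
          (TensorProduct.map comul comul t)) := by
    intro t
    induction t with
    | zero => simp
    | add x y hx hy => simp only [map_add, hx, hy]
    | tmul a b =>
      rw [TensorProduct.map_tmul, TensorProduct.comul_tmul, comul_antipode']
      rfl
  rw [e0] at key
  have k1 := comul_comul_mid ((TensorProduct.lid k H).toLinearMap ∘ₗ
    TensorProduct.map (TensorProduct.lift s.form) (LinearMap.mul' k H) ∘ₗ
    (TensorProduct.tensorTensorTensorComm k H H H H).toLinearMap ∘ₗ
    TensorProduct.map LinearMap.id
        (TensorProduct.map (antipode k) (antipode k) ∘ₗ (TensorProduct.comm k H H).toLinearMap))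
    (LinearMap.toSpanSingleton k H 1 ∘ₗ TensorProduct.lift s.form ∘ₗ
      TensorProduct.map LinearMap.id (antipode k) ∘ₗ TensorProduct.map LinearMap.id
      ((TensorProduct.lid k H).toLinearMap ∘ₗ TensorProduct.map counit LinearMap.id)) ?_ h
  · have k2 := comul_comul_mid ((TensorProduct.rid k H).toLinearMap ∘ₗ
    TensorProduct.map (LinearMap.mul' k H ∘ₗ (TensorProduct.comm k H H).toLinearMap) (TensorProduct.lift s.form) ∘ₗ
    (TensorProduct.tensorTensorTensorComm k H H H H).toLinearMap ∘ₗ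
    TensorProduct.map LinearMap.id
        (TensorProduct.map (antipode k) (antipode k) ∘ₗ (TensorProduct.comm k H H).toLinearMap))
     (TensorProduct.lift ((LinearMap.mul k H).flip) ∘ₗ TensorProduct.map LinearMap.id
      (TensorProduct.lid k H ∘ₗ TensorProduct.map s.dv (antipode k))) ?_ h
    · refine Eq.trans ?_ ((k1.symm.trans key).trans k2)
      have : TensorProduct.map LinearMap.id ((TensorProduct.lid k H).toLinearMap ∘ₗ
          TensorProduct.map counit LinearMap.id) (TensorProduct.map LinearMap.id comul (comul (R := k) h)) = comul h := by
        rw [← LinearMap.comp_apply, ← TensorProduct.map_comp]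
        have : ((TensorProduct.lid k H).toLinearMap ∘ₗ
          TensorProduct.map counit LinearMap.id) ∘ₗ (comul : H →ₗ[k] _) = LinearMap.id := by
          ext x
          have := Coalgebra.rTensor_counit_comul (R := k) x
          simp only [LinearMap.rTensor] at this
          simp [this]
        rw [this]; simp
      simp only [LinearMap.comp_apply] at this ⊢
      rw [this]
      simp [dv]
    · intro a x d
      generalize hw : comul (R := k) x = w
      have : s.dv x = TensorProduct.lift s.form (TensorProduct.map LinearMap.id (antipode k) w) := by
        simp [dv, hw]
      simp [this]
      clear hw this
      induction w with
      | zero => simp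
      | add x y hx hy => simp only [map_add, TensorProduct.add_tmul, TensorProduct.tmul_add, hx, hy, add_smul]
      | tmul p q => simp
  · intro a x d
    have := HopfAlgebra.mul_antipode_lTensor_comul_apply (R := k) x
    generalize hw : comul (R := k) x = w at this
    have e : ∀ w : H ⊗[k] H, (TensorProduct.lid k H) ((TensorProduct.map (TensorProduct.lift s.form) (LinearMap.mul' k H)) ((TensorProduct.tensorTensorTensorComm k H H H H) (TensorProduct.map LinearMap.id
        (TensorProduct.map (antipode k) (antipode k) ∘ₗ (TensorProduct.comm k H H).toLinearMap) ((TensorProduct.assoc k H H (H ⊗[k] H)).symm (a ⊗ₜ (TensorProduct.assoc k H H H (w ⊗ₜ d))))))) = s.form a (antipode k d) • LinearMap.mul' k H ((antipode k).lTensor H w) := by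
      intro w
      induction w with
      | zero => simp
      | add x y hx hy => simp only [map_add, TensorProduct.add_tmul, TensorProduct.tmul_add, hx, hy, smul_add]
      | tmul p q => simp
    refine (e w).trans ?_
    rw [this]
    simp [Algebra.algebraMap_eq_smul_one, smul_smul, mul_comm]

/-- `v(h₁) S²(h₂) = h₁ v(h₂)`. -/
lemma dv_antipode (h : H) :
    TensorProduct.lid k H (TensorProduct.map s.dv (antipode k ∘ₗ antipode k) (comul h)) =
    TensorProduct.rid k H (TensorProduct.map LinearMap.id s.dv (comul h)) := by
  have e : (TensorProduct.lid k H).toLinearMap ∘ₗ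
      TensorProduct.map s.dv (antipode k ∘ₗ antipode k) =
      TensorProduct.lift ((LinearMap.mul k H).flip) ∘ₗ
      TensorProduct.map (LinearMap.toSpanSingleton k H 1 ∘ₗ s.dv) (antipode k ∘ₗ antipode k) := by
    ext a b; simp
  have h1 := LinearMap.congr_fun e (comul h)
  simp only [LinearMap.comp_apply, LinearEquiv.coe_coe] at h1
  rw [h1]
  have e2 : LinearMap.toSpanSingleton k H 1 ∘ₗ s.dv = (TensorProduct.lift ((LinearMap.mul k H).flip) ∘ₗ TensorProduct.map LinearMap.id
      (TensorProduct.lid k H ∘ₗ TensorProduct.map s.dv (antipode k))) ∘ₗ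
      (TensorProduct.map LinearMap.id comul ∘ₗ comul) := by
    ext x
    simpa using s.dv_smul_one x
  rw [e2]
  have tree : TensorProduct.map (TensorProduct.map LinearMap.id comul ∘ₗ comul) LinearMap.id ∘ₗ
      (comul : H →ₗ[k] H ⊗[k] H) = (TensorProduct.assoc k H (H ⊗[k] H) H).symm.toLinearMap ∘ₗ
      TensorProduct.map LinearMap.id ((TensorProduct.assoc k H H H).symm.toLinearMap ∘ₗ
        TensorProduct.map LinearMap.id comul) ∘ₗ TensorProduct.map LinearMap.id comul ∘ₗ comul := by
    simp only [coassoc_simps]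
  set G : H ⊗[k] (H ⊗[k] H) →ₗ[k] H := TensorProduct.lift ((LinearMap.mul k H).flip) ∘ₗ
    TensorProduct.map (LinearMap.id : H →ₗ[k] H)
      (TensorProduct.lid k H ∘ₗ TensorProduct.map s.dv (antipode k)) with hG
  have tree' := LinearMap.congr_fun tree h
  have e3 : TensorProduct.map (G ∘ₗ (TensorProduct.map LinearMap.id comul ∘ₗ comul))
      ((antipode k : H →ₗ[k] H) ∘ₗ (antipode k : H →ₗ[k] H)) =
      TensorProduct.map G (antipode k ∘ₗ antipode k) ∘ₗ
        TensorProduct.map (TensorProduct.map LinearMap.id comul ∘ₗ comul) LinearMap.id := by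
    rw [← TensorProduct.map_comp, LinearMap.comp_id]
  rw [e3]
  simp only [LinearMap.comp_apply] at tree' ⊢
  rw [tree']
  have e4 : TensorProduct.lift ((LinearMap.mul k H).flip) ∘ₗ
      TensorProduct.map G ((antipode k : H →ₗ[k] H) ∘ₗ (antipode k : H →ₗ[k] H)) ∘ₗ
      (TensorProduct.assoc k H (H ⊗[k] H) H).symm.toLinearMap ∘ₗ
      TensorProduct.map LinearMap.id ((TensorProduct.assoc k H H H).symm.toLinearMap ∘ₗ
        TensorProduct.map LinearMap.id comul) =
      (TensorProduct.rid k H).toLinearMap ∘ₗ TensorProduct.map LinearMap.id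
        ((TensorProduct.rid k k).toLinearMap ∘ₗ TensorProduct.map s.dv (counit : H →ₗ[k] k)) := by
    ext a b y
    have := congrArg (antipode k) (HopfAlgebra.mul_antipode_lTensor_comul_apply (R := k) y)
    have e : ∀ w : H ⊗[k] H, TensorProduct.lift ((LinearMap.mul k H).flip)
        (TensorProduct.map G (antipode k ∘ₗ antipode k)
          ((TensorProduct.assoc k H (H ⊗[k] H) H).symm (a ⊗ₜ (TensorProduct.assoc k H H H).symm
            (b ⊗ₜ w)))) = s.dv b • (antipode k (LinearMap.mul' k H ((antipode k).lTensor H w)) * a) := by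
      intro w
      induction w with
      | zero => simp
      | add x y hx hy => simp only [map_add, TensorProduct.tmul_add, hx, hy, smul_add, add_mul]
      | tmul p q =>
        simp [hG, HopfAlgebra.antipode_mul_antidistrib, mul_assoc]
    refine (e _).trans ?_
    rw [this]
    simp [Algebra.algebraMap_eq_smul_one, smul_smul, mul_comm]
  refine (LinearMap.congr_fun e4 (TensorProduct.map LinearMap.id comul (comul h))).trans ?_
  have e5 : (TensorProduct.map (LinearMap.id : H →ₗ[k] H)
        ((TensorProduct.rid k k).toLinearMap ∘ₗ TensorProduct.map s.dv (counit : H →ₗ[k] k))) ∘ₗ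
      TensorProduct.map LinearMap.id comul ∘ₗ (comul : H →ₗ[k] H ⊗[k] H) =
      TensorProduct.map LinearMap.id s.dv ∘ₗ comul := by
    rw [← LinearMap.comp_assoc, ← TensorProduct.map_comp]
    congr 2
    ext x
    have e6 : (TensorProduct.rid k k).toLinearMap ∘ₗ TensorProduct.map s.dv (counit : H →ₗ[k] k) =
      s.dv ∘ₗ (TensorProduct.rid k H).toLinearMap ∘ₗ TensorProduct.map LinearMap.id counit := by
      ext a b; simp [mul_comm]
    rw [e6]
    have := Coalgebra.lTensor_counit_comul (R := k) x
    simp only [LinearMap.lTensor] at this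
    simp [this]
  exact congrArg (TensorProduct.rid k H) (LinearMap.congr_fun e5 h)

lemma lift_form_antipode : TensorProduct.lift s.inv =
    TensorProduct.lift s.form ∘ₗ TensorProduct.map (antipode k) LinearMap.id := by
  have h1 : WithConv.toConv (TensorProduct.lift s.form ∘ₗ TensorProduct.map (antipode k) LinearMap.id) *
      WithConv.toConv (TensorProduct.lift s.form) = 1 := by
    ext a b
    have e : ∀ w u : H ⊗[k] H, LinearMap.mul' k k (TensorProduct.map
        (TensorProduct.lift s.form ∘ₗ TensorProduct.map (antipode k) LinearMap.id)
        (TensorProduct.lift s.form) (TensorProduct.tensorTensorTensorComm k H H H H (w ⊗ₜ u))) =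
        LinearMap.mul' k k (TensorProduct.map (TensorProduct.lift s.form) (TensorProduct.lift s.form)
          (TensorProduct.tensorTensorTensorComm k H H H H ((antipode k).rTensor H w ⊗ₜ u))) := by
      intro w u
      induction w with
      | zero => simp
      | add x y hx hy => simp only [map_add, TensorProduct.add_tmul, hx, hy]
      | tmul p q =>
        induction u with
        | zero => simp
        | add x y hx hy => simp only [map_add, TensorProduct.tmul_add, hx, hy]
        | tmul r t => simp
    have e' : ∀ w : H ⊗[k] H, LinearMap.mul' k k (TensorProduct.map (TensorProduct.lift s.form) (TensorProduct.lift s.form)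
          (TensorProduct.tensorTensorTensorComm k H H H H (w ⊗ₜ comul b))) =
          s.form (LinearMap.mul' k H w) b := by
      intro w
      induction w with
      | zero => simp
      | add x y hx hy => simp only [map_add, TensorProduct.add_tmul, hx, hy, LinearMap.add_apply]
      | tmul p q =>
        rw [LinearMap.mul'_apply, form_mul_left']
        generalize comul (R := k) b = u
        induction u with
        | zero => simp
        | add x y hx hy => simp only [map_add, TensorProduct.tmul_add, hx, hy]
        | tmul r t => simp
    refine (e (comul a) (comul b)).trans ((e' _).trans ?_)
    rw [HopfAlgebra.mul_antipode_rTensor_comul_apply]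
    simp [Algebra.algebraMap_eq_smul_one, form_one_left', mul_comm]
  exact (congrArg WithConv.ofConv (left_inv_eq_right_inv h1 s.form_conv_inv)).symm

lemma form_antipode_antipode (a b : H) : s.form (antipode k a) (antipode k b) = s.form a b := by
  have h1 : WithConv.toConv (TensorProduct.lift s.form ∘ₗ TensorProduct.map (antipode k) (antipode k)) *
      WithConv.toConv (TensorProduct.lift s.inv) = 1 := by
    rw [lift_form_antipode]
    ext a b
    have e : ∀ w u : H ⊗[k] H, LinearMap.mul' k k (TensorProduct.map
        (TensorProduct.lift s.form ∘ₗ TensorProduct.map (antipode k) (antipode k))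
        (TensorProduct.lift s.form ∘ₗ TensorProduct.map (antipode k) LinearMap.id)
        (TensorProduct.tensorTensorTensorComm k H H H H (w ⊗ₜ u))) =
        LinearMap.mul' k k (TensorProduct.map (TensorProduct.lift s.form) (TensorProduct.lift s.form)
          (TensorProduct.tensorTensorTensorComm k H H H H
            (TensorProduct.comm k H H (TensorProduct.map (antipode k) (antipode k) (TensorProduct.comm k H H w)) ⊗ₜ
              (antipode k).rTensor H u))) := by
      intro w u
      induction w with
      | zero => simp
      | add x y hx hy => simp only [map_add, TensorProduct.add_tmul, hx, hy]
      | tmul p q =>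
        induction u with
        | zero => simp
        | add x y hx hy => simp only [map_add, TensorProduct.tmul_add, hx, hy]
        | tmul r t => simp
    have e' : ∀ (w : H ⊗[k] H) (a : H), LinearMap.mul' k k (TensorProduct.map (TensorProduct.lift s.form) (TensorProduct.lift s.form)
          (TensorProduct.tensorTensorTensorComm k H H H H (TensorProduct.comm k H H (comul a) ⊗ₜ w))) =
          s.form a (LinearMap.mul' k H w) := by
      intro w a
      induction w with
      | zero => simp
      | add x y hx hy => simp only [map_add, TensorProduct.tmul_add, hx, hy]
      | tmul p q =>
        rw [LinearMap.mul'_apply, form_mul_right']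
        generalize comul (R := k) a = u
        induction u with
        | zero => simp
        | add x y hx hy => simp only [map_add, TensorProduct.add_tmul, hx, hy]
        | tmul r t => simp [mul_comm]
    refine (e (comul a) (comul b)).trans ?_
    rw [← comul_antipode', e', HopfAlgebra.mul_antipode_rTensor_comul_apply]
    simp [Algebra.algebraMap_eq_smul_one, form_one_right', mul_comm]
  have := congrArg WithConv.ofConv (left_inv_eq_right_inv h1 s.inv_conv_form)
  simpa using LinearMap.congr_fun this (a ⊗ₜ b)

/-- `w(h) = σ(S²(h₁), h₂)`. -/
noncomputable def dw : H →ₗ[k] k :=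
  TensorProduct.lift s.form ∘ₗ TensorProduct.map (antipode k ∘ₗ antipode k) LinearMap.id ∘ₗ comul

lemma map_antipode_sq_comul (h : H) :
    comul (R := k) (antipode k (antipode k h)) =
    TensorProduct.map (antipode k ∘ₗ antipode k) (antipode k ∘ₗ antipode k) (comul (R := k) h) := by
  rw [comul_antipode', comul_antipode']
  generalize comul (R := k) h = u
  induction u with
  | zero => simp
  | add x y hx hy => simp only [map_add, hx, hy]
  | tmul r t => simp

lemma dv_antipode_sq (h : H) : s.dv (antipode k (antipode k h)) = s.dv h := by
  simp only [dv, LinearMap.comp_apply, map_antipode_sq_comul]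
  generalize comul (R := k) h = u
  induction u with
  | zero => simp
  | add x y hx hy => simp only [map_add, hx, hy]
  | tmul r t => simp [form_antipode_antipode]

lemma dw_antipode_sq (h : H) : s.dw (antipode k (antipode k h)) = s.dw h := by
  simp only [dw, LinearMap.comp_apply, map_antipode_sq_comul]
  generalize comul (R := k) h = u
  induction u with
  | zero => simp
  | add x y hx hy => simp only [map_add, hx, hy]
  | tmul r t => simp [form_antipode_antipode]

lemma dv_mul_dw (h : H) : LinearMap.mul' k k (TensorProduct.map s.dv s.dw (comul h)) = counit h := by
  -- regroup as `(v(h₁) S²(h₂)) ⊗ h₃`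
  have tree : TensorProduct.map LinearMap.id comul ∘ₗ (comul : H →ₗ[k] H ⊗[k] H) =
      (TensorProduct.assoc k H H H).toLinearMap ∘ₗ
      TensorProduct.map comul LinearMap.id ∘ₗ comul := by
    simp only [coassoc_simps]
  have e1 : LinearMap.mul' k k ∘ₗ TensorProduct.map s.dv s.dw =
      (LinearMap.mul' k k ∘ₗ TensorProduct.map s.dv (TensorProduct.lift s.form ∘ₗ
        TensorProduct.map (antipode k ∘ₗ antipode k) LinearMap.id)) ∘ₗ
        TensorProduct.map LinearMap.id comul := by
    rw [LinearMap.comp_assoc, ← TensorProduct.map_comp]; rfl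
  have e2 : (LinearMap.mul' k k ∘ₗ TensorProduct.map s.dv (TensorProduct.lift s.form ∘ₗ
        TensorProduct.map (antipode k ∘ₗ antipode k) LinearMap.id)) ∘ₗ
      (TensorProduct.assoc k H H H).toLinearMap = TensorProduct.lift s.form ∘ₗ
        TensorProduct.map ((TensorProduct.lid k H).toLinearMap ∘ₗ
          TensorProduct.map s.dv (antipode k ∘ₗ antipode k)) LinearMap.id := by
    ext a b c; simp
  have e3 : TensorProduct.map ((TensorProduct.lid k H).toLinearMap ∘ₗ
          TensorProduct.map s.dv (antipode k ∘ₗ antipode k)) LinearMap.id ∘ₗ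
          TensorProduct.map (comul : H →ₗ[k] H ⊗[k] H) (LinearMap.id : H →ₗ[k] H) =
        TensorProduct.map ((TensorProduct.rid k H).toLinearMap ∘ₗ
          TensorProduct.map LinearMap.id s.dv) LinearMap.id ∘ₗ
          TensorProduct.map (comul : H →ₗ[k] H ⊗[k] H) (LinearMap.id : H →ₗ[k] H) := by
    rw [← TensorProduct.map_comp, ← TensorProduct.map_comp]
    congr 1
    ext x
    simpa using s.dv_antipode x
  have e4 : TensorProduct.lift s.form ∘ₗ TensorProduct.map ((TensorProduct.rid k H).toLinearMap ∘ₗ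
          TensorProduct.map LinearMap.id s.dv) LinearMap.id = (TensorProduct.lift s.form ∘ₗ
          TensorProduct.map LinearMap.id ((TensorProduct.lid k H).toLinearMap ∘ₗ
          TensorProduct.map s.dv LinearMap.id)) ∘ₗ (TensorProduct.assoc k H H H).toLinearMap := by
    ext a b c; simp
  have e5 : LinearMap.mul' k k (TensorProduct.map s.dv s.dw (comul h)) =
      (TensorProduct.lift s.form ∘ₗ
          TensorProduct.map LinearMap.id ((TensorProduct.lid k H).toLinearMap ∘ₗ
          TensorProduct.map s.dv LinearMap.id)) (TensorProduct.map LinearMap.id comul (comul h)) := by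
    have t := LinearMap.congr_fun tree h
    have h1 := LinearMap.congr_fun e1 (comul h)
    have h3 := LinearMap.congr_fun e3 (comul h)
    simp only [LinearMap.comp_apply, LinearEquiv.coe_coe] at t h1 h3
    refine h1.trans ?_
    rw [t]
    refine (LinearMap.congr_fun e2 _).trans ?_
    refine (congrArg (TensorProduct.lift s.form) h3).trans ?_
    exact (LinearMap.congr_fun e4 _)
  rw [e5]
  rw [← comul_comul_mid (LinearMap.mul' k k ∘ₗ TensorProduct.map (TensorProduct.lift s.form)
      (TensorProduct.lift s.form ∘ₗ TensorProduct.map LinearMap.id (antipode k)) ∘ₗ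
      (TensorProduct.tensorTensorTensorComm k H H H H).toLinearMap ∘ₗ
      TensorProduct.map LinearMap.id (TensorProduct.comm k H H).toLinearMap)]
  · have e6 : (LinearMap.mul' k k ∘ₗ TensorProduct.map (TensorProduct.lift s.form)
      (TensorProduct.lift s.form ∘ₗ TensorProduct.map LinearMap.id (antipode k)) ∘ₗ
      (TensorProduct.tensorTensorTensorComm k H H H H).toLinearMap ∘ₗ
      TensorProduct.map LinearMap.id (TensorProduct.comm k H H).toLinearMap) ∘ₗ
      TensorProduct.map (comul : H →ₗ[k] H ⊗[k] H) (comul : H →ₗ[k] H ⊗[k] H) =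
      LinearMap.mul' k k ∘ₗ TensorProduct.map counit counit := by
      ext x y
      have := HopfAlgebra.mul_antipode_rTensor_comul_apply (R := k) y
      generalize hw : comul (R := k) y = w at this
      have e7 : ∀ w : H ⊗[k] H, (LinearMap.mul' k k ∘ₗ TensorProduct.map (TensorProduct.lift s.form)
      (TensorProduct.lift s.form ∘ₗ TensorProduct.map LinearMap.id (antipode k)) ∘ₗ
      (TensorProduct.tensorTensorTensorComm k H H H H).toLinearMap ∘ₗ
      TensorProduct.map LinearMap.id (TensorProduct.comm k H H).toLinearMap) (comul x ⊗ₜ w) =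
        s.form x (LinearMap.mul' k H ((antipode k).rTensor H w)) := by
        intro w
        induction w with
        | zero => simp
        | add x y hx hy => simp only [map_add, TensorProduct.tmul_add, hx, hy]
        | tmul p q =>
          rw [LinearMap.rTensor_tmul, LinearMap.mul'_apply, form_mul_right']
          generalize comul (R := k) x = u
          induction u with
          | zero => simp
          | add x y hx hy => simp only [map_add, TensorProduct.add_tmul, hx, hy]
          | tmul r t => simp
      have := (e7 w).trans (congrArg (s.form x) this)
      subst hw
      refine this.trans ?_
      simp [Algebra.algebraMap_eq_smul_one, form_one_right', mul_comm]
    refine (LinearMap.congr_fun e6 (comul h)).trans ?_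
    have e8 : LinearMap.mul' k k ∘ₗ TensorProduct.map (counit : H →ₗ[k] k) (counit : H →ₗ[k] k) =
      (counit : H →ₗ[k] k) ∘ₗ (TensorProduct.lid k H).toLinearMap ∘ₗ
        TensorProduct.map counit LinearMap.id := by
      ext a b; simp
    refine (LinearMap.congr_fun e8 (comul h)).trans ?_
    have := Coalgebra.rTensor_counit_comul (R := k) h
    simp only [LinearMap.rTensor] at this
    simp [this]
  · intro a x d
    have : s.dv x = TensorProduct.lift s.form (TensorProduct.map LinearMap.id (antipode k)
      (comul (R := k) x)) := by simp [dv]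
    simp only [LinearMap.comp_apply, TensorProduct.map_tmul, TensorProduct.lift.tmul,
      LinearMap.id_apply, LinearEquiv.coe_coe, TensorProduct.lid_tmul, map_smul, this]
    generalize comul (R := k) x = w
    induction w with
    | zero => simp
    | add x y hx hy => simp only [map_add, TensorProduct.add_tmul, TensorProduct.tmul_add, hx, hy, add_smul]
    | tmul p q => simp [mul_comm]

/-- `h ↦ v(h₁) h₂ w(h₃)`, inverse to the square of the antipode -/
noncomputable def sqInv : H →ₗ[k] H := (TensorProduct.lid k H).toLinearMap ∘ₗ
  TensorProduct.map s.dv ((TensorProduct.rid k H).toLinearMap ∘ₗ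
    TensorProduct.map LinearMap.id s.dw ∘ₗ comul) ∘ₗ comul

lemma antipode_sq_sqInv (h : H) : antipode k (antipode k (s.sqInv h)) = h := by
  have tree : TensorProduct.map LinearMap.id comul ∘ₗ (comul : H →ₗ[k] H ⊗[k] H) =
      (TensorProduct.assoc k H H H).toLinearMap ∘ₗ
      TensorProduct.map comul LinearMap.id ∘ₗ comul := by
    simp only [coassoc_simps]
  have e1 : (antipode k ∘ₗ antipode k) ∘ₗ (TensorProduct.lid k H).toLinearMap ∘ₗ
      TensorProduct.map s.dv ((TensorProduct.rid k H).toLinearMap ∘ₗ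
      TensorProduct.map LinearMap.id s.dw) ∘ₗ (TensorProduct.assoc k H H H).toLinearMap =
      (TensorProduct.rid k H).toLinearMap ∘ₗ TensorProduct.map
        ((TensorProduct.lid k H).toLinearMap ∘ₗ TensorProduct.map s.dv (antipode k ∘ₗ antipode k))
        s.dw := by
    ext a b c; simp
  have e3 : TensorProduct.map ((TensorProduct.lid k H).toLinearMap ∘ₗ
          TensorProduct.map s.dv (antipode k ∘ₗ antipode k)) s.dw ∘ₗ
          TensorProduct.map (comul : H →ₗ[k] H ⊗[k] H) (LinearMap.id : H →ₗ[k] H) =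
        TensorProduct.map ((TensorProduct.rid k H).toLinearMap ∘ₗ
          TensorProduct.map LinearMap.id s.dv) s.dw ∘ₗ
          TensorProduct.map (comul : H →ₗ[k] H ⊗[k] H) (LinearMap.id : H →ₗ[k] H) := by
    rw [← TensorProduct.map_comp, ← TensorProduct.map_comp]
    congr 1
    ext x
    simpa using s.dv_antipode x
  have e4 : (TensorProduct.rid k H).toLinearMap ∘ₗ TensorProduct.map
      ((TensorProduct.rid k H).toLinearMap ∘ₗ TensorProduct.map LinearMap.id s.dv) s.dw =
      (TensorProduct.rid k H).toLinearMap ∘ₗ TensorProduct.map LinearMap.id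
        (LinearMap.mul' k k ∘ₗ TensorProduct.map s.dv s.dw) ∘ₗ
        (TensorProduct.assoc k H H H).toLinearMap := by
    ext a b c; simp [smul_smul, mul_comm]
  have e5 : TensorProduct.map LinearMap.id (LinearMap.mul' k k ∘ₗ TensorProduct.map s.dv s.dw) ∘ₗ
      TensorProduct.map (LinearMap.id : H →ₗ[k] H) (comul : H →ₗ[k] H ⊗[k] H) =
      TensorProduct.map LinearMap.id counit := by
    rw [← TensorProduct.map_comp]
    congr 1
    ext x
    exact s.dv_mul_dw x
  have e0 : s.sqInv = ((TensorProduct.lid k H).toLinearMap ∘ₗ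
      TensorProduct.map s.dv ((TensorProduct.rid k H).toLinearMap ∘ₗ
      TensorProduct.map LinearMap.id s.dw)) ∘ₗ TensorProduct.map LinearMap.id comul ∘ₗ comul := by
    have e6 : TensorProduct.map s.dv ((TensorProduct.rid k H).toLinearMap ∘ₗ
      TensorProduct.map LinearMap.id s.dw ∘ₗ comul) = TensorProduct.map s.dv
      ((TensorProduct.rid k H).toLinearMap ∘ₗ TensorProduct.map LinearMap.id s.dw) ∘ₗ
      TensorProduct.map LinearMap.id comul := by
      rw [← TensorProduct.map_comp]; rfl
    unfold sqInv
    rw [e6]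
    rfl
  have t := LinearMap.congr_fun tree h
  have h3 := LinearMap.congr_fun e3 (comul h)
  have h5 := LinearMap.congr_fun e5 (comul h)
  rw [e0]
  simp only [LinearMap.comp_apply] at t h3 h5 ⊢
  rw [t]
  refine (LinearMap.congr_fun e1 _).trans ((congrArg (TensorProduct.rid k H) h3).trans
    ((LinearMap.congr_fun e4 _).trans ?_))
  simp only [LinearMap.comp_apply]
  rw [← t]
  refine (congrArg (TensorProduct.rid k H) h5).trans ?_
  have := Coalgebra.lTensor_counit_comul (R := k) h
  simp only [LinearMap.lTensor] at this
  simp [this]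

lemma sqInv_antipode_sq (h : H) : s.sqInv (antipode k (antipode k h)) = h := by
  refine Eq.trans ?_ (s.antipode_sq_sqInv h)
  have key : ∀ x : H, ((TensorProduct.rid k H).toLinearMap ∘ₗ TensorProduct.map LinearMap.id s.dw ∘ₗ
      comul) (antipode k (antipode k x)) = antipode k (antipode k
      (((TensorProduct.rid k H).toLinearMap ∘ₗ TensorProduct.map LinearMap.id s.dw ∘ₗ comul) x)) := by
    intro x
    simp only [LinearMap.comp_apply, map_antipode_sq_comul]
    generalize comul (R := k) x = u
    induction u with
    | zero => simp
    | add x y hx hy => simp only [map_add, hx, hy]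
    | tmul r t => simp [dw_antipode_sq]
  unfold sqInv
  set G := (TensorProduct.rid k H).toLinearMap ∘ₗ TensorProduct.map LinearMap.id s.dw ∘ₗ
      (comul : H →ₗ[k] H ⊗[k] H)
  simp only [LinearMap.comp_apply, map_antipode_sq_comul]
  generalize comul (R := k) h = u
  induction u with
  | zero => simp
  | add x y hx hy => simp only [map_add, hx, hy]
  | tmul r t =>
    simp only [TensorProduct.map_tmul, LinearMap.comp_apply, key, dv_antipode_sq]
    simp

/-- The antipode of a coquasitriangular Hopf algebra is bijective. -/
theorem antipode_bijective (s : CQTStructure k H) : Function.Bijective (antipode k (A := H)) := by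
  refine ⟨fun x y hxy => ?_, fun x => ⟨_, s.antipode_sq_sqInv x⟩⟩
  rw [← s.sqInv_antipode_sq x, hxy, s.sqInv_antipode_sq]

end CQTStructure

/-- The co-opposite of a bialgebra: the same algebra, with comultiplication `b ↦ b₂ ⊗ b₁`. -/
def Cop (B : Type*) : Type _ := B

namespace Cop
variable {k : Type*} [Field k] {B : Type*}

instance [Ring B] : Ring (Cop B) := inferInstanceAs (Ring B)
instance [Ring B] [Algebra k B] : Algebra k (Cop B) := inferInstanceAs (Algebra k B)

noncomputable instance [Ring B] [Bialgebra k B] : Coalgebra k (Cop B) where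
  comul := ((TensorProduct.comm k B B).toLinearMap ∘ₗ (comul : B →ₗ[k] B ⊗[k] B) : B →ₗ[k] B ⊗[k] B)
  counit := (counit : B →ₗ[k] k)
  coassoc := by
    change (TensorProduct.assoc k B B B).toLinearMap ∘ₗ LinearMap.rTensor B ((TensorProduct.comm k B B).toLinearMap ∘ₗ (comul : B →ₗ[k] B ⊗[k] B)) ∘ₗ ((TensorProduct.comm k B B).toLinearMap ∘ₗ (comul : B →ₗ[k] B ⊗[k] B)) = LinearMap.lTensor B ((TensorProduct.comm k B B).toLinearMap ∘ₗ (comul : B →ₗ[k] B ⊗[k] B)) ∘ₗ ((TensorProduct.comm k B B).toLinearMap ∘ₗ (comul : B →ₗ[k] B ⊗[k] B))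
    have e1 : (TensorProduct.assoc k B B B).toLinearMap ∘ₗ LinearMap.rTensor B
        ((TensorProduct.comm k B B).toLinearMap ∘ₗ (comul : B →ₗ[k] B ⊗[k] B)) ∘ₗ
        (TensorProduct.comm k B B).toLinearMap =
        (LinearMap.lTensor B (TensorProduct.comm k B B).toLinearMap ∘ₗ
          (TensorProduct.comm k (B ⊗[k] B) B).toLinearMap) ∘ₗ
          (TensorProduct.assoc k B B B).symm.toLinearMap ∘ₗ LinearMap.lTensor B comul := by
      ext a b
      simp only [TensorProduct.AlgebraTensorModule.curry_apply, TensorProduct.curry_apply,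
        LinearMap.coe_restrictScalars, LinearMap.comp_apply, LinearEquiv.coe_coe,
        TensorProduct.comm_tmul, LinearMap.rTensor_tmul, LinearMap.lTensor_tmul]
      generalize comul (R := k) b = w
      induction w with
      | zero => simp
      | add x y hx hy => simp only [map_add, TensorProduct.add_tmul, TensorProduct.tmul_add, hx, hy]
      | tmul p q => simp
    have e2 : LinearMap.lTensor B
        ((TensorProduct.comm k B B).toLinearMap ∘ₗ (comul : B →ₗ[k] B ⊗[k] B)) ∘ₗ
        (TensorProduct.comm k B B).toLinearMap =
        (LinearMap.lTensor B (TensorProduct.comm k B B).toLinearMap ∘ₗ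
          (TensorProduct.comm k (B ⊗[k] B) B).toLinearMap) ∘ₗ LinearMap.rTensor B comul := by
      ext a b
      simp
    ext x
    have h1 := LinearMap.congr_fun e1 (comul x)
    have h2 := LinearMap.congr_fun e2 (comul x)
    simp only [LinearMap.comp_apply, LinearEquiv.coe_coe] at h1 h2 ⊢
    rw [h1, h2, Coalgebra.coassoc_symm_apply]
  rTensor_counit_comp_comul := by
    change LinearMap.rTensor B (counit : B →ₗ[k] k) ∘ₗ ((TensorProduct.comm k B B).toLinearMap ∘ₗ (comul : B →ₗ[k] B ⊗[k] B)) = TensorProduct.mk k k B 1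
    ext x
    have := congrArg (TensorProduct.comm k B k) (Coalgebra.lTensor_counit_comul (R := k) x)
    rw [TensorProduct.comm_tmul] at this
    refine Eq.trans ?_ this
    simp only [LinearMap.comp_apply, LinearMap.lTensor, LinearMap.rTensor, LinearEquiv.coe_coe, TensorProduct.map_comm]
  lTensor_counit_comp_comul := by
    change LinearMap.lTensor B (counit : B →ₗ[k] k) ∘ₗ ((TensorProduct.comm k B B).toLinearMap ∘ₗ (comul : B →ₗ[k] B ⊗[k] B)) = (TensorProduct.mk k B k).flip 1
    ext x
    have := congrArg (TensorProduct.comm k k B) (Coalgebra.rTensor_counit_comul (R := k) x)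
    rw [TensorProduct.comm_tmul] at this
    refine Eq.trans ?_ this
    simp only [LinearMap.comp_apply, LinearMap.lTensor, LinearMap.rTensor, LinearEquiv.coe_coe, TensorProduct.map_comm]

noncomputable instance [Ring B] [Bialgebra k B] : Bialgebra k (Cop B) :=
  Bialgebra.mk' k (Cop B) (Bialgebra.counit_one (A := B)) (Bialgebra.counit_mul (A := B) _ _)
    (by
      change (TensorProduct.comm k B B) (comul (1 : B)) = 1
      rw [Bialgebra.comul_one]; rfl)
    (by
      intro a b
      let a' : B := a
      let b' : B := b
      change (TensorProduct.comm k B B) (comul (R := k) (a' * b')) = (Algebra.TensorProduct.comm k B B (comul (R := k) a')) * (Algebra.TensorProduct.comm k B B (comul (R := k) b') : B ⊗[k] B)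
      rw [Bialgebra.comul_mul]; exact map_mul (Algebra.TensorProduct.comm k B B) _ _)
end Cop

section sep
variable {k : Type*} [Field k] {V W : Type*} [AddCommGroup V] [Module k V] [AddCommGroup W] [Module k W]

/-- Separating families of functionals give a separating family on the tensor product. -/
lemma tensor_separating {ι κ : Type*} (p : ι → V →ₗ[k] k) (q : κ → W →ₗ[k] k)
    (hp : ∀ v, (∀ i, p i v = 0) → v = 0) (hq : ∀ w, (∀ j, q j w = 0) → w = 0)
    (t : V ⊗[k] W) (ht : ∀ i j, LinearMap.mul' k k (TensorProduct.map (p i) (q j) t) = 0) :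
    t = 0 := by
  classical
  let b := Module.Basis.ofVectorSpace k W
  rw [← (TensorProduct.equivFinsuppOfBasisRight (M := V) b).map_eq_zero_iff]
  set u := TensorProduct.equivFinsuppOfBasisRight (M := V) b t with hu
  have key : ∀ i, TensorProduct.lid k W (TensorProduct.map (p i) LinearMap.id t) = 0 := by
    intro i
    apply hq
    intro j
    rw [← ht i j]
    have : q j ∘ₗ (TensorProduct.lid k W).toLinearMap ∘ₗ TensorProduct.map (p i) LinearMap.id =
      LinearMap.mul' k k ∘ₗ TensorProduct.map (p i) (q j) := by ext; simp
    exact LinearMap.congr_fun this t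
  have key2 : ∀ i c, p i (u c) = b.repr (TensorProduct.lid k W (TensorProduct.map (p i) LinearMap.id t)) c := by
    intro i c
    rw [hu]
    generalize t = t
    induction t with
    | zero => simp
    | add x y hx hy => simp only [map_add, Finsupp.add_apply, hx, hy]
    | tmul v w => simp [mul_comm]
  ext c
  apply hp
  intro i
  rw [key2, key]; simp
end sep

section findual
variable {k : Type*} [Field k] {H : Type*} [Ring H] [Bialgebra k H]
variable {U : Type*} [Ring U] [Algebra k U]

/-- Evaluation at `h`, on an algebra mapping to the dual algebra of `H`. -/
noncomputable def evalAt (j : U →ₐ[k] WithConv (H →ₗ[k] k)) (h : H) : U →ₗ[k] k where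
  toFun f := (j f).ofConv h
  map_add' x y := by rw [map_add]; rfl
  map_smul' x y := by rw [map_smul]; rfl

lemma evalAt_separating (j : U →ₐ[k] WithConv (H →ₗ[k] k)) (hj : Function.Injective j) (f : U)
    (hf : ∀ h, evalAt j h f = 0) : f = 0 := by
  apply hj
  apply WithConv.ofConv_injective
  rw [map_zero]
  ext h
  exact hf h

noncomputable def tensorEvalLin (j : U →ₐ[k] WithConv (H →ₗ[k] k)) :
    U ⊗[k] U →ₗ[k] WithConv (H ⊗[k] H →ₗ[k] k) :=
  (WithConv.linearEquiv k (H ⊗[k] H →ₗ[k] k)).symm.toLinearMap ∘ₗ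
      TensorProduct.dualDistrib k H H ∘ₗ
      TensorProduct.map ((WithConv.linearEquiv k (H →ₗ[k] k)).toLinearMap ∘ₗ j.toLinearMap)
        ((WithConv.linearEquiv k (H →ₗ[k] k)).toLinearMap ∘ₗ j.toLinearMap)

lemma tensorEvalLin_tmul (j : U →ₐ[k] WithConv (H →ₗ[k] k)) (f g : U) :
    tensorEvalLin j (f ⊗ₜ g) = WithConv.toConv ((Algebra.TensorProduct.lmul' k (S := k)).toLinearMap ∘ₗ
      TensorProduct.map (j f).ofConv (j g).ofConv) := by
  apply WithConv.ofConv_injective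
  ext a b
  simp [tensorEvalLin]

lemma tensorEvalLin_mul (j : U →ₐ[k] WithConv (H →ₗ[k] k)) (x y : U ⊗[k] U) :
    tensorEvalLin j (x * y) = tensorEvalLin j x * tensorEvalLin j y := by
  induction x with
  | zero => simp
  | add x y hx hy => simp only [add_mul, map_add, hx, hy]
  | tmul a b =>
    induction y with
    | zero => simp
    | add x y hx hy => simp only [mul_add, map_add, hx, hy]
    | tmul c d =>
      rw [Algebra.TensorProduct.tmul_mul_tmul, tensorEvalLin_tmul, tensorEvalLin_tmul,
        tensorEvalLin_tmul, map_mul, map_mul]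
      have := LinearMap.algHom_comp_convMul_distrib (Algebra.TensorProduct.lmul' k (S := k))
        (WithConv.toConv (TensorProduct.map (j a).ofConv (j b).ofConv))
        (WithConv.toConv (TensorProduct.map (j c).ofConv (j d).ofConv))
      rw [TensorProduct.map_convMul_map] at this
      exact congrArg WithConv.toConv this

/-- The algebra map `f ⊗ g ↦ (h ⊗ h' ↦ f h * g h')`. -/
noncomputable def tensorEval (j : U →ₐ[k] WithConv (H →ₗ[k] k)) :
    U ⊗[k] U →ₐ[k] WithConv (H ⊗[k] H →ₗ[k] k) :=
  AlgHom.ofLinearMap (tensorEvalLin j)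
    (by
      rw [Algebra.TensorProduct.one_def, tensorEvalLin_tmul, map_one]
      apply WithConv.ofConv_injective
      ext a b
      change _ = algebraMap k k (counit (R := k) (a ⊗ₜ[k] b))
      change Algebra.TensorProduct.lmul' k (S := k) (algebraMap k k (counit (R := k) a) ⊗ₜ
        algebraMap k k (counit (R := k) b)) = _
      simp [mul_comm])
    (tensorEvalLin_mul j)

lemma tensorEval_apply (j : U →ₐ[k] WithConv (H →ₗ[k] k)) (t : U ⊗[k] U) (h h' : H) :
    (tensorEval j t).ofConv (h ⊗ₜ h') =
      LinearMap.mul' k k (TensorProduct.map (evalAt j h) (evalAt j h') t) := by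
  induction t with
  | zero => simp
  | add x y hx hy => simp only [map_add, WithConv.ofConv_add, LinearMap.add_apply, hx, hy]
  | tmul a b =>
    change (tensorEvalLin j (a ⊗ₜ b)).ofConv (h ⊗ₜ h') = _
    rw [tensorEvalLin_tmul]
    rfl

lemma tensorEval_injective (j : U →ₐ[k] WithConv (H →ₗ[k] k)) (hj : Function.Injective j) :
    Function.Injective (tensorEval j) := by
  rw [injective_iff_map_eq_zero]
  intro t ht
  refine tensor_separating (evalAt j) (evalAt j) (evalAt_separating j hj) (evalAt_separating j hj) t ?_
  intro h h'
  rw [← tensorEval_apply, ht]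
  rfl

variable (k H) in
/-- The algebra map `f ↦ (h ⊗ h' ↦ f (h * h'))`. -/
noncomputable def mulDual : WithConv (H →ₗ[k] k) →ₐ[k] WithConv (H ⊗[k] H →ₗ[k] k) :=
  AlgHom.ofLinearMap
    ((WithConv.linearEquiv k (H ⊗[k] H →ₗ[k] k)).symm.toLinearMap ∘ₗ
      LinearMap.lcomp k k (LinearMap.mul' k H) ∘ₗ (WithConv.linearEquiv k (H →ₗ[k] k)).toLinearMap)
    (by
      apply WithConv.ofConv_injective
      ext a b
      change algebraMap k k (counit (R := k) (a * b)) = algebraMap k k (counit (R := k) (a ⊗ₜ[k] b))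
      simp [mul_comm])
    (by
      intro f g
      apply WithConv.ofConv_injective
      ext a b
      change LinearMap.mul' k k (TensorProduct.map f.ofConv g.ofConv (comul (a * b))) =
        LinearMap.mul' k k (TensorProduct.map (f.ofConv ∘ₗ LinearMap.mul' k H)
          (g.ofConv ∘ₗ LinearMap.mul' k H) (comul (a ⊗ₜ[k] b)))
      rw [Bialgebra.comul_mul, TensorProduct.comul_tmul]
      generalize comul (R := k) a = u
      generalize comul (R := k) b = v
      induction u with
      | zero => simp
      | add x y hx hy => simp only [add_mul, map_add, add_tmul, hx, hy]
      | tmul a b =>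
        induction v with
        | zero => simp
        | add x y hx hy => simp only [mul_add, map_add, tmul_add, hx, hy]
        | tmul c d => simp)

lemma mulDual_apply (f : WithConv (H →ₗ[k] k)) (h h' : H) :
    (mulDual k H f).ofConv (h ⊗ₜ h') = f.ofConv (h * h') := rfl

/-- The comultiplication `f ↦ f₁ ⊗ f₂` with `f (h * h') = f₁ h * f₂ h'`. -/
noncomputable def dualComul (j : U →ₐ[k] WithConv (H →ₗ[k] k)) (hj : Function.Injective j)
    (hU : ∀ f, mulDual k H (j f) ∈ (tensorEval j).range) : U →ₐ[k] U ⊗[k] U :=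
  (AlgEquiv.ofInjective (tensorEval j) (tensorEval_injective j hj)).symm.toAlgHom.comp
    (((mulDual k H).comp j).codRestrict (tensorEval j).range hU)

lemma tensorEval_dualComul (j : U →ₐ[k] WithConv (H →ₗ[k] k)) (hj : Function.Injective j)
    (hU : ∀ f, mulDual k H (j f) ∈ (tensorEval j).range) (f : U) :
    tensorEval j (dualComul j hj hU f) = mulDual k H (j f) := by
  have := (AlgEquiv.ofInjective (tensorEval j) (tensorEval_injective j hj)).apply_symm_apply
    ((((mulDual k H).comp j).codRestrict (tensorEval j).range hU) f)
  exact congrArg Subtype.val this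

lemma eval_dualComul (j : U →ₐ[k] WithConv (H →ₗ[k] k)) (hj : Function.Injective j)
    (hU : ∀ f, mulDual k H (j f) ∈ (tensorEval j).range) (f : U) (h h' : H) :
    LinearMap.mul' k k (TensorProduct.map (evalAt j h) (evalAt j h') (dualComul j hj hU f)) =
      evalAt j (h * h') f := by
  rw [← tensorEval_apply, tensorEval_dualComul]
  rfl

/-- The counit `f ↦ f 1`. -/
noncomputable def dualCounit (j : U →ₐ[k] WithConv (H →ₗ[k] k)) : U →ₐ[k] k :=
  AlgHom.ofLinearMap (evalAt j 1)
    (by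
      change (j 1).ofConv 1 = 1
      have e : j 1 = 1 := map_one j
      rw [e]
      change algebraMap k k (counit (R := k) (1 : H)) = 1
      simp)
    (by
      intro f g
      change (j (f * g)).ofConv 1 = _
      rw [map_mul]
      change LinearMap.mul' k k (TensorProduct.map (j f).ofConv (j g).ofConv (comul (1 : H))) = _
      rw [Bialgebra.comul_one]
      rfl)

/-- The bialgebra structure on a subalgebra of the dual, with `f (h * h') = f₁ h * f₂ h'`. -/
noncomputable abbrev dualBialgebra (j : U →ₐ[k] WithConv (H →ₗ[k] k)) (hj : Function.Injective j)
    (hU : ∀ f, mulDual k H (j f) ∈ (tensorEval j).range) : Bialgebra k U :=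
  Bialgebra.ofAlgHom (dualComul j hj hU) (dualCounit j)
    (by
      ext1 f
      rw [← sub_eq_zero]
      refine tensor_separating (evalAt j)
        (fun p : H × H => LinearMap.mul' k k ∘ₗ TensorProduct.map (evalAt j p.1) (evalAt j p.2))
        (evalAt_separating j hj) (fun t ht => tensor_separating (evalAt j) (evalAt j)
          (evalAt_separating j hj) (evalAt_separating j hj) t (fun i j => ht (i, j))) _ ?_
      rintro a ⟨b, c⟩
      rw [map_sub, map_sub, sub_eq_zero]
      have e1 : ∀ t : U ⊗[k] U, LinearMap.mul' k k (TensorProduct.map (evalAt j a)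
          (LinearMap.mul' k k ∘ₗ TensorProduct.map (evalAt j b) (evalAt j c))
          (Algebra.TensorProduct.map (.id k U) (dualComul j hj hU) t)) =
          LinearMap.mul' k k (TensorProduct.map (evalAt j a) (evalAt j (b * c)) t) := by
        intro t
        induction t with
        | zero => simp
        | add x y hx hy => simp only [map_add, hx, hy]
        | tmul x y =>
          have := eval_dualComul j hj hU y b c
          simp [this]
      have e2 : ∀ t : U ⊗[k] U, LinearMap.mul' k k (TensorProduct.map (evalAt j a)
          (LinearMap.mul' k k ∘ₗ TensorProduct.map (evalAt j b) (evalAt j c))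
          (Algebra.TensorProduct.assoc k k k U U U
            (Algebra.TensorProduct.map (dualComul j hj hU) (.id k U) t))) =
          LinearMap.mul' k k (TensorProduct.map (evalAt j (a * b)) (evalAt j c) t) := by
        intro t
        induction t with
        | zero => simp
        | add x y hx hy => simp only [map_add, hx, hy]
        | tmul x y =>
          have := eval_dualComul j hj hU x a b
          simp only [Algebra.TensorProduct.map_tmul, AlgHom.id_apply, TensorProduct.map_tmul,
            LinearMap.mul'_apply, ← this]
          generalize dualComul j hj hU x = w
          induction w with
          | zero => simp
          | add x y hx hy => simp only [map_add, add_tmul, add_mul, hx, hy]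
          | tmul p q => simp [mul_assoc]
      exact (e2 _).trans (((eval_dualComul j hj hU f (a * b) c).trans (by rw [mul_assoc])).trans
        ((e1 _).trans (eval_dualComul j hj hU f a (b * c))).symm))
    (by
      ext1 f
      have e : ∀ (h : H) (t : U ⊗[k] U), evalAt j h (TensorProduct.lid k U
          (TensorProduct.map (evalAt j 1) LinearMap.id t)) =
          LinearMap.mul' k k (TensorProduct.map (evalAt j 1) (evalAt j h) t) := by
        intro h w
        induction w with
        | zero => simp
        | add x y hx hy => simp only [map_add, hx, hy]
        | tmul p q => simp
      apply (Algebra.TensorProduct.lid k U).injective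
      change TensorProduct.lid k U (TensorProduct.map (evalAt j 1) LinearMap.id
        (dualComul j hj hU f)) = _
      rw [← sub_eq_zero]
      apply evalAt_separating j hj
      intro h
      rw [map_sub, sub_eq_zero]
      have := eval_dualComul j hj hU f 1 h
      rw [one_mul] at this
      refine (e h _).trans (this.trans ?_)
      exact congrArg (evalAt j h) ((Algebra.TensorProduct.lid k U).apply_symm_apply f).symm)
    (by
      ext1 f
      have e : ∀ (h : H) (t : U ⊗[k] U), evalAt j h (TensorProduct.rid k U
          (TensorProduct.map LinearMap.id (evalAt j 1) t)) =
          LinearMap.mul' k k (TensorProduct.map (evalAt j h) (evalAt j 1) t) := by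
        intro h w
        induction w with
        | zero => simp
        | add x y hx hy => simp only [map_add, hx, hy]
        | tmul p q => simp [mul_comm]
      apply (Algebra.TensorProduct.rid k k U).injective
      change TensorProduct.rid k U (TensorProduct.map LinearMap.id (evalAt j 1)
        (dualComul j hj hU f)) = _
      rw [← sub_eq_zero]
      apply evalAt_separating j hj
      intro h
      rw [map_sub, sub_eq_zero]
      have := eval_dualComul j hj hU f h 1
      rw [mul_one] at this
      refine (e h _).trans (this.trans ?_)
      exact congrArg (evalAt j h) ((Algebra.TensorProduct.rid k k U).apply_symm_apply f).symm)

end findual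

namespace CQTStructure
section comapSec
variable {k : Type*} [Field k] {H : Type*} [Ring H] [Bialgebra k H]
  {X : Type*} [Ring X] [Bialgebra k X]

lemma lift_compl₁₂ (φ : H →ₗ[k] H →ₗ[k] k) (ι : X →ₗ[k] H) :
    TensorProduct.lift (φ.compl₁₂ ι ι) = TensorProduct.lift φ ∘ₗ TensorProduct.map ι ι := by
  ext a b
  simp

/-- Restriction of a coquasitriangular structure along an injective bialgebra map. -/
noncomputable def comap (s : CQTStructure k H) (ι : X →ₐc[k] H) (hι : Function.Injective ι) :
    CQTStructure k X where
  form := s.form.compl₁₂ (ι : X →ₗ[k] H) (ι : X →ₗ[k] H)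
  inv := s.inv.compl₁₂ (ι : X →ₗ[k] H) (ι : X →ₗ[k] H)
  form_conv_inv := by
    rw [lift_compl₁₂, lift_compl₁₂]
    have := LinearMap.convMul_comp_coalgHom_distrib (WithConv.toConv (TensorProduct.lift s.form))
      (WithConv.toConv (TensorProduct.lift s.inv))
      (Coalgebra.TensorProduct.map (ι : X →ₗc[k] H) (ι : X →ₗc[k] H))
    rw [s.form_conv_inv] at this
    refine (congrArg WithConv.toConv this).symm.trans ?_
    apply WithConv.ofConv_injective
    ext a b
    change counit (R := k) (ι a ⊗ₜ[k] ι b) = counit (R := k) (a ⊗ₜ[k] b)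
    simp
  inv_conv_form := by
    rw [lift_compl₁₂, lift_compl₁₂]
    have := LinearMap.convMul_comp_coalgHom_distrib (WithConv.toConv (TensorProduct.lift s.inv))
      (WithConv.toConv (TensorProduct.lift s.form))
      (Coalgebra.TensorProduct.map (ι : X →ₗc[k] H) (ι : X →ₗc[k] H))
    rw [s.inv_conv_form] at this
    refine (congrArg WithConv.toConv this).symm.trans ?_
    apply WithConv.ofConv_injective
    ext a b
    change counit (R := k) (ι a ⊗ₜ[k] ι b) = counit (R := k) (a ⊗ₜ[k] b)
    simp
  form_mul_left := by
    intro a b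
    have := LinearMap.convMul_comp_coalgHom_distrib (WithConv.toConv (s.form (ι a)))
      (WithConv.toConv (s.form (ι b))) (ι : X →ₗc[k] H)
    rw [← s.form_mul_left] at this
    refine Eq.trans ?_ (congrArg WithConv.toConv this)
    apply WithConv.ofConv_injective
    ext c
    change s.form (ι (a * b)) (ι c) = s.form (ι a * ι b) (ι c)
    rw [map_mul]
  form_mul_right := by
    intro a b
    have := LinearMap.convMul_comp_coalgHom_distrib (WithConv.toConv (s.form.flip (ι b)))
      (WithConv.toConv (s.form.flip (ι a))) (ι : X →ₗc[k] H)
    rw [← s.form_mul_right] at this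
    refine Eq.trans ?_ (congrArg WithConv.toConv this)
    apply WithConv.ofConv_injective
    ext c
    change s.form (ι c) (ι (a * b)) = s.form (ι c) (ι a * ι b)
    rw [map_mul]
  form_one_left := by
    ext c
    change s.form (ι 1) (ι c) = _
    rw [map_one, s.form_one_left]
    simp
  form_one_right := by
    ext c
    change s.form.flip (ι 1) (ι c) = _
    rw [map_one, s.form_one_right]
    simp
  comm := by
    rw [lift_compl₁₂]
    have key := congrArg (fun f => WithConv.ofConv f ∘ₗ TensorProduct.map (ι : X →ₗ[k] H) (ι : X →ₗ[k] H)) s.comm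
    have h1 := LinearMap.convMul_comp_coalgHom_distrib
      (WithConv.toConv (Algebra.linearMap k H ∘ₗ TensorProduct.lift s.form))
      (WithConv.toConv (LinearMap.mul' k H))
      (Coalgebra.TensorProduct.map (ι : X →ₗc[k] H) (ι : X →ₗc[k] H))
    have h2 := LinearMap.convMul_comp_coalgHom_distrib
      (WithConv.toConv (LinearMap.mul' k H ∘ₗ (TensorProduct.comm k H H).toLinearMap))
      (WithConv.toConv (Algebra.linearMap k H ∘ₗ TensorProduct.lift s.form))
      (Coalgebra.TensorProduct.map (ι : X →ₗc[k] H) (ι : X →ₗc[k] H))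
    have h3 := LinearMap.algHom_comp_convMul_distrib (ι : X →ₐ[k] H)
      (WithConv.toConv (Algebra.linearMap k X ∘ₗ TensorProduct.lift s.form ∘ₗ TensorProduct.map (ι : X →ₗ[k] H) (ι : X →ₗ[k] H)))
      (WithConv.toConv (LinearMap.mul' k X))
    have h4 := LinearMap.algHom_comp_convMul_distrib (ι : X →ₐ[k] H)
      (WithConv.toConv (LinearMap.mul' k X ∘ₗ (TensorProduct.comm k X X).toLinearMap))
      (WithConv.toConv (Algebra.linearMap k X ∘ₗ TensorProduct.lift s.form ∘ₗ TensorProduct.map (ι : X →ₗ[k] H) (ι : X →ₗ[k] H)))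
    have a1 : (ι : X →ₐ[k] H).toLinearMap ∘ₗ (Algebra.linearMap k X ∘ₗ TensorProduct.lift s.form ∘ₗ TensorProduct.map (ι : X →ₗ[k] H) (ι : X →ₗ[k] H)) =
        (Algebra.linearMap k H ∘ₗ TensorProduct.lift s.form) ∘ₗ TensorProduct.map (ι : X →ₗ[k] H) (ι : X →ₗ[k] H) := by
      ext a b
      exact AlgHomClass.commutes ι _
    have a2 : (ι : X →ₐ[k] H).toLinearMap ∘ₗ LinearMap.mul' k X =
        LinearMap.mul' k H ∘ₗ TensorProduct.map (ι : X →ₗ[k] H) (ι : X →ₗ[k] H) := by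
      ext a b; simp
    have a3 : (ι : X →ₐ[k] H).toLinearMap ∘ₗ LinearMap.mul' k X ∘ₗ (TensorProduct.comm k X X).toLinearMap =
        (LinearMap.mul' k H ∘ₗ (TensorProduct.comm k H H).toLinearMap) ∘ₗ TensorProduct.map (ι : X →ₗ[k] H) (ι : X →ₗ[k] H) := by
      ext a b; simp
    apply WithConv.ofConv_injective
    ext1
    apply LinearMap.ext
    intro a
    apply LinearMap.ext
    intro b
    apply hι
    rw [a1] at h3 h4
    rw [a2] at h3
    rw [a3] at h4
    exact LinearMap.congr_fun (h3.trans (h1.symm.trans (key.trans (h2.trans h4.symm)))) (a ⊗ₜ b)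

end comapSec

section inv
variable {k : Type*} [Field k] {H : Type*} [Ring H] [HopfAlgebra k H] (s : CQTStructure k H)

/-- The inverse of the antipode. -/
noncomputable def antipodeInv : H →ₗ[k] H :=
  (LinearEquiv.ofBijective (antipode k (A := H)) s.antipode_bijective).symm.toLinearMap

lemma antipode_antipodeInv (h : H) : antipode k (s.antipodeInv h) = h :=
  (LinearEquiv.ofBijective (antipode k (A := H)) s.antipode_bijective).apply_symm_apply h

lemma antipodeInv_antipode (h : H) : s.antipodeInv (antipode k h) = h :=
  (LinearEquiv.ofBijective (antipode k (A := H)) s.antipode_bijective).symm_apply_apply h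

lemma comul_antipodeInv (h : H) : comul (R := k) (s.antipodeInv h) =
    TensorProduct.map s.antipodeInv s.antipodeInv (TensorProduct.comm k H H (comul (R := k) h)) := by
  have e := comul_antipode' (k := k) (s.antipodeInv h)
  rw [s.antipode_antipodeInv] at e
  rw [e]
  generalize comul (R := k) (s.antipodeInv h) = w
  induction w with
  | zero => simp
  | add x y hx hy => simp only [map_add]; rw [← hx, ← hy]
  | tmul p q => simp [antipodeInv_antipode]

lemma mul_antipodeInv_comul (h : H) : LinearMap.mul' k H (TensorProduct.map LinearMap.id s.antipodeInv
    (TensorProduct.comm k H H (comul (R := k) h))) = algebraMap k H (counit h) := by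
  apply s.antipode_bijective.1
  have e := HopfAlgebra.mul_antipode_lTensor_comul_apply (R := k) h
  refine Eq.trans (Eq.trans ?_ e) ?_
  · generalize comul (R := k) h = w
    induction w with
    | zero => simp
    | add x y hx hy => simp only [map_add]; rw [← hx, ← hy]
    | tmul p q => simp [antipode_antipodeInv, antipode_mul_antidistrib]
  · simp [Algebra.algebraMap_eq_smul_one]

lemma antipodeInv_mul_comul (h : H) : LinearMap.mul' k H (TensorProduct.map s.antipodeInv LinearMap.id
    (TensorProduct.comm k H H (comul (R := k) h))) = algebraMap k H (counit h) := by
  apply s.antipode_bijective.1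
  have e := HopfAlgebra.mul_antipode_rTensor_comul_apply (R := k) h
  refine Eq.trans (Eq.trans ?_ e) ?_
  · generalize comul (R := k) h = w
    induction w with
    | zero => simp
    | add x y hx hy => simp only [map_add]; rw [← hx, ← hy]
    | tmul p q => simp [antipode_antipodeInv, antipode_mul_antidistrib]
  · simp [Algebra.algebraMap_eq_smul_one]

end inv
end CQTStructure

section hom
variable {k : Type*} [Field k] {H : Type*} [Ring H] [HopfAlgebra k H]
  {X : Type*} [Ring X] [HopfAlgebra k X]

/-- Bialgebra maps between Hopf algebras commute with the antipodes. -/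
lemma map_antipode' (ι : X →ₐc[k] H) (x : X) : ι (antipode k x) = antipode k (ι x) := by
  have h1 : WithConv.toConv ((ι : X →ₐ[k] H).toLinearMap ∘ₗ antipode k) *
      WithConv.toConv ((ι : X →ₐ[k] H).toLinearMap) = 1 := by
    have := LinearMap.algHom_comp_convMul_distrib (ι : X →ₐ[k] H)
      (WithConv.toConv (antipode k)) (WithConv.toConv LinearMap.id)
    rw [LinearMap.antipode_mul_id] at this
    refine (congrArg WithConv.toConv this).symm.trans ?_
    ext x
    exact AlgHomClass.commutes ι _
  have h2 : WithConv.toConv ((ι : X →ₐ[k] H).toLinearMap) *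
      WithConv.toConv (antipode k ∘ₗ (ι : X →ₐ[k] H).toLinearMap) = 1 := by
    have := LinearMap.convMul_comp_coalgHom_distrib (WithConv.toConv LinearMap.id)
      (WithConv.toConv (antipode k (A := H))) (ι : X →ₗc[k] H)
    rw [LinearMap.id_mul_antipode] at this
    refine (congrArg WithConv.toConv this).symm.trans ?_
    apply WithConv.ofConv_injective
    ext x
    change algebraMap k H (counit (R := k) (ι x)) = algebraMap k H (counit (R := k) x)
    simp
  exact LinearMap.congr_fun (congrArg WithConv.ofConv (left_inv_eq_right_inv h1 h2)) x

end hom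

namespace CQTStructure
section HXAdef
variable {k : Type*} [Field k] {H : Type*} [Ring H] [Bialgebra k H]
  {A : Type*} [Ring A] [Bialgebra k A] {X : Type*} [Ring X] [Bialgebra k X]

/-- `x ↦ l_x = σ(-, x)`. -/
noncomputable def lMap (s : CQTStructure k H) (ι : X →ₐc[k] H) : X →ₗ[k] WithConv (H →ₗ[k] k) :=
  (WithConv.linearEquiv k (H →ₗ[k] k)).symm.toLinearMap ∘ₗ s.form.flip ∘ₗ (ι : X →ₗ[k] H)

/-- `a ↦ r_a = σ(a, -)`. -/
noncomputable def rMap (s : CQTStructure k H) (ι : A →ₐc[k] H) : A →ₗ[k] WithConv (H →ₗ[k] k) :=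
  (WithConv.linearEquiv k (H →ₗ[k] k)).symm.toLinearMap ∘ₗ s.form ∘ₗ (ι : A →ₗ[k] H)

/-- The subalgebra of the dual algebra generated by the `l_x` and the `r_a`. -/
noncomputable def subalg (s : CQTStructure k H) (ιX : X →ₐc[k] H) (ιA : A →ₐc[k] H) :
    Subalgebra k (WithConv (H →ₗ[k] k)) :=
  Algebra.adjoin k (Set.range (s.lMap ιX) ∪ Set.range (s.rMap ιA))

/-- `H_{X,A}`, the subalgebra generated by the `l_x` and the `r_a`. Its product is convolution, its
comultiplication is `f ↦ f₁ ⊗ f₂` with `f (h * h') = f₁ h * f₂ h'`, its counit is `f ↦ f 1`. -/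
def HXA (s : CQTStructure k H) (ιX : X →ₐc[k] H) (ιA : A →ₐc[k] H) : Type _ := s.subalg ιX ιA

variable (s : CQTStructure k H) (ιX : X →ₐc[k] H) (ιA : A →ₐc[k] H)

noncomputable instance : Ring (s.HXA ιX ιA) := inferInstanceAs (Ring (s.subalg ιX ιA))
noncomputable instance : Algebra k (s.HXA ιX ιA) := inferInstanceAs (Algebra k (s.subalg ιX ιA))

/-- The inclusion of `H_{X,A}` into the dual algebra of `H`. -/
noncomputable def incl : s.HXA ιX ιA →ₐ[k] WithConv (H →ₗ[k] k) := (s.subalg ιX ιA).val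

lemma incl_injective : Function.Injective (s.incl ιX ιA) := Subtype.val_injective

/-- `l_x` as an element of `H_{X,A}`. -/
noncomputable def lElt : X →ₗ[k] s.HXA ιX ιA :=
  (s.lMap ιX).codRestrict (Subalgebra.toSubmodule (s.subalg ιX ιA))
    (fun x => Algebra.subset_adjoin (Or.inl ⟨x, rfl⟩))

/-- `r_a` as an element of `H_{X,A}`. -/
noncomputable def rElt : A →ₗ[k] s.HXA ιX ιA :=
  (s.rMap ιA).codRestrict (Subalgebra.toSubmodule (s.subalg ιX ιA))
    (fun x => Algebra.subset_adjoin (Or.inr ⟨x, rfl⟩))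

lemma mulDual_mem (f : s.HXA ιX ιA) :
    mulDual k H (s.incl ιX ιA f) ∈ (tensorEval (s.incl ιX ιA)).range := by
  have : s.subalg ιX ιA ≤ (tensorEval (s.incl ιX ιA)).range.comap (mulDual k H) := by
    apply Algebra.adjoin_le
    rintro g (⟨x, rfl⟩ | ⟨a, rfl⟩)
    · refine ⟨TensorProduct.map (s.lElt ιX ιA) (s.lElt ιX ιA) (comul x), ?_⟩
      apply WithConv.ofConv_injective
      ext h h'
      refine (tensorEval_apply _ _ h h').trans ?_
      change _ = s.form (h * h') (ιX x)
      rw [show s.form (h * h') (ιX x) = LinearMap.mul' k k (TensorProduct.map (s.form h) (s.form h')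
        (comul (ιX x))) from LinearMap.congr_fun (congrArg WithConv.ofConv (s.form_mul_left h h')) _,
        ← CoalgHomClass.map_comp_comul_apply]
      generalize comul (R := k) x = w
      induction w with
      | zero => simp
      | add x y hx hy => simp only [map_add, hx, hy]
      | tmul p q => rfl
    · refine ⟨TensorProduct.map (s.rElt ιX ιA) (s.rElt ιX ιA) (TensorProduct.comm k A A (comul a)), ?_⟩
      apply WithConv.ofConv_injective
      ext h h'
      refine (tensorEval_apply _ _ h h').trans ?_
      change _ = s.form (ιA a) (h * h')
      rw [show s.form (ιA a) (h * h') = LinearMap.mul' k k (TensorProduct.map (s.form.flip h')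
        (s.form.flip h) (comul (ιA a))) from
          LinearMap.congr_fun (congrArg WithConv.ofConv (s.form_mul_right h h')) _,
        ← CoalgHomClass.map_comp_comul_apply]
      generalize comul (R := k) a = w
      induction w with
      | zero => simp
      | add x y hx hy => simp only [map_add, hx, hy]
      | tmul p q => exact mul_comm _ _
  exact this f.2

noncomputable instance : Bialgebra k (s.HXA ιX ιA) :=
  dualBialgebra (s.incl ιX ιA) (s.incl_injective ιX ιA) (s.mulDual_mem ιX ιA)

end HXAdef

section HXAHopf
variable {k : Type*} [Field k] {H : Type*} [Ring H] [HopfAlgebra k H]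
  {A : Type*} [Ring A] [HopfAlgebra k A] {X : Type*} [Ring X] [HopfAlgebra k X]
variable (s : CQTStructure k H) (ιX : X →ₐc[k] H) (ιA : A →ₐc[k] H)

/-- `f ↦ f ∘ S⁻¹` on the dual of `H`. -/
noncomputable def dualAntipodeInv : WithConv (H →ₗ[k] k) →ₗ[k] WithConv (H →ₗ[k] k) :=
  (WithConv.linearEquiv k (H →ₗ[k] k)).symm.toLinearMap ∘ₗ
    LinearMap.lcomp k k s.antipodeInv ∘ₗ (WithConv.linearEquiv k (H →ₗ[k] k)).toLinearMap

lemma dualAntipodeInv_mul (f g : WithConv (H →ₗ[k] k)) :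
    s.dualAntipodeInv (f * g) = s.dualAntipodeInv g * s.dualAntipodeInv f := by
  apply WithConv.ofConv_injective
  ext h
  change LinearMap.mul' k k (TensorProduct.map f.ofConv g.ofConv (comul (s.antipodeInv h))) =
    LinearMap.mul' k k (TensorProduct.map (g.ofConv ∘ₗ s.antipodeInv) (f.ofConv ∘ₗ s.antipodeInv)
      (comul h))
  rw [comul_antipodeInv]
  generalize comul (R := k) h = w
  induction w with
  | zero => simp
  | add x y hx hy => simp only [map_add, hx, hy]
  | tmul p q => exact mul_comm _ _

lemma dualAntipodeInv_mem (f : WithConv (H →ₗ[k] k)) (hf : f ∈ s.subalg ιX ιA) :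
    s.dualAntipodeInv f ∈ s.subalg ιX ιA := by
  induction hf using Algebra.adjoin_induction with
  | mem f hf =>
    rcases hf with ⟨x, rfl⟩ | ⟨a, rfl⟩
    · refine Algebra.subset_adjoin (Or.inl ⟨antipode k x, ?_⟩)
      apply WithConv.ofConv_injective
      ext h
      change s.form h (ιX (antipode k x)) = s.form (s.antipodeInv h) (ιX x)
      rw [map_antipode', ← s.form_antipode_antipode (s.antipodeInv h), s.antipode_antipodeInv]
    · refine Algebra.subset_adjoin (Or.inr ⟨antipode k a, ?_⟩)
      apply WithConv.ofConv_injective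
      ext h
      change s.form (ιA (antipode k a)) h = s.form (ιA a) (s.antipodeInv h)
      rw [map_antipode', ← s.form_antipode_antipode _ (s.antipodeInv h), s.antipode_antipodeInv]
  | algebraMap r =>
    rw [Algebra.algebraMap_eq_smul_one, map_smul]
    refine Subalgebra.smul_mem _ ?_ r
    have : s.dualAntipodeInv 1 = 1 := by
      apply WithConv.ofConv_injective
      ext h
      change counit (R := k) (s.antipodeInv h) = counit (R := k) h
      conv_rhs => rw [← s.antipode_antipodeInv h, counit_antipode]
    rw [this]
    exact one_mem _
  | add f g _ _ hf hg => rw [map_add]; exact add_mem hf hg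
  | mul f g _ _ hf hg => rw [dualAntipodeInv_mul]; exact mul_mem hg hf

/-- The antipode `f ↦ f ∘ S⁻¹` of the co-opposite of `H_{X,A}`. -/
noncomputable def copAntipode : s.HXA ιX ιA →ₗ[k] s.HXA ιX ιA :=
  s.dualAntipodeInv.restrict (p := Subalgebra.toSubmodule (s.subalg ιX ιA))
    (q := Subalgebra.toSubmodule (s.subalg ιX ιA)) (s.dualAntipodeInv_mem ιX ιA)

lemma eval_copAntipode (h : H) (f : s.HXA ιX ιA) :
    evalAt (s.incl ιX ιA) h (s.copAntipode ιX ιA f) = evalAt (s.incl ιX ιA) (s.antipodeInv h) f := rfl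

lemma tensorEval_comul (f : s.HXA ιX ιA) (t : H ⊗[k] H) :
    (tensorEval (s.incl ιX ιA) (comul (R := k) f)).ofConv t =
      (s.incl ιX ιA f).ofConv (LinearMap.mul' k H t) := by
  have := tensorEval_dualComul (s.incl ιX ιA) (s.incl_injective ιX ιA) (s.mulDual_mem ιX ιA) f
  exact LinearMap.congr_fun (congrArg WithConv.ofConv this) t

lemma eval_ext (f g : s.HXA ιX ιA)
    (h : ∀ h, evalAt (s.incl ιX ιA) h f = evalAt (s.incl ιX ιA) h g) : f = g := by
  rw [← sub_eq_zero]
  apply evalAt_separating (s.incl ιX ιA) (s.incl_injective ιX ιA)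
  intro x
  rw [map_sub, sub_eq_zero, h]

lemma eval_mul (h : H) (f g : s.HXA ιX ιA) : evalAt (s.incl ιX ιA) h (f * g) =
    LinearMap.mul' k k (TensorProduct.map (s.incl ιX ιA f).ofConv (s.incl ιX ιA g).ofConv
      (comul h)) := rfl

lemma tensorEval_tmul (f g : s.HXA ιX ιA) (t : H ⊗[k] H) :
    (tensorEval (s.incl ιX ιA) (f ⊗ₜ g)).ofConv t =
    LinearMap.mul' k k (TensorProduct.map (s.incl ιX ιA f).ofConv (s.incl ιX ιA g).ofConv t) := by
  refine (LinearMap.congr_fun (congrArg WithConv.ofConv (tensorEvalLin_tmul (s.incl ιX ιA) f g)) t)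

noncomputable instance : HopfAlgebra k (Cop (s.HXA ιX ιA)) where
  antipode := s.copAntipode ιX ιA
  mul_antipode_rTensor_comul := by
    have key : ∀ (h : H) (t : s.HXA ιX ιA ⊗[k] s.HXA ιX ιA), evalAt (s.incl ιX ιA) h
        (LinearMap.mul' k (s.HXA ιX ιA) ((s.copAntipode ιX ιA).rTensor (s.HXA ιX ιA)
          (TensorProduct.comm k _ _ t))) = (tensorEval (s.incl ιX ιA) t).ofConv
          (TensorProduct.map LinearMap.id s.antipodeInv (TensorProduct.comm k H H (comul h))) := by
      intro h t
      induction t with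
      | zero => simp
      | add x y hx hy => simp only [map_add, hx, hy, WithConv.ofConv_add, LinearMap.add_apply]
      | tmul f g =>
        rw [tensorEval_tmul]
        simp only [comm_tmul, LinearMap.rTensor_tmul, LinearMap.mul'_apply, eval_mul]
        generalize comul (R := k) h = w
        induction w with
        | zero => simp
        | add x y hx hy => simp only [map_add, hx, hy]
        | tmul p q => exact mul_comm _ _
    ext f
    refine s.eval_ext ιX ιA _ _ (fun h => ?_)
    refine (key h (comul (R := k) (A := s.HXA ιX ιA) f)).trans ?_
    refine (s.tensorEval_comul ιX ιA f _).trans ?_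
    rw [mul_antipodeInv_comul, Algebra.algebraMap_eq_smul_one, map_smul]
    change _ = (s.incl ιX ιA (algebraMap k (s.HXA ιX ιA)
      ((s.incl ιX ιA f).ofConv 1))).ofConv h
    rw [AlgHom.commutes]
    exact mul_comm _ _
  mul_antipode_lTensor_comul := by
    have key : ∀ (h : H) (t : s.HXA ιX ιA ⊗[k] s.HXA ιX ιA), evalAt (s.incl ιX ιA) h
        (LinearMap.mul' k (s.HXA ιX ιA) ((s.copAntipode ιX ιA).lTensor (s.HXA ιX ιA)
          (TensorProduct.comm k _ _ t))) = (tensorEval (s.incl ιX ιA) t).ofConv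
          (TensorProduct.map s.antipodeInv LinearMap.id (TensorProduct.comm k H H (comul h))) := by
      intro h t
      induction t with
      | zero => simp
      | add x y hx hy => simp only [map_add, hx, hy, WithConv.ofConv_add, LinearMap.add_apply]
      | tmul f g =>
        rw [tensorEval_tmul]
        simp only [comm_tmul, LinearMap.lTensor_tmul, LinearMap.mul'_apply, eval_mul]
        generalize comul (R := k) h = w
        induction w with
        | zero => simp
        | add x y hx hy => simp only [map_add, hx, hy]
        | tmul p q => exact mul_comm _ _
    ext f
    refine s.eval_ext ιX ιA _ _ (fun h => ?_)
    refine (key h (comul (R := k) (A := s.HXA ιX ιA) f)).trans ?_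
    refine (s.tensorEval_comul ιX ιA f _).trans ?_
    rw [antipodeInv_mul_comul, Algebra.algebraMap_eq_smul_one, map_smul]
    change _ = (s.incl ιX ιA (algebraMap k (s.HXA ιX ιA)
      ((s.incl ιX ιA f).ofConv 1))).ofConv h
    rw [AlgHom.commutes]
    exact mul_comm _ _

end HXAHopf
end CQTStructure

section comodule
open CategoryTheory MonoidalCategory
universe u

/-- A right coaction `v ↦ v₍₀₎ ⊗ v₍₁₎` of the coalgebra `C` on `V`. -/
structure RightCoaction (k C V : Type*) [Field k] [AddCommGroup C] [Module k C] [Coalgebra k C]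
    [AddCommGroup V] [Module k V] where
  coact : V →ₗ[k] V ⊗[k] C
  coassoc : ∀ v, TensorProduct.assoc k V C C (coact.rTensor C (coact v)) =
    (comul (R := k) (A := C)).lTensor V (coact v)
  counit_coact : ∀ v, TensorProduct.rid k V ((counit (R := k) (A := C)).lTensor V (coact v)) = v

namespace RightCoaction
variable {k C V W : Type*} [Field k] [Ring C] [AddCommGroup V] [Module k V] [AddCommGroup W]
  [Module k W]

section alg
variable [Algebra k C]
variable (k C V W) in
/-- `(v ⊗ c) ⊗ (w ⊗ d) ↦ (v ⊗ w) ⊗ c d`. -/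
noncomputable def tensorMul : V ⊗[k] C →ₗ[k] W ⊗[k] C →ₗ[k] (V ⊗[k] W) ⊗[k] C :=
  TensorProduct.map₂ (TensorProduct.mk k V W) (LinearMap.mul k C)

@[simp] lemma tensorMul_tmul (v : V) (c : C) (w : W) (d : C) :
    tensorMul k C V W (v ⊗ₜ c) (w ⊗ₜ d) = (v ⊗ₜ w) ⊗ₜ (c * d) := rfl

lemma tensorMul_map {D : Type*} [Ring D] [Algebra k D] (φ : C →ₐ[k] D) (x : V ⊗[k] C)
    (y : W ⊗[k] C) : φ.toLinearMap.lTensor (V ⊗[k] W) (tensorMul k C V W x y) =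
      tensorMul k D V W (φ.toLinearMap.lTensor V x) (φ.toLinearMap.lTensor W y) := by
  induction x with
  | zero => simp
  | add x y hx hy => simp only [map_add, LinearMap.add_apply, hx, hy]
  | tmul v c =>
    induction y with
    | zero => simp
    | add x y hx hy => simp only [map_add, hx, hy]
    | tmul w d => simp

lemma tensorMul_assoc (x : V ⊗[k] C) (w : W ⊗[k] C) (c d : C) :
    TensorProduct.assoc k _ _ _ (tensorMul k C V W x w ⊗ₜ (c * d)) =
    tensorMul k (C ⊗[k] C) V W (TensorProduct.assoc k _ _ _ (x ⊗ₜ c))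
      (TensorProduct.assoc k _ _ _ (w ⊗ₜ d)) := by
  induction x with
  | zero => simp
  | add x y hx hy => simp only [map_add, LinearMap.add_apply, add_tmul, hx, hy]
  | tmul v c =>
    induction w with
    | zero => simp
    | add x y hx hy => simp only [map_add, add_tmul, hx, hy]
    | tmul w d => simp

end alg

variable [Bialgebra k C]

/-- The diagonal coaction `v ⊗ w ↦ v₍₀₎ ⊗ w₍₀₎ ⊗ v₍₁₎ w₍₁₎`. -/
noncomputable def tensor (ρ : RightCoaction k C V) (τ : RightCoaction k C W) :
    RightCoaction k C (V ⊗[k] W) where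
  coact := TensorProduct.lift ((tensorMul k C V W).compl₁₂ ρ.coact τ.coact)
  coassoc := by
    have key : ∀ (x : V ⊗[k] C) (y : W ⊗[k] C), TensorProduct.assoc k (V ⊗[k] W) C C
        ((TensorProduct.lift ((tensorMul k C V W).compl₁₂ ρ.coact τ.coact)).rTensor C
          (tensorMul k C V W x y)) = tensorMul k (C ⊗[k] C) V W
          (TensorProduct.assoc k V C C (ρ.coact.rTensor C x))
          (TensorProduct.assoc k W C C (τ.coact.rTensor C y)) := by
      intro x y
      induction x with
      | zero => simp
      | add x y hx hy => simp only [map_add, LinearMap.add_apply, hx, hy]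
      | tmul v c =>
        induction y with
        | zero => simp
        | add x y hx hy => simp only [map_add, hx, hy]
        | tmul w d =>
          simp only [tensorMul_tmul, LinearMap.rTensor_tmul, TensorProduct.lift.tmul,
            LinearMap.compl₁₂_apply]
          exact tensorMul_assoc (ρ.coact v) (τ.coact w) c d
    intro t
    induction t with
    | zero => simp
    | add x y hx hy => simp only [map_add, hx, hy]
    | tmul v w =>
      rw [TensorProduct.lift.tmul, LinearMap.compl₁₂_apply, key, ρ.coassoc, τ.coassoc]
      exact (tensorMul_map (Bialgebra.comulAlgHom k C) _ _).symm
  counit_coact := by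
    intro t
    induction t with
    | zero => simp
    | add x y hx hy => simp only [map_add, hx, hy]
    | tmul v w =>
      rw [TensorProduct.lift.tmul, LinearMap.compl₁₂_apply]
      have key : ∀ (x : V ⊗[k] k) (y : W ⊗[k] k), TensorProduct.rid k (V ⊗[k] W)
          (tensorMul k k V W x y) = TensorProduct.rid k V x ⊗ₜ TensorProduct.rid k W y := by
        intro x y
        induction x with
        | zero => simp
        | add x y hx hy => simp only [map_add, LinearMap.add_apply, add_tmul, hx, hy]
        | tmul v c =>
          induction y with
          | zero => simp
          | add x y hx hy => simp only [map_add, tmul_add, hx, hy]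
          | tmul w d => simp [TensorProduct.smul_tmul', smul_smul, mul_comm]
      refine (congrArg (TensorProduct.rid k (V ⊗[k] W))
        (tensorMul_map (Bialgebra.counitAlgHom k C) (ρ.coact v) (τ.coact w))).trans ?_
      rw [key]
      exact congrArg₂ (fun a b => a ⊗ₜ b) (ρ.counit_coact v) (τ.counit_coact w)

@[simp] lemma tensor_coact_tmul (ρ : RightCoaction k C V) (τ : RightCoaction k C W) (v : V) (w : W) :
    (ρ.tensor τ).coact (v ⊗ₜ w) = tensorMul k C V W (ρ.coact v) (τ.coact w) := rfl

variable (k C) in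
/-- The trivial coaction `r ↦ r ⊗ 1`. -/
noncomputable def triv : RightCoaction k C k where
  coact := (TensorProduct.mk k k C).flip 1
  coassoc v := by simp [Algebra.TensorProduct.one_def]
  counit_coact v := by simp

lemma assoc_coact {U : Type*} [AddCommGroup U] [Module k U] (ρ : RightCoaction k C U)
    (τ : RightCoaction k C V) (υ : RightCoaction k C W) (t : (U ⊗[k] V) ⊗[k] W) :
    (ρ.tensor (τ.tensor υ)).coact (TensorProduct.assoc k U V W t) =
      (TensorProduct.assoc k U V W).toLinearMap.rTensor C (((ρ.tensor τ).tensor υ).coact t) := by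
  have key : ∀ (x : U ⊗[k] C) (y : V ⊗[k] C) (z : W ⊗[k] C),
      tensorMul k C U (V ⊗[k] W) x (tensorMul k C V W y z) =
      (TensorProduct.assoc k U V W).toLinearMap.rTensor C
        (tensorMul k C (U ⊗[k] V) W (tensorMul k C U V x y) z) := by
    intro x y z
    induction x with
    | zero => simp
    | add x y hx hy => simp only [map_add, LinearMap.add_apply, hx, hy]
    | tmul v c =>
      induction y with
      | zero => simp
      | add x y hx hy => simp only [map_add, LinearMap.add_apply, hx, hy]
      | tmul w d =>
        induction z with
        | zero => simp
        | add x y hx hy => simp only [map_add, hx, hy]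
        | tmul u e => simp [mul_assoc]
  induction t with
  | zero => simp
  | add x y hx hy => simp only [map_add, hx, hy]
  | tmul t n =>
    induction t with
    | zero => simp
    | add x y hx hy => simp only [add_tmul, map_add, hx, hy]
    | tmul l m => exact key _ _ _

lemma lid_coact (ρ : RightCoaction k C V) (t : k ⊗[k] V) :
    ρ.coact (TensorProduct.lid k V t) =
      (TensorProduct.lid k V).toLinearMap.rTensor C (((triv k C).tensor ρ).coact t) := by
  have key : ∀ (r : k) (x : V ⊗[k] C), r • x = (TensorProduct.lid k V).toLinearMap.rTensor C
      (tensorMul k C k V (r ⊗ₜ 1) x) := by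
    intro r x
    induction x with
    | zero => simp
    | add x y hx hy => rw [smul_add, map_add, map_add, hx, hy]
    | tmul v c => simp [TensorProduct.smul_tmul']
  induction t with
  | zero => simp
  | add x y hx hy => simp only [map_add, hx, hy]
  | tmul r m =>
    rw [TensorProduct.lid_tmul, map_smul]
    exact key _ _

lemma rid_coact (ρ : RightCoaction k C V) (t : V ⊗[k] k) :
    ρ.coact (TensorProduct.rid k V t) =
      (TensorProduct.rid k V).toLinearMap.rTensor C ((ρ.tensor (triv k C)).coact t) := by
  have key : ∀ (r : k) (x : V ⊗[k] C), r • x = (TensorProduct.rid k V).toLinearMap.rTensor C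
      (tensorMul k C V k x (r ⊗ₜ 1)) := by
    intro r x
    induction x with
    | zero => simp
    | add x y hx hy => rw [smul_add, map_add, LinearMap.add_apply, map_add, hx, hy]
    | tmul v c => simp [TensorProduct.smul_tmul']
  induction t with
  | zero => simp
  | add x y hx hy => simp only [map_add, hx, hy]
  | tmul m r =>
    rw [TensorProduct.rid_tmul, map_smul]
    exact key _ _

end RightCoaction

/-- Right comodules over `C`. -/
structure RightComod (k C : Type u) [Field k] [Ring C] [Bialgebra k C] where
  V : ModuleCat.{u} k
  str : RightCoaction k C V

namespace RightComod
variable {k C : Type u} [Field k] [Ring C] [Bialgebra k C]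

/-- The coaction. -/
abbrev coact (M : RightComod k C) : M.V →ₗ[k] M.V ⊗[k] C := M.str.coact

/-- Colinear maps. -/
@[ext] structure Hom (M N : RightComod k C) where
  lin : M.V →ₗ[k] N.V
  colin : ∀ m, N.coact (lin m) = lin.rTensor C (M.coact m)

instance : Category (RightComod k C) where
  Hom M N := Hom M N
  id M := ⟨LinearMap.id, fun m => by simp⟩
  comp f g := ⟨g.lin ∘ₗ f.lin, fun m => by
    rw [LinearMap.comp_apply, g.colin, f.colin, LinearMap.rTensor_comp]; rfl⟩

@[ext] lemma hom_ext {M N : RightComod k C} {f g : M ⟶ N} (h : Hom.lin f = Hom.lin g) : f = g :=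
  Hom.ext h

/-- The forgetful functor to vector spaces. -/
def forget : RightComod k C ⥤ ModuleCat.{u} k where
  obj M := M.V
  map f := ModuleCat.ofHom (Hom.lin f)

instance : (forget (k := k) (C := C)).Faithful where
  map_injective h := hom_ext (congrArg ModuleCat.Hom.hom h)

/-- Bijective colinear maps are isomorphisms. -/
def isoOfEquiv {M N : RightComod k C} (e : M.V ≃ₗ[k] N.V)
    (h : ∀ m, N.coact (e m) = e.toLinearMap.rTensor C (M.coact m)) : M ≅ N where
  hom := ⟨e.toLinearMap, h⟩
  inv := ⟨e.symm.toLinearMap, fun n => by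
    have := h (e.symm n)
    rw [e.apply_symm_apply] at this
    change M.coact (e.symm n) = _
    rw [this, ← LinearMap.comp_apply, ← LinearMap.rTensor_comp]
    simp⟩
  hom_inv_id := hom_ext (by ext m; exact e.symm_apply_apply m)
  inv_hom_id := hom_ext (by ext m; exact e.apply_symm_apply m)

/-- The tensor product of two maps is colinear. -/
lemma map_colin {M N M' N' : RightComod k C} (f : Hom M M') (g : Hom N N') (t : M.V ⊗[k] N.V) :
    (M'.str.tensor N'.str).coact (TensorProduct.map f.lin g.lin t) =
      (TensorProduct.map f.lin g.lin).rTensor C ((M.str.tensor N.str).coact t) := by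
  induction t with
  | zero => simp
  | add x y hx hy => simp only [map_add, hx, hy]
  | tmul m n =>
    rw [TensorProduct.map_tmul, RightCoaction.tensor_coact_tmul, RightCoaction.tensor_coact_tmul]
    refine (congrArg₂ (fun a b => RightCoaction.tensorMul k C M'.V N'.V a b)
      (f.colin m) (g.colin n)).trans ?_
    generalize M.coact m = x
    generalize N.coact n = y
    induction x with
    | zero => simp
    | add x y hx hy => simp only [map_add, LinearMap.add_apply, hx, hy]
    | tmul v c =>
      induction y with
      | zero => simp
      | add x y hx hy => simp only [map_add, hx, hy]
      | tmul w d => simp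

noncomputable instance : MonoidalCategoryStruct (RightComod k C) where
  tensorObj M N := ⟨ModuleCat.of k (M.V ⊗[k] N.V), M.str.tensor N.str⟩
  tensorUnit := ⟨ModuleCat.of k k, RightCoaction.triv k C⟩
  tensorHom f g := ⟨TensorProduct.map (Hom.lin f) (Hom.lin g), map_colin f g⟩
  whiskerLeft M _ _ g := ⟨TensorProduct.map LinearMap.id (Hom.lin g), map_colin (Hom.mk LinearMap.id (by simp)) g⟩
  whiskerRight f N := ⟨TensorProduct.map (Hom.lin f) LinearMap.id, map_colin f (Hom.mk LinearMap.id (by simp))⟩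
  associator L M N := isoOfEquiv (TensorProduct.assoc k L.V M.V N.V)
    (RightCoaction.assoc_coact L.str M.str N.str)
  leftUnitor M := isoOfEquiv (TensorProduct.lid k M.V) (RightCoaction.lid_coact M.str)
  rightUnitor M := isoOfEquiv (TensorProduct.rid k M.V) (RightCoaction.rid_coact M.str)

noncomputable instance : MonoidalCategory (RightComod k C) :=
  Monoidal.induced forget
  { μIso _ _ := .refl _
    εIso := .refl _
    associator_eq _ _ _ := by ext1; exact TensorProduct.ext (TensorProduct.ext rfl)
    leftUnitor_eq _ := by ext1; exact TensorProduct.ext rfl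
    rightUnitor_eq _ := by ext1; exact TensorProduct.ext rfl }

end RightComod
end comodule

section yd
open CategoryTheory MonoidalCategory
universe u

/-- For `v : V`, the map `κ ⊗ κ' ↦ (κ ▷ v)₍₋₁₎ κ' ⊗ (κ ▷ v)₍₀₎`. -/
noncomputable def ydRight {k K V : Type*} [Field k] [Ring K] [Algebra k K] [AddCommGroup V]
    [Module k V] (act : K →ₗ[k] V →ₗ[k] V) (coact : V →ₗ[k] K ⊗[k] V) (v : V) :
    K ⊗[k] K →ₗ[k] K ⊗[k] V :=
  TensorProduct.lift
    ((LinearMap.rTensorHom V ∘ₗ (LinearMap.mul k K).flip).flip ∘ₗ coact ∘ₗ act.flip v)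

/-- A left-left Yetter-Drinfeld module structure over the bialgebra `K` on `V`: an action, a
coaction `v ↦ v₍₋₁₎ ⊗ v₍₀₎`, and
`κ₁ v₍₋₁₎ ⊗ κ₂ ▷ v₍₀₎ = (κ₁ ▷ v)₍₋₁₎ κ₂ ⊗ (κ₁ ▷ v)₍₀₎`. -/
structure YDStruct (k K V : Type*) [Field k] [Ring K] [Bialgebra k K]
    [AddCommGroup V] [Module k V] where
  act : K →ₗ[k] V →ₗ[k] V
  one_act : ∀ v, act 1 v = v
  mul_act : ∀ κ κ' v, act (κ * κ') v = act κ (act κ' v)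
  coact : V →ₗ[k] K ⊗[k] V
  coassoc : ∀ v, TensorProduct.assoc k K K V ((comul (R := k) (A := K)).rTensor V (coact v)) =
    coact.lTensor K (coact v)
  counit_coact : ∀ v, TensorProduct.lid k V ((counit (R := k) (A := K)).rTensor V (coact v)) = v
  compat : ∀ κ v, TensorProduct.map₂ (LinearMap.mul k K) act (comul (R := k) κ) (coact v) =
    ydRight act coact v (comul (R := k) κ)

namespace YDStruct
variable {k K V W : Type*} [Field k] [Ring K] [AddCommGroup V] [Module k V] [AddCommGroup W]
  [Module k W]

section alg
variable [Algebra k K]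
variable (k K V W) in
/-- `(c ⊗ v) ⊗ (d ⊗ w) ↦ c d ⊗ (v ⊗ w)`. -/
noncomputable def tensorMul : K ⊗[k] V →ₗ[k] K ⊗[k] W →ₗ[k] K ⊗[k] (V ⊗[k] W) :=
  TensorProduct.map₂ (LinearMap.mul k K) (TensorProduct.mk k V W)

@[simp] lemma tensorMul_tmul (v : V) (c : K) (w : W) (d : K) :
    tensorMul k K V W (c ⊗ₜ v) (d ⊗ₜ w) = (c * d) ⊗ₜ (v ⊗ₜ w) := rfl

lemma tensorMul_map {D : Type*} [Ring D] [Algebra k D] (φ : K →ₐ[k] D) (x : K ⊗[k] V)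
    (y : K ⊗[k] W) : φ.toLinearMap.rTensor (V ⊗[k] W) (tensorMul k K V W x y) =
      tensorMul k D V W (φ.toLinearMap.rTensor V x) (φ.toLinearMap.rTensor W y) := by
  induction x with
  | zero => simp
  | add x y hx hy => simp only [map_add, LinearMap.add_apply, hx, hy]
  | tmul v c =>
    induction y with
    | zero => simp
    | add x y hx hy => simp only [map_add, hx, hy]
    | tmul w d => simp

lemma tensorMul_assoc (x : K ⊗[k] V) (w : K ⊗[k] W) (c d : K) :
    (c * d) ⊗ₜ tensorMul k K V W x w = TensorProduct.assoc k _ _ _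
    (tensorMul k (K ⊗[k] K) V W ((TensorProduct.assoc k _ _ _).symm (c ⊗ₜ x))
      ((TensorProduct.assoc k _ _ _).symm (d ⊗ₜ w))) := by
  induction x with
  | zero => simp
  | add x y hx hy => simp only [map_add, LinearMap.add_apply, tmul_add, hx, hy]
  | tmul v c =>
    induction w with
    | zero => simp
    | add x y hx hy => simp only [map_add, tmul_add, hx, hy]
    | tmul w d => simp

lemma map₂_mul (act : K →ₗ[k] V →ₗ[k] V) (act' : K →ₗ[k] W →ₗ[k] W)
    (h : ∀ κ κ' v, act (κ * κ') v = act κ (act κ' v))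
    (h' : ∀ κ κ' v, act' (κ * κ') v = act' κ (act' κ' v)) (s t : K ⊗[k] K) (x : V ⊗[k] W) :
    TensorProduct.map₂ act act' (s * t) x =
      TensorProduct.map₂ act act' s (TensorProduct.map₂ act act' t x) := by
  induction s with
  | zero => simp
  | add x y hx hy => simp only [add_mul, map_add, LinearMap.add_apply, hx, hy]
  | tmul a b =>
    induction t with
    | zero => simp
    | add x y hx hy => simp only [mul_add, map_add, LinearMap.add_apply, hx, hy]
    | tmul c d =>
      induction x with
      | zero => simp
      | add x y hx hy => simp only [map_add, hx, hy]
      | tmul v w => simp [h, h']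

end alg

variable [Bialgebra k K]

/-- The tensor product coaction. -/
noncomputable def tensorCoact (M : YDStruct k K V) (N : YDStruct k K W) :
    V ⊗[k] W →ₗ[k] K ⊗[k] (V ⊗[k] W) :=
  TensorProduct.lift ((tensorMul k K V W).compl₁₂ M.coact N.coact)

/-- The tensor product action. -/
noncomputable def tensorAct (M : YDStruct k K V) (N : YDStruct k K W) :
    K →ₗ[k] V ⊗[k] W →ₗ[k] V ⊗[k] W :=
  TensorProduct.map₂ M.act N.act ∘ₗ (comul (R := k) (A := K))

lemma tensor_compat (M : YDStruct k K V) (N : YDStruct k K W) (κ : K) (t : V ⊗[k] W) :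
    TensorProduct.map₂ (LinearMap.mul k K) (tensorAct M N) (comul (R := k) κ) (tensorCoact M N t) =
    ydRight (tensorAct M N) (tensorCoact M N) t (comul (R := k) κ) := by
  have rlin : ∀ x y : V ⊗[k] W, ydRight (tensorAct M N) (tensorCoact M N) (x + y) =
      ydRight (tensorAct M N) (tensorCoact M N) x + ydRight (tensorAct M N) (tensorCoact M N) y := by
    intro x y
    ext a b
    simp [ydRight]
  induction t with
  | zero =>
    have : ydRight (tensorAct M N) (tensorCoact M N) 0 = 0 := by
      ext a b
      simp [ydRight]
    simp [this]
  | add x y hx hy => simp only [map_add, rlin, LinearMap.add_apply, hx, hy]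
  | tmul v w =>
    set L := TensorProduct.map₂ (LinearMap.mul k K) M.act with hL
    set L' := TensorProduct.map₂ (LinearMap.mul k K) N.act with hL'
    let T := tensorMul k K V W
    set p := M.coact v with hp
    set q := N.coact w with hq
    let G : K ⊗[k] (K ⊗[k] K) →ₗ[k] K ⊗[k] (V ⊗[k] W) :=
      TensorProduct.lift ((T ∘ₗ M.coact ∘ₗ M.act.flip v).compl₂ (ydRight N.act N.coact w))
    let G2 : K ⊗[k] (K ⊗[k] K) →ₗ[k] K ⊗[k] (V ⊗[k] W) :=
      TensorProduct.lift ((T ∘ₗ M.coact ∘ₗ M.act.flip v).compl₂ (L'.flip q))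
    let G3 : (K ⊗[k] K) ⊗[k] K →ₗ[k] K ⊗[k] (V ⊗[k] W) :=
      TensorProduct.lift (T.compl₁₂ (L.flip p) (L'.flip q ∘ₗ TensorProduct.mk k K K 1))
    have s1 : ∀ z : K ⊗[k] K, ydRight (tensorAct M N) (tensorCoact M N) (v ⊗ₜ w) z =
        G (TensorProduct.assoc k K K K (comul.rTensor K z)) := by
      intro z
      induction z with
      | zero => simp
      | add x y hx hy => simp only [map_add, hx, hy]
      | tmul a b =>
        simp only [ydRight, tensorAct, LinearMap.rTensor_tmul, TensorProduct.lift.tmul,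
          LinearMap.comp_apply, LinearMap.flip_apply]
        generalize comul (R := k) a = t
        induction t with
        | zero => simp
        | add x y hx hy => simp only [map_add, LinearMap.add_apply, add_tmul, hx, hy]
        | tmul x y =>
          simp only [TensorProduct.map₂_apply_tmul, TensorProduct.map_tmul, tensorCoact,
            TensorProduct.lift.tmul, LinearMap.compl₁₂_apply, TensorProduct.assoc_tmul, G,
            LinearMap.compl₂_apply, LinearMap.comp_apply, LinearMap.flip_apply, ydRight, T]
          generalize M.coact (M.act x v) = c
          generalize N.coact (N.act y w) = d
          induction c with
          | zero => simp
          | add x y hx hy => simp only [map_add, LinearMap.add_apply, hx, hy]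
          | tmul c c' =>
            induction d with
            | zero => simp
            | add x y hx hy => simp only [map_add, hx, hy]
            | tmul d d' => simp [mul_assoc]
    have s2 : ∀ z : K ⊗[k] K, G (comul.lTensor K z) = G2 (comul.lTensor K z) := by
      intro z
      induction z with
      | zero => simp
      | add x y hx hy => simp only [map_add, hx, hy]
      | tmul a b =>
        simp only [G, G2, LinearMap.lTensor_tmul, TensorProduct.lift.tmul, LinearMap.compl₂_apply,
          LinearMap.flip_apply, hL', hq, N.compat]
    have s3 : ∀ z : K ⊗[k] K, G2 (TensorProduct.assoc k K K K (comul.rTensor K z)) =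
        G3 (comul.rTensor K z) := by
      intro z
      induction z with
      | zero => simp
      | add x y hx hy => simp only [map_add, hx, hy]
      | tmul a b =>
        have e : ∀ t : K ⊗[k] K, G2 (TensorProduct.assoc k K K K (t ⊗ₜ b)) =
            T (ydRight M.act M.coact v t) (L' (1 ⊗ₜ b) q) := by
          intro t
          induction t with
          | zero => simp
          | add x y hx hy => simp only [map_add, LinearMap.add_apply, add_tmul, hx, hy]
          | tmul x y =>
            simp only [TensorProduct.assoc_tmul, G2, LinearMap.compl₂_apply, LinearMap.comp_apply,
              TensorProduct.lift.tmul, LinearMap.flip_apply, ydRight, T, hL']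
            generalize M.coact (M.act x v) = c
            generalize q = d
            induction c with
            | zero => simp
            | add x y hx hy => simp only [map_add, LinearMap.add_apply, hx, hy]
            | tmul c c' =>
              induction d with
              | zero => simp
              | add x y hx hy => simp only [map_add, hx, hy]
              | tmul d d' => simp [mul_assoc]
        rw [LinearMap.rTensor_tmul, e, ← M.compat]
        rfl
    have s4 : ∀ z : K ⊗[k] K, TensorProduct.map₂ (LinearMap.mul k K) (tensorAct M N) z (T p q) =
        G3 ((TensorProduct.assoc k K K K).symm (comul.lTensor K z)) := by
      intro z
      induction z with
      | zero => simp
      | add x y hx hy => simp only [map_add, LinearMap.add_apply, hx, hy]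
      | tmul a b =>
        simp only [tensorAct, LinearMap.lTensor_tmul]
        have e : ∀ (t : K ⊗[k] K) (p' : K ⊗[k] V) (q' : K ⊗[k] W),
            TensorProduct.map (LinearMap.mul k K a) (TensorProduct.map₂ M.act N.act t) (T p' q') =
            TensorProduct.lift (T.compl₁₂ (L.flip p') (L'.flip q' ∘ₗ TensorProduct.mk k K K 1))
              ((TensorProduct.assoc k K K K).symm (a ⊗ₜ t)) := by
          intro t p' q'
          induction t with
          | zero => simp
          | add x y hx hy => simp only [map_add, TensorProduct.map_add_right, LinearMap.add_apply, tmul_add, hx, hy]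
          | tmul x y =>
            simp only [TensorProduct.assoc_symm_tmul, TensorProduct.lift.tmul,
              LinearMap.compl₁₂_apply, LinearMap.comp_apply, LinearMap.flip_apply,
              TensorProduct.mk_apply, hL, hL', T]
            induction p' with
            | zero => simp
            | add x y hx hy => simp only [map_add, LinearMap.add_apply, hx, hy]
            | tmul c c' =>
              induction q' with
              | zero => simp
              | add x y hx hy => simp only [map_add, hx, hy]
              | tmul d d' => simp [mul_assoc]
        exact e _ p q
    refine (s4 _).trans ?_
    rw [Coalgebra.coassoc_symm_apply, ← s3, Coalgebra.coassoc_apply, ← s2,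
      ← Coalgebra.coassoc_apply, ← s1]

/-- The tensor product of two Yetter-Drinfeld modules, with
`κ ▷ (v ⊗ w) = κ₁ ▷ v ⊗ κ₂ ▷ w` and `v ⊗ w ↦ v₍₋₁₎ w₍₋₁₎ ⊗ v₍₀₎ ⊗ w₍₀₎`. -/
noncomputable def tensor (M : YDStruct k K V) (N : YDStruct k K W) : YDStruct k K (V ⊗[k] W) where
  act := tensorAct M N
  one_act := by
    intro t
    rw [tensorAct, LinearMap.comp_apply, Bialgebra.comul_one, Algebra.TensorProduct.one_def,
      TensorProduct.map₂_apply_tmul]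
    have h1 : M.act 1 = LinearMap.id := LinearMap.ext M.one_act
    have h2 : N.act 1 = LinearMap.id := LinearMap.ext N.one_act
    rw [h1, h2]
    simp
  mul_act := by
    intro κ κ' t
    rw [tensorAct, LinearMap.comp_apply, Bialgebra.comul_mul,
      map₂_mul _ _ M.mul_act N.mul_act]
    rfl
  coact := tensorCoact M N
  coassoc := by
    have key : ∀ (x : K ⊗[k] V) (y : K ⊗[k] W),
        (tensorCoact M N).lTensor K
          (tensorMul k K V W x y) = TensorProduct.assoc k K K (V ⊗[k] W) (tensorMul k (K ⊗[k] K) V W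
          ((TensorProduct.assoc k K K V).symm (M.coact.lTensor K x))
          ((TensorProduct.assoc k K K W).symm (N.coact.lTensor K y))) := by
      intro x y
      induction x with
      | zero => simp
      | add x y hx hy => simp only [map_add, LinearMap.add_apply, hx, hy]
      | tmul c v =>
        induction y with
        | zero => simp
        | add x y hx hy => simp only [map_add, hx, hy]
        | tmul d w =>
          simp only [tensorMul_tmul, LinearMap.lTensor_tmul, tensorCoact, TensorProduct.lift.tmul,
            LinearMap.compl₁₂_apply]
          exact tensorMul_assoc (M.coact v) (N.coact w) c d
    intro t
    induction t with
    | zero => simp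
    | add x y hx hy => simp only [map_add, hx, hy]
    | tmul v w =>
      have e : tensorCoact M N (v ⊗ₜ w) = tensorMul k K V W (M.coact v) (N.coact w) := rfl
      rw [e, key, ← M.coassoc, ← N.coassoc, LinearEquiv.symm_apply_apply, LinearEquiv.symm_apply_apply]
      exact congrArg _ (tensorMul_map (Bialgebra.comulAlgHom k K) _ _)
  counit_coact := by
    intro t
    induction t with
    | zero => simp
    | add x y hx hy => simp only [map_add, hx, hy]
    | tmul v w =>
      have e : tensorCoact M N (v ⊗ₜ w) = tensorMul k K V W (M.coact v) (N.coact w) := rfl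
      rw [e]
      have key : ∀ (x : k ⊗[k] V) (y : k ⊗[k] W), TensorProduct.lid k (V ⊗[k] W)
          (tensorMul k k V W x y) = TensorProduct.lid k V x ⊗ₜ TensorProduct.lid k W y := by
        intro x y
        induction x with
        | zero => simp
        | add x y hx hy => simp only [map_add, LinearMap.add_apply, add_tmul, hx, hy]
        | tmul v c =>
          induction y with
          | zero => simp
          | add x y hx hy => simp only [map_add, tmul_add, hx, hy]
          | tmul w d => simp [TensorProduct.smul_tmul', smul_smul, mul_comm]
      refine (congrArg (TensorProduct.lid k (V ⊗[k] W))
        (tensorMul_map (Bialgebra.counitAlgHom k K) (M.coact v) (N.coact w))).trans ?_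
      rw [key]
      exact congrArg₂ (fun a b => a ⊗ₜ b) (M.counit_coact v) (N.counit_coact w)
  compat := tensor_compat M N

variable (k K) in
/-- The trivial Yetter-Drinfeld module `k`. -/
noncomputable def triv : YDStruct k K k where
  act := LinearMap.lsmul k k ∘ₗ (counit (R := k) (A := K))
  one_act v := by simp
  mul_act κ κ' v := by simp [mul_assoc]
  coact := TensorProduct.mk k K k 1
  coassoc v := by simp [Algebra.TensorProduct.one_def]
  counit_coact v := by simp
  compat κ v := by
    have e1 : ∀ t : K ⊗[k] K, TensorProduct.map₂ (LinearMap.mul k K)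
        (LinearMap.lsmul k k ∘ₗ (counit (R := k) (A := K))) t (1 ⊗ₜ v) =
        v • (counit.lTensor K t : K ⊗[k] k) := by
      intro t
      induction t with
      | zero => simp
      | add x y hx hy => simp only [map_add, LinearMap.add_apply, smul_add, hx, hy]
      | tmul a b => simp [← TensorProduct.tmul_smul, mul_comm]
    have e2 : ∀ t : K ⊗[k] K, ydRight (LinearMap.lsmul k k ∘ₗ (counit (R := k) (A := K)))
        (TensorProduct.mk k K k 1) v t =
        v • TensorProduct.comm k k K (counit.rTensor K t) := by
      intro t
      induction t with
      | zero => simp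
      | add x y hx hy => simp only [map_add, smul_add, hx, hy]
      | tmul a b => simp [ydRight, ← TensorProduct.tmul_smul, mul_comm]
    refine (e1 _).trans (Eq.trans ?_ (e2 _).symm)
    simp

section mor
variable {U : Type*} [AddCommGroup U] [Module k U]

@[simp] lemma tensor_coact_tmul (M : YDStruct k K V) (N : YDStruct k K W) (v : V) (w : W) :
    (M.tensor N).coact (v ⊗ₜ w) = tensorMul k K V W (M.coact v) (N.coact w) := rfl

lemma tensor_act (M : YDStruct k K V) (N : YDStruct k K W) (κ : K) :
    (M.tensor N).act κ = TensorProduct.map₂ M.act N.act (comul (R := k) κ) := rfl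

lemma assoc_act (L : YDStruct k K U) (M : YDStruct k K V) (N : YDStruct k K W) (κ : K)
    (t : (U ⊗[k] V) ⊗[k] W) :
    TensorProduct.assoc k U V W (((L.tensor M).tensor N).act κ t) =
      (L.tensor (M.tensor N)).act κ (TensorProduct.assoc k U V W t) := by
  have e1 : ∀ z : K ⊗[k] K, TensorProduct.assoc k U V W
      (TensorProduct.map₂ (L.tensor M).act N.act z t) =
      TensorProduct.map₂ L.act (TensorProduct.map₂ M.act N.act)
        (TensorProduct.assoc k K K K (comul.rTensor K z)) (TensorProduct.assoc k U V W t) := by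
    intro z
    induction z with
    | zero => simp
    | add x y hx hy => simp only [map_add, LinearMap.add_apply, hx, hy]
    | tmul a b =>
      rw [TensorProduct.map₂_apply_tmul, tensor_act, LinearMap.rTensor_tmul]
      generalize comul (R := k) a = s
      induction s with
      | zero => simp
      | add x y hx hy =>
        simp only [map_add, TensorProduct.map_add_left, LinearMap.add_apply, add_tmul, hx, hy]
      | tmul x y =>
        induction t with
        | zero => simp
        | add x y hx hy => simp only [map_add, hx, hy]
        | tmul t w =>
          induction t with
          | zero => simp
          | add x y hx hy => simp only [map_add, add_tmul, hx, hy]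
          | tmul u v => simp
  have e2 : ∀ z : K ⊗[k] K, TensorProduct.map₂ L.act (M.tensor N).act z
      (TensorProduct.assoc k U V W t) =
      TensorProduct.map₂ L.act (TensorProduct.map₂ M.act N.act) (comul.lTensor K z)
        (TensorProduct.assoc k U V W t) := by
    intro z
    induction z with
    | zero => simp
    | add x y hx hy => simp only [map_add, LinearMap.add_apply, hx, hy]
    | tmul a b => simp [tensor_act]
  rw [tensor_act, tensor_act, e1, e2, Coalgebra.coassoc_apply]

lemma assoc_coact (L : YDStruct k K U) (M : YDStruct k K V) (N : YDStruct k K W)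
    (t : (U ⊗[k] V) ⊗[k] W) :
    (L.tensor (M.tensor N)).coact (TensorProduct.assoc k U V W t) =
      (TensorProduct.assoc k U V W).toLinearMap.lTensor K (((L.tensor M).tensor N).coact t) := by
  have key : ∀ (x : K ⊗[k] U) (y : K ⊗[k] V) (z : K ⊗[k] W),
      tensorMul k K U (V ⊗[k] W) x (tensorMul k K V W y z) =
      (TensorProduct.assoc k U V W).toLinearMap.lTensor K
        (tensorMul k K (U ⊗[k] V) W (tensorMul k K U V x y) z) := by
    intro x y z
    induction x with
    | zero => simp
    | add x y hx hy => simp only [map_add, LinearMap.add_apply, hx, hy]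
    | tmul v c =>
      induction y with
      | zero => simp
      | add x y hx hy => simp only [map_add, LinearMap.add_apply, hx, hy]
      | tmul w d =>
        induction z with
        | zero => simp
        | add x y hx hy => simp only [map_add, hx, hy]
        | tmul u e => simp [mul_assoc]
  induction t with
  | zero => simp
  | add x y hx hy => simp only [map_add, hx, hy]
  | tmul t n =>
    induction t with
    | zero => simp
    | add x y hx hy => simp only [add_tmul, map_add, hx, hy]
    | tmul l m => exact key _ _ _

lemma lid_act (M : YDStruct k K V) (κ : K) (t : k ⊗[k] V) :
    TensorProduct.lid k V (((triv k K).tensor M).act κ t) =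
      M.act κ (TensorProduct.lid k V t) := by
  induction t with
  | zero => simp
  | add x y hx hy => simp only [map_add, hx, hy]
  | tmul r v =>
    have e : ∀ z : K ⊗[k] K, TensorProduct.lid k V (TensorProduct.map₂ (triv k K).act M.act z
        (r ⊗ₜ v)) = r • M.act (TensorProduct.lid k K (counit.rTensor K z)) v := by
      intro z
      induction z with
      | zero => simp
      | add x y hx hy => simp only [map_add, LinearMap.add_apply, smul_add, hx, hy]
      | tmul a b => simp [triv, smul_smul, mul_comm]
    rw [tensor_act, e]
    simp

lemma rid_act (M : YDStruct k K V) (κ : K) (t : V ⊗[k] k) :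
    TensorProduct.rid k V ((M.tensor (triv k K)).act κ t) =
      M.act κ (TensorProduct.rid k V t) := by
  induction t with
  | zero => simp
  | add x y hx hy => simp only [map_add, hx, hy]
  | tmul v r =>
    have e : ∀ z : K ⊗[k] K, TensorProduct.rid k V (TensorProduct.map₂ M.act (triv k K).act z
        (v ⊗ₜ r)) = r • M.act (TensorProduct.rid k K (counit.lTensor K z)) v := by
      intro z
      induction z with
      | zero => simp
      | add x y hx hy => simp only [map_add, LinearMap.add_apply, smul_add, hx, hy]
      | tmul a b => simp [triv, smul_smul, mul_comm]
    rw [tensor_act, e]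
    simp

lemma lid_coact (M : YDStruct k K V) (t : k ⊗[k] V) :
    M.coact (TensorProduct.lid k V t) =
      (TensorProduct.lid k V).toLinearMap.lTensor K (((triv k K).tensor M).coact t) := by
  have key : ∀ (r : k) (x : K ⊗[k] V), r • x = (TensorProduct.lid k V).toLinearMap.lTensor K
      (tensorMul k K k V (1 ⊗ₜ r) x) := by
    intro r x
    induction x with
    | zero => simp
    | add x y hx hy => rw [smul_add, map_add, map_add, hx, hy]
    | tmul v c => simp
  induction t with
  | zero => simp
  | add x y hx hy => simp only [map_add, hx, hy]
  | tmul r m =>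
    rw [TensorProduct.lid_tmul, map_smul]
    exact key _ _

lemma rid_coact (M : YDStruct k K V) (t : V ⊗[k] k) :
    M.coact (TensorProduct.rid k V t) =
      (TensorProduct.rid k V).toLinearMap.lTensor K ((M.tensor (triv k K)).coact t) := by
  have key : ∀ (r : k) (x : K ⊗[k] V), r • x = (TensorProduct.rid k V).toLinearMap.lTensor K
      (tensorMul k K V k x (1 ⊗ₜ r)) := by
    intro r x
    induction x with
    | zero => simp
    | add x y hx hy => rw [smul_add, map_add, LinearMap.add_apply, map_add, hx, hy]
    | tmul v c => simp
  induction t with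
  | zero => simp
  | add x y hx hy => simp only [map_add, hx, hy]
  | tmul m r =>
    rw [TensorProduct.rid_tmul, map_smul]
    exact key _ _

/-- `f` preserves the action and the coaction. -/
structure IsHom (M : YDStruct k K V) (N : YDStruct k K W) (f : V →ₗ[k] W) : Prop where
  map_act : ∀ κ v, f (M.act κ v) = N.act κ (f v)
  map_coact : ∀ v, N.coact (f v) = f.lTensor K (M.coact v)

lemma IsHom.id (M : YDStruct k K V) : IsHom M M LinearMap.id := ⟨by simp, by simp⟩

lemma IsHom.tensor {V' W' : Type*} [AddCommGroup V'] [Module k V'] [AddCommGroup W'] [Module k W']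
    {M : YDStruct k K V} {N : YDStruct k K W} {M' : YDStruct k K V'} {N' : YDStruct k K W'}
    {f : V →ₗ[k] V'} {g : W →ₗ[k] W'} (hf : IsHom M M' f) (hg : IsHom N N' g) :
    IsHom (M.tensor N) (M'.tensor N') (TensorProduct.map f g) := by
  constructor
  · intro κ t
    rw [tensor_act, tensor_act]
    generalize comul (R := k) κ = z
    induction z with
    | zero => simp
    | add x y hx hy => simp only [map_add, LinearMap.add_apply, hx, hy]
    | tmul a b =>
      induction t with
      | zero => simp
      | add x y hx hy => simp only [map_add, hx, hy]
      | tmul v w => simp [hf.map_act, hg.map_act]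
  · intro t
    induction t with
    | zero => simp
    | add x y hx hy => simp only [map_add, hx, hy]
    | tmul m n =>
      rw [TensorProduct.map_tmul, tensor_coact_tmul, tensor_coact_tmul, hf.map_coact, hg.map_coact]
      generalize M.coact m = x
      generalize N.coact n = y
      induction x with
      | zero => simp
      | add x y hx hy => simp only [map_add, LinearMap.add_apply, hx, hy]
      | tmul v c =>
        induction y with
        | zero => simp
        | add x y hx hy => simp only [map_add, hx, hy]
        | tmul w d => simp

lemma IsHom.symm {M : YDStruct k K V} {N : YDStruct k K W} {e : V ≃ₗ[k] W}
    (h : IsHom M N e.toLinearMap) : IsHom N M e.symm.toLinearMap := by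
  constructor
  · intro κ w
    apply e.injective
    have := h.map_act κ (e.symm w)
    simp only [LinearEquiv.coe_coe, LinearEquiv.apply_symm_apply] at this ⊢
    exact this.symm
  · intro w
    have := h.map_coact (e.symm w)
    simp only [LinearEquiv.coe_coe, LinearEquiv.apply_symm_apply] at this ⊢
    rw [this, ← LinearMap.comp_apply, ← LinearMap.lTensor_comp]
    simp

end mor

end YDStruct

/-- Left-left Yetter-Drinfeld modules over `K`. -/
structure YD (k K : Type u) [Field k] [Ring K] [Bialgebra k K] where
  V : ModuleCat.{u} k
  str : YDStruct k K V

namespace YD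
variable {k K : Type u} [Field k] [Ring K] [Bialgebra k K]

/-- Linear maps that preserve the action and the coaction. -/
@[ext] structure Hom (M N : YD k K) where
  lin : M.V →ₗ[k] N.V
  isHom : YDStruct.IsHom M.str N.str lin

instance : Category (YD k K) where
  Hom M N := Hom M N
  id M := ⟨LinearMap.id, YDStruct.IsHom.id M.str⟩
  comp f g := ⟨g.lin ∘ₗ f.lin,
    ⟨fun κ v => by simp [f.isHom.map_act, g.isHom.map_act], fun v => by
      rw [LinearMap.comp_apply, g.isHom.map_coact, f.isHom.map_coact, LinearMap.lTensor_comp]; rfl⟩⟩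

@[ext] lemma hom_ext {M N : YD k K} {f g : M ⟶ N} (h : Hom.lin f = Hom.lin g) : f = g :=
  Hom.ext h

/-- The forgetful functor to vector spaces. -/
def forget : YD k K ⥤ ModuleCat.{u} k where
  obj M := M.V
  map f := ModuleCat.ofHom (Hom.lin f)

instance : (forget (k := k) (K := K)).Faithful where
  map_injective h := hom_ext (congrArg ModuleCat.Hom.hom h)

/-- Bijective morphisms are isomorphisms. -/
def isoOfEquiv {M N : YD k K} (e : M.V ≃ₗ[k] N.V)
    (h : YDStruct.IsHom M.str N.str e.toLinearMap) : M ≅ N where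
  hom := ⟨e.toLinearMap, h⟩
  inv := ⟨e.symm.toLinearMap, h.symm⟩
  hom_inv_id := hom_ext (by ext m; exact e.symm_apply_apply m)
  inv_hom_id := hom_ext (by ext m; exact e.apply_symm_apply m)

noncomputable instance : MonoidalCategoryStruct (YD k K) where
  tensorObj M N := ⟨ModuleCat.of k (M.V ⊗[k] N.V), M.str.tensor N.str⟩
  tensorUnit := ⟨ModuleCat.of k k, YDStruct.triv k K⟩
  tensorHom f g := ⟨TensorProduct.map (Hom.lin f) (Hom.lin g), (Hom.isHom f).tensor (Hom.isHom g)⟩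
  whiskerLeft M _ _ g := ⟨TensorProduct.map LinearMap.id (Hom.lin g),
    (YDStruct.IsHom.id M.str).tensor (Hom.isHom g)⟩
  whiskerRight f N := ⟨TensorProduct.map (Hom.lin f) LinearMap.id,
    (Hom.isHom f).tensor (YDStruct.IsHom.id N.str)⟩
  associator L M N := isoOfEquiv (TensorProduct.assoc k L.V M.V N.V)
    ⟨YDStruct.assoc_act L.str M.str N.str, YDStruct.assoc_coact L.str M.str N.str⟩
  leftUnitor M := isoOfEquiv (TensorProduct.lid k M.V)
    ⟨YDStruct.lid_act M.str, YDStruct.lid_coact M.str⟩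
  rightUnitor M := isoOfEquiv (TensorProduct.rid k M.V)
    ⟨YDStruct.rid_act M.str, YDStruct.rid_coact M.str⟩

noncomputable instance : MonoidalCategory (YD k K) :=
  Monoidal.induced forget
  { μIso _ _ := .refl _
    εIso := .refl _
    associator_eq _ _ _ := by ext1; exact TensorProduct.ext (TensorProduct.ext rfl)
    leftUnitor_eq _ := by ext1; exact TensorProduct.ext rfl
    rightUnitor_eq _ := by ext1; exact TensorProduct.ext rfl }

end YD

end yd

section braidingMaps
open CategoryTheory MonoidalCategory
universe u

/-- `m ⊗ n ↦ φ(m₍₁₎, n₍₁₎) m₍₀₎ ⊗ n₍₀₎` for a bilinear form `φ` on `C`. -/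
noncomputable def RightComod.twist {k C : Type u} [Field k] [Ring C] [Bialgebra k C]
    (φ : C →ₗ[k] C →ₗ[k] k) (M N : RightComod k C) : M.V ⊗[k] N.V →ₗ[k] M.V ⊗[k] N.V :=
  (TensorProduct.rid k (M.V ⊗[k] N.V)).toLinearMap ∘ₗ
    (TensorProduct.lift φ).lTensor (M.V ⊗[k] N.V) ∘ₗ
    (TensorProduct.tensorTensorTensorComm k M.V C N.V C).toLinearMap ∘ₗ
    TensorProduct.map M.coact N.coact

/-- The braiding `m ⊗ n ↦ σ(m₍₁₎, n₍₁₎) n₍₀₎ ⊗ m₍₀₎` of right comodules. -/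
noncomputable def RightComod.braidLin {k C : Type u} [Field k] [Ring C] [Bialgebra k C]
    (s : CQTStructure k C) (M N : RightComod k C) : M.V ⊗[k] N.V →ₗ[k] N.V ⊗[k] M.V :=
  (TensorProduct.comm k M.V N.V).toLinearMap ∘ₗ RightComod.twist s.form M N

/-- The braiding `m ⊗ n ↦ m₍₋₁₎ ▷ n ⊗ m₍₀₎` of Yetter-Drinfeld modules. -/
noncomputable def YD.braidLin {k K : Type u} [Field k] [Ring K] [Bialgebra k K]
    (M N : YD k K) : M.V ⊗[k] N.V →ₗ[k] N.V ⊗[k] M.V :=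
  (TensorProduct.lift N.str.act).rTensor M.V ∘ₗ
    (TensorProduct.rightComm k K M.V N.V).toLinearMap ∘ₗ M.str.coact.rTensor N.V

/-- The functor `M ↦ M`, `f ↦ f` given by Yetter-Drinfeld structures on all right comodules
that are preserved by all colinear maps. -/
def ydFunctor {k C K : Type u} [Field k] [Ring C] [Bialgebra k C] [Ring K] [Bialgebra k K]
    (yd : ∀ M : RightComod k C, YDStruct k K M.V)
    (hyd : ∀ (M N : RightComod k C) (f : M ⟶ N),
      YDStruct.IsHom (yd M) (yd N) (RightComod.Hom.lin f)) : RightComod k C ⥤ YD k K where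
  obj M := ⟨M.V, yd M⟩
  map f := ⟨RightComod.Hom.lin f, hyd _ _ f⟩
end braidingMaps

namespace CQTStructure
section transmutation
variable {k X : Type*} [Field k] [Ring X] [HopfAlgebra k X]

variable (k X) in
/-- The right adjoint coaction `x ↦ x₂ ⊗ S(x₁) x₃`. -/
noncomputable def adCoact : X →ₗ[k] X ⊗[k] X :=
  (LinearMap.mul' k X ∘ₗ (antipode k).rTensor X).lTensor X ∘ₗ
    (TensorProduct.leftComm k X X X).toLinearMap ∘ₗ
    (comul (R := k) (A := X)).lTensor X ∘ₗ (comul (R := k) (A := X))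

/-- The transmuted product `x ⊗ y ↦ σ(S(x₁) x₃, S(y₁)) x₂ y₂`. -/
noncomputable def transMul (s : CQTStructure k X) : X ⊗[k] X →ₗ[k] X :=
  (TensorProduct.lid k X).toLinearMap ∘ₗ
    TensorProduct.map (TensorProduct.lift (s.form.compl₂ (antipode k))) (LinearMap.mul' k X) ∘ₗ
    (TensorProduct.tensorTensorTensorComm k X X X X).toLinearMap ∘ₗ
    TensorProduct.map ((TensorProduct.comm k X X).toLinearMap ∘ₗ adCoact k X)
      (comul (R := k) (A := X))

/-- The transmuted antipode `x ↦ σ(S²(x₃) S(x₁), x₄) S(x₂)`. -/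
noncomputable def transAntipode (s : CQTStructure k X) : X →ₗ[k] X :=
  (TensorProduct.rid k X).toLinearMap ∘ₗ
    TensorProduct.map (antipode k)
      (TensorProduct.lift s.form ∘ₗ
        (LinearMap.mul' k X ∘ₗ (TensorProduct.comm k X X).toLinearMap ∘ₗ
          TensorProduct.map (antipode k) (antipode k ∘ₗ antipode k)).rTensor X ∘ₗ
        (TensorProduct.assoc k X X X).symm.toLinearMap) ∘ₗ
    (TensorProduct.leftComm k X X (X ⊗[k] X)).toLinearMap ∘ₗ
    ((comul (R := k) (A := X)).lTensor X ∘ₗ (comul (R := k) (A := X))).lTensor X ∘ₗ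
    (comul (R := k) (A := X))
end transmutation
end CQTStructure

namespace GenDouble
variable {k K V : Type*} [Field k] [Ring K] [HopfAlgebra k K] [Ring V] [HopfAlgebra k V]
  (p p' : K →ₗ[k] V →ₗ[k] k)

/-- The bilinear form `(f ⊗ h, g ⊗ y) ↦ ε(f) p(g, h) ε(y)` on `K ⊗ V`. -/
noncomputable def cocycle : (K ⊗[k] V) ⊗[k] (K ⊗[k] V) →ₗ[k] k :=
  TensorProduct.lift (p.flip.compl₁₂
    ((TensorProduct.lid k V).toLinearMap ∘ₗ (counit (R := k) (A := K)).rTensor V)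
    ((TensorProduct.rid k K).toLinearMap ∘ₗ (counit (R := k) (A := V)).lTensor K))

/-- The multiplication of the generalized quantum double `D(K, V)` of a skew pairing `p` with
convolution inverse `p'`: the twist `a • b = τ(a₁, b₁) a₂ b₂ τ⁻¹(a₃, b₃)` of the tensor product
algebra `K ⊗ V`, that is,
`(f ⊗ h) • (g ⊗ y) = p(g₁, h₁) p'(g₃, h₃) f g₂ ⊗ h₂ y`. -/
noncomputable def mul : (K ⊗[k] V) ⊗[k] (K ⊗[k] V) →ₗ[k] K ⊗[k] V :=
  (WithConv.toConv (Algebra.linearMap k (K ⊗[k] V) ∘ₗ cocycle p) *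
    WithConv.toConv (LinearMap.mul' k (K ⊗[k] V)) *
    WithConv.toConv (Algebra.linearMap k (K ⊗[k] V) ∘ₗ cocycle p')).ofConv

/-- The antipode `f ⊗ h ↦ (1 ⊗ S h) • (S f ⊗ 1)` of `D(K, V)`. -/
noncomputable def anti : K ⊗[k] V →ₗ[k] K ⊗[k] V :=
  mul p p' ∘ₗ TensorProduct.map (TensorProduct.mk k K V 1 ∘ₗ antipode k)
    ((TensorProduct.mk k K V).flip 1 ∘ₗ antipode k) ∘ₗ (TensorProduct.comm k K V).toLinearMap

variable (k K V) in
/-- The inclusion `i : f ↦ f ⊗ 1` of `K` into `D(K, V)`. -/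
noncomputable def incl : K →ₗ[k] K ⊗[k] V := (TensorProduct.mk k K V).flip 1

variable (γ : V →ₗ[k] K)

/-- The projection `π : f ⊗ y ↦ f γ(y)` of `D(K, V)` onto `K`. -/
noncomputable def proj : K ⊗[k] V →ₗ[k] K := LinearMap.mul' k K ∘ₗ γ.lTensor K

/-- The coinvariants `{a | a₁ ⊗ π(a₂) = a ⊗ 1}`. -/
noncomputable def coinv : Submodule k (K ⊗[k] V) :=
  LinearMap.eqLocus ((proj γ).lTensor (K ⊗[k] V) ∘ₗ (comul (R := k) (A := K ⊗[k] V)))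
    ((TensorProduct.mk k (K ⊗[k] V) K).flip 1)

/-- The adjoint action `κ ⊗ a ↦ i(κ₁) • a • i(S κ₂)`. -/
noncomputable def adj : K ⊗[k] (K ⊗[k] V) →ₗ[k] K ⊗[k] V :=
  mul p p' ∘ₗ (mul p p').rTensor (K ⊗[k] V) ∘ₗ
    TensorProduct.map (TensorProduct.map (incl k K V) LinearMap.id)
      (incl k K V ∘ₗ antipode k) ∘ₗ
    (TensorProduct.rightComm k K K (K ⊗[k] V)).toLinearMap ∘ₗ
    (comul (R := k) (A := K)).rTensor (K ⊗[k] V)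

/-- The map `a ↦ a₁ • i(S(π(a₂)))`. -/
noncomputable def projCoinv : K ⊗[k] V →ₗ[k] K ⊗[k] V :=
  mul p p' ∘ₗ (incl k K V ∘ₗ antipode k ∘ₗ proj γ).lTensor (K ⊗[k] V) ∘ₗ
    (comul (R := k) (A := K ⊗[k] V))

/-- The braided antipode `b ↦ i(π(b₁)) • S(b₂)`. -/
noncomputable def braidedAnti : K ⊗[k] V →ₗ[k] K ⊗[k] V :=
  mul p p' ∘ₗ TensorProduct.map (incl k K V ∘ₗ proj γ) (anti p p') ∘ₗ
    (comul (R := k) (A := K ⊗[k] V))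

/-- The map `y ↦ γ(S⁻¹(y₂)) ⊗ y₁`, where `Sinv` is the inverse of the antipode of `V`. -/
noncomputable def theta (Sinv : V →ₗ[k] V) : V →ₗ[k] K ⊗[k] V :=
  (γ ∘ₗ Sinv).rTensor V ∘ₗ (TensorProduct.comm k V V).toLinearMap ∘ₗ (comul (R := k) (A := V))

/-- The Yetter-Drinfeld structure `M` and the maps `m, e, Δ, ε, S` on `V` are the ones induced
along `θ` from the braided Hopf algebra `B = coinv γ` of the Radford biproduct decomposition
`D(K, V) ≅ B × K`: the map `θ` is a bijection onto `B`, and it carries the structure of `V` to that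
of `B`, namely to the action `κ ▷ b = i(κ₁) • b • i(S κ₂)`, the coaction `b ↦ π(b₁) ⊗ b₂`, the
multiplication, unit and counit of `D(K, V)`, the comultiplication
`Π(a) ↦ Π(a₁) ⊗ Π(a₂)` with `Π(a) = a₁ • i(S(π(a₂)))`, and the antipode
`b ↦ i(π(b₁)) • S(b₂)`. -/
structure IsInduced (θ : V →ₗ[k] K ⊗[k] V) (M : YDStruct k K V) (m : V ⊗[k] V →ₗ[k] V)
    (e : k →ₗ[k] V) (Δ : V →ₗ[k] V ⊗[k] V) (ε : V →ₗ[k] k) (S : V →ₗ[k] V) : Prop where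
  injective : Function.Injective θ
  range_eq : LinearMap.range θ = coinv γ
  act : ∀ κ v, θ (M.act κ v) = adj p p' (κ ⊗ₜ θ v)
  coact : ∀ v, θ.lTensor K (M.coact v) = (proj γ).rTensor (K ⊗[k] V) (comul (R := k) (θ v))
  mul : ∀ v w, θ (m (v ⊗ₜ w)) = GenDouble.mul p p' (θ v ⊗ₜ θ w)
  one : θ (e 1) = 1 ⊗ₜ 1
  comul : ∀ a v, θ v = projCoinv p p' γ a → TensorProduct.map θ θ (Δ v) =
    TensorProduct.map (projCoinv p p' γ) (projCoinv p p' γ) (comul (R := k) a)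
  counit : ∀ v, ε v = counit (R := k) (θ v)
  antipode : ∀ v, θ (S v) = braidedAnti p p' γ (θ v)

end GenDouble

namespace CQTStructure
section setting
universe u
variable {k H A X : Type u} [Field k] [Ring H] [HopfAlgebra k H] [Ring A] [HopfAlgebra k A]
  [Ring X] [HopfAlgebra k X] (s : CQTStructure k H) (ιX : X →ₐc[k] H) (ιA : A →ₐc[k] H)

/-- The co-opposite Hopf algebra of `H_{X,A}`. -/
abbrev HXAcop : Type u := Cop (s.HXA ιX ιA)

/-- The evaluation pairing `⟨f, x⟩ = f(x)`. -/
noncomputable def pairing : s.HXAcop ιX ιA →ₗ[k] X →ₗ[k] k :=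
  LinearMap.lcomp k k (ιX : X →ₗ[k] H) ∘ₗ (WithConv.linearEquiv k (H →ₗ[k] k)).toLinearMap ∘ₗ
    (s.incl ιX ιA).toLinearMap

/-- The convolution inverse `(f, x) ↦ ⟨S f, x⟩` of the pairing, with `S` the antipode of the
co-opposite of `H_{X,A}`. -/
noncomputable def pairingInv : s.HXAcop ιX ιA →ₗ[k] X →ₗ[k] k :=
  s.pairing ιX ιA ∘ₗ antipode k

/-- `x ↦ l_x` with values in the co-opposite of `H_{X,A}`. -/
noncomputable def lCop : X →ₗ[k] s.HXAcop ιX ιA := s.lElt ιX ιA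

variable (hX : Function.Injective ιX)

/-- The square `S⁻²` of the inverse of the antipode of `X`. -/
noncomputable def invSq : X →ₗ[k] X :=
  (s.comap ιX hX).antipodeInv ∘ₗ (s.comap ιX hX).antipodeInv

/-- The map `γ : y ↦ l_{S⁻¹(y)}`. -/
noncomputable def gamma : X →ₗ[k] s.HXAcop ιX ιA :=
  s.lCop ιX ιA ∘ₗ (s.comap ιX hX).antipodeInv

/-- The action `f ▷ m = f(S⁻²(m₍₁₎)) m₍₀₎` on a right comodule. -/
noncomputable def actLin (M : RightComod k X) (f : s.HXAcop ιX ιA) : M.V →ₗ[k] M.V :=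
  (TensorProduct.rid k M.V).toLinearMap ∘ₗ
    (s.pairing ιX ιA f ∘ₗ s.invSq ιX hX).lTensor M.V ∘ₗ M.coact

/-- The left coaction `m ↦ l_{S⁻²(m₍₁₎)} ⊗ m₍₀₎` on a right comodule. -/
noncomputable def coactLin (M : RightComod k X) : M.V →ₗ[k] s.HXAcop ιX ιA ⊗[k] M.V :=
  (s.lCop ιX ιA ∘ₗ s.invSq ιX hX).rTensor M.V ∘ₗ (TensorProduct.comm k M.V X).toLinearMap ∘ₗ
    M.coact

end setting
end CQTStructure

open CategoryTheory MonoidalCategory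
universe u

/-! Everything rests on three properties of σ: it is multiplicative in each variable, it satisfies
the commutation rule σ(h₁,h'₁)h₂h'₂ = h'₁h₁σ(h₂,h'₂), and it is invariant under S ⊗ S.

Factorization of H_{X,A}. Pairing the commutation rule with σ(a,-) gives a crossing relation between
r_a and l_x (`rMap_lMap`). The form σ(-,S(-)) solves it in both directions, so the spans of the l_x
and of the r_a commute as subspaces. Each span is closed under products, hence so is their product
(`subalg_eq`).

The functor. On a comodule, the Yetter–Drinfeld condition is the commutation rule again (`ydOf`).
Since K is co-opposite, it acts and coacts on F(M) ⊗ F(N) through n₍₁₎m₍₁₎, and on F(M ⊗ N) through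
m₍₁₎n₍₁₎. Twisting by σ exchanges the two orders, so the twist is an isomorphism φ₂⁻¹
(`isHom_formTwist`). Coherence is the 2-cocycle property of σ (`formTwist_assoc`). Compatibility
with the braidings comes from the invariance of σ under S⁻² (`formTwist_comm`). The braiding of
Yetter–Drinfeld modules is invertible because f ↦ f ∘ S inverts the antipode of K.

Transmutation. The product is colinear by the commutation rule (`ts_ad_transMul`), and the remaining
bialgebra axioms follow by expanding σ and cancelling antipodes (`transMul_assoc`,
`comul_transMul`). For the antipode, the functional v(h) = σ(h₁,S(h₂)) and its inverse w implement
S², and the antipode takes the form σ⁻¹(x₁,x₄)w(x₃)S(x₂) (`transAntipode_apply`). In each antipode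
axiom σ cancels against σ⁻¹ on outer legs, and w against v. A braided functor carries Hopf monoids
to Hopf monoids.

Comparison with B. An element of K ⊗ X is determined by the values of its first leg at all w in H
(`ev_tensor_ext`), and the product of the double has a short evaluated form (`ev_double_mul`). The
clauses for product, action and antipode thus become identities in X, settled by the commutation
rule for σ or for σ⁻¹. For the comultiplication, Π factors as θ after an explicit map D → X
(`theta_thetaRetract`), which reduces the claim to an identity in X ⊗ X.

The calculations use finite sums `ts t f` over a presentation of a tensor. The class `LinFun` lets
instance search prove the multilinearity that makes such sums independent of the presentation. -/

set_option synthInstance.maxSize 10000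

/-! ### Sweedler sums -/

/-- `f` is `k`-linear. -/
class LinFun (k : Type*) {V W : Type*} [Field k] [AddCommGroup V] [Module k V] [AddCommGroup W]
    [Module k W] (f : V → W) : Prop where
  map_add : ∀ a b, f (a + b) = f a + f b
  map_smul : ∀ (r : k) a, f (r • a) = r • f a

namespace LinFun
variable {k U V W : Type*} [Field k] [AddCommGroup U] [Module k U] [AddCommGroup V] [Module k V]
  [AddCommGroup W] [Module k W]

instance id' : LinFun k (fun x : V => x) := ⟨fun _ _ => rfl, fun _ _ => rfl⟩

/-- Kept as a lemma because as an instance it would match any function. Where an arbitrary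
multilinear `f` is composed with another map, the result is put into the context by `have`, and
instance search finds it there. -/
lemma comp (f : V → W) [h' : LinFun k f] (g : U → V) [h : LinFun k g] :
    LinFun k (fun x => f (g x)) :=
  ⟨fun a b => by rw [h.map_add, h'.map_add], fun r a => by rw [h.map_smul, h'.map_smul]⟩

instance lin (L : V →ₗ[k] W) (f : U → V) [h : LinFun k f] : LinFun k (fun x => L (f x)) :=
  ⟨fun a b => by rw [h.map_add, _root_.map_add], fun r a => by rw [h.map_smul, _root_.map_smul]⟩

instance coe (L : V →ₗ[k] W) : LinFun k (L : V → W) := ⟨L.map_add, L.map_smul⟩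

instance app (f : U → V →ₗ[k] W) (v : V) [h : LinFun k f] : LinFun k (fun x => f x v) :=
  ⟨fun a b => by rw [h.map_add, LinearMap.add_apply],
    fun r a => by rw [h.map_smul, LinearMap.smul_apply]⟩

instance smul_left (f : U → k) (v : V) [h : LinFun k f] : LinFun k (fun x => f x • v) :=
  ⟨fun a b => by rw [h.map_add, add_smul], fun r a => by rw [h.map_smul, smul_assoc]⟩

instance smul_right (r : k) (f : U → V) [h : LinFun k f] : LinFun k (fun x => r • f x) :=
  ⟨fun a b => by rw [h.map_add, smul_add], fun r a => by rw [h.map_smul, smul_comm]⟩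

instance smul_eta (r : k) : LinFun k (HSMul.hSMul r : V → V) :=
  ⟨fun a b => smul_add r a b, fun r' a => smul_comm r r' a⟩

instance tmul_eta (w : W) : LinFun k (TensorProduct.tmul k w : V → W ⊗[k] V) :=
  ⟨fun a b => tmul_add w a b, fun r a => tmul_smul r w a⟩

instance tmul_left (f : U → V) (w : W) [h : LinFun k f] : LinFun k (fun x => f x ⊗ₜ[k] w) :=
  ⟨fun a b => by rw [h.map_add, add_tmul], fun r a => by rw [h.map_smul, smul_tmul']⟩

instance tmul_right (f : U → V) (w : W) [h : LinFun k f] : LinFun k (fun x => w ⊗ₜ[k] f x) :=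
  ⟨fun a b => by rw [h.map_add, tmul_add], fun r a => by rw [h.map_smul, tmul_smul]⟩

section
variable {A : Type*} [Ring A] [Algebra k A]

instance mul_left (f : U → A) (c : A) [h : LinFun k f] : LinFun k (fun x => f x * c) :=
  ⟨fun a b => by rw [h.map_add, add_mul], fun r a => by rw [h.map_smul, smul_mul_assoc]⟩

instance mul_eta (c : A) : LinFun k (HMul.hMul c : A → A) :=
  ⟨fun a b => mul_add c a b, fun r a => mul_smul_comm r c a⟩

instance mul_right (f : U → A) (c : A) [h : LinFun k f] : LinFun k (fun x => c * f x) :=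
  ⟨fun a b => by rw [h.map_add, mul_add], fun r a => by rw [h.map_smul, mul_smul_comm]⟩

instance smul_left_algebra (f : U → k) (v : A) [h : LinFun k f] : LinFun k (fun x => f x • v) :=
  smul_left f v

instance smul_right_algebra (r : k) (f : U → A) [h : LinFun k f] : LinFun k (fun x => r • f x) :=
  smul_right r f

instance smul_eta_algebra (r : k) : LinFun k (HSMul.hSMul r : A → A) := smul_eta r

instance smul_left_tensor (f : U → k) (v : V ⊗[k] W) [h : LinFun k f] :
    LinFun k (fun x => f x • v) := smul_left f v

instance smul_right_tensor (r : k) (f : U → V ⊗[k] W) [h : LinFun k f] :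
    LinFun k (fun x => r • f x) := smul_right r f

instance bialgHom_coe {B C : Type*} [Ring B] [Bialgebra k B] [Ring C] [Bialgebra k C]
    (L : B →ₐc[k] C) : LinFun k (L : B → C) :=
  ⟨fun a b => _root_.map_add L a b, fun r a => _root_.map_smul L r a⟩

instance bialgHom {B C : Type*} [Ring B] [Bialgebra k B] [Ring C] [Bialgebra k C]
    (L : B →ₐc[k] C) (f : U → B) [h : LinFun k f] : LinFun k (fun x => L (f x)) :=
  ⟨fun a b => by rw [h.map_add, _root_.map_add], fun r a => by rw [h.map_smul, _root_.map_smul]⟩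
end

end LinFun

/-! ### Sums over a presentation of a tensor, and their independence of the presentation. -/

section ts
variable {k U V W Z : Type*} [Field k] [AddCommGroup U] [Module k U] [AddCommGroup V] [Module k V]
  [AddCommGroup W] [Module k W] [AddCommGroup Z] [Module k Z]

/-- The sum `∑ f v w` over a chosen presentation `t = ∑ v ⊗ w`. -/
noncomputable def ts (t : V ⊗[k] W) (f : V → W → U) : U :=
  ∑ p ∈ (TensorProduct.exists_finset t).choose, f p.1 p.2

lemma ts_self (t : V ⊗[k] W) : ts t (fun a b => a ⊗ₜ[k] b) = t :=
  (TensorProduct.exists_finset t).choose_spec.symm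

/-- No linearity of `f` is needed as long as the tensor being presented stays the same: only
finiteness of the sum enters. -/
lemma map_ts (L : U →ₗ[k] Z) (t : V ⊗[k] W) (f : V → W → U) :
    L (ts t f) = ts t (fun a b => L (f a b)) := map_sum _ _ _

lemma map_ts_equiv (L : U ≃ₗ[k] Z) (t : V ⊗[k] W) (f : V → W → U) :
    L (ts t f) = ts t (fun a b => L (f a b)) := map_sum _ _ _

lemma map_ts₂ {Y : Type*} [AddCommGroup Y] [Module k Y] (B : U →ₗ[k] Z →ₗ[k] Y) (t : V ⊗[k] W)
    (f : V → W → U) (z : Z) : B (ts t f) z = ts t (fun a b => B (f a b) z) := by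
  simp only [ts, map_sum, LinearMap.sum_apply]

lemma lin_eq_ts (L : V ⊗[k] W →ₗ[k] U) (t : V ⊗[k] W) :
    L t = ts t (fun a b => L (a ⊗ₜ b)) := by
  rw [← map_ts, ts_self]

lemma map_eq_ts (p : V →ₗ[k] U) (q : W →ₗ[k] Z) (t : V ⊗[k] W) :
    TensorProduct.map p q t = ts t (fun a b => p a ⊗ₜ q b) := lin_eq_ts _ _

lemma lTensor_eq_ts (q : W →ₗ[k] Z) (t : V ⊗[k] W) :
    q.lTensor V t = ts t (fun a b => a ⊗ₜ q b) := lin_eq_ts _ _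

lemma rTensor_eq_ts (p : V →ₗ[k] U) (t : V ⊗[k] W) :
    p.rTensor W t = ts t (fun a b => p a ⊗ₜ b) := lin_eq_ts _ _

lemma comm_eq_ts (t : V ⊗[k] W) :
    TensorProduct.comm k V W t = ts t (fun a b => b ⊗ₜ a) :=
  lin_eq_ts (TensorProduct.comm k V W).toLinearMap _

lemma assoc_tmul_eq_ts (t : V ⊗[k] W) (z : Z) :
    TensorProduct.assoc k V W Z (t ⊗ₜ z) = ts t (fun a b => a ⊗ₜ (b ⊗ₜ z)) :=
  lin_eq_ts ((TensorProduct.assoc k V W Z).toLinearMap ∘ₗ (TensorProduct.mk k _ _).flip z) _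

lemma assoc_symm_tmul_eq_ts (t : V ⊗[k] W) (z : Z) :
    (TensorProduct.assoc k Z V W).symm (z ⊗ₜ t) = ts t (fun a b => (z ⊗ₜ a) ⊗ₜ b) :=
  lin_eq_ts ((TensorProduct.assoc k Z V W).symm.toLinearMap ∘ₗ TensorProduct.mk k _ _ z) _

lemma leftComm_tmul_eq_ts (t : V ⊗[k] W) (z : Z) :
    TensorProduct.leftComm k Z V W (z ⊗ₜ t) = ts t (fun a b => a ⊗ₜ (z ⊗ₜ b)) :=
  lin_eq_ts ((TensorProduct.leftComm k Z V W).toLinearMap ∘ₗ TensorProduct.mk k _ _ z) _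

lemma ts_apply (t : V ⊗[k] W) (f : V → W → U →ₗ[k] Z) (u : U) :
    ts t f u = ts t (fun a b => f a b u) := by
  simp only [ts, LinearMap.sum_apply]

lemma ts_smul (t : V ⊗[k] W) (f : V → W → k) (u : U) :
    ts t f • u = ts t (fun a b => f a b • u) := Finset.sum_smul

lemma smul_ts (r : k) (t : V ⊗[k] W) (f : V → W → U) :
    r • ts t f = ts t (fun a b => r • f a b) := Finset.smul_sum

lemma ts_tmul_left (t : V ⊗[k] W) (f : V → W → U) (z : Z) :
    ts t f ⊗ₜ[k] z = ts t (fun a b => f a b ⊗ₜ[k] z) := TensorProduct.sum_tmul _ _ _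

lemma tmul_ts (t : V ⊗[k] W) (f : V → W → U) (z : Z) :
    z ⊗ₜ[k] ts t f = ts t (fun a b => z ⊗ₜ[k] f a b) := TensorProduct.tmul_sum _ _ _

lemma ts_mul {A : Type*} [Ring A] (t : V ⊗[k] W) (f : V → W → A) (u : A) :
    ts t f * u = ts t (fun a b => f a b * u) := Finset.sum_mul _ _ _

lemma mul_ts {A : Type*} [Ring A] (t : V ⊗[k] W) (f : V → W → A) (u : A) :
    u * ts t f = ts t (fun a b => u * f a b) := Finset.mul_sum _ _ _

-- Neither tensor may depend on the summation variables of the other. Blocks with internal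
-- dependence are moved by `ts_comm₂` and `ts_comm₃`.
omit [Module k U] in
lemma ts_comm {V' W' : Type*} [AddCommGroup V'] [Module k V'] [AddCommGroup W'] [Module k W']
    (t : V ⊗[k] W) (t' : V' ⊗[k] W') (f : V → W → V' → W' → U) :
    ts t (fun a b => ts t' (fun c d => f a b c d)) =
      ts t' (fun c d => ts t (fun a b => f a b c d)) := Finset.sum_comm

omit [Module k U] in
lemma ts_congr {t : V ⊗[k] W} {f g : V → W → U} (h : ∀ a b, f a b = g a b) : ts t f = ts t g :=
  Finset.sum_congr rfl fun _ _ => h _ _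

/-- The linear map given by a bilinear function. -/
def LinFun.lift (f : V → W → U) [h1 : ∀ b, LinFun k (fun a => f a b)]
    [h2 : ∀ a, LinFun k (fun b => f a b)] : V ⊗[k] W →ₗ[k] U :=
  TensorProduct.lift (LinearMap.mk₂ k f (fun a a' b => (h1 b).map_add a a')
    (fun r a b => (h1 b).map_smul r a) (fun a b b' => (h2 a).map_add b b')
    (fun r a b => (h2 a).map_smul r b))

/-- Here the choice of presentation disappears: for bilinear `f` the sum is the value of a linear
map at `t`. -/
lemma ts_eq_lift (t : V ⊗[k] W) (f : V → W → U) [∀ b, LinFun k (fun a => f a b)]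
    [∀ a, LinFun k (fun b => f a b)] : ts t f = LinFun.lift f t := by
  conv_rhs => rw [← ts_self t, map_ts]
  rfl

instance LinFun.ts_left (g : U → V ⊗[k] W) (f : V → W → Z) [h : LinFun k g]
    [∀ b, LinFun k (fun a => f a b)] [∀ a, LinFun k (fun b => f a b)] :
    LinFun k (fun x => ts (g x) f) :=
  ⟨fun a b => by simp only [ts_eq_lift, h.map_add, _root_.map_add],
    fun r a => by simp only [ts_eq_lift, h.map_smul, _root_.map_smul]⟩

instance LinFun.ts_right (t : V ⊗[k] W) (f : U → V → W → Z) [h : ∀ a b, LinFun k (fun x => f x a b)] :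
    LinFun k (fun x => ts t (f x)) :=
  ⟨fun a b => by
    simp only [ts, ← Finset.sum_add_distrib]
    exact Finset.sum_congr rfl fun p _ => (h p.1 p.2).map_add a b,
   fun r a => by
    simp only [ts, Finset.smul_sum]
    exact Finset.sum_congr rfl fun p _ => (h p.1 p.2).map_smul r a⟩

lemma ts_tmul (v : V) (w : W) (f : V → W → U) [∀ b, LinFun k (fun a => f a b)]
    [∀ a, LinFun k (fun b => f a b)] : ts (v ⊗ₜ[k] w) f = f v w := by
  rw [ts_eq_lift]; rfl

/-- Bilinearity is essential, since the presentation chosen for the inner sum is unrelated to those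
chosen for the tensors `g a b`. -/
lemma ts_ts {V' W' : Type*} [AddCommGroup V'] [Module k V'] [AddCommGroup W'] [Module k W']
    (t : V' ⊗[k] W') (g : V' → W' → V ⊗[k] W) (f : V → W → U) [∀ b, LinFun k (fun a => f a b)]
    [∀ a, LinFun k (fun b => f a b)] :
    ts (ts t g) f = ts t (fun a b => ts (g a b) f) := by
  simp only [ts_eq_lift (f := f), map_ts]

lemma ts_map {V' W' : Type*} [AddCommGroup V'] [Module k V'] [AddCommGroup W'] [Module k W']
    (p : V' →ₗ[k] V) (q : W' →ₗ[k] W) (t : V' ⊗[k] W') (f : V → W → U)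
    [∀ b, LinFun k (fun a => f a b)] [∀ a, LinFun k (fun b => f a b)] :
    ts (TensorProduct.map p q t) f = ts t (fun a b => f (p a) (q b)) := by
  conv_lhs => rw [← ts_self t, map_ts]
  simp only [TensorProduct.map_tmul, ts_ts, ts_tmul]

lemma ts_comm_tensor (t : W ⊗[k] V) (f : V → W → U)
    [∀ b, LinFun k (fun a => f a b)] [∀ a, LinFun k (fun b => f a b)] :
    ts (TensorProduct.comm k W V t) f = ts t (fun a b => f b a) := by
  conv_lhs => rw [← ts_self t, map_ts_equiv]
  simp only [TensorProduct.comm_tmul, ts_ts, ts_tmul]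

end ts

/-! ### Coalgebra, Hopf algebra and coaction axioms as rules for Sweedler sums. -/

section coalg
variable {k U V C : Type*} [Field k] [AddCommGroup U] [Module k U] [AddCommGroup V] [Module k V]
  [AddCommGroup C] [Module k C] [Coalgebra k C]

section
variable (x : C) (f : C → C → C → U) [h1 : ∀ b c, LinFun k (fun a => f a b c)]
    [h2 : ∀ a c, LinFun k (fun b => f a b c)] [h3 : ∀ a b, LinFun k (fun c => f a b c)]
include h1 h2 h3

/-- Directed so that simplification brings every iterated comultiplication to the right-nested form
x₁, x₂, x₃, …; two Sweedler expressions can then be compared leg by leg. -/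
lemma ts_coassoc :
    ts (comul (R := k) x) (fun a b => ts (comul (R := k) a) (fun c d => f c d b)) =
      ts (comul (R := k) x) (fun a b => ts (comul (R := k) b) (fun c d => f a c d)) := by
  have h := congrArg (LinFun.lift (k := k) (fun (a : C) (t : C ⊗[k] C) => ts t (fun c d => f a c d)))
    (Coalgebra.coassoc_apply (R := k) x)
  rw [← ts_eq_lift, ← ts_eq_lift] at h
  conv_lhs at h =>
    rw [← ts_self (comul (R := k) x), map_ts, map_ts_equiv, ts_ts]
    arg 2; intro a b
    rw [LinearMap.rTensor_tmul, ← ts_self (comul (R := k) a), ts_tmul_left, map_ts_equiv, ts_ts]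
    arg 2; intro c d
    rw [TensorProduct.assoc_tmul, ts_tmul, ts_tmul]
  rw [h, LinearMap.lTensor, ts_map]
  rfl
end

lemma ts_counit_left (x : C) (f : C → U) [LinFun k f] :
    ts (comul (R := k) x) (fun a b => counit (R := k) a • f b) = f x := by
  have h := congrArg (LinFun.lift (k := k) (fun (a : k) (b : C) => a • f b))
    (Coalgebra.rTensor_counit_comul (R := k) x)
  rw [← ts_eq_lift, ← ts_eq_lift, LinearMap.rTensor, ts_map, ts_tmul] at h
  simpa using h

lemma ts_counit_right (x : C) (f : C → U) [LinFun k f] :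
    ts (comul (R := k) x) (fun a b => counit (R := k) b • f a) = f x := by
  have h := congrArg (LinFun.lift (k := k) (fun (b : C) (a : k) => a • f b))
    (Coalgebra.lTensor_counit_comul (R := k) x)
  rw [← ts_eq_lift, ← ts_eq_lift, LinearMap.lTensor, ts_map, ts_tmul] at h
  simpa using h
end coalg

section hopf
variable {k U X : Type*} [Field k] [AddCommGroup U] [Module k U]

lemma ts_comul_mul [Ring X] [Bialgebra k X] (x y : X) (f : X → X → U)
    [∀ b, LinFun k (fun a => f a b)] [∀ a, LinFun k (fun b => f a b)] :
    ts (comul (R := k) (x * y)) f = ts (comul (R := k) x) fun a b =>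
      ts (comul (R := k) y) fun c d => f (a * c) (b * d) := by
  have h : comul (R := k) (x * y) = ts (comul (R := k) x) fun a b =>
      ts (comul (R := k) y) fun c d => (a * c) ⊗ₜ[k] (b * d) := by
    rw [Bialgebra.comul_mul]
    conv_lhs => rw [← ts_self (comul (R := k) x), ← ts_self (comul (R := k) y)]
    simp only [ts_mul, mul_ts, Algebra.TensorProduct.tmul_mul_tmul]
    rw [ts_comm]
  rw [h]
  simp only [ts_ts, ts_tmul]

lemma comul_tmul_eq_ts {C D : Type*} [AddCommGroup C] [Module k C] [Coalgebra k C]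
    [AddCommGroup D] [Module k D] [Coalgebra k D] (x : C) (y : D) :
    comul (R := k) (x ⊗ₜ[k] y) = ts (comul (R := k) x) fun a b =>
      ts (comul (R := k) y) fun c d => (a ⊗ₜ c) ⊗ₜ[k] (b ⊗ₜ d) := by
  rw [TensorProduct.comul_tmul]
  conv_lhs => rw [← ts_self (comul (R := k) x), ← ts_self (comul (R := k) y)]
  simp only [ts_tmul_left, tmul_ts, map_ts_equiv,
    TensorProduct.AlgebraTensorModule.tensorTensorTensorComm_tmul]
  rw [ts_comm]

lemma ts_comul_one [Ring X] [Bialgebra k X] (f : X → X → U)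
    [∀ b, LinFun k (fun a => f a b)] [∀ a, LinFun k (fun b => f a b)] :
    ts (comul (R := k) (1 : X)) f = f 1 1 := by
  rw [Bialgebra.comul_one, Algebra.TensorProduct.one_def, ts_tmul]

variable [Ring X] [HopfAlgebra k X]

lemma ts_comul_antipode (x : X) (f : X → X → U)
    [∀ b, LinFun k (fun a => f a b)] [∀ a, LinFun k (fun b => f a b)] :
    ts (comul (R := k) (antipode k x)) f = ts (comul (R := k) x) fun a b =>
      f (antipode k b) (antipode k a) := by
  have (b : X) := LinFun.comp (k := k) (fun a => f a b) (fun x : X => antipode k x)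
  have (a : X) := LinFun.comp (k := k) (f a) (fun x : X => antipode k x)
  rw [comul_antipode', ts_map, ts_comm_tensor]

lemma ts_antipode_left (x : X) (f : X → U) [h : LinFun k f] :
    ts (comul (R := k) x) (fun a b => f (antipode k a * b)) = counit (R := k) x • f 1 := by
  rw [← h.map_smul, ← Algebra.algebraMap_eq_smul_one, ← mul_antipode_rTensor_comul_apply,
    rTensor_eq_ts]
  -- Bundling `f` as a linear map allows the sum to be pulled through it.
  let F : X →ₗ[k] U := ⟨⟨f, h.map_add⟩, h.map_smul⟩
  change _ = F _
  simp only [map_ts, LinearMap.mul'_apply]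
  rfl

lemma ts_antipode_right (x : X) (f : X → U) [h : LinFun k f] :
    ts (comul (R := k) x) (fun a b => f (a * antipode k b)) = counit (R := k) x • f 1 := by
  rw [← h.map_smul, ← Algebra.algebraMap_eq_smul_one, ← mul_antipode_lTensor_comul_apply,
    lTensor_eq_ts]
  let F : X →ₗ[k] U := ⟨⟨f, h.map_add⟩, h.map_smul⟩
  change _ = F _
  simp only [map_ts, LinearMap.mul'_apply]
  rfl
end hopf

section coaction
variable {k U V C : Type*} [Field k] [AddCommGroup U] [Module k U] [AddCommGroup V] [Module k V]

section
variable [AddCommGroup C] [Module k C] [Coalgebra k C] (ρ : RightCoaction k C V)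

lemma ts_coact (v : V) (f : V → C → C → U) [∀ b c, LinFun k (fun a => f a b c)]
    [∀ a c, LinFun k (fun b => f a b c)] [∀ a b, LinFun k (fun c => f a b c)] :
    ts (ρ.coact v) (fun a b => ts (ρ.coact a) (fun c d => f c d b)) =
      ts (ρ.coact v) (fun a b => ts (comul (R := k) b) (fun c d => f a c d)) := by
  have h := congrArg (LinFun.lift (k := k) (fun (a : V) (t : C ⊗[k] C) => ts t (fun c d => f a c d)))
    (ρ.coassoc v)
  rw [← ts_eq_lift, ← ts_eq_lift] at h
  simpa only [rTensor_eq_ts, lTensor_eq_ts, map_ts_equiv,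
    assoc_tmul_eq_ts, ts_ts, ts_tmul] using h

lemma ts_coact_counit (v : V) (f : V → U) [LinFun k f] :
    ts (ρ.coact v) (fun a b => counit (R := k) b • f a) = f v := by
  conv_rhs => rw [← ρ.counit_coact v, lTensor_eq_ts, map_ts_equiv]
  let F : V →ₗ[k] U := ⟨⟨f, LinFun.map_add k⟩, LinFun.map_smul⟩
  change _ = F _
  simp only [map_ts, TensorProduct.rid_tmul, map_smul]
  rfl
end

/-- Coassociativity in both variables at once. Exchanging the two middle sums, before and after,
makes `ts_coact` applicable to each variable. -/
lemma ts_coact₂ {W D : Type*} [AddCommGroup W] [Module k W] [AddCommGroup C] [Module k C]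
    [Coalgebra k C] [AddCommGroup D] [Module k D] [Coalgebra k D]
    (ρ : RightCoaction k C V) (τ : RightCoaction k D W) (v : V) (w : W)
    (f : V → C → C → W → D → D → U)
    [∀ a b c d e, LinFun k fun x => f x a b c d e] [∀ a b c d e, LinFun k fun x => f a x b c d e]
    [∀ a b c d e, LinFun k fun x => f a b x c d e] [∀ a b c d e, LinFun k fun x => f a b c x d e]
    [∀ a b c d e, LinFun k fun x => f a b c d x e] [∀ a b c d e, LinFun k fun x => f a b c d e x] :
    (ts (ρ.coact v) fun a b => ts (τ.coact w) fun c d => ts (ρ.coact a) fun a' b' =>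
      ts (τ.coact c) fun c' d' => f a' b' b c' d' d) =
    (ts (ρ.coact v) fun a b => ts (τ.coact w) fun c d => ts (comul (R := k) b) fun b' b =>
      ts (comul (R := k) d) fun d' d => f a b' b c d' d) := by
  refine (ts_congr fun a b => ts_comm _ _ _).trans ?_
  simp only [ts_coact]
  exact ts_congr fun a b => ts_comm _ _ _

lemma RightCoaction.tensor_coact_eq {W : Type*} [AddCommGroup W] [Module k W] [Ring C]
    [Bialgebra k C] (ρ : RightCoaction k C V) (τ : RightCoaction k C W) (v : V) (w : W) :
    (ρ.tensor τ).coact (v ⊗ₜ w) = ts (ρ.coact v) fun a b => ts (τ.coact w) fun c d =>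
      (a ⊗ₜ c) ⊗ₜ (b * d) := by
  rw [RightCoaction.tensor_coact_tmul]
  conv_lhs => rw [← ts_self (ρ.coact v), ← ts_self (τ.coact w)]
  simp only [map_ts, map_ts₂, RightCoaction.tensorMul_tmul]
  rw [ts_comm]
end coaction

section ydmod
variable {k U V K : Type*} [Field k] [AddCommGroup U] [Module k U] [AddCommGroup V] [Module k V]
  [Ring K] [Bialgebra k K] (M : YDStruct k K V)

lemma ts_ydcoact (v : V) (f : K → K → V → U) [∀ b c, LinFun k (fun a => f a b c)]
    [∀ a c, LinFun k (fun b => f a b c)] [∀ a b, LinFun k (fun c => f a b c)] :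
    ts (M.coact v) (fun a b => ts (comul (R := k) a) (fun c d => f c d b)) =
      ts (M.coact v) (fun a b => ts (M.coact b) (fun c d => f a c d)) := by
  have h := congrArg (LinFun.lift (k := k) (fun (a : K) (t : K ⊗[k] V) => ts t (fun c d => f a c d)))
    (M.coassoc v)
  rw [← ts_eq_lift, ← ts_eq_lift] at h
  simpa only [rTensor_eq_ts, lTensor_eq_ts, map_ts_equiv,
    assoc_tmul_eq_ts, ts_ts, ts_tmul] using h

lemma ts_ydcoact_counit (v : V) (f : V → U) [LinFun k f] :
    ts (M.coact v) (fun a b => counit (R := k) a • f b) = f v := by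
  conv_rhs => rw [← M.counit_coact v, rTensor_eq_ts, map_ts_equiv]
  let F : V →ₗ[k] U := ⟨⟨f, LinFun.map_add k⟩, LinFun.map_smul⟩
  change _ = F _
  simp only [map_ts, TensorProduct.lid_tmul, map_smul]
  rfl

/-- The Yetter–Drinfeld condition under an arbitrary bilinear function, so that it can be applied
inside larger sums. -/
lemma YDStruct.ts_compat (κ : K) (v : V) (f : K → V → U) [∀ b, LinFun k (fun a => f a b)]
    [∀ a, LinFun k (fun b => f a b)] :
    (ts (comul (R := k) κ) fun a b => ts (M.coact v) fun c d => f (a * c) (M.act b d)) =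
      ts (comul (R := k) κ) fun a b => ts (M.coact (M.act a v)) fun c d => f (c * b) d := by
  have h := congrArg (LinFun.lift (k := k) f) (M.compat κ v)
  rw [← ts_eq_lift, ← ts_eq_lift] at h
  have e1 : TensorProduct.map₂ (LinearMap.mul k K) M.act (comul (R := k) κ) (M.coact v) =
      ts (comul (R := k) κ) fun a b => ts (M.coact v) fun c d => (a * c) ⊗ₜ (M.act b d) := by
    conv_lhs => rw [← ts_self (comul (R := k) κ), ← ts_self (M.coact v)]
    simp only [map_ts, map_ts₂, TensorProduct.map₂_apply_tmul, TensorProduct.map_tmul,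
      LinearMap.mul_apply']
    rw [ts_comm]
  have e2 : ydRight M.act M.coact v (comul (R := k) κ) =
      ts (comul (R := k) κ) fun a b => ts (M.coact (M.act a v)) fun c d => (c * b) ⊗ₜ d := by
    conv_lhs => rw [← ts_self (comul (R := k) κ)]
    simp [map_ts, ydRight, rTensor_eq_ts]
  have : ∀ (a : V) (u w : K), LinFun k fun c => f (u * c) (M.act w a) := fun a u w =>
    LinFun.comp (fun c => f c (M.act w a)) _
  have : ∀ (a : K) (u w : K), LinFun k fun c => f (a * u) (M.act w c) := fun a u w =>
    LinFun.comp (fun c => f (a * u) c) _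
  simpa only [e1, e2, ts_ts, ts_tmul] using h

lemma YDStruct.tensor_coact_eq {W : Type*} [AddCommGroup W] [Module k W]
    (N : YDStruct k K W) (v : V) (w : W) :
    (M.tensor N).coact (v ⊗ₜ w) = ts (M.coact v) fun a b => ts (N.coact w) fun c d =>
      (a * c) ⊗ₜ (b ⊗ₜ d) := by
  rw [YDStruct.tensor_coact_tmul]
  conv_lhs => rw [← ts_self (M.coact v), ← ts_self (N.coact w)]
  simp only [map_ts, map_ts₂, YDStruct.tensorMul_tmul]
  rw [ts_comm]

lemma YDStruct.tensor_act_eq {W : Type*} [AddCommGroup W] [Module k W]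
    (N : YDStruct k K W) (κ : K) (v : V) (w : W) :
    (M.tensor N).act κ (v ⊗ₜ w) = ts (comul (R := k) κ) fun a b => M.act a v ⊗ₜ N.act b w := by
  rw [YDStruct.tensor_act]
  conv_lhs => rw [← ts_self (comul (R := k) κ)]
  simp only [map_ts₂, TensorProduct.map₂_apply_tmul, TensorProduct.map_tmul]
end ydmod

/-! ### The axioms of σ in Sweedler form, and their consequences on comodules. -/

namespace CQTStructure
section
variable {k U H : Type*} [Field k] [AddCommGroup U] [Module k U] [Ring H] [HopfAlgebra k H]
  (s : CQTStructure k H)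

lemma form_mul_l (h h' g : H) : s.form (h * h') g =
    ts (comul (R := k) g) fun a b => s.form h a * s.form h' b := by
  rw [s.form_mul_left', map_eq_ts]
  simp only [map_ts, LinearMap.mul'_apply]

lemma form_mul_r (g h h' : H) : s.form g (h * h') =
    ts (comul (R := k) g) fun a b => s.form a h' * s.form b h := by
  rw [s.form_mul_right', map_eq_ts]
  simp only [map_ts, LinearMap.mul'_apply]
  rfl

lemma inv_apply (x y : H) : s.inv x y = s.form (antipode k x) y := by
  have := LinearMap.congr_fun s.lift_form_antipode (x ⊗ₜ y)
  simpa using this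

lemma form_comm (x y : H) (f : H → U) [h : LinFun k f] :
    (ts (comul (R := k) x) fun a b => ts (comul (R := k) y) fun c d => s.form a c • f (b * d)) =
    ts (comul (R := k) x) fun a b => ts (comul (R := k) y) fun c d => s.form b d • f (c * a) := by
  have e := s.comm_apply (x ⊗ₜ y)
  rw [comul_tmul_eq_ts] at e
  let F : H →ₗ[k] U := ⟨⟨f, h.map_add⟩, h.map_smul⟩
  replace e := congrArg F e
  simpa [map_ts, map_ts_equiv, F] using e

lemma form_inv (x y : H) : (ts (comul (R := k) x) fun a b => ts (comul (R := k) y) fun c d =>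
    s.form a c * s.inv b d) = counit (R := k) x * counit (R := k) y := by
  have e := LinearMap.congr_fun (congrArg WithConv.ofConv s.form_conv_inv) (x ⊗ₜ y)
  rw [LinearMap.convMul_apply, comul_tmul_eq_ts] at e
  simpa [map_ts, mul_comm] using e

lemma inv_form (x y : H) : (ts (comul (R := k) x) fun a b => ts (comul (R := k) y) fun c d =>
    s.inv a c * s.form b d) = counit (R := k) x * counit (R := k) y := by
  have e := LinearMap.congr_fun (congrArg WithConv.ofConv s.inv_conv_form) (x ⊗ₜ y)
  rw [LinearMap.convMul_apply, comul_tmul_eq_ts] at e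
  simpa [map_ts, mul_comm] using e
end
end CQTStructure

section
variable {k U V W P C : Type*} [Field k] [AddCommGroup U] [Module k U] [AddCommGroup V] [Module k V]
  [AddCommGroup W] [Module k W] [AddCommGroup P] [Module k P] [Ring C] [HopfAlgebra k C]
  (s : CQTStructure k C) (ρ : RightCoaction k C V) (τ : RightCoaction k C W)
  (υ : RightCoaction k C P)

/-- Coassociativity moves all splittings to the comultiplications of v₍₁₎ and w₍₁₎, where the claim
is the commutation rule. It yields the colinearity of the braiding, and later the morphism property
and the associativity of the twist by σ. -/
lemma CQTStructure.ts_coact_form (v : V) (w : W) (f : V → W → C → U)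
    [∀ b c, LinFun k fun a => f a b c] [∀ a c, LinFun k fun b => f a b c]
    [∀ a b, LinFun k fun c => f a b c] :
    (ts (ρ.coact v) fun a b => ts (τ.coact w) fun c d => s.form b d •
      ts (τ.coact c) fun c d => ts (ρ.coact a) fun a b => f a c (d * b)) =
    (ts (ρ.coact v) fun a b => ts (τ.coact w) fun c d => ts (ρ.coact a) fun a b' =>
      ts (τ.coact c) fun c d' => s.form b' d' • f a c (b * d)) := by
  have (a : V) (c : W) (d : C) : LinFun k fun b => f a c (b * d) :=
    LinFun.comp (f a c) (fun b => b * d)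
  have (a : V) (c : W) (d : C) : LinFun k fun b => f a c (d * b) :=
    LinFun.comp (f a c) (fun b => d * b)
  simp only [smul_ts]
  refine (ts_congr fun a b => ts_congr fun c d => ts_comm _ _ _).trans ?_
  rw [ts_coact₂ ρ τ v w (fun a b b' c d d' => s.form b' d' • f a c (d * b)),
    ts_coact₂ ρ τ v w (fun a b b' c d d' => s.form b d • f a c (b' * d'))]
  exact ts_congr fun a b => ts_congr fun c d => (s.form_comm b d (f a c)).symm

/-- The first hexagon: multiplicativity of σ in the second variable splits v₍₁₎ into two legs, one
braided past w and the other past p. -/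
lemma CQTStructure.ts_coact_form_mul_r (v : V) (w : W) (p : P) (f : V → W → P → U)
    [∀ b c, LinFun k fun a => f a b c] [∀ a c, LinFun k fun b => f a b c]
    [∀ a b, LinFun k fun c => f a b c] :
    (ts (ρ.coact v) fun a b => ts (τ.coact w) fun c d => ts (υ.coact p) fun e g =>
      s.form b (d * g) • f a c e) =
    (ts (ρ.coact v) fun a b => ts (τ.coact w) fun c d => s.form b d •
      ts (ρ.coact a) fun a b => ts (υ.coact p) fun e g => s.form b g • f a c e) := by
  simp only [s.form_mul_r, ts_smul, smul_ts, smul_smul]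
  symm
  refine (ts_congr fun a b => ts_comm _ _ _).trans ?_
  rw [ts_coact ρ v (fun a b b' => ts (τ.coact w) fun c d => ts (υ.coact p) fun e g =>
    (s.form b' d * s.form b g) • f a c e)]
  refine ts_congr fun a b => (ts_comm _ _ _).trans (ts_congr fun c d => (ts_comm _ _ _).trans ?_)
  simp only [mul_comm]

/-- The second hexagon, by multiplicativity in the first variable; it is p₍₁₎ that splits. -/
lemma CQTStructure.ts_coact_form_mul_l (v : V) (w : W) (p : P) (f : V → W → P → U)
    [∀ b c, LinFun k fun a => f a b c] [∀ a c, LinFun k fun b => f a b c]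
    [∀ a b, LinFun k fun c => f a b c] :
    (ts (ρ.coact v) fun a b => ts (τ.coact w) fun c d => ts (υ.coact p) fun e g =>
      s.form (b * d) g • f a c e) =
    (ts (τ.coact w) fun c d => ts (υ.coact p) fun e g => s.form d g •
      ts (ρ.coact v) fun a b => ts (υ.coact e) fun e g => s.form b g • f a c e) := by
  simp only [s.form_mul_l, ts_smul, smul_ts, smul_smul]
  rw [ts_comm]
  refine ts_congr fun c d => (ts_comm _ _ _).trans ?_
  symm
  refine (ts_congr fun a b => ts_comm _ _ _).trans ?_
  rw [ts_coact υ p (fun e g g' => ts (ρ.coact v) fun a b => (s.form d g' * s.form b g) • f a c e)]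
  refine ts_congr fun a b => (ts_comm _ _ _).trans ?_
  simp only [mul_comm]

end

/-! ### The braided category of right comodules. -/

namespace RightComod
variable {k C : Type u} [Field k] [Ring C]

section
variable [Bialgebra k C]

lemma twist_tmul (φ : C →ₗ[k] C →ₗ[k] k) (M N : RightComod k C) (m : M.V) (n : N.V) :
    twist φ M N (m ⊗ₜ n) = ts (M.str.coact m) fun a b => ts (N.str.coact n) fun c d =>
      φ b d • (a ⊗ₜ c) := by
  simp only [twist, LinearMap.comp_apply, TensorProduct.map_tmul, LinearEquiv.coe_coe]
  conv_lhs => rw [← ts_self (M.coact m), ← ts_self (N.coact n)]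
  simp only [ts_tmul_left, tmul_ts, map_ts, map_ts_equiv, TensorProduct.tensorTensorTensorComm_tmul,
    LinearMap.lTensor_tmul, TensorProduct.lift.tmul, TensorProduct.rid_tmul]
  rw [ts_comm]

end

variable [HopfAlgebra k C] (s : CQTStructure k C)

lemma braidLin_tmul (M N : RightComod k C) (m : M.V) (n : N.V) :
    braidLin s M N (m ⊗ₜ n) = ts (M.str.coact m) fun a b => ts (N.str.coact n) fun c d =>
      s.form b d • (c ⊗ₜ a) := by
  simp only [braidLin, LinearMap.comp_apply, twist_tmul, map_ts_equiv, LinearEquiv.coe_coe, map_smul,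
    TensorProduct.comm_tmul]

/-- Composition of twists is the twist by the convolution product of the forms, so
convolution-inverse forms give mutually inverse twists. -/
lemma twist_twist (φ ψ : C →ₗ[k] C →ₗ[k] k) (M N : RightComod k C) (m : M.V) (n : N.V) :
    twist φ M N (twist ψ M N (m ⊗ₜ n)) = ts (M.str.coact m) fun a b => ts (N.str.coact n) fun c d =>
      (ts (comul (R := k) b) fun b b' => ts (comul (R := k) d) fun d d' => φ b d * ψ b' d') •
        (a ⊗ₜ c) := by
  simp only [twist_tmul, map_ts, smul_ts, map_smul, ts_smul, ts_coact₂, smul_smul, mul_comm]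

lemma twist_form_inv (M N : RightComod k C) (t : M.V ⊗[k] N.V) :
    twist s.form M N (twist s.inv M N t) = t := by
  induction t with
  | zero => simp
  | add x y hx hy => simp only [map_add, hx, hy]
  | tmul m n =>
    simp only [twist_twist, s.form_inv, mul_smul]
    rw [ts_comm]
    simp only [ts_coact_counit]

lemma twist_inv_form (M N : RightComod k C) (t : M.V ⊗[k] N.V) :
    twist s.inv M N (twist s.form M N t) = t := by
  induction t with
  | zero => simp
  | add x y hx hy => simp only [map_add, hx, hy]
  | tmul m n =>
    simp only [twist_twist, s.inv_form, mul_smul]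
    rw [ts_comm]
    simp only [ts_coact_counit]

/-- `twist s.form` as an equivalence. -/
noncomputable def twistEquiv (M N : RightComod k C) : M.V ⊗[k] N.V ≃ₗ[k] M.V ⊗[k] N.V :=
  LinearEquiv.ofLinearMap (twist s.form M N) (twist s.inv M N)
    (LinearMap.ext (twist_form_inv s M N)) (LinearMap.ext (twist_inv_form s M N))

lemma colin_braidLin (M N : RightComod k C) (t : M.V ⊗[k] N.V) :
    (N.str.tensor M.str).coact (braidLin s M N t) =
      (braidLin s M N).rTensor C ((M.str.tensor N.str).coact t) := by
  induction t with
  | zero => simp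
  | add x y hx hy => simp only [map_add, hx, hy]
  | tmul m n =>
    simp only [braidLin_tmul, map_ts, map_smul, RightCoaction.tensor_coact_eq,
      LinearMap.rTensor_tmul, ts_tmul_left, ← smul_tmul']
    exact s.ts_coact_form M.str N.str m n fun a c x => (c ⊗ₜ[k] a) ⊗ₜ[k] x

/-- The braiding of right comodules. -/
noncomputable def braidIso (M N : RightComod k C) : M ⊗ N ≅ N ⊗ M :=
  isoOfEquiv (M := M ⊗ N) (N := N ⊗ M) ((twistEquiv s M N).trans (TensorProduct.comm k M.V N.V))
    (colin_braidLin s M N)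

lemma twist_naturality (φ : C →ₗ[k] C →ₗ[k] k) {M N M' N' : RightComod k C} (f : M ⟶ M')
    (g : N ⟶ N') (m : M.V) (n : N.V) : twist φ M' N' (Hom.lin f m ⊗ₜ Hom.lin g n) =
      TensorProduct.map (Hom.lin f) (Hom.lin g) (twist φ M N (m ⊗ₜ n)) := by
  have h1 := Hom.colin f m
  have h2 := Hom.colin g n
  simp only [twist_tmul, map_ts, map_smul, TensorProduct.map_tmul]
  rw [show M'.str.coact (Hom.lin f m) = _ from h1, show N'.str.coact (Hom.lin g n) = _ from h2]
  simp only [rTensor_eq_ts, ts_ts, ts_tmul]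

lemma braidLin_naturality {M N M' N' : RightComod k C} (f : M ⟶ M')
    (g : N ⟶ N') (m : M.V) (n : N.V) : braidLin s M' N' (Hom.lin f m ⊗ₜ Hom.lin g n) =
      TensorProduct.map (Hom.lin g) (Hom.lin f) (braidLin s M N (m ⊗ₜ n)) := by
  simp only [braidLin, LinearMap.comp_apply, twist_naturality, LinearEquiv.coe_coe]
  exact (TensorProduct.map_comm _ _ _).symm

lemma hexagon_forward_tmul (M N P : RightComod k C) (m : M.V) (n : N.V) (p : P.V) :
    TensorProduct.assoc k N.V P.V M.V (braidLin s M (N ⊗ P) (m ⊗ₜ[k] (n ⊗ₜ[k] p : N.V ⊗[k] P.V))) =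
      (braidLin s M P).lTensor N.V (TensorProduct.assoc k N.V M.V P.V
        (braidLin s M N (m ⊗ₜ n) ⊗ₜ p)) := by
  have h : (N ⊗ P).str.coact (n ⊗ₜ[k] p : N.V ⊗[k] P.V) = ts (N.str.coact n) fun a b =>
      ts (P.str.coact p) fun c d => (a ⊗ₜ c) ⊗ₜ (b * d) :=
    RightCoaction.tensor_coact_eq N.str P.str n p
  have e : braidLin s M (N ⊗ P) (m ⊗ₜ[k] (n ⊗ₜ[k] p : N.V ⊗[k] P.V)) =
      ts (M.str.coact m) fun a b => ts (N.str.coact n) fun c d => ts (P.str.coact p) fun e g =>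
        s.form b (d * g) • (c ⊗ₜ[k] e) ⊗ₜ[k] a := by
    rw [braidLin_tmul, h]
    exact ts_congr fun a b => by simp only [ts_ts, ts_tmul]
  rw [e]
  simp only [braidLin_tmul, map_ts_equiv, map_smul, TensorProduct.assoc_tmul, ts_tmul_left,
    ← smul_tmul', map_ts, LinearMap.lTensor_tmul, tmul_ts, tmul_smul]
  exact s.ts_coact_form_mul_r M.str N.str P.str m n p fun a c e => c ⊗ₜ[k] (e ⊗ₜ[k] a)

lemma hexagon_reverse_tmul (M N P : RightComod k C) (m : M.V) (n : N.V) (p : P.V) :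
    (TensorProduct.assoc k P.V M.V N.V).symm
      (braidLin s (M ⊗ N) P ((m ⊗ₜ[k] n : M.V ⊗[k] N.V) ⊗ₜ[k] p)) =
      (braidLin s M P).rTensor N.V ((TensorProduct.assoc k M.V P.V N.V).symm
        (m ⊗ₜ braidLin s N P (n ⊗ₜ p))) := by
  have h : (M ⊗ N).str.coact (m ⊗ₜ[k] n : M.V ⊗[k] N.V) = ts (M.str.coact m) fun a b =>
      ts (N.str.coact n) fun c d => (a ⊗ₜ c) ⊗ₜ (b * d) :=
    RightCoaction.tensor_coact_eq M.str N.str m n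
  have e : braidLin s (M ⊗ N) P ((m ⊗ₜ[k] n : M.V ⊗[k] N.V) ⊗ₜ[k] p) =
      ts (M.str.coact m) fun a b => ts (N.str.coact n) fun c d => ts (P.str.coact p) fun e g =>
        s.form (b * d) g • e ⊗ₜ[k] (a ⊗ₜ[k] c) := by
    rw [braidLin_tmul, h]
    simp only [ts_ts, ts_tmul]
  rw [e]
  simp only [braidLin_tmul, map_ts_equiv, map_smul, TensorProduct.assoc_symm_tmul, ts_tmul_left,
    ← smul_tmul', map_ts, LinearMap.rTensor_tmul, tmul_ts, tmul_smul]
  exact s.ts_coact_form_mul_l M.str N.str P.str m n p fun a c e => (e ⊗ₜ[k] a) ⊗ₜ[k] c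

/-- The braided category of right comodules over a coquasitriangular Hopf algebra. -/
@[reducible] noncomputable def braided : BraidedCategory (RightComod k C) where
  braiding := braidIso s
  braiding_naturality_right M N P f := by
    apply hom_ext
    exact TensorProduct.ext' fun m n => braidLin_naturality s (𝟙 M) f m n
  braiding_naturality_left f P := by
    apply hom_ext
    exact TensorProduct.ext' fun m n => braidLin_naturality s f (𝟙 P) m n
  hexagon_forward M N P := by
    apply hom_ext
    exact TensorProduct.ext_threefold fun m n p => hexagon_forward_tmul s M N P m n p
  hexagon_reverse M N P := by
    -- Precomposing with the associator makes the source left-bracketed, so that the identity can be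
    -- tested on tensors (m ⊗ n) ⊗ p.
    rw [← cancel_epi (α_ M N P).hom]
    apply hom_ext
    exact TensorProduct.ext_threefold fun m n p => hexagon_reverse_tmul s M N P m n p

end RightComod

/-! ### Braiding of Yetter–Drinfeld modules over a Hopf algebra with bijective antipode. -/

section
variable {k U V W P K : Type*} [Field k] [AddCommGroup U] [Module k U] [AddCommGroup V] [Module k V]
  [AddCommGroup W] [Module k W] [AddCommGroup P] [Module k P] [Ring K] [HopfAlgebra k K]

/-- With T = S⁻¹, the antipode is antimultiplicative and sends κ₂T(κ₁) to κ₁S(κ₂), which is ε(κ)1.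
-/
lemma ts_mul_antipode_inv (T : K →ₗ[k] K) (h1 : ∀ κ, antipode k (T κ) = κ)
    (h2 : ∀ κ, T (antipode k κ) = κ) (κ : K) (f : K → U) [LinFun k f] :
    ts (comul (R := k) κ) (fun a b => f (b * T a)) = counit (R := k) κ • f 1 := by
  have e : ts (comul (R := k) κ) (fun a b => b * T a) = counit (R := k) κ • (1 : K) := by
    rw [← h2 (ts _ _), map_ts]
    simp only [antipode_mul_antidistrib, h1]
    rw [ts_antipode_right κ (fun x => x), map_smul]
    congr 1
    conv_lhs => rw [← antipode_one (R := k) (A := K), h2]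
  rw [← LinFun.map_smul (k := k) (f := f), ← e]
  let F : K →ₗ[k] U := ⟨⟨f, LinFun.map_add k⟩, LinFun.map_smul⟩
  exact (map_ts F _ _).symm

/-- Likewise, S sends T(κ₂)κ₁ to S(κ₁)κ₂. -/
lemma ts_antipode_inv_mul (T : K →ₗ[k] K) (h1 : ∀ κ, antipode k (T κ) = κ)
    (h2 : ∀ κ, T (antipode k κ) = κ) (κ : K) (f : K → U) [LinFun k f] :
    ts (comul (R := k) κ) (fun a b => f (T b * a)) = counit (R := k) κ • f 1 := by
  have e : ts (comul (R := k) κ) (fun a b => T b * a) = counit (R := k) κ • (1 : K) := by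
    rw [← h2 (ts _ _), map_ts]
    simp only [antipode_mul_antidistrib, h1]
    rw [ts_antipode_left κ (fun x => x), map_smul]
    congr 1
    conv_lhs => rw [← antipode_one (R := k) (A := K), h2]
  rw [← LinFun.map_smul (k := k) (f := f), ← e]
  let F : K →ₗ[k] U := ⟨⟨f, LinFun.map_add k⟩, LinFun.map_smul⟩
  exact (map_ts F _ _).symm

end

section
variable {k V W P K : Type*} [Field k] [AddCommGroup V] [Module k V]
  [AddCommGroup W] [Module k W] [AddCommGroup P] [Module k P] [Ring K] 

namespace YDStruct

/-- The braiding `m ⊗ n ↦ m₍₋₁₎ ▷ n ⊗ m₍₀₎`. -/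
noncomputable def braid [Bialgebra k K] (M : YDStruct k K V) (N : YDStruct k K W) :
    V ⊗[k] W →ₗ[k] W ⊗[k] V :=
  LinFun.lift fun (m : V) (n : W) => ts (M.coact m) fun a b => N.act a n ⊗ₜ[k] b

lemma braid_tmul [Bialgebra k K] (M : YDStruct k K V) (N : YDStruct k K W) (m : V) (n : W) :
    M.braid N (m ⊗ₜ n) = ts (M.coact m) fun a b => N.act a n ⊗ₜ[k] b := rfl

lemma braid_eq [Bialgebra k K] (M : YDStruct k K V) (N : YDStruct k K W) :
    (TensorProduct.lift N.act).rTensor V ∘ₗ (TensorProduct.rightComm k K V W).toLinearMap ∘ₗ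
      M.coact.rTensor W = M.braid N := by
  refine TensorProduct.ext' fun m n => ?_
  rw [braid_tmul, LinearMap.comp_apply, LinearMap.comp_apply, LinearMap.rTensor_tmul]
  exact lin_eq_ts ((TensorProduct.lift N.act).rTensor V ∘ₗ
    (TensorProduct.rightComm k K V W).toLinearMap ∘ₗ (TensorProduct.mk k _ _).flip n) (M.coact m)

variable [HopfAlgebra k K]

/-- The inverse braiding `n ⊗ m ↦ m₍₀₎ ⊗ S⁻¹(m₍₋₁₎) ▷ n`. -/
noncomputable def braidInv (T : K →ₗ[k] K) (M : YDStruct k K V) (N : YDStruct k K W) :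
    W ⊗[k] V →ₗ[k] V ⊗[k] W :=
  LinFun.lift fun (n : W) (m : V) => ts (M.coact m) fun a b => b ⊗ₜ[k] N.act (T a) n

lemma braidInv_tmul (T : K →ₗ[k] K) (M : YDStruct k K V) (N : YDStruct k K W) (n : W) (m : V) :
    braidInv T M N (n ⊗ₜ m) = ts (M.coact m) fun a b => b ⊗ₜ[k] N.act (T a) n := rfl

variable (T : K →ₗ[k] K) (M : YDStruct k K V) (N : YDStruct k K W) (R : YDStruct k K P)

/-- Coassociativity of the coaction of m merges the two actions on n into the action of κ₂S⁻¹(κ₁)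
with κ = m₍₋₁₎, which collapses to ε(κ). -/
lemma braid_braidInv (h1 : ∀ κ, antipode k (T κ) = κ) (h2 : ∀ κ, T (antipode k κ) = κ)
    (t : W ⊗[k] V) : M.braid N (M.braidInv T N t) = t := by
  induction t with
  | zero => simp
  | add x y hx hy => simp only [map_add, hx, hy]
  | tmul n m =>
    simp only [braidInv_tmul, map_ts, braid_tmul, ← N.mul_act]
    rw [← ts_ydcoact M m fun a b c => N.act (b * T a) n ⊗ₜ[k] c]
    have h (a : K) (b : V) := ts_mul_antipode_inv T h1 h2 a fun x => N.act x n ⊗ₜ[k] b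
    simp only [h, ts_ydcoact_counit, N.one_act]

lemma braidInv_braid (h1 : ∀ κ, antipode k (T κ) = κ) (h2 : ∀ κ, T (antipode k κ) = κ)
    (t : V ⊗[k] W) : M.braidInv T N (M.braid N t) = t := by
  induction t with
  | zero => simp
  | add x y hx hy => simp only [map_add, hx, hy]
  | tmul m n =>
    simp only [braidInv_tmul, map_ts, braid_tmul, ← N.mul_act]
    rw [← ts_ydcoact M m fun a b c => c ⊗ₜ[k] N.act (T b * a) n]
    have h (a : K) (b : V) := ts_antipode_inv_mul T h1 h2 a fun x => b ⊗ₜ[k] N.act x n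
    simp only [h, ts_ydcoact_counit, N.one_act]

/-- K-linearity is the Yetter–Drinfeld condition of M with its K-leg acting on n; K-colinearity is
the condition of N, after m₍₋₁₎ has been split by coassociativity. -/
lemma isHom_braid : IsHom (M.tensor N) (N.tensor M) (M.braid N) where
  map_act κ t := by
    induction t with
    | zero => simp
    | add x y hx hy => simp only [map_add, hx, hy]
    | tmul m n =>
      simp only [tensor_act_eq, map_ts, braid_tmul, ← N.mul_act]
      exact (M.ts_compat κ m fun x y => N.act x n ⊗ₜ[k] y).symm.trans (ts_comm _ _ _)
  map_coact t := by
    induction t with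
    | zero => simp
    | add x y hx hy => simp only [map_add, hx, hy]
    | tmul m n =>
      simp only [tensor_coact_eq, map_ts, braid_tmul, LinearMap.lTensor_tmul, tmul_ts]
      refine (ts_congr fun a b => ts_comm _ _ _).trans ?_
      rw [← ts_ydcoact M m fun a e g => ts (N.coact (N.act a n)) fun c d =>
        (c * e) ⊗ₜ[k] (d ⊗ₜ[k] g)]
      have h (a : K) (b : V) := N.ts_compat a n fun x y => x ⊗ₜ[k] (y ⊗ₜ[k] b)
      simp only [← h]
      rw [ts_ydcoact M m fun a e g => ts (N.coact n) fun c d =>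
        (a * c) ⊗ₜ[k] (N.act e d ⊗ₜ[k] g)]
      exact ts_congr fun a b => ts_comm _ _ _

/-- On N ⊗ R the element m₍₋₁₎ acts through its comultiplication, so this hexagon is coassociativity
of the coaction of M. -/
lemma braid_tensor_right (m : V) (n : W) (p : P) :
    TensorProduct.assoc k W P V (M.braid (N.tensor R) (m ⊗ₜ[k] (n ⊗ₜ[k] p))) =
      (M.braid R).lTensor W (TensorProduct.assoc k W V P (M.braid N (m ⊗ₜ n) ⊗ₜ p)) := by
  simp only [braid_tmul, tensor_act_eq, map_ts_equiv, map_ts, ts_tmul_left,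
    TensorProduct.assoc_tmul, LinearMap.lTensor_tmul, tmul_ts]
  exact ts_ydcoact M m fun a b c => N.act a n ⊗ₜ[k] (R.act b p ⊗ₜ[k] c)

/-- The coaction of M ⊗ N multiplies its K-legs, so this hexagon is the module axiom of R. -/
lemma braid_tensor_left (m : V) (n : W) (p : P) :
    (TensorProduct.assoc k P V W).symm ((M.tensor N).braid R ((m ⊗ₜ[k] n) ⊗ₜ[k] p)) =
      (M.braid R).rTensor W ((TensorProduct.assoc k V P W).symm
        (m ⊗ₜ N.braid R (n ⊗ₜ p))) := by
  simp only [braid_tmul, tensor_coact_eq, map_ts_equiv, map_ts, ts_tmul_left, ts_ts, ts_tmul,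
    TensorProduct.assoc_symm_tmul, LinearMap.rTensor_tmul, tmul_ts, R.mul_act]
  exact ts_comm _ _ _

end YDStruct
end

namespace YD
variable {k K : Type u} [Field k] [Ring K]

lemma braidLin_eq_braid [Bialgebra k K] (M N : YD k K) : braidLin M N = M.str.braid N.str :=
  M.str.braid_eq N.str

variable [HopfAlgebra k K] (T : K →ₗ[k] K) (h1 : ∀ κ, antipode k (T κ) = κ)
  (h2 : ∀ κ, T (antipode k κ) = κ)

/-- The braiding of Yetter-Drinfeld modules over a Hopf algebra with bijective antipode. -/
noncomputable def braidIso (M N : YD k K) : M ⊗ N ≅ N ⊗ M :=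
  isoOfEquiv (M := M ⊗ N) (N := N ⊗ M) (LinearEquiv.ofLinearMap (M.str.braid N.str)
    (M.str.braidInv T N.str) (LinearMap.ext (M.str.braid_braidInv T N.str h1 h2))
    (LinearMap.ext (M.str.braidInv_braid T N.str h1 h2))) (M.str.isHom_braid N.str)

lemma braid_naturality {M N M' N' : YD k K} (f : M ⟶ M')
    (g : N ⟶ N') (m : M.V) (n : N.V) : M'.str.braid N'.str (Hom.lin f m ⊗ₜ Hom.lin g n) =
      TensorProduct.map (Hom.lin g) (Hom.lin f) (M.str.braid N.str (m ⊗ₜ n)) := by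
  simp only [YDStruct.braid_tmul, map_ts, TensorProduct.map_tmul]
  rw [show M'.str.coact (Hom.lin f m) = _ from (Hom.isHom f).map_coact m, lTensor_eq_ts]
  simp only [ts_ts, ts_tmul, (Hom.isHom g).map_act]

/-- The braided category of Yetter-Drinfeld modules over a Hopf algebra with bijective antipode. -/
@[reducible] noncomputable def braided : BraidedCategory (YD k K) where
  braiding := braidIso T h1 h2
  braiding_naturality_right M N P f := by
    apply hom_ext
    exact TensorProduct.ext' fun m n => braid_naturality (𝟙 M) f m n
  braiding_naturality_left f P := by
    apply hom_ext
    exact TensorProduct.ext' fun m n => braid_naturality f (𝟙 P) m n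
  hexagon_forward M N P := by
    apply hom_ext
    exact TensorProduct.ext_threefold fun m n p => M.str.braid_tensor_right N.str P.str m n p
  hexagon_reverse M N P := by
    rw [← cancel_epi (α_ M N P).hom]
    apply hom_ext
    exact TensorProduct.ext_threefold fun m n p => M.str.braid_tensor_left N.str P.str m n p

end YD

/-! ### Expanded Yetter–Drinfeld condition, and regrouping of iterated sums. -/

section
variable {k U V K : Type*} [Field k] [AddCommGroup U] [Module k U] [AddCommGroup V] [Module k V]
  [Ring K] [Algebra k K]

lemma map₂_mul_act_eq_ts (act : K →ₗ[k] V →ₗ[k] V) (z : K ⊗[k] K) (t : K ⊗[k] V) :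
    TensorProduct.map₂ (LinearMap.mul k K) act z t =
      ts z fun a b => ts t fun c d => (a * c) ⊗ₜ (act b d) := by
  conv_lhs => rw [← ts_self z, ← ts_self t]
  simp only [map_ts, map_ts₂, TensorProduct.map₂_apply_tmul, TensorProduct.map_tmul,
    LinearMap.mul_apply']
  rw [ts_comm]

lemma ydRight_eq_ts (act : K →ₗ[k] V →ₗ[k] V) (coact : V →ₗ[k] K ⊗[k] V) (v : V) (z : K ⊗[k] K) :
    ydRight act coact v z = ts z fun a b => ts (coact (act a v)) fun c d => (c * b) ⊗ₜ d := by
  conv_lhs => rw [← ts_self z]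
  simp [map_ts, ydRight, rTensor_eq_ts]

end

section
variable {k U C D : Type*} [Field k] [AddCommGroup U] [Module k U]

omit [Module k U] in
lemma ts_reverse₃ {V W V' W' V'' W'' : Type*} [AddCommGroup V] [Module k V] [AddCommGroup W]
    [Module k W] [AddCommGroup V'] [Module k V'] [AddCommGroup W'] [Module k W']
    [AddCommGroup V''] [Module k V''] [AddCommGroup W''] [Module k W'']
    (t : V ⊗[k] W) (t' : V' ⊗[k] W') (t'' : V'' ⊗[k] W'') (f : V → W → V' → W' → V'' → W'' → U) :
    (ts t fun a b => ts t' fun c d => ts t'' fun e g => f a b c d e g) =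
      ts t'' fun e g => ts t' fun c d => ts t fun a b => f a b c d e g := by
  rw [ts_comm]
  exact (ts_congr fun _ _ => ts_comm _ _ _).trans (ts_comm _ _ _)

variable [AddCommGroup C] [Module k C] [Coalgebra k C] [AddCommGroup D] [Module k D]
  [Coalgebra k D]

/-- Coassociativity is applied in opposite directions in the two variables. This moves a form next
to its convolution inverse on adjacent legs. -/
lemma ts_coassoc₂_right_left (x : C) (y : D) (f : C → C → C → D → D → D → U)
    [∀ a b c d e, LinFun k fun x => f x a b c d e] [∀ a b c d e, LinFun k fun x => f a x b c d e]
    [∀ a b c d e, LinFun k fun x => f a b x c d e] [∀ a b c d e, LinFun k fun x => f a b c x d e]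
    [∀ a b c d e, LinFun k fun x => f a b c d x e] [∀ a b c d e, LinFun k fun x => f a b c d e x] :
    (ts (comul (R := k) x) fun a b => ts (comul (R := k) y) fun c d =>
      ts (comul (R := k) b) fun b b' => ts (comul (R := k) c) fun c c' => f a b b' c c' d) =
    ts (comul (R := k) x) fun a b => ts (comul (R := k) y) fun c d =>
      ts (comul (R := k) a) fun a a' => ts (comul (R := k) d) fun d d' => f a a' b c d d' := by
  refine (ts_congr fun a b => ts_comm _ _ _).trans ?_
  simp only [ts_coassoc]
  rw [← ts_coassoc x (fun a b b' => ts (comul (R := k) y) fun c d =>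
    ts (comul (R := k) d) fun d d' => f a b b' c d d')]
  exact ts_congr fun a b => ts_comm _ _ _

end

/-! ### The factorization of H_{X,A}. -/

namespace CQTStructure
section dual
variable {k : Type*} [Field k] {H : Type*} [Ring H] [HopfAlgebra k H]
  {A : Type*} [Ring A] [HopfAlgebra k A] {X : Type*} [Ring X] [HopfAlgebra k X]
variable (s : CQTStructure k H) (ιX : X →ₐc[k] H) (ιA : A →ₐc[k] H)

lemma convMul_apply_ts (f g : WithConv (H →ₗ[k] k)) (h : H) :
    (f * g).ofConv h = ts (comul (R := k) h) fun a b => f.ofConv a * g.ofConv b := by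
  rw [LinearMap.convMul_apply, map_eq_ts]
  simp only [map_ts, LinearMap.mul'_apply]

lemma ts_comul_bialgHom {U : Type*} [AddCommGroup U] [Module k U] (x : X) (f : H → H → U)
    [∀ b, LinFun k (fun a => f a b)] [∀ a, LinFun k (fun b => f a b)] :
    ts (comul (R := k) (ιX x)) f = ts (comul (R := k) x) fun a b => f (ιX a) (ιX b) := by
  have (a : H) := LinFun.comp (k := k) (fun b => f a b) (fun x => ιX x)
  have (a : H) := LinFun.comp (k := k) (fun b => f b a) (fun x => ιX x)
  rw [← CoalgHomClass.map_comp_comul_apply, ts_map]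
  rfl

lemma lMap_mul (x y : X) : s.lMap ιX x * s.lMap ιX y = s.lMap ιX (y * x) := by
  apply WithConv.ofConv_injective
  ext h
  rw [convMul_apply_ts]
  change _ = s.form h (ιX (y * x))
  rw [map_mul, form_mul_r]
  rfl

lemma rMap_mul (x y : A) : s.rMap ιA x * s.rMap ιA y = s.rMap ιA (x * y) := by
  apply WithConv.ofConv_injective
  ext h
  rw [convMul_apply_ts]
  change _ = s.form (ιA (x * y)) h
  rw [map_mul, form_mul_l]
  rfl

lemma lMap_one : s.lMap ιX 1 = 1 := by
  apply WithConv.ofConv_injective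
  ext h
  change s.form h (ιX 1) = counit (R := k) h
  rw [map_one, s.form_one_right']

lemma rMap_one : s.rMap ιA 1 = 1 := by
  apply WithConv.ofConv_injective
  ext h
  change s.form (ιA 1) h = counit (R := k) h
  rw [map_one, s.form_one_left']

/-- Evaluation at `h` on the dual of `H`. -/
noncomputable def dualEval (h : H) : WithConv (H →ₗ[k] k) →ₗ[k] k :=
  LinearMap.applyₗ h ∘ₗ (WithConv.linearEquiv k (H →ₗ[k] k)).toLinearMap

lemma dualEval_ext {f g : WithConv (H →ₗ[k] k)} (h : ∀ x : H, dualEval x f = dualEval x g) :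
    f = g :=
  WithConv.ofConv_injective (LinearMap.ext h)

lemma dualEval_mul (f g : WithConv (H →ₗ[k] k)) (h : H) :
    dualEval h (f * g) = ts (comul (R := k) h) fun a b => dualEval a f * dualEval b g :=
  convMul_apply_ts f g h

lemma dualEval_lMap (x : X) (h : H) : dualEval h (s.lMap ιX x) = s.form h (ιX x) := rfl

lemma dualEval_rMap (a : A) (h : H) : dualEval h (s.rMap ιA a) = s.form (ιA a) h := rfl

/-- At h this is the commutation rule for h and x, paired with σ(a,-) and expanded by
multiplicativity of σ in the second variable. -/
lemma rMap_lMap (a : A) (x : X) :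
    (ts (comul (R := k) a) fun a b => ts (comul (R := k) x) fun c d =>
      s.form (ιA b) (ιX c) • (s.rMap ιA a * s.lMap ιX d)) =
    ts (comul (R := k) a) fun a b => ts (comul (R := k) x) fun c d =>
      s.form (ιA a) (ιX d) • (s.lMap ιX c * s.rMap ιA b) := by
  refine dualEval_ext fun h => ?_
  have key := s.form_comm h (ιX x) (s.form (ιA a))
  simp only [ts_comul_bialgHom, form_mul_r] at key
  simp only [map_ts, map_smul, dualEval_mul, dualEval_lMap, dualEval_rMap]
  simp only [smul_ts] at key ⊢
  rw [ts_reverse₃]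
  refine Eq.trans ?_ (key.symm.trans ?_)
  · exact ts_congr fun _ _ => ts_congr fun _ _ => ts_congr fun _ _ => by
      simp only [smul_eq_mul]; ring
  · rw [ts_reverse₃]
    exact ts_congr fun _ _ => ts_congr fun _ _ => ts_congr fun _ _ => by
      simp only [smul_eq_mul]; ring

/-- The left side is the expansion of σ(a, S(x₁)x₂). -/
lemma ts_form_antipode_mul (a : A) (x : X) :
    (ts (comul (R := k) a) fun a b => ts (comul (R := k) x) fun c d =>
      s.form (ιA b) (ιX (antipode k c)) * s.form (ιA a) (ιX d)) =
    counit (R := k) a * counit (R := k) x := by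
  have (g : H) := LinFun.comp (k := k) (fun a => s.form g a) (fun x => ιX x)
  have h := ts_antipode_left (k := k) x fun x => s.form (ιA a) (ιX x)
  simp only [map_mul, map_one, form_mul_r, ts_comul_bialgHom, form_one_right', smul_eq_mul,
    CoalgHomClass.counit_comp_apply] at h
  rw [ts_comm, mul_comm, ← h]
  simp only [mul_comm]

lemma ts_form_mul_antipode (a : A) (x : X) :
    (ts (comul (R := k) a) fun a b => ts (comul (R := k) x) fun c d =>
      s.form (ιA b) (ιX c) * s.form (ιA a) (ιX (antipode k d))) =
    counit (R := k) a * counit (R := k) x := by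
  have (g : H) := LinFun.comp (k := k) (fun a => s.form g a) (fun x => ιX x)
  have h := ts_antipode_right (k := k) x fun x => s.form (ιA a) (ιX x)
  simp only [map_mul, map_one, form_mul_r, ts_comul_bialgHom, form_one_right', smul_eq_mul,
    CoalgHomClass.counit_comp_apply] at h
  rw [ts_comm, mul_comm, ← h]
  simp only [mul_comm]

/-- The crossing relation `rMap_lMap` solved for r_a l_x by convolving with σ(-,S(-)). The exact
coefficients do not matter later: the point is that the right side is a combination of products of
an l with an r. -/
lemma rMap_mul_lMap (a : A) (x : X) : s.rMap ιA a * s.lMap ιX x =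
    ts (comul (R := k) a) fun a e => ts (comul (R := k) x) fun g x =>
      s.form (ιA e) (ιX (antipode k g)) •
      ts (comul (R := k) a) fun a b => ts (comul (R := k) x) fun c d =>
        s.form (ιA a) (ιX d) • (s.lMap ιX c * s.rMap ιA b) := by
  simp only [← rMap_lMap, smul_ts, smul_smul]
  rw [← ts_coassoc₂_right_left a x fun a b e g c d => (s.form (ιA e) (ιX (antipode k g)) *
    s.form (ιA b) (ιX c)) • (s.rMap ιA a * s.lMap ιX d)]
  simp only [← ts_smul]
  simp only [ts_form_antipode_mul, mul_smul, ← smul_ts, ts_counit_left, ts_counit_right]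

/-- The same relation solved for the opposite product, with σ(-,S(-)) applied on the other outer
legs. -/
lemma lMap_mul_rMap (a : A) (x : X) : s.lMap ιX x * s.rMap ιA a =
    ts (comul (R := k) a) fun e a => ts (comul (R := k) x) fun x g =>
      s.form (ιA e) (ιX (antipode k g)) •
      ts (comul (R := k) a) fun a b => ts (comul (R := k) x) fun c d =>
        s.form (ιA b) (ιX c) • (s.rMap ιA a * s.lMap ιX d) := by
  simp only [rMap_lMap, smul_ts, smul_smul]
  rw [ts_coassoc₂_right_left a x fun e a b c d g => (s.form (ιA e) (ιX (antipode k g)) *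
    s.form (ιA a) (ιX d)) • (s.lMap ιX c * s.rMap ιA b)]
  simp only [mul_comm (s.form _ _) (s.form _ _)]
  simp only [← ts_smul]
  simp only [ts_form_mul_antipode, mul_smul, ← smul_ts, ts_counit_left, ts_counit_right]

lemma ts_mem {V W U : Type*} [AddCommGroup V] [Module k V] [AddCommGroup W] [Module k W]
    [AddCommGroup U] [Module k U] (p : Submodule k U) (t : V ⊗[k] W) (f : V → W → U)
    (h : ∀ a b, f a b ∈ p) : ts t f ∈ p := Submodule.sum_mem _ fun _ _ => h _ _

lemma range_mul_range_comm : LinearMap.range (s.rMap ιA) * LinearMap.range (s.lMap ιX) =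
    LinearMap.range (s.lMap ιX) * LinearMap.range (s.rMap ιA) := by
  apply le_antisymm
  · rw [Submodule.mul_le]
    rintro _ ⟨a, rfl⟩ _ ⟨x, rfl⟩
    rw [rMap_mul_lMap]
    exact ts_mem _ _ _ fun _ _ => ts_mem _ _ _ fun _ _ => Submodule.smul_mem _ _ <|
      ts_mem _ _ _ fun _ _ => ts_mem _ _ _ fun _ _ => Submodule.smul_mem _ _ <|
      Submodule.mul_mem_mul ⟨_, rfl⟩ ⟨_, rfl⟩
  · rw [Submodule.mul_le]
    rintro _ ⟨x, rfl⟩ _ ⟨a, rfl⟩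
    rw [lMap_mul_rMap]
    exact ts_mem _ _ _ fun _ _ => ts_mem _ _ _ fun _ _ => Submodule.smul_mem _ _ <|
      ts_mem _ _ _ fun _ _ => ts_mem _ _ _ fun _ _ => Submodule.smul_mem _ _ <|
      Submodule.mul_mem_mul ⟨_, rfl⟩ ⟨_, rfl⟩

lemma range_lMap_mul_self :
    LinearMap.range (s.lMap ιX) * LinearMap.range (s.lMap ιX) ≤ LinearMap.range (s.lMap ιX) := by
  rw [Submodule.mul_le]
  rintro _ ⟨x, rfl⟩ _ ⟨y, rfl⟩
  exact ⟨_, (s.lMap_mul ιX x y).symm⟩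

lemma range_rMap_mul_self :
    LinearMap.range (s.rMap ιA) * LinearMap.range (s.rMap ιA) ≤ LinearMap.range (s.rMap ιA) := by
  rw [Submodule.mul_le]
  rintro _ ⟨x, rfl⟩ _ ⟨y, rfl⟩
  exact ⟨_, (s.rMap_mul ιA x y).symm⟩

/-- For the spans L and R of the l_x and of the r_a, (LR)(LR) = L(RL)R = LLRR ⊆ LR. As 1 lies in
both spans, LR is a subalgebra containing all generators. -/
lemma subalg_eq : Subalgebra.toSubmodule (s.subalg ιX ιA) =
    LinearMap.range (s.lMap ιX) * LinearMap.range (s.rMap ιA) := by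
  set L := LinearMap.range (s.lMap ιX) with hL
  set R := LinearMap.range (s.rMap ιA) with hR
  have l1 : 1 ∈ L := ⟨1, s.lMap_one ιX⟩
  have r1 : 1 ∈ R := ⟨1, s.rMap_one ιA⟩
  apply le_antisymm
  · have hm : (L * R) * (L * R) ≤ L * R := by
      calc (L * R) * (L * R) = (L * R * L) * R := (mul_assoc (L * R) L R).symm
        _ = L * (L * R) * R := congrArg (· * R) ((mul_assoc L R L).trans
          (congrArg (L * ·) (s.range_mul_range_comm ιX ιA)))
        _ = (L * L) * (R * R) := (congrArg (· * R) (mul_assoc L L R).symm).trans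
          (mul_assoc (L * L) R R)
        _ ≤ L * R := mul_le_mul' (s.range_lMap_mul_self ιX) (s.range_rMap_mul_self ιA)
    have h1 : (1 : WithConv (H →ₗ[k] k)) ∈ L * R := by
      rw [← one_mul (1 : WithConv (H →ₗ[k] k))]
      exact Submodule.mul_mem_mul l1 r1
    have : s.subalg ιX ιA ≤ (L * R).toSubalgebra h1
        fun x y hx hy => hm (Submodule.mul_mem_mul hx hy) := by
      apply Algebra.adjoin_le
      rintro g (hg | hg)
      · change g ∈ L * R
        rw [← mul_one g]
        exact Submodule.mul_mem_mul hg r1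
      · change g ∈ L * R
        rw [← one_mul g]
        exact Submodule.mul_mem_mul l1 hg
    exact this
  · rw [Submodule.mul_le]
    exact fun f hf g hg => Subalgebra.mul_mem _ (Algebra.subset_adjoin (Or.inl hf))
      (Algebra.subset_adjoin (Or.inr hg))

end dual
end CQTStructure

/-! ### The inverse antipodes, and evaluation of elements of K on H. -/

namespace CQTStructure
section antipodeInv
variable {k U : Type*} [Field k] [AddCommGroup U] [Module k U] {H : Type*} [Ring H]
  [HopfAlgebra k H] (s : CQTStructure k H)

lemma ts_comul_antipodeInv (x : H) (f : H → H → U)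
    [∀ b, LinFun k (fun a => f a b)] [∀ a, LinFun k (fun b => f a b)] :
    ts (comul (R := k) (s.antipodeInv x)) f = ts (comul (R := k) x) fun a b =>
      f (s.antipodeInv b) (s.antipodeInv a) := by
  have (b : H) := LinFun.comp (k := k) (fun a => f a b) (fun x => s.antipodeInv x)
  have (a : H) := LinFun.comp (k := k) (f a) (fun x => s.antipodeInv x)
  rw [comul_antipodeInv, ts_map, ts_comm_tensor]

lemma antipodeInv_mul (x y : H) :
    s.antipodeInv (x * y) = s.antipodeInv y * s.antipodeInv x := by
  apply s.antipode_bijective.1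
  rw [antipode_mul_antidistrib, s.antipode_antipodeInv, s.antipode_antipodeInv,
    s.antipode_antipodeInv]

lemma antipodeInv_one : s.antipodeInv 1 = 1 := by
  conv_lhs => rw [← antipode_one (R := k) (A := H), s.antipodeInv_antipode]

lemma counit_antipodeInv (x : H) : counit (R := k) (s.antipodeInv x) = counit (R := k) x := by
  conv_rhs => rw [← s.antipode_antipodeInv x, counit_antipode]

lemma ts_antipodeInv_mul (x : H) (f : H → U) [LinFun k f] :
    ts (comul (R := k) x) (fun a b => f (s.antipodeInv b * a)) = counit (R := k) x • f 1 :=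
  ts_antipode_inv_mul s.antipodeInv s.antipode_antipodeInv s.antipodeInv_antipode x f

lemma form_antipodeInv_antipodeInv (x y : H) :
    s.form (s.antipodeInv x) (s.antipodeInv y) = s.form x y := by
  rw [← s.form_antipode_antipode, s.antipode_antipodeInv, s.antipode_antipodeInv]

lemma map_antipodeInv {X : Type*} [Ring X] [HopfAlgebra k X] (ι : X →ₐc[k] H)
    (hι : Function.Injective ι) (x : X) :
    ι ((s.comap ι hι).antipodeInv x) = s.antipodeInv (ι x) := by
  apply s.antipode_bijective.1
  rw [← map_antipode', antipode_antipodeInv, antipode_antipodeInv]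

end antipodeInv

section K
variable {U : Type*} {k H A X : Type u} [Field k] [AddCommGroup U] [Module k U] [Ring H]
  [HopfAlgebra k H] [Ring A] [HopfAlgebra k A] [Ring X] [HopfAlgebra k X]
  (s : CQTStructure k H) (ιX : X →ₐc[k] H) (ιA : A →ₐc[k] H)

/-- The evaluation of elements of the co-opposite of `H_{X,A}`. -/
noncomputable def ev : s.HXAcop ιX ιA →ₗ[k] H →ₗ[k] k :=
  (WithConv.linearEquiv k (H →ₗ[k] k)).toLinearMap ∘ₗ (s.incl ιX ιA).toLinearMap

variable {s ιX ιA} in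
lemma ev_ext {f g : s.HXAcop ιX ιA} (h : ∀ x, s.ev ιX ιA f x = s.ev ιX ιA g x) : f = g :=
  s.eval_ext ιX ιA f g h

lemma ev_mul (f g : s.HXAcop ιX ιA) (h : H) : s.ev ιX ιA (f * g) h =
    ts (comul (R := k) h) fun a b => s.ev ιX ιA f a * s.ev ιX ιA g b :=
  convMul_apply_ts _ _ h

lemma ev_one (h : H) : s.ev ιX ιA 1 h = counit (R := k) h := rfl

lemma ev_antipode (f : s.HXAcop ιX ιA) (h : H) :
    s.ev ιX ιA (antipode k f) h = s.ev ιX ιA f (s.antipodeInv h) := rfl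

lemma counit_eq_ev (f : s.HXAcop ιX ιA) : counit (R := k) f = s.ev ιX ιA f 1 := rfl

/-- The factors x and y appear reversed because K carries the co-opposite comultiplication. -/
lemma ts_comul_ev (f : s.HXAcop ιX ιA) (x y : H) :
    (ts (comul (R := k) f) fun a b => s.ev ιX ιA a x * s.ev ιX ιA b y) = s.ev ιX ιA f (y * x) := by
  have key (t : s.HXAcop ιX ιA ⊗[k] s.HXAcop ιX ιA) :
      (ts (TensorProduct.comm k _ _ t) fun a b => s.ev ιX ιA a x * s.ev ιX ιA b y) =
      LinearMap.mul' k k (TensorProduct.map ((s.ev ιX ιA).flip y) ((s.ev ιX ιA).flip x) t) := by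
    rw [ts_comm_tensor, map_eq_ts, map_ts]
    exact ts_congr fun a b => mul_comm _ _
  refine (key (comul (R := k) (A := s.HXA ιX ιA) f)).trans
    (Eq.trans ?_ (s.tensorEval_comul ιX ιA f (y ⊗ₜ x)))
  rw [tensorEval_apply]
  rfl

/-- Evaluations at elements of H separate points of K, and linear functionals separate points of V.
Identities in K ⊗ V, in particular in the double, are thereby reduced to identities in V with a
parameter x in H. -/
lemma ev_tensor_ext {V : Type*} [AddCommGroup V] [Module k V] {t u : s.HXAcop ιX ιA ⊗[k] V}
    (h : ∀ x : H, (ts t fun f v => s.ev ιX ιA f x • v) = ts u fun f v => s.ev ιX ιA f x • v) :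
    t = u := by
  rw [← sub_eq_zero]
  refine tensor_separating (fun x : H => (s.ev ιX ιA).flip x) (fun φ : Module.Dual k V => φ)
    (fun f hf => ev_ext fun x => by rw [map_zero]; exact hf x)
    (fun v hv => (Module.forall_dual_apply_eq_zero_iff k v).1 hv) _ fun x φ => ?_
  have h' := congrArg φ (h x)
  rw [map_ts, map_ts] at h'
  simp only [map_sub, sub_eq_zero, map_eq_ts, map_ts]
  simpa only [map_smul, smul_eq_mul, LinearMap.mul'_apply, LinearMap.flip_apply] using h'

lemma ev_lCop (x : X) (h : H) : s.ev ιX ιA (s.lCop ιX ιA x) h = s.form h (ιX x) := rfl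

/-- Invariance of σ under S ⊗ S moves S⁻¹ on the first argument to S on the second. -/
lemma antipode_lCop (x : X) : antipode k (s.lCop ιX ιA x) = s.lCop ιX ιA (antipode k x) :=
  ev_ext fun h => by
    rw [ev_antipode, ev_lCop, ev_lCop, map_antipode', ← s.form_antipode_antipode,
      s.antipode_antipodeInv]

/-- Multiplicativity of σ in the first variable; the legs come out reversed because of the
co-opposite. -/
lemma comul_lCop (x : X) : comul (R := k) (s.lCop ιX ιA x) =
    ts (comul (R := k) x) fun a b => s.lCop ιX ιA b ⊗ₜ s.lCop ιX ιA a := by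
  refine ev_tensor_ext s ιX ιA fun g => ev_ext fun h => ?_
  simp only [ts_ts, ts_tmul, map_ts, map_smul, ts_apply, LinearMap.smul_apply, smul_eq_mul,
    ts_comul_ev, ev_lCop]
  rw [form_mul_l, ts_comul_bialgHom]
  simp only [mul_comm]

lemma ts_comul_lCop (x : X) (f : s.HXAcop ιX ιA → s.HXAcop ιX ιA → U)
    [∀ b, LinFun k (fun a => f a b)] [∀ a, LinFun k (fun b => f a b)] :
    ts (comul (R := k) (s.lCop ιX ιA x)) f = ts (comul (R := k) x) fun a b =>
      f (s.lCop ιX ιA b) (s.lCop ιX ιA a) := by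
  have (b : s.HXAcop ιX ιA) :=
    LinFun.comp (k := k) (fun a => f a b) (fun x => s.lCop ιX ιA x)
  have (b : s.HXAcop ιX ιA) :=
    LinFun.comp (k := k) (fun a => f b a) (fun x => s.lCop ιX ιA x)
  rw [comul_lCop]
  simp only [ts_ts, ts_tmul]

/-- `f ↦ f ∘ S` on the dual of `H`. -/
noncomputable def dualAntipode : WithConv (H →ₗ[k] k) →ₗ[k] WithConv (H →ₗ[k] k) :=
  (WithConv.linearEquiv k (H →ₗ[k] k)).symm.toLinearMap ∘ₗ
    LinearMap.lcomp k k (antipode k) ∘ₗ (WithConv.linearEquiv k (H →ₗ[k] k)).toLinearMap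

lemma dualEval_dualAntipode (f : WithConv (H →ₗ[k] k)) (h : H) :
    dualEval h (dualAntipode f) = dualEval (antipode k h) f := rfl

lemma dualAntipode_mul (f g : WithConv (H →ₗ[k] k)) :
    dualAntipode (f * g) = dualAntipode g * dualAntipode f := by
  refine dualEval_ext fun h => ?_
  have (f : WithConv (H →ₗ[k] k)) : LinFun k fun x => dualEval x f :=
    LinFun.coe (WithConv.linearEquiv k (H →ₗ[k] k) f)
  simp only [dualEval_dualAntipode, dualEval_mul, ts_comul_antipode, mul_comm]

variable (hX : Function.Injective ιX) (hA : Function.Injective ιA)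
include hX hA

/-- The restricted forms make X and A coquasitriangular, so S⁻¹ preserves both. By invariance of σ,
l_x ∘ S = l_{S⁻¹(x)} and r_a ∘ S = r_{S⁻¹(a)} are again generators. This provides the inverse of the
antipode of K that the braiding requires. -/
lemma dualAntipode_mem (f : WithConv (H →ₗ[k] k)) (hf : f ∈ s.subalg ιX ιA) :
    dualAntipode f ∈ s.subalg ιX ιA := by
  induction hf using Algebra.adjoin_induction with
  | mem f hf =>
    rcases hf with ⟨x, rfl⟩ | ⟨a, rfl⟩
    · refine Algebra.subset_adjoin (Or.inl ⟨(s.comap ιX hX).antipodeInv x, dualEval_ext fun h => ?_⟩)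
      rw [dualEval_dualAntipode, dualEval_lMap, dualEval_lMap, map_antipodeInv,
        ← s.form_antipode_antipode, s.antipode_antipodeInv]
    · refine Algebra.subset_adjoin (Or.inr ⟨(s.comap ιA hA).antipodeInv a, dualEval_ext fun h => ?_⟩)
      rw [dualEval_dualAntipode, dualEval_rMap, dualEval_rMap, map_antipodeInv,
        ← s.form_antipode_antipode, s.antipode_antipodeInv]
  | algebraMap r =>
    rw [Algebra.algebraMap_eq_smul_one, map_smul]
    refine Subalgebra.smul_mem _ ?_ r
    have : dualAntipode (1 : WithConv (H →ₗ[k] k)) = 1 :=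
      dualEval_ext fun h => counit_antipode (R := k) h
    rw [this]
    exact one_mem _
  | add f g _ _ hf hg => rw [map_add]; exact add_mem hf hg
  | mul f g _ _ hf hg => rw [dualAntipode_mul]; exact mul_mem hg hf

omit hX hA in
/-- The inverse `f ↦ f ∘ S` of the antipode of the co-opposite of `H_{X,A}`. -/
noncomputable def copAntipodeInv (hX : Function.Injective ιX) (hA : Function.Injective ιA) :
    s.HXAcop ιX ιA →ₗ[k] s.HXAcop ιX ιA :=
  dualAntipode.restrict (p := Subalgebra.toSubmodule (s.subalg ιX ιA))
    (q := Subalgebra.toSubmodule (s.subalg ιX ιA)) (s.dualAntipode_mem ιX ιA hX hA)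

lemma ev_copAntipodeInv (f : s.HXAcop ιX ιA) (h : H) :
    s.ev ιX ιA (s.copAntipodeInv ιX ιA hX hA f) h = s.ev ιX ιA f (antipode k h) := rfl

lemma antipode_copAntipodeInv (f : s.HXAcop ιX ιA) :
    antipode k (s.copAntipodeInv ιX ιA hX hA f) = f :=
  ev_ext fun h => by rw [ev_antipode, ev_copAntipodeInv, antipode_antipodeInv]

lemma copAntipodeInv_antipode (f : s.HXAcop ιX ιA) :
    s.copAntipodeInv ιX ιA hX hA (antipode k f) = f :=
  ev_ext fun h => by rw [ev_copAntipodeInv, ev_antipode, antipodeInv_antipode]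

end K
end CQTStructure

section
variable {k U V W V' W' V'' W'' V₃ W₃ : Type*} [Field k] [AddCommGroup U] [AddCommGroup V]
  [Module k V] [AddCommGroup W] [Module k W] [AddCommGroup V'] [Module k V'] [AddCommGroup W']
  [Module k W'] [AddCommGroup V''] [Module k V''] [AddCommGroup W''] [Module k W'']
  [AddCommGroup V₃] [Module k V₃] [AddCommGroup W₃] [Module k W₃]

/-- An independent sum is carried inside a block whose second tensor depends on the variables of the
first. -/
lemma ts_comm₂ (t : V ⊗[k] W) (t' : V' ⊗[k] W') (t'' : V' → W' → V'' ⊗[k] W'')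
    (f : V → W → V' → W' → V'' → W'' → U) :
    (ts t fun a b => ts t' fun c d => ts (t'' c d) fun e g => f a b c d e g) =
      ts t' fun c d => ts (t'' c d) fun e g => ts t fun a b => f a b c d e g := by
  rw [ts_comm]
  exact ts_congr fun _ _ => ts_comm _ _ _

lemma ts_comm₃ (t : V ⊗[k] W) (t' : V' ⊗[k] W') (t'' : V' → W' → V'' ⊗[k] W'')
    (t₃ : V' → W' → V'' → W'' → V₃ ⊗[k] W₃) (f : V → W → V' → W' → V'' → W'' → V₃ → W₃ → U) :
    (ts t fun a b => ts t' fun c d => ts (t'' c d) fun e g => ts (t₃ c d e g) fun h i =>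
      f a b c d e g h i) =
      ts t' fun c d => ts (t'' c d) fun e g => ts (t₃ c d e g) fun h i => ts t fun a b =>
        f a b c d e g h i := by
  rw [ts_comm₂]
  exact ts_congr fun _ _ => ts_congr fun _ _ => ts_comm _ _ _

end

/-! ### The functor F on objects, and the twist by σ. -/

namespace CQTStructure
section ydOf
variable {U V W : Type*} {k H A X : Type u} [Field k] [AddCommGroup U] [Module k U]
  [AddCommGroup V] [Module k V] [AddCommGroup W] [Module k W] [Ring H]
  [HopfAlgebra k H] [Ring A] [HopfAlgebra k A] [Ring X] [HopfAlgebra k X]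
  (s : CQTStructure k H) (ιX : X →ₐc[k] H) (ιA : A →ₐc[k] H) (hX : Function.Injective ιX)

/-- `x ↦ S⁻²(x)`, with values in `H`. -/
noncomputable def invSqH : X →ₗ[k] H := (ιX : X →ₗ[k] H) ∘ₗ s.invSq ιX hX

/-- `x ↦ l_{S⁻²(x)}`. -/
noncomputable def lInvSq : X →ₗ[k] s.HXAcop ιX ιA := s.lCop ιX ιA ∘ₗ s.invSq ιX hX

lemma invSqH_eq (x : X) : s.invSqH ιX hX x = s.antipodeInv (s.antipodeInv (ιX x)) := by
  rw [← map_antipodeInv s ιX hX, ← map_antipodeInv s ιX hX]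
  rfl

/-- S⁻¹ reverses the comultiplication, so its square preserves it. -/
lemma ts_comul_invSq (x : X) (f : X → X → U)
    [∀ b, LinFun k (fun a => f a b)] [∀ a, LinFun k (fun b => f a b)] :
    ts (comul (R := k) (s.invSq ιX hX x)) f = ts (comul (R := k) x) fun a b =>
      f (s.invSq ιX hX a) (s.invSq ιX hX b) := by
  have (a : X) := LinFun.comp (k := k) (fun b => f a b) (fun x => (s.comap ιX hX).antipodeInv x)
  have (a : X) := LinFun.comp (k := k) (fun b => f b a) (fun x => (s.comap ιX hX).antipodeInv x)
  exact ((s.comap ιX hX).ts_comul_antipodeInv _ f).trans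
    ((s.comap ιX hX).ts_comul_antipodeInv x _)

lemma ts_comul_invSqH (x : X) (f : H → H → U)
    [∀ b, LinFun k (fun a => f a b)] [∀ a, LinFun k (fun b => f a b)] :
    ts (comul (R := k) (s.invSqH ιX hX x)) f = ts (comul (R := k) x) fun a b =>
      f (s.invSqH ιX hX a) (s.invSqH ιX hX b) := by
  have (a : H) := LinFun.comp (k := k) (fun b => f a b) (fun x => s.invSqH ιX hX x)
  have (a : H) := LinFun.comp (k := k) (fun b => f b a) (fun x => s.invSqH ιX hX x)
  have (a : H) := LinFun.comp (k := k) (fun b => f a b) (fun x => ιX x)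
  have (a : H) := LinFun.comp (k := k) (fun b => f b a) (fun x => ιX x)
  refine (ts_comul_bialgHom ιX (s.invSq ιX hX x) f).trans ?_
  exact s.ts_comul_invSq ιX hX x fun a b => f (ιX a) (ιX b)

lemma invSqH_mul (x y : X) :
    s.invSqH ιX hX (x * y) = s.invSqH ιX hX x * s.invSqH ιX hX y := by
  simp only [invSqH_eq, map_mul, antipodeInv_mul]

lemma invSqH_one : s.invSqH ιX hX 1 = 1 := by
  simp only [invSqH_eq, map_one, antipodeInv_one]

lemma counit_invSqH (x : X) : counit (R := k) (s.invSqH ιX hX x) = counit (R := k) x := by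
  simp only [invSqH_eq, counit_antipodeInv, CoalgHomClass.counit_comp_apply]

lemma form_invSqH (x y : X) :
    s.form (s.invSqH ιX hX x) (s.invSqH ιX hX y) = s.form (ιX x) (ιX y) := by
  simp only [invSqH_eq, form_antipodeInv_antipodeInv]

lemma ev_lInvSq (x : X) (h : H) :
    s.ev ιX ιA (s.lInvSq ιX ιA hX x) h = s.form h (s.invSqH ιX hX x) := rfl

lemma lInvSq_one : s.lInvSq ιX ιA hX 1 = 1 :=
  ev_ext fun h => by rw [ev_lInvSq, invSqH_one, form_one_right', ev_one]

/-- The reversal reflects σ(g,hh') = σ(g₂,h)σ(g₁,h'). It is what makes the coaction on F(V) ⊗ F(W)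
run through w₍₁₎v₍₁₎. -/
lemma lInvSq_mul (x y : X) :
    s.lInvSq ιX ιA hX x * s.lInvSq ιX ιA hX y = s.lInvSq ιX ιA hX (y * x) :=
  ev_ext fun h => by
    rw [ev_lInvSq, invSqH_mul, form_mul_r, ev_mul]
    rfl

lemma counit_lInvSq (x : X) : counit (R := k) (s.lInvSq ιX ιA hX x) = counit (R := k) x := by
  rw [counit_eq_ev, ev_lInvSq, form_one_left', counit_invSqH]

lemma ts_comul_lInvSq (x : X) (f : s.HXAcop ιX ιA → s.HXAcop ιX ιA → U)
    [∀ b, LinFun k (fun a => f a b)] [∀ a, LinFun k (fun b => f a b)] :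
    ts (comul (R := k) (s.lInvSq ιX ιA hX x)) f = ts (comul (R := k) x) fun a b =>
      f (s.lInvSq ιX ιA hX b) (s.lInvSq ιX ιA hX a) := by
  have (b : s.HXAcop ιX ιA) := LinFun.comp (k := k) (fun a => f a b) (fun x => s.lCop ιX ιA x)
  have (b : s.HXAcop ιX ιA) := LinFun.comp (k := k) (fun a => f b a) (fun x => s.lCop ιX ιA x)
  refine (s.ts_comul_lCop ιX ιA (s.invSq ιX hX x) f).trans ?_
  exact s.ts_comul_invSq ιX hX x fun a b => f (s.lCop ιX ιA b) (s.lCop ιX ιA a)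

variable (ρ : RightCoaction k X V) (τ : RightCoaction k X W)

lemma ts_comul_ev_smul (f : s.HXAcop ιX ιA) (x y : H) (v : V) :
    (ts (comul (R := k) f) fun a b => s.ev ιX ιA a x • s.ev ιX ιA b y • v) =
      s.ev ιX ιA f (y * x) • v := by
  simp only [smul_smul, ← ts_comul_ev, ts_smul]

lemma ts_comul_ev_smul' (f : s.HXAcop ιX ιA) (x y : H) (v : V) :
    (ts (comul (R := k) f) fun a b => s.ev ιX ιA b y • s.ev ιX ιA a x • v) =
      s.ev ιX ιA f (y * x) • v := by
  rw [← ts_comul_ev_smul]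
  exact ts_congr fun _ _ => smul_comm _ _ _

/-- The commutation rule for w and S⁻²(x), with f evaluated on the product: the content of the
Yetter–Drinfeld condition for `ydOf`. -/
lemma ev_comm (f : s.HXAcop ιX ιA) (w : H) (x : X) (v : V) :
    (ts (comul (R := k) w) fun c d => ts (comul (R := k) x) fun a b =>
      s.form c (s.invSqH ιX hX a) • s.ev ιX ιA f (d * s.invSqH ιX hX b) • v) =
    ts (comul (R := k) w) fun c d => ts (comul (R := k) x) fun a b =>
      s.form d (s.invSqH ιX hX b) • s.ev ιX ιA f (s.invSqH ιX hX a * c) • v := by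
  have h := s.form_comm w (s.invSqH ιX hX x) fun y => s.ev ιX ιA f y • v
  simpa only [ts_comul_invSqH] using h

/-- The action `f ▷ v = f(S⁻²(v₍₁₎)) v₍₀₎`. -/
noncomputable def ydAct : s.HXAcop ιX ιA →ₗ[k] V →ₗ[k] V :=
  TensorProduct.curry (LinFun.lift fun (f : s.HXAcop ιX ιA) (v : V) =>
    ts (ρ.coact v) fun a b => s.ev ιX ιA f (s.invSqH ιX hX b) • a)

/-- The coaction `v ↦ l_{S⁻²(v₍₁₎)} ⊗ v₍₀₎`. -/
noncomputable def ydCoact : V →ₗ[k] s.HXAcop ιX ιA ⊗[k] V :=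
  LinFun.lift (fun a b => s.lInvSq ιX ιA hX b ⊗ₜ[k] a) ∘ₗ ρ.coact

lemma ydAct_apply (f : s.HXAcop ιX ιA) (v : V) : s.ydAct ιX ιA hX ρ f v =
    ts (ρ.coact v) fun a b => s.ev ιX ιA f (s.invSqH ιX hX b) • a := rfl

lemma ydCoact_apply (v : V) : s.ydCoact ιX ιA hX ρ v =
    ts (ρ.coact v) fun a b => s.lInvSq ιX ιA hX b ⊗ₜ[k] a := (ts_eq_lift _ _).symm

/-- The Yetter-Drinfeld structure `f ▷ v = f(S⁻²(v₍₁₎)) v₍₀₎`, `v ↦ l_{S⁻²(v₍₁₎)} ⊗ v₍₀₎` on a right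
comodule. -/
noncomputable def ydOf : YDStruct k (s.HXAcop ιX ιA) V where
  act := s.ydAct ιX ιA hX ρ
  coact := s.ydCoact ιX ιA hX ρ
  one_act v := by
    simp only [ydAct_apply, ev_one, counit_invSqH, ts_coact_counit]
  mul_act f g v := by
    simp only [ydAct_apply, ev_mul, map_ts, map_smul, ts_comul_invSqH, ts_smul, smul_ts, smul_smul]
    exact ((ts_coact ρ v fun a b c => (s.ev ιX ιA g (s.invSqH ιX hX c) *
      s.ev ιX ιA f (s.invSqH ιX hX b)) • a).trans (by simp only [mul_comm])).symm
  coassoc v := by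
    simp only [ydCoact_apply, map_ts, map_ts_equiv, LinearMap.rTensor_tmul, LinearMap.lTensor_tmul,
      assoc_tmul_eq_ts, ts_comul_lInvSq, tmul_ts]
    exact (ts_coact ρ v fun a b c => s.lInvSq ιX ιA hX c ⊗ₜ[k] (s.lInvSq ιX ιA hX b ⊗ₜ[k] a)).symm
  counit_coact v := by
    simp only [ydCoact_apply, map_ts, map_ts_equiv, LinearMap.rTensor_tmul, counit_lInvSq,
      TensorProduct.lid_tmul, ts_coact_counit]
  compat f v := by
    refine ev_tensor_ext s ιX ιA fun w => ?_
    rw [map₂_mul_act_eq_ts, ydRight_eq_ts]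
    simp only [ydAct_apply, ydCoact_apply, map_ts, map_smul, smul_tmul', ts_ts, ts_tmul, ev_mul,
      ts_smul, smul_ts, mul_smul, ev_lInvSq, LinearMap.smul_apply, smul_assoc]
    -- The comultiplication of f is moved innermost, where its two evaluations merge into one
    -- evaluation of f at a product. What remains is `ev_comm` for w and v₍₁₎.
    rw [ts_comm₃, ts_comm₃ (comul (R := k) f)]
    simp only [smul_comm (s.form _ _) (s.ev _ _ _ _), ts_comul_ev_smul]
    simp only [smul_comm (s.ev _ _ _ _) (s.form _ _)]
    rw [ts_coact ρ v fun a b c => ts (comul (R := k) w) fun h i =>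
        s.form i (s.invSqH ιX hX c) • s.ev ιX ιA f (s.invSqH ιX hX b * h) • a,
      ts_coact ρ v fun a b c => ts (comul (R := k) w) fun h i =>
        s.form h (s.invSqH ιX hX b) • s.ev ιX ιA f (i * s.invSqH ιX hX c) • a]
    exact ts_congr fun a b => (ts_comm _ _ _).trans
      ((s.ev_comm ιX ιA hX f w b a).symm.trans (ts_comm _ _ _))

lemma ydOf_act (f : s.HXAcop ιX ιA) (v : V) : (s.ydOf ιX ιA hX ρ).act f v =
    ts (ρ.coact v) fun a b => s.ev ιX ιA f (s.invSqH ιX hX b) • a := rfl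

lemma ydOf_coact (v : V) : (s.ydOf ιX ιA hX ρ).coact v =
    ts (ρ.coact v) fun a b => s.lInvSq ιX ιA hX b ⊗ₜ[k] a := s.ydCoact_apply ιX ιA hX ρ v

lemma isHom_ydOf (φ : V →ₗ[k] W) (hφ : ∀ v, τ.coact (φ v) = φ.rTensor X (ρ.coact v)) :
    YDStruct.IsHom (s.ydOf ιX ιA hX ρ) (s.ydOf ιX ιA hX τ) φ where
  map_act f v := by
    simp only [ydOf_act, hφ, rTensor_eq_ts, ts_ts, ts_tmul, map_ts, map_smul]
  map_coact v := by
    simp only [ydOf_coact, hφ, rTensor_eq_ts, ts_ts, ts_tmul, map_ts, LinearMap.lTensor_tmul]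

/-- `v ⊗ w ↦ σ(v₍₁₎, w₍₁₎) v₍₀₎ ⊗ w₍₀₎`. -/
noncomputable def formTwist (s : CQTStructure k X) : V ⊗[k] W →ₗ[k] V ⊗[k] W :=
  LinFun.lift fun (v : V) (w : W) => ts (ρ.coact v) fun a b => ts (τ.coact w) fun c d =>
    s.form b d • (a ⊗ₜ[k] c)

lemma formTwist_tmul (s : CQTStructure k X) (v : V) (w : W) : s.formTwist ρ τ (v ⊗ₜ w) =
    ts (ρ.coact v) fun a b => ts (τ.coact w) fun c d => s.form b d • (a ⊗ₜ[k] c) := rfl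

/-- This twist is φ₂⁻¹; working with it keeps σ⁻¹ out of the calculation. Action and coaction on F(V
⊗ W) use v₍₁₎w₍₁₎, those on F(V) ⊗ F(W) use w₍₁₎v₍₁₎, and `ts_coact_form` converts one order into
the other. -/
lemma isHom_formTwist : YDStruct.IsHom (s.ydOf ιX ιA hX (ρ.tensor τ))
    ((s.ydOf ιX ιA hX ρ).tensor (s.ydOf ιX ιA hX τ)) ((s.comap ιX hX).formTwist ρ τ) where
  map_act f t := by
    induction t with
    | zero => simp
    | add x y hx hy => simp only [map_add, hx, hy]
    | tmul v w =>
      simp only [ydOf_act, RightCoaction.tensor_coact_eq, formTwist_tmul, map_ts, map_smul, ts_ts,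
        ts_tmul, YDStruct.tensor_act_eq, ts_tmul_left, tmul_ts, smul_ts, tmul_smul, ← smul_tmul']
      refine Eq.trans ?_ (ts_congr fun a b => ts_congr fun c d => ts_reverse₃ _ _ _ _).symm
      simp only [← smul_ts, ts_comul_ev_smul']
      have := ((s.comap ιX hX).ts_coact_form ρ τ v w fun a c x =>
        s.ev ιX ιA f (s.invSqH ιX hX x) • a ⊗ₜ[k] c).symm
      simp only [invSqH_mul, smul_ts, smul_comm (s.ev _ _ _ _) ((s.comap ιX hX).form _ _)] at this ⊢
      refine this.trans ?_
      exact ts_congr fun _ _ => ts_congr fun _ _ => ts_comm _ _ _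
  map_coact t := by
    induction t with
    | zero => simp
    | add x y hx hy => simp only [map_add, hx, hy]
    | tmul v w =>
      simp only [ydOf_coact, RightCoaction.tensor_coact_eq, formTwist_tmul, map_ts, map_smul, ts_ts,
        ts_tmul, YDStruct.tensor_coact_eq, tmul_ts, lInvSq_mul, LinearMap.lTensor_tmul,
        tmul_smul]
      have h := (s.comap ιX hX).ts_coact_form ρ τ v w fun a c x =>
        s.lInvSq ιX ιA hX x ⊗ₜ[k] (a ⊗ₜ[k] c)
      refine Eq.trans ?_ h
      exact ts_congr fun _ _ => ts_congr fun _ _ => congrArg _ (ts_comm _ _ _)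

variable {P : Type*} [AddCommGroup P] [Module k P] (υ : RightCoaction k X P)

/-- The 2-cocycle identity of σ. On the left, the commutation rule first replaces v₍₁₎w₍₁₎ by
w₍₁₎v₍₁₎; then multiplicativity of σ in the first variable on the left, and in the second variable
on the right, gives the same product of three values of σ. -/
lemma formTwist_assoc (s : CQTStructure k X) (v : V) (w : W) (p : P) :
    TensorProduct.assoc k V W P ((s.formTwist ρ τ).rTensor P
      (s.formTwist (ρ.tensor τ) υ ((v ⊗ₜ w) ⊗ₜ p))) =
    (s.formTwist τ υ).lTensor V (s.formTwist ρ (τ.tensor υ) (v ⊗ₜ (w ⊗ₜ p))) := by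
  simp only [formTwist_tmul, RightCoaction.tensor_coact_eq, ts_ts, ts_tmul, map_ts, map_ts_equiv,
    map_smul, LinearMap.rTensor_tmul, LinearMap.lTensor_tmul, ts_tmul_left, tmul_ts, ← smul_tmul',
    tmul_smul, TensorProduct.assoc_tmul]
  refine Eq.trans ?_ (s.ts_coact_form_mul_r ρ τ υ v w p fun a c e => ts (τ.coact c) fun c d =>
    ts (υ.coact e) fun e g => s.form d g • a ⊗ₜ[k] (c ⊗ₜ[k] e)).symm
  refine Eq.trans (ts_comm₂ (υ.coact p) (ρ.coact v) (fun _ _ => τ.coact w) _).symm ?_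
  -- Reversing the order of v₍₁₎ and w₍₁₎ inside σ(v₍₁₎w₍₁₎, p₍₁₎) makes the leg of v meet p after
  -- the leg of w, as on the other side.
  have h (e : P) (g : X) := (s.ts_coact_form ρ τ v w fun a c x =>
    s.form x g • a ⊗ₜ[k] (c ⊗ₜ[k] e)).symm
  simp only [smul_ts] at h ⊢
  simp only [smul_comm (s.form (_ * _) _) (s.form _ _), h]
  rw [ts_comm₂]
  refine ts_congr fun a b => ts_congr fun c d => ?_
  simp only [← smul_ts]
  refine congrArg _ ?_
  rw [ts_comm₂]
  exact s.ts_coact_form_mul_l τ ρ υ c a p fun c a e => a ⊗ₜ[k] (c ⊗ₜ[k] e)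

/-- As l_{S⁻²(v₍₁₎)} acts on w by σ(S⁻²(w₍₁₎),S⁻²(v₍₁₎)) = σ(w₍₁₎,v₍₁₎), the braiding of the
Yetter–Drinfeld modules is the flip followed by the twist by σ. -/
lemma formTwist_comm (v : V) (w : W) :
    (s.comap ιX hX).formTwist τ ρ
      (TensorProduct.comm k V W ((s.comap ιX hX).formTwist ρ τ (v ⊗ₜ w))) =
    (s.ydOf ιX ιA hX ρ).braid (s.ydOf ιX ιA hX τ) ((s.comap ιX hX).formTwist ρ τ (v ⊗ₜ w)) := by
  simp only [formTwist_tmul, map_ts, map_ts_equiv, map_smul, YDStruct.braid_tmul, ydOf_act,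
    ydOf_coact, ev_lInvSq, form_invSqH, TensorProduct.comm_tmul, ts_tmul_left, ts_ts, ts_tmul,
    ← smul_tmul']
  exact ts_congr fun _ _ => ts_congr fun _ _ => congrArg _ (ts_comm _ _ _)

end ydOf
end CQTStructure

/-! ### F as a braided monoidal functor. -/

namespace CQTStructure
section functor
variable {k H A X : Type u} [Field k] [Ring H]
  [HopfAlgebra k H] [Ring A] [HopfAlgebra k A] [Ring X] [HopfAlgebra k X]
  (s : CQTStructure k H) (ιX : X →ₐc[k] H) (ιA : A →ₐc[k] H) (hX : Function.Injective ιX)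
  (hA : Function.Injective ιA)

lemma twist_eq_formTwist (s : CQTStructure k X) (M N : RightComod k X) :
    RightComod.twist s.form M N = s.formTwist M.str N.str :=
  TensorProduct.ext' fun m n => RightComod.twist_tmul s.form M N m n

lemma pairing_apply (f : s.HXAcop ιX ιA) (x : X) :
    s.pairing ιX ιA f x = s.ev ιX ιA f (ιX x) := rfl

lemma ydOf_act_eq (M : RightComod k X) (f : s.HXAcop ιX ιA) :
    (s.ydOf ιX ιA hX M.str).act f = s.actLin ιX ιA hX M f := by
  refine LinearMap.ext fun m => ?_
  simp only [ydOf_act, actLin, LinearMap.comp_apply]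
  rw [lTensor_eq_ts]
  simp only [LinearEquiv.coe_coe, map_ts_equiv, TensorProduct.rid_tmul, pairing_apply,
    LinearMap.comp_apply]
  rfl

lemma ydOf_coact_eq (M : RightComod k X) :
    (s.ydOf ιX ιA hX M.str).coact = s.coactLin ιX ιA hX M := by
  refine LinearMap.ext fun m => ?_
  simp only [ydOf_coact, coactLin, LinearMap.comp_apply, LinearEquiv.coe_coe]
  rw [comm_eq_ts, map_ts]
  simp only [LinearMap.rTensor_tmul]
  rfl

lemma ts_triv {U : Type*} [AddCommGroup U] [Module k U] (c : k) (f : k → X → U)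
    [∀ b, LinFun k fun a => f a b] [∀ a, LinFun k fun b => f a b] :
    ts ((RightCoaction.triv k X).coact c) f = f c 1 :=
  ts_tmul c 1 f

lemma isHom_ydOf_triv : YDStruct.IsHom (YDStruct.triv k (s.HXAcop ιX ιA))
    (s.ydOf ιX ιA hX (RightCoaction.triv k X)) LinearMap.id where
  map_act f v := by
    simp only [ydOf_act, ts_triv, YDStruct.triv, LinearMap.id_apply, invSqH_one, LinearMap.comp_apply,
      LinearMap.lsmul_apply, counit_eq_ev]
  map_coact v := by
    simp only [ydOf_coact, ts_triv, YDStruct.triv, LinearMap.id_apply, lInvSq_one,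
      LinearMap.lTensor_id, TensorProduct.mk_apply]

lemma formTwist_triv_left (s : CQTStructure k X) {V : Type*} [AddCommGroup V] [Module k V]
    (ρ : RightCoaction k X V) (c : k) (v : V) :
    s.formTwist (RightCoaction.triv k X) ρ (c ⊗ₜ v) = c ⊗ₜ v := by
  simp only [formTwist_tmul, ts_triv, form_one_left', ← tmul_smul, ← tmul_ts, ts_coact_counit]

lemma formTwist_triv_right (s : CQTStructure k X) {V : Type*} [AddCommGroup V] [Module k V]
    (ρ : RightCoaction k X V) (c : k) (v : V) :
    s.formTwist ρ (RightCoaction.triv k X) (v ⊗ₜ c) = v ⊗ₜ c := by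
  simp only [formTwist_tmul, ts_triv, form_one_right', smul_tmul', ← ts_tmul_left, ts_coact_counit]

/-- The functor from right comodules to Yetter-Drinfeld modules given by
`f ▷ m = f(S⁻²(m₍₁₎)) m₍₀₎` and `m ↦ l_{S⁻²(m₍₁₎)} ⊗ m₍₀₎`. -/
noncomputable abbrev toYD : RightComod k X ⥤ YD k (s.HXAcop ιX ιA) :=
  ydFunctor (fun M => s.ydOf ιX ιA hX M.str)
    fun M N f => s.isHom_ydOf ιX ιA hX M.str N.str (RightComod.Hom.lin f) (RightComod.Hom.colin f)

/-- The inverse of the monoidal structure of `toYD`. -/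
noncomputable def toYDδ (M N : RightComod k X) :
    (s.toYD ιX ιA hX).obj (M ⊗ N) ≅ (s.toYD ιX ιA hX).obj M ⊗ (s.toYD ιX ιA hX).obj N :=
  YD.isoOfEquiv (M := (s.toYD ιX ιA hX).obj (M ⊗ N))
    (N := (s.toYD ιX ιA hX).obj M ⊗ (s.toYD ιX ιA hX).obj N)
    (LinearEquiv.ofLinearMap ((s.comap ιX hX).formTwist M.str N.str)
      (RightComod.twist (s.comap ιX hX).inv M N)
      (by rw [← twist_eq_formTwist]
          exact LinearMap.ext (RightComod.twist_form_inv (s.comap ιX hX) M N))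
      (by rw [← twist_eq_formTwist]
          exact LinearMap.ext (RightComod.twist_inv_form (s.comap ιX hX) M N)))
    (s.isHom_formTwist ιX ιA hX M.str N.str)

lemma toYDδ_assoc (M N P : RightComod k X) :
    (s.toYDδ ιX ιA hX (M ⊗ N) P).hom ≫
      (s.toYDδ ιX ιA hX M N).hom ▷ (s.toYD ιX ιA hX).obj P ≫ (α_ _ _ _).hom =
    (s.toYD ιX ιA hX).map (α_ M N P).hom ≫ (s.toYDδ ιX ιA hX M (N ⊗ P)).hom ≫
      (s.toYD ιX ιA hX).obj M ◁ (s.toYDδ ιX ιA hX N P).hom := by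
  apply YD.hom_ext
  refine TensorProduct.ext_threefold fun m n p => ?_
  exact formTwist_assoc M.str N.str P.str (s.comap ιX hX) m n p

lemma toYDδ_naturality {M N M' N' : RightComod k X} (f : M ⟶ M') (g : N ⟶ N') :
    (s.toYDδ ιX ιA hX M N).hom ≫ ((s.toYD ιX ιA hX).map f ⊗ₘ (s.toYD ιX ιA hX).map g) =
      (s.toYD ιX ιA hX).map (f ⊗ₘ g) ≫ (s.toYDδ ιX ιA hX M' N').hom := by
  apply YD.hom_ext
  refine TensorProduct.ext' fun m n => ?_
  have h := RightComod.twist_naturality (s.comap ιX hX).form f g m n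
  rw [twist_eq_formTwist, twist_eq_formTwist] at h
  exact h.symm

/-- The functor from right comodules to Yetter-Drinfeld modules preserves the unit. -/
noncomputable def toYDε :
    𝟙_ (YD k (s.HXAcop ιX ιA)) ≅ (s.toYD ιX ιA hX).obj (𝟙_ (RightComod k X)) :=
  YD.isoOfEquiv (M := 𝟙_ (YD k (s.HXAcop ιX ιA)))
    (N := (s.toYD ιX ιA hX).obj (𝟙_ (RightComod k X)))
    (LinearEquiv.refl k k) (s.isHom_ydOf_triv ιX ιA hX)

/-- The functor from right comodules to Yetter-Drinfeld modules is monoidal. -/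
noncomputable def toYDCore : (s.toYD ιX ιA hX).CoreMonoidal where
  εIso := s.toYDε ιX ιA hX
  μIso M N := (s.toYDδ ιX ιA hX M N).symm
  μIso_hom_natural_left f N := by
    have h := s.toYDδ_naturality ιX ιA hX f (𝟙 N)
    rw [Iso.symm_hom, Iso.symm_hom, Iso.comp_inv_eq, Category.assoc, Iso.eq_inv_comp]
    simpa using h
  μIso_hom_natural_right N f := by
    have h := s.toYDδ_naturality ιX ιA hX (𝟙 N) f
    rw [Iso.symm_hom, Iso.symm_hom, Iso.comp_inv_eq, Category.assoc, Iso.eq_inv_comp]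
    simpa using h
  associativity M N P := by
    have h := s.toYDδ_assoc ιX ιA hX M N P
    simp only [Iso.symm_hom]
    -- Cancelling the invertible twists turns associativity of φ₂ into `toYDδ_assoc`, its
    -- counterpart for φ₂⁻¹.
    rw [← cancel_epi ((s.toYDδ ιX ιA hX M N).hom ▷ (s.toYD ιX ιA hX).obj P),
      ← cancel_epi (s.toYDδ ιX ιA hX (M ⊗ N) P).hom, reassoc_of% h]
    simp [← comp_whiskerRight_assoc, ← MonoidalCategory.whiskerLeft_comp_assoc]
  left_unitality M := by
    have h : (s.toYDδ ιX ιA hX (𝟙_ _) M).hom ≫ (s.toYDε ιX ιA hX).inv ▷ (s.toYD ιX ιA hX).obj M ≫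
        (λ_ ((s.toYD ιX ιA hX).obj M)).hom = (s.toYD ιX ιA hX).map (λ_ M).hom := by
      apply YD.hom_ext
      exact TensorProduct.ext' fun c m => congrArg (TensorProduct.lid k M.V)
        ((LinearMap.congr_fun TensorProduct.map_id _).trans
          (formTwist_triv_left (s.comap ιX hX) M.str c m))
    simp [← h]
  right_unitality M := by
    have h : (s.toYDδ ιX ιA hX M (𝟙_ _)).hom ≫ (s.toYD ιX ιA hX).obj M ◁ (s.toYDε ιX ιA hX).inv ≫
        (ρ_ ((s.toYD ιX ιA hX).obj M)).hom = (s.toYD ιX ιA hX).map (ρ_ M).hom := by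
      apply YD.hom_ext
      exact TensorProduct.ext' fun m c => congrArg (TensorProduct.rid k M.V)
        ((LinearMap.congr_fun TensorProduct.map_id _).trans
          (formTwist_triv_right (s.comap ιX hX) M.str c m))
    simp [← h]

/-- The functor from right comodules to Yetter-Drinfeld modules is braided monoidal. -/
@[reducible] noncomputable def toYDBraided :
    @Functor.Braided _ _ _ (RightComod.braided (s.comap ιX hX)) _ _ _
      (YD.braided (s.copAntipodeInv ιX ιA hX hA) (s.antipode_copAntipodeInv ιX ιA hX hA)
        (s.copAntipodeInv_antipode ιX ιA hX hA)) (s.toYD ιX ιA hX) :=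
  letI := RightComod.braided (s.comap ιX hX)
  letI := YD.braided (s.copAntipodeInv ιX ιA hX hA) (s.antipode_copAntipodeInv ιX ιA hX hA)
        (s.copAntipodeInv_antipode ιX ιA hX hA)
  letI := (s.toYDCore ιX ιA hX).toMonoidal
  { braided := fun M N => by
      -- The condition is transferred from φ₂ to φ₂⁻¹, where it is `formTwist_comm`.
      change (s.toYDδ ιX ιA hX M N).inv ≫ _ = _ ≫ (s.toYDδ ιX ιA hX N M).inv
      rw [Iso.inv_comp_eq, ← Category.assoc, Iso.eq_comp_inv]
      apply YD.hom_ext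
      refine TensorProduct.ext' fun m n => ?_
      exact (congrArg (fun L : M.V ⊗[k] N.V →ₗ[k] M.V ⊗[k] N.V =>
        (s.comap ιX hX).formTwist N.str M.str (TensorProduct.comm k M.V N.V (L (m ⊗ₜ n))))
        (twist_eq_formTwist (s.comap ιX hX) M N)).trans (s.formTwist_comm ιX ιA hX M.str N.str m n) }

end functor
end CQTStructure

/-! ### The adjoint coaction and the transmuted structure maps. -/

namespace CQTStructure
section transmutation
variable {k U X : Type*} [Field k] [AddCommGroup U] [Module k U] [Ring X] [HopfAlgebra k X]

/-- The regrouping behind coassociativity of the adjoint coaction: the left leg enters through S and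
the right leg directly, and both are split. -/
lemma ts_comul_right_left (x : X) (f : X → X → X → X → X → U)
    [∀ a b c d, LinFun k fun x => f x a b c d] [∀ a b c d, LinFun k fun x => f a x b c d]
    [∀ a b c d, LinFun k fun x => f a b x c d] [∀ a b c d, LinFun k fun x => f a b c x d]
    [∀ a b c d, LinFun k fun x => f a b c d x] :
    (ts (comul (R := k) x) fun a b => ts (comul (R := k) b) fun c d => ts (comul (R := k) a)
      fun e g => ts (comul (R := k) d) fun h i => f e g c h i) =
    ts (comul (R := k) x) fun a b => ts (comul (R := k) b) fun c d => ts (comul (R := k) d)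
      fun e g => ts (comul (R := k) g) fun h i => f a c e h i := by
  refine (ts_congr fun a b => ts_comm _ _ _).trans ?_
  exact ts_coassoc x fun a c d => ts (comul (R := k) d) fun e g => ts (comul (R := k) g) fun h i =>
    f a c e h i

/-- Cancellation of x₁S(x₂) in front of a remaining leg x₃, stated for direct use in the middle of a
right-nested sum. -/
lemma ts_mul_antipode_cancel (x : X) (f : X → X → U) [∀ b, LinFun k fun a => f a b]
    [∀ a, LinFun k fun b => f a b] :
    (ts (comul (R := k) x) fun a b => ts (comul (R := k) b) fun c d => f (a * antipode k c) d) =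
      f 1 x := by
  have (b : X) (L : X → X) [LinFun k L] := LinFun.comp (k := k) (fun a => f a b) L
  exact (ts_coassoc x fun a c d => f (a * antipode k c) d).symm.trans
    ((ts_congr fun a b => ts_antipode_right a fun u => f u b).trans (ts_counit_left x (f 1)))

lemma ts_antipode_mul_cancel (x : X) (f : X → X → U) [∀ b, LinFun k fun a => f a b]
    [∀ a, LinFun k fun b => f a b] :
    (ts (comul (R := k) x) fun a b => ts (comul (R := k) b) fun c d => f (antipode k a * c) d) =
      f 1 x := by
  have (b : X) (L : X → X) [LinFun k L] := LinFun.comp (k := k) (fun a => f a b) L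
  exact (ts_coassoc x fun a c d => f (antipode k a * c) d).symm.trans
    ((ts_congr fun a b => ts_antipode_left a fun u => f u b).trans (ts_counit_left x (f 1)))

lemma tmul_comul_eq_ts {V : Type*} [AddCommGroup V] [Module k V] (v : V) (x : X) :
    v ⊗ₜ[k] comul (R := k) x = ts (comul (R := k) x) fun a b => v ⊗ₜ[k] (a ⊗ₜ[k] b) := by
  rw [← tmul_ts, ts_self]

lemma adCoact_apply (x : X) : adCoact k X x = ts (comul (R := k) x) fun a b =>
    ts (comul (R := k) b) fun c d => c ⊗ₜ (antipode k a * d) := by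
  simp only [adCoact, LinearMap.comp_apply, LinearEquiv.coe_coe, lTensor_eq_ts, map_ts,
    leftComm_tmul_eq_ts, map_ts_equiv, ts_ts, ts_tmul, LinearMap.rTensor_tmul,
    LinearMap.mul'_apply]

lemma ts_adCoact (x : X) (f : X → X → U) [∀ b, LinFun k fun a => f a b]
    [∀ a, LinFun k fun b => f a b] :
    ts (adCoact k X x) f = ts (comul (R := k) x) fun a b => ts (comul (R := k) b) fun c d =>
      f c (antipode k a * d) := by
  simp only [adCoact_apply, ts_ts, ts_tmul]

variable (k X) in
/-- The right adjoint coaction. -/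
noncomputable def adCoaction : RightCoaction k X X where
  coact := adCoact k X
  coassoc x := by
    simp only [rTensor_eq_ts, lTensor_eq_ts, map_ts_equiv, assoc_tmul_eq_ts, ts_adCoact, ts_ts,
      ts_tmul, tmul_comul_eq_ts, ts_comul_mul, ts_comul_antipode, ts_coassoc]
    exact (ts_comul_right_left x fun a b c d e =>
      c ⊗ₜ[k] ((antipode k b * d) ⊗ₜ[k] (antipode k a * e))).symm
  counit_coact x := by
    simp only [lTensor_eq_ts, map_ts_equiv, ts_adCoact, TensorProduct.rid_tmul, Bialgebra.counit_mul,
      counit_antipode, mul_smul, ← smul_ts, ts_counit_left, ts_counit_right]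

lemma ts_ad (x : X) (f : X → X → U) [∀ b, LinFun k fun a => f a b]
    [∀ a, LinFun k fun b => f a b] :
    ts ((adCoaction k X).coact x) f = ts (comul (R := k) x) fun a b => ts (comul (R := k) b)
      fun c d => f c (antipode k a * d) := ts_adCoact x f

/-- The adjoint coaction is not multiplicative: x₍₁₎ ends up between S(y₁) and y₃. The factor σ in
the transmuted product corrects this. -/
lemma ts_ad_mul (x y : X) (f : X → X → U) [∀ b, LinFun k fun a => f a b]
    [∀ a, LinFun k fun b => f a b] :
    ts ((adCoaction k X).coact (x * y)) f = ts ((adCoaction k X).coact x) fun a b =>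
      ts (comul (R := k) y) fun c d => ts (comul (R := k) d) fun d e =>
        f (a * d) (antipode k c * b * e) := by
  have (b : X) (L : X → X) [LinFun k L] := LinFun.comp (k := k) (fun a => f a b) L
  have (a : X) (L : X → X) [LinFun k L] := LinFun.comp (k := k) (fun b => f a b) L
  simp only [ts_ad, ts_comul_mul, antipode_mul_antidistrib, mul_assoc]
  refine ts_congr fun a b => ?_
  rw [ts_comm]

/-- The coactions of x₁ and x₂ multiply to S(x₁)x₃S(x₄)x₆, in which x₃S(x₄) cancels. This is
colinearity of the comultiplication. -/
lemma ts_ad_comul (x : X) (f : X → X → X → U) [∀ b c, LinFun k fun a => f a b c]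
    [∀ a c, LinFun k fun b => f a b c] [∀ a b, LinFun k fun c => f a b c] :
    (ts ((adCoaction k X).coact x) fun a b => ts (comul (R := k) a) fun c d => f c d b) =
      ts (comul (R := k) x) fun a b => ts ((adCoaction k X).coact a) fun c d =>
        ts ((adCoaction k X).coact b) fun e g => f c e (d * g) := by
  have (a b : X) (L : X → X) [LinFun k L] := LinFun.comp (k := k) (fun c => f a b c) L
  have (a b : X) (L : X → X →ₗ[k] X) (y : X) [LinFun k L] : LinFun k fun x => f a b (L x y) :=
    LinFun.comp (k := k) (fun c => f a b c) fun x => L x y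
  simp only [ts_ad, ts_coassoc]
  refine ts_congr fun a b => ts_congr fun c d => ?_
  refine Eq.trans ?_ (ts_congr fun e g => ts_congr fun h i => ts_congr fun l m => by
    rw [show antipode k a * e * (antipode k h * m) = antipode k a * (e * antipode k h) * m by
      simp only [mul_assoc]]).symm
  have := ts_mul_antipode_cancel (k := k) d fun u r => ts (comul (R := k) r) fun l m =>
    f c l (antipode k a * u * m)
  simp only [mul_one] at this
  exact this.symm

lemma ts_ad_one (f : X → X → U) [∀ b, LinFun k fun a => f a b] [∀ a, LinFun k fun b => f a b] :
    ts ((adCoaction k X).coact 1) f = f 1 1 := by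
  have (a : X) (L : X → X) [LinFun k L] := LinFun.comp (k := k) (fun b => f a b) L
  simp only [ts_ad, ts_comul_one, antipode_one, mul_one]

lemma ts_ad_antipode (x : X) (f : X → X → U) [∀ b, LinFun k fun a => f a b]
    [∀ a, LinFun k fun b => f a b] :
    ts ((adCoaction k X).coact (antipode k x)) f = ts (comul (R := k) x) fun a b =>
      ts (comul (R := k) b) fun c d =>
        f (antipode k c) (antipode k (antipode k d) * antipode k a) := by
  have (b : X) (L : X → X) [LinFun k L] := LinFun.comp (k := k) (fun a => f a b) L
  have (a : X) (L : X → X) [LinFun k L] := LinFun.comp (k := k) (fun b => f a b) L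
  simp only [ts_ad, ts_comul_antipode, ts_coassoc]

variable (s : CQTStructure k X)

lemma form_comm_antipode (x y : X) (f : X → U) [LinFun k f] :
    (ts (comul (R := k) x) fun a b => ts (comul (R := k) y) fun c d =>
      s.form a (antipode k d) • f (b * antipode k c)) =
    ts (comul (R := k) x) fun a b => ts (comul (R := k) y) fun c d =>
      s.form b (antipode k c) • f (antipode k d * a) := by
  have (L : X → X) [LinFun k L] := LinFun.comp (k := k) f L
  simpa only [ts_comul_antipode] using s.form_comm x (antipode k y) f

lemma transMul_tmul (x y : X) : s.transMul (x ⊗ₜ y) = ts ((adCoaction k X).coact x) fun a b =>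
    ts (comul (R := k) y) fun c d => s.form b (antipode k c) • (a * d) := by
  simp only [transMul, LinearMap.comp_apply, TensorProduct.map_tmul, LinearEquiv.coe_coe]
  rw [comm_eq_ts]
  conv_lhs => rw [← ts_self (comul (R := k) y)]
  simp only [ts_tmul_left, tmul_ts, map_ts, map_ts_equiv,
    TensorProduct.tensorTensorTensorComm_tmul, TensorProduct.map_tmul, TensorProduct.lift.tmul,
    LinearMap.mul'_apply, TensorProduct.lid_tmul, LinearMap.compl₂_apply]
  exact ts_comm _ _ _

/-- Colinearity of the product. After `ts_ad_mul` one side carries S(y₂)x₍₁₎ with its value of σ,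
the other x₍₁₎S(y₁); the commutation rule for x₍₁₎ and S(y) exchanges them. -/
lemma ts_ad_transMul (x y : X) (f : X → X → U) [∀ b, LinFun k fun a => f a b]
    [∀ a, LinFun k fun b => f a b] :
    ts ((adCoaction k X).coact (s.transMul (x ⊗ₜ y))) f =
      ts ((adCoaction k X).coact x) fun a b => ts ((adCoaction k X).coact y) fun c d =>
        f (s.transMul (a ⊗ₜ c)) (b * d) := by
  have (b : X) (L : X → X) [LinFun k L] := LinFun.comp (k := k) (fun a => f a b) L
  have (a : X) (L : X → X) [LinFun k L] := LinFun.comp (k := k) (fun b => f a b) L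
  have h (t : X ⊗[k] X) (g : X → X → X) (b : X) : f (ts t g) b = ts t fun c d => f (g c d) b :=
    map_ts (U := X) (Z := U) ⟨⟨(f · b), LinFun.map_add (f := (f · b)) k⟩,
      LinFun.map_smul (f := (f · b))⟩ t g
  have h' (r : k) (a b : X) : f (r • a) b = r • f a b := LinFun.map_smul (f := (f · b)) r a
  have e : ts ((adCoaction k X).coact (s.transMul (x ⊗ₜ y))) f =
      ts ((adCoaction k X).coact x) fun a b => ts (comul (R := k) y) fun c d =>
        s.form b (antipode k c) • ts ((adCoaction k X).coact (a * d)) f := by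
    rw [transMul_tmul, ts_eq_lift]
    simp only [map_ts, map_smul, ← ts_eq_lift]
  rw [e]
  simp only [ts_ad_mul, transMul_tmul, h, h', smul_ts]
  refine (ts_congr fun a b => ts_comm (comul (R := k) y) ((adCoaction k X).coact a) _).trans ?_
  rw [ts_coact (adCoaction k X) x fun a b b' => ts (comul (R := k) y) fun c d =>
    ts (comul (R := k) d) fun d e => ts (comul (R := k) e) fun e g => s.form b' (antipode k c) •
      f (a * e) (antipode k d * b * g)]
  symm
  refine (ts_congr fun a b => ts_comm ((adCoaction k X).coact y) ((adCoaction k X).coact a) _).trans ?_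
  rw [ts_coact (adCoaction k X) x fun a b b' => ts ((adCoaction k X).coact y) fun c d =>
    ts (comul (R := k) c) fun c e => s.form b (antipode k c) • f (a * e) (b' * d)]
  refine ts_congr fun a b => ?_
  simp only [ts_ad, ts_coassoc]
  have e1 := ts_coassoc (k := k) y fun c e v => ts (comul (R := k) b) fun p q => ts (comul (R := k) v)
    fun m n => s.form p (antipode k e) • f (a * m) (q * antipode k c * n)
  have e2 := ts_coassoc (k := k) y fun c d v => ts (comul (R := k) b) fun p q => ts (comul (R := k) v)
    fun m n => s.form q (antipode k c) • f (a * m) (antipode k d * p * n)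
  -- The only use of the commutation rule; `e1` and `e2` merely isolate a leg u of y to which it
  -- applies.
  have e3 (u v : X) := s.form_comm_antipode b u fun z => ts (comul (R := k) v) fun m n =>
    f (a * m) (z * n)
  refine Eq.trans (Eq.trans ?_ e1.symm) (Eq.trans ?_ (e2.trans ?_))
  · simp only [← mul_assoc]
    exact ts_comm₂ _ _ _ _
  · refine ts_congr fun u v => ?_
    rw [ts_comm, ts_comm (comul (R := k) u)]
    simpa only [smul_ts] using e3 u v
  · exact (ts_comm₂ _ _ _ _).symm

lemma transMul_colin (x y : X) : (adCoaction k X).coact (s.transMul (x ⊗ₜ y)) =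
    s.transMul.rTensor X (((adCoaction k X).tensor (adCoaction k X)).coact (x ⊗ₜ y)) := by
  rw [← ts_self (RightCoaction.coact _ _), ts_ad_transMul, RightCoaction.tensor_coact_eq]
  simp only [map_ts, LinearMap.rTensor_tmul]

/-- The left side uses colinearity of the product to know the coaction of x·y. Once all values of σ
are expanded multiplicatively, both sides are the same sum, with one factor for each pair among x,
y, z. -/
lemma transMul_assoc (x y z : X) :
    s.transMul (s.transMul (x ⊗ₜ y) ⊗ₜ z) = s.transMul (x ⊗ₜ s.transMul (y ⊗ₜ z)) := by
  have e1 : s.transMul (s.transMul (x ⊗ₜ y) ⊗ₜ z) = ts ((adCoaction k X).coact x) fun a b =>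
      ts ((adCoaction k X).coact y) fun c d => ts (comul (R := k) z) fun e g =>
      s.form (b * d) (antipode k e) • (s.transMul (a ⊗ₜ c) * g) := by
    rw [transMul_tmul, ts_ad_transMul]
  have e2 : s.transMul (x ⊗ₜ s.transMul (y ⊗ₜ z)) = ts ((adCoaction k X).coact y) fun c d =>
      ts (comul (R := k) z) fun e g => s.form d (antipode k e) • s.transMul (x ⊗ₜ (c * g)) := by
    rw [transMul_tmul s y]
    simp only [tmul_ts, map_ts, tmul_smul, map_smul]
  rw [e1, e2]
  simp only [transMul_tmul, form_mul_l, form_mul_r, ts_comul_antipode, ts_comul_mul,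
    antipode_mul_antidistrib, ts_mul, ts_smul, smul_ts, smul_mul_assoc, mul_smul, ts_coassoc]
  refine (ts_congr fun a b => (ts_comm₂ ((adCoaction k X).coact a) ((adCoaction k X).coact y)
    (fun _ _ => comul (R := k) z) _).symm).trans ?_
  rw [ts_coact (adCoaction k X) x fun a b b' => ts ((adCoaction k X).coact y) fun c d =>
    ts (comul (R := k) z) fun e g => ts (comul (R := k) c) fun p q => ts (comul (R := k) e)
      fun m n => s.form b' (antipode k n) • s.form d (antipode k m) • s.form b (antipode k p) •
        (a * q * g)]
  refine Eq.trans ?_ (ts_comm₂ ((adCoaction k X).coact x) ((adCoaction k X).coact y)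
    (fun _ _ => comul (R := k) z) _)
  refine ts_congr fun a b => (ts_comm₂ _ _ _ _).trans (ts_congr fun c d => ?_)
  refine Eq.trans ?_ ((ts_coassoc (k := k) z fun m n g => ts (comul (R := k) b) fun p q =>
    ts (comul (R := k) c) fun v w => s.form d (antipode k m) • s.form p (antipode k v) •
      s.form q (antipode k n) • (a * (w * g))).trans ?_)
  · refine ts_congr fun e g => Eq.trans ?_ (ts_comm₂ _ _ _ _).symm
    refine ts_congr fun p q => ts_congr fun v w => ts_congr fun m n => ?_
    rw [mul_assoc a, smul_comm (s.form q _), smul_comm (s.form q _)]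
  · refine ts_congr fun e g => Eq.trans ?_ (ts_comm _ _ _)
    exact ts_congr fun m n => ts_comm _ _ _

lemma one_transMul (x : X) : s.transMul (1 ⊗ₜ x) = x := by
  simp only [transMul_tmul, ts_ad_one, form_one_left', one_mul, counit_antipode, ts_counit_left]

lemma transMul_one (x : X) : s.transMul (x ⊗ₜ 1) = x := by
  simp only [transMul_tmul, ts_comul_one, antipode_one, form_one_right', mul_one, ts_coact_counit]

lemma ts_ad_counit (x : X) (f : X → U) [LinFun k f] :
    (ts ((adCoaction k X).coact x) fun a b => counit (R := k) a • f b) =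
      counit (R := k) x • f 1 := by
  have (L : X → X) [LinFun k L] := LinFun.comp (k := k) f L
  rw [ts_ad]
  simp only [ts_counit_left]
  exact ts_antipode_left x f

lemma counit_transMul (x y : X) :
    counit (R := k) (s.transMul (x ⊗ₜ y)) = counit (R := k) x * counit (R := k) y := by
  have h : counit (R := k) (s.transMul (x ⊗ₜ y)) = ts ((adCoaction k X).coact x) fun a b =>
      counit (R := k) a • ts (comul (R := k) y) fun c d => counit (R := k) d •
        s.form b (antipode k c) := by
    simp only [transMul_tmul, map_ts, map_smul, Bialgebra.counit_mul, smul_ts]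
    exact ts_congr fun _ _ => ts_congr fun _ _ => by simp only [smul_eq_mul]; ring
  rw [h, ts_ad_counit x fun b => ts (comul (R := k) y) fun c d => counit (R := k) d •
        s.form b (antipode k c)]
  simp only [form_one_left', counit_antipode, ts_counit_right]
  rfl

/-- On the left, colinearity of the comultiplication distributes σ over the two factors coming from
x. On the right, the braiding contributes σ(-,S(y₁)y₄) and the second product σ(-,S(y₅)), both on
the coaction leg of x₂; they merge into σ(-,S(y₁)y₄S(y₅)), where y₄S(y₅) cancels. -/
lemma comul_transMul (x y : X) :
    comul (R := k) (s.transMul (x ⊗ₜ y)) =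
      ts (comul (R := k) x) fun a b => ts (comul (R := k) y) fun c d =>
        ts ((adCoaction k X).coact b) fun b p => ts ((adCoaction k X).coact c) fun c q =>
          s.form p q • (s.transMul (a ⊗ₜ c) ⊗ₜ[k] s.transMul (b ⊗ₜ d)) := by
  trans ts (comul (R := k) x) fun a b => ts ((adCoaction k X).coact a) fun a r =>
      ts ((adCoaction k X).coact b) fun b p => ts (comul (R := k) y) fun c d =>
        ts (comul (R := k) d) fun d e => ts (comul (R := k) e) fun e g =>
        s.form p (antipode k c) • s.form r (antipode k d) • ((a * e) ⊗ₜ[k] (b * g))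
  · have e1 : comul (R := k) (s.transMul (x ⊗ₜ y)) = ts ((adCoaction k X).coact x) fun a b =>
      ts (comul (R := k) a) fun a a' => ts (comul (R := k) y) fun c d => ts (comul (R := k) d)
        fun d e => s.form b (antipode k c) • ((a * d) ⊗ₜ[k] (a' * e)) := by
      rw [transMul_tmul]
      simp only [map_ts, map_smul]
      refine ts_congr fun a b => ?_
      refine Eq.trans (ts_congr fun c d => ?_) (ts_comm _ _ _)
      rw [← ts_self (comul (R := k) (a * d)), ts_comul_mul, smul_ts]
      simp only [smul_ts]
    rw [e1, ts_ad_comul x fun a a' b => ts (comul (R := k) y) fun c d => ts (comul (R := k) d)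
        fun d e => s.form b (antipode k c) • ((a * d) ⊗ₜ[k] (a' * e))]
    refine ts_congr fun a b => ts_congr fun c d => ts_congr fun e g => ?_
    simp only [form_mul_l, ts_comul_antipode, ts_smul, mul_smul]
    refine (ts_congr fun u v => ts_comm _ _ _).trans ?_
    refine (ts_coassoc (k := k) y fun p q r => ts (comul (R := k) r) fun u v =>
      s.form d (antipode k q) • s.form g (antipode k p) • ((c * u) ⊗ₜ[k] (e * v))).trans ?_
    simp only [smul_comm (s.form d _) (s.form g _)]
  · refine ts_congr fun a b => ?_
    simp only [transMul_tmul, ts_tmul_left, tmul_ts, smul_ts, tmul_smul, ← smul_tmul']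
    symm
    have e1 (c d : X) := ts_coact (k := k) (adCoaction k X) b fun b t p =>
      ts ((adCoaction k X).coact c) fun c q => ts (comul (R := k) d) fun h i =>
      ts ((adCoaction k X).coact a) fun a r => ts (comul (R := k) c) fun e g =>
      s.form p q • s.form t (antipode k h) • s.form r (antipode k e) • ((a * g) ⊗ₜ[k] (b * i))
    refine (ts_congr fun c d => (ts_congr fun b p => ts_comm _ _ _).trans (e1 c d)).trans ?_
    refine (ts_congr fun c d => ts_congr fun b p => ts_congr fun t p =>
      (ts_comm₂ _ _ _ _).symm).trans ?_
    refine (ts_comm₃ _ _ _ _ _).symm.trans (ts_congr fun a r => ?_)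
    refine (ts_comm _ _ _).trans (ts_congr fun b p => ?_)
    simp only [ts_ad]
    refine (ts_congr fun c d => ts_comm₃ (comul (R := k) p) (comul (R := k) c)
      (fun _ v => comul (R := k) v) (fun _ _ _ _ => comul (R := k) d) _).trans ?_
    refine (ts_congr fun c d => ts_congr fun u v => ts_congr fun w z =>
      (ts_congr fun h i => ts_comm _ _ _).trans (ts_comm _ _ _)).trans ?_
    -- Multiplicativity in the second variable, read backwards: the factor from the braiding and the
    -- factor from the second product become one value of σ.
    have e2 (q h : X) (z : X ⊗[k] X) : (ts (comul (R := k) p) fun t p =>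
        s.form p q • s.form t h • z) = s.form p (q * h) • z := by
      simp only [form_mul_r, ts_smul, smul_smul, mul_comm]
    simp only [e2, ts_coassoc]
    refine ts_congr fun u v => ts_congr fun e v => ts_congr fun g v => ?_
    have e3 := ts_mul_antipode_cancel (k := k) v fun z i => s.form p (antipode k u * z) •
      s.form r (antipode k e) • ((a * g) ⊗ₜ[k] (b * i))
    simp only [mul_one, ← mul_assoc] at e3
    exact e3

lemma dv_apply (x : X) :
    s.dv x = ts (comul (R := k) x) fun a b => s.form a (antipode k b) := by
  simp only [dv, LinearMap.comp_apply, map_eq_ts, map_ts, TensorProduct.lift.tmul,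
    LinearMap.id_apply]

lemma dw_apply (x : X) :
    s.dw x = ts (comul (R := k) x) fun a b => s.form (antipode k (antipode k a)) b := by
  simp only [dw, LinearMap.comp_apply, map_eq_ts, map_ts, TensorProduct.lift.tmul,
    LinearMap.id_apply]

lemma ts_dv_antipode_sq (x : X) (f : X → U) [LinFun k f] :
    (ts (comul (R := k) x) fun a b => s.dv a • f (antipode k (antipode k b))) =
      ts (comul (R := k) x) fun a b => s.dv b • f a := by
  let F : X →ₗ[k] U := ⟨⟨f, LinFun.map_add k⟩, LinFun.map_smul⟩
  have h := congrArg F (s.dv_antipode x)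
  simp only [map_eq_ts, map_ts, map_ts_equiv, TensorProduct.lid_tmul, TensorProduct.rid_tmul,
    map_smul, LinearMap.comp_apply, LinearMap.id_apply] at h
  exact h

lemma ts_dv_mul_dw (x : X) (u : U) :
    (ts (comul (R := k) x) fun a b => s.dv a • s.dw b • u) = counit (R := k) x • u := by
  rw [← s.dv_mul_dw x]
  simp only [map_eq_ts, map_ts, LinearMap.mul'_apply, ts_smul, mul_smul]

/-- That w is also a left inverse of v follows from v * w = ε by moving v to the other leg with
`ts_dv_antipode_sq`, since w is invariant under S². -/
lemma ts_dw_mul_dv (x : X) (u : U) :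
    (ts (comul (R := k) x) fun a b => s.dw a • s.dv b • u) = counit (R := k) x • u := by
  rw [← ts_dv_mul_dw s]
  have h := s.ts_dv_antipode_sq x fun b => s.dw b • u
  simp only [dw_antipode_sq] at h
  exact (h.trans (ts_congr fun _ _ => smul_comm _ _ _)).symm

/-- The relation v(x₁)S²(x₂) = x₁v(x₂), convolved on both sides with w = v⁻¹. -/
lemma ts_dw_antipode_sq (x : X) (f : X → U) [LinFun k f] :
    (ts (comul (R := k) x) fun a b => s.dw b • f (antipode k (antipode k a))) =
      ts (comul (R := k) x) fun a b => s.dw a • f b := by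
  have (L : X → X) [LinFun k L] := LinFun.comp (k := k) f L
  have e1 (b : X) : f b = ts (comul (R := k) b) fun c g => ts (comul (R := k) c) fun c e =>
      s.dv c • s.dw g • f (antipode k (antipode k e)) := by
    refine ((ts_counit_right (k := k) b f).symm.trans (ts_congr fun c d =>
      (s.ts_dv_mul_dw d (f c)).symm)).trans ?_
    refine (ts_coassoc b fun c e g => s.dv e • s.dw g • f c).symm.trans (ts_congr fun u g => ?_)
    exact (s.ts_dv_antipode_sq u fun c => s.dw g • f c).symm
  symm
  refine (ts_congr fun a b => congrArg (s.dw a • ·) (e1 b)).trans ?_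
  simp only [smul_ts, ts_coassoc]
  rw [← ts_coassoc x fun a c d => ts (comul (R := k) d) fun e g =>
    s.dw a • s.dv c • s.dw g • f (antipode k (antipode k e))]
  refine (ts_congr fun u d => (ts_comm _ _ _)).trans ?_
  simp only [ts_dw_mul_dv, ← smul_ts, ts_counit_left]

/-- Multiplicativity splits σ(S²(x₃)S(x₁),x₄) into w on the legs next to each other and σ(S(x₁),-) =
σ⁻¹(x₁,-) on the outer legs. In this shape the inverse relations for σ and for w apply. -/
lemma transAntipode_apply (x : X) : s.transAntipode x = ts (comul (R := k) x) fun a b =>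
    ts (comul (R := k) b) fun c d => ts (comul (R := k) d) fun e g =>
      s.inv a g • s.dw e • antipode k c := by
  have e1 : s.transAntipode x = ts (comul (R := k) x) fun a b =>
      ts (comul (R := k) b) fun c d => ts (comul (R := k) d) fun e g =>
      s.form (antipode k (antipode k e) * antipode k a) g • antipode k c := by
    simp only [transAntipode, LinearMap.comp_apply, LinearEquiv.coe_coe]
    rw [lTensor_eq_ts]
    simp only [LinearMap.comp_apply, lTensor_eq_ts, tmul_ts, map_ts, map_ts_equiv,
      TensorProduct.leftComm_tmul, TensorProduct.map_tmul, LinearEquiv.coe_coe,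
      assoc_symm_tmul_eq_ts, LinearMap.rTensor_tmul, TensorProduct.comm_tmul, LinearMap.mul'_apply,
      TensorProduct.lift.tmul, TensorProduct.rid_tmul, ts_smul]
  simp only [e1, form_mul_l, ts_smul, dw_apply, smul_ts, mul_smul, inv_apply]
  refine ts_congr fun a b => ts_congr fun c d => ?_
  rw [← ts_coassoc d fun e g h => s.form (antipode k (antipode k e)) g •
    s.form (antipode k a) h • antipode k c]
  exact ts_congr fun _ _ => ts_congr fun _ _ => smul_comm _ _ _

lemma ts_dw_antipode_sq₂ (x : X) (f : X → X → U) [∀ b, LinFun k fun a => f a b]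
    [∀ a, LinFun k fun b => f a b] :
    (ts (comul (R := k) x) fun a b => ts (comul (R := k) b) fun b c =>
      s.dw b • f (antipode k (antipode k a)) c) =
    ts (comul (R := k) x) fun a b => ts (comul (R := k) b) fun b c => s.dw a • f b c := by
  have (c : X) (L : X → X) [LinFun k L] := LinFun.comp (k := k) (fun a => f a c) L
  rw [← ts_coassoc x fun a b c => s.dw b • f (antipode k (antipode k a)) c,
    ← ts_coassoc x fun a b c => s.dw a • f b c]
  exact ts_congr fun u c => s.ts_dw_antipode_sq u fun a => f a c

/-- The adjoint coaction of S(x₂) introduces an S², which w absorbs by `ts_dw_antipode_sq₂`. -/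
lemma ts_ad_transAntipode (x : X) (f : X → X → U) [∀ b, LinFun k fun a => f a b]
    [∀ a, LinFun k fun b => f a b] :
    ts ((adCoaction k X).coact (s.transAntipode x)) f = ts (comul (R := k) x) fun a b =>
      ts (comul (R := k) b) fun p b => ts (comul (R := k) b) fun q b => ts (comul (R := k) b)
        fun r b => ts (comul (R := k) b) fun e g => s.inv a g • s.dw r •
          f (antipode k q) (e * antipode k p) := by
  have (b : X) (L : X → X) [LinFun k L] := LinFun.comp (k := k) (fun a => f a b) L
  have (a : X) (L : X → X) [LinFun k L] := LinFun.comp (k := k) (fun b => f a b) L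
  have e : ts ((adCoaction k X).coact (s.transAntipode x)) f =
      ts (comul (R := k) x) fun a b => ts (comul (R := k) b) fun c d => ts (comul (R := k) d)
        fun e g => s.inv a g • s.dw e • ts ((adCoaction k X).coact (antipode k c)) f := by
    rw [transAntipode_apply, ts_eq_lift]
    simp only [map_ts, map_smul, ← ts_eq_lift]
  rw [e]
  simp only [ts_ad_antipode, smul_ts]
  refine ts_congr fun a b => (ts_congr fun c d => ts_comm₂ _ _ _ _).trans ?_
  simp only [ts_coassoc]
  refine ts_congr fun p b => ts_congr fun q b => ?_
  have h := s.ts_dw_antipode_sq₂ b fun r g => s.inv a g •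
    f (antipode k q) (r * antipode k p)
  simp only [smul_comm (s.dw _) (s.inv _ _)] at h
  exact h

/-- The commutation rule for S(x) and y, since σ⁻¹ = σ(S(-),-). -/
lemma inv_comm (x y : X) (f : X → U) [LinFun k f] :
    (ts (comul (R := k) x) fun a b => ts (comul (R := k) y) fun c d =>
      s.inv a d • f (c * antipode k b)) =
    ts (comul (R := k) x) fun a b => ts (comul (R := k) y) fun c d =>
      s.inv b c • f (antipode k a * d) := by
  have (L : X → X) [LinFun k L] := LinFun.comp (k := k) f L
  simpa only [ts_comul_antipode, inv_apply] using (s.form_comm (antipode k x) y f).symm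

lemma transAntipode_colin (x : X) : (adCoaction k X).coact (s.transAntipode x) =
    s.transAntipode.rTensor X ((adCoaction k X).coact x) := by
  rw [← ts_self (RightCoaction.coact _ (s.transAntipode x)), ts_ad_transAntipode, rTensor_eq_ts]
  -- Regrouping x into an initial part u and a final part y puts the two legs of σ⁻¹ in the position
  -- of `inv_comm`, with w(r)S(q) in between untouched.
  have key : (ts (comul (R := k) x) fun u v => ts (comul (R := k) u) fun a p =>
      ts (comul (R := k) v) fun q w => ts (comul (R := k) w) fun r y => ts (comul (R := k) y)
        fun e g => s.inv a g • s.dw r • antipode k q ⊗ₜ[k] (e * antipode k p)) =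
      ts (comul (R := k) x) fun u v => ts (comul (R := k) u) fun a p =>
        ts (comul (R := k) v) fun q w => ts (comul (R := k) w) fun r y => ts (comul (R := k) y)
        fun e g => s.inv p e • s.dw r • antipode k q ⊗ₜ[k] (antipode k a * g) := by
    refine ts_congr fun u v => (ts_comm₂ _ _ _ _).trans (Eq.trans ?_ (ts_comm₂ _ _ _ _).symm)
    exact ts_congr fun q w => ts_congr fun r y => s.inv_comm u y fun z => s.dw r •
      antipode k q ⊗ₜ[k] z
  simp only [ts_coassoc] at key
  rw [key]
  simp only [ts_ad, transAntipode_apply, ts_tmul_left, ← smul_tmul', ts_coassoc]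

/-- Mutually inverse forms placed on the outer legs around a middle leg cancel: φ(x₁,x₄)ψ(x₂,x₅)
pairs the initial part of x with its final part. The two variants below split the middle into three
legs, and allow a leg after the pair. -/
lemma ts_comul_sandwich (φ ψ : X →ₗ[k] X →ₗ[k] k)
    (h : ∀ x y, (ts (comul (R := k) x) fun a b => ts (comul (R := k) y) fun c d =>
      φ a c * ψ b d) = counit (R := k) x * counit (R := k) y) (x : X) (f : X → U) [LinFun k f] :
    (ts (comul (R := k) x) fun u v => ts (comul (R := k) u) fun a b => ts (comul (R := k) v)
      fun m y => ts (comul (R := k) y) fun c d => φ a c • ψ b d • f m) = f x := by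
  have e (u v : X) : (ts (comul (R := k) u) fun a b => ts (comul (R := k) v)
      fun m y => ts (comul (R := k) y) fun c d => φ a c • ψ b d • f m) =
      counit (R := k) u • ts (comul (R := k) v) fun m y => counit (R := k) y • f m := by
    rw [ts_comm, smul_ts]
    refine ts_congr fun m y => ?_
    rw [smul_smul, ← h]
    simp only [ts_smul, mul_smul]
  simp only [e, ts_counit_right, ts_counit_left]

lemma ts_comul_sandwich₃ (φ ψ : X →ₗ[k] X →ₗ[k] k)
    (h : ∀ x y, (ts (comul (R := k) x) fun a b => ts (comul (R := k) y) fun c d =>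
      φ a c * ψ b d) = counit (R := k) x * counit (R := k) y) (x : X) (f : X → X → X → U)
    [∀ b c, LinFun k fun a => f a b c] [∀ a c, LinFun k fun b => f a b c]
    [∀ a b, LinFun k fun c => f a b c] :
    (ts (comul (R := k) x) fun a x => ts (comul (R := k) x) fun b x => ts (comul (R := k) x)
      fun m x => ts (comul (R := k) x) fun n x => ts (comul (R := k) x) fun p x =>
      ts (comul (R := k) x) fun c d => φ a c • ψ b d • f m n p) =
    ts (comul (R := k) x) fun m x => ts (comul (R := k) x) fun n p => f m n p := by
  rw [← ts_comul_sandwich φ ψ h x fun x => ts (comul (R := k) x) fun m x =>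
    ts (comul (R := k) x) fun n p => f m n p]
  simp only [smul_ts]
  symm
  refine (ts_congr fun u v => ts_congr fun a b => ts_congr fun m y => ts_comm₂ _ _ _ _).trans ?_
  simp only [ts_coassoc]

lemma ts_comul_sandwich₄ (φ ψ : X →ₗ[k] X →ₗ[k] k)
    (h : ∀ x y, (ts (comul (R := k) x) fun a b => ts (comul (R := k) y) fun c d =>
      φ a c * ψ b d) = counit (R := k) x * counit (R := k) y) (x : X) (f : X → X → X → X → U)
    [∀ b c d, LinFun k fun a => f a b c d] [∀ a c d, LinFun k fun b => f a b c d]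
    [∀ a b d, LinFun k fun c => f a b c d] [∀ a b c, LinFun k fun d => f a b c d] :
    (ts (comul (R := k) x) fun a x => ts (comul (R := k) x) fun b x => ts (comul (R := k) x)
      fun m x => ts (comul (R := k) x) fun n x => ts (comul (R := k) x) fun p x =>
      ts (comul (R := k) x) fun c x => ts (comul (R := k) x) fun d q => φ a c • ψ b d • f m n p q) =
    ts (comul (R := k) x) fun m x => ts (comul (R := k) x) fun n x => ts (comul (R := k) x)
      fun p q => f m n p q := by
  have e := ts_congr (t := comul (R := k) x) fun z q =>
    ts_comul_sandwich₃ φ ψ h z fun m n p => f m n p q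
  simp only [ts_coassoc] at e
  exact e

lemma ts_coassoc₆ (x : X) (f : X → X → X → X → X → X → X → U)
    [∀ b c d e g h, LinFun k fun a => f a b c d e g h]
    [∀ a c d e g h, LinFun k fun b => f a b c d e g h]
    [∀ a b d e g h, LinFun k fun c => f a b c d e g h]
    [∀ a b c e g h, LinFun k fun d => f a b c d e g h]
    [∀ a b c d g h, LinFun k fun e => f a b c d e g h]
    [∀ a b c d e h, LinFun k fun g => f a b c d e g h]
    [∀ a b c d e g, LinFun k fun h => f a b c d e g h] :
    (ts (comul (R := k) x) fun u v => ts (comul (R := k) u) fun a u => ts (comul (R := k) u)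
      fun b u => ts (comul (R := k) u) fun c u => ts (comul (R := k) u) fun d u =>
      ts (comul (R := k) u) fun e g => f a b c d e g v) =
    ts (comul (R := k) x) fun a u => ts (comul (R := k) u) fun b u => ts (comul (R := k) u)
      fun c u => ts (comul (R := k) u) fun d u => ts (comul (R := k) u) fun e u =>
      ts (comul (R := k) u) fun g v => f a b c d e g v := by
  simp only [ts_coassoc]

lemma ts_comul_transAntipode (x : X) (f : X → X → U) [∀ b, LinFun k fun a => f a b]
    [∀ a, LinFun k fun b => f a b] :
    ts (comul (R := k) (s.transAntipode x)) f = ts (comul (R := k) x) fun a x =>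
      ts (comul (R := k) x) fun m x => ts (comul (R := k) x) fun p x => ts (comul (R := k) x)
      fun n g => s.inv a g • s.dw n • f (antipode k p) (antipode k m) := by
  have (b : X) (L : X → X) [LinFun k L] := LinFun.comp (k := k) (fun a => f a b) L
  have (a : X) (L : X → X) [LinFun k L] := LinFun.comp (k := k) (fun b => f a b) L
  have e : ts (comul (R := k) (s.transAntipode x)) f =
      ts (comul (R := k) x) fun a b => ts (comul (R := k) b) fun c d => ts (comul (R := k) d)
        fun e g => s.inv a g • s.dw e • ts (comul (R := k) (antipode k c)) f := by
    rw [transAntipode_apply, ts_eq_lift]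
    simp only [map_ts, map_smul, ← ts_eq_lift]
  rw [e]
  simp only [ts_comul_antipode, smul_ts]
  refine ts_congr fun a b => (ts_congr fun c d => ts_comm _ _ _).trans ?_
  simp only [ts_coassoc]

/-- The coaction leg of the antipode produces a σ that cancels the σ⁻¹ of the antipode on the outer
legs. The remaining factor of σ from the product is v, which cancels w, and S(x₁)x₂ is left. -/
lemma transMul_transAntipode_left (x : X) :
    (ts (comul (R := k) x) fun u v => s.transMul (s.transAntipode u ⊗ₜ v)) =
      counit (R := k) x • 1 := by
  have e : (ts (comul (R := k) x) fun u v => s.transMul (s.transAntipode u ⊗ₜ v)) =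
      ts (comul (R := k) x) fun a x => ts (comul (R := k) x) fun b x => ts (comul (R := k) x)
      fun m x => ts (comul (R := k) x) fun n x => ts (comul (R := k) x) fun p x =>
      ts (comul (R := k) x) fun c x => ts (comul (R := k) x) fun d q =>
        s.inv a c • s.form b d • ts (comul (R := k) q) fun q v =>
          s.dw n • s.form p (antipode k q) • (antipode k m * v) := by
    simp only [transMul_tmul, ts_ad_transAntipode]
    refine Eq.trans ?_ (ts_coassoc₆ x fun a b m n p c v => ts (comul (R := k) v) fun d q =>
      s.inv a c • s.form b d • ts (comul (R := k) q) fun q v =>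
          s.dw n • s.form p (antipode k q) • (antipode k m * v))
    refine ts_congr fun u v => ts_congr fun a u => ts_congr fun b u => ts_congr fun m u =>
      ts_congr fun n u => ts_congr fun p c => ?_
    simp only [form_mul_l, ts_comul_antipode, form_antipode_antipode, ts_smul, mul_smul, smul_ts,
      ts_coassoc]
    refine ts_congr fun d q => ts_congr fun q v => congrArg _ ?_
    rw [smul_comm (s.form p _), smul_comm (s.dw n), smul_comm (s.dw n)]
  rw [e, ts_comul_sandwich₄ s.inv s.form s.inv_form x fun m n p q =>
    ts (comul (R := k) q) fun q v => s.dw n • s.form p (antipode k q) • (antipode k m * v)]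
  have h1 (n z m : X) : (ts (comul (R := k) z) fun p q => ts (comul (R := k) q) fun q v =>
      s.dw n • s.form p (antipode k q) • (antipode k m * v)) =
      ts (comul (R := k) z) fun p v => s.dw n • s.dv p • (antipode k m * v) := by
    simp only [dv_apply, ts_smul, smul_ts, ts_coassoc]
  have h2 (m z : X) : (ts (comul (R := k) z) fun n z => ts (comul (R := k) z) fun p v =>
      s.dw n • s.dv p • (antipode k m * v)) = antipode k m * z := by
    rw [← ts_coassoc z fun n p v => s.dw n • s.dv p • (antipode k m * v)]
    simp only [ts_dw_mul_dv, ts_counit_left]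
  simp only [h1, h2]
  exact ts_antipode_left x fun u => u

/-- Again σ and σ⁻¹ cancel on the outer legs, after which the legs d and S(m) cancel. -/
lemma transMul_transAntipode_right (x : X) :
    (ts (comul (R := k) x) fun u v => s.transMul (u ⊗ₜ s.transAntipode v)) =
      counit (R := k) x • 1 := by
  have e (x y : X) : s.transMul (x ⊗ₜ s.transAntipode y) = ts (comul (R := k) x) fun c b =>
      ts (comul (R := k) b) fun d b =>
      ts (comul (R := k) y) fun a y => ts (comul (R := k) y) fun m y => ts (comul (R := k) y)
      fun n y => ts (comul (R := k) y) fun p y => ts (comul (R := k) y) fun e g =>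
        s.form b e • s.inv a g • s.form (antipode k c) p • s.dw n • (d * antipode k m) := by
    rw [transMul_tmul, ts_ad x fun a b => ts (comul (R := k) (s.transAntipode y)) fun c d =>
      s.form b (antipode k c) • (a * d)]
    refine ts_congr fun c b => ts_congr fun d b => ?_
    rw [ts_comul_transAntipode]
    refine ts_congr fun a y => ts_congr fun m y => ?_
    have h := s.ts_dw_antipode_sq₂ y fun p g => s.inv a g • s.form (antipode k c * b) p •
      (d * antipode k m)
    simp only [smul_comm (s.dw _) (s.inv _ _)] at h
    refine h.trans (ts_congr fun n y => ?_)
    simp only [form_mul_l, ts_smul, smul_ts, mul_smul, ts_coassoc]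
    refine ts_congr fun p y => ts_congr fun e g => ?_
    rw [smul_comm (s.form b _), smul_comm (s.dw n), smul_comm (s.dw n),
      smul_comm (s.form (antipode k c) _) (s.form b _)]
  have e' : (ts (comul (R := k) x) fun u v => s.transMul (u ⊗ₜ s.transAntipode v)) =
      ts (comul (R := k) x) fun c x => ts (comul (R := k) x) fun d x =>
      ts (comul (R := k) x) fun a x => ts (comul (R := k) x) fun b x => ts (comul (R := k) x)
      fun m x => ts (comul (R := k) x) fun n x => ts (comul (R := k) x) fun p x =>
      ts (comul (R := k) x) fun e g => s.form a e • s.inv b g •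
        s.form (antipode k c) p • s.dw n • (d * antipode k m) := by
    simp only [e]
    refine (ts_coassoc x fun c w v => ts (comul (R := k) w) fun d b => ts (comul (R := k) v)
      fun a y => ts (comul (R := k) y) fun m y => ts (comul (R := k) y) fun n y =>
      ts (comul (R := k) y) fun p y => ts (comul (R := k) y) fun e g => s.form b e • s.inv a g •
        s.form (antipode k c) p • s.dw n • (d * antipode k m)).trans (ts_congr fun c z => ?_)
    exact ts_coassoc z fun d b v => ts (comul (R := k) v)
      fun a y => ts (comul (R := k) y) fun m y => ts (comul (R := k) y) fun n y =>
      ts (comul (R := k) y) fun p y => ts (comul (R := k) y) fun e g => s.form b e • s.inv a g •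
        s.form (antipode k c) p • s.dw n • (d * antipode k m)
  rw [e']
  trans ts (comul (R := k) x) fun c z => ts (comul (R := k) z) fun n p => s.dw n •
    s.form (antipode k c) p • (1 : X)
  · refine ts_congr fun c z => (ts_congr fun d y => ts_comul_sandwich₃ s.form s.inv s.form_inv y
      fun m n p => s.form (antipode k c) p • s.dw n • (d * antipode k m)).trans ?_
    exact (ts_mul_antipode_cancel z fun u x => ts (comul (R := k) x) fun n p =>
      s.form (antipode k c) p • s.dw n • u).trans (ts_congr fun _ _ => smul_comm _ _ _)
  -- The remaining value σ(S(c),p) becomes σ(S(c),S²(p)) = σ(c,S(p)) when w moves to the other leg;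
  -- this is v, which cancels w.
  · have h (c z : X) := s.ts_dw_antipode_sq z fun p => s.form (antipode k c) p • (1 : X)
    simp only [← h, form_antipode_antipode]
    rw [← ts_coassoc x fun c p n => s.dw n • s.form c (antipode k p) • (1 : X)]
    refine (ts_congr fun u n => ?_).trans ((s.ts_dv_mul_dw x (1 : X)))
    simp only [dv_apply, ts_smul]
    exact ts_congr fun _ _ => smul_comm _ _ _

end transmutation
end CQTStructure

/-! ### Braided functors carry Hopf monoids to Hopf monoids. -/

section
open scoped CategoryTheory.Obj
open Functor.LaxMonoidal Functor.OplaxMonoidal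
universe v₁ v₂ u₁ u₂
variable {C : Type u₁} [Category.{v₁} C] [MonoidalCategory C] [BraidedCategory C]
  {D : Type u₂} [Category.{v₂} D] [MonoidalCategory D] [BraidedCategory D]

attribute [local instance] Functor.obj.instComonObj

/-- The image of a Hopf monoid under a braided monoidal functor. -/
abbrev CategoryTheory.Functor.hopfObjObj (F : C ⥤ D) [F.Braided] (X : C) [HopfObj X] :
    HopfObj (F.obj X) where
  toMonObj := F.monObjObj X
  toComonObj := Functor.obj.instComonObj X F
  mul_comul := by
    -- Composing with μ removes the final δ. The claim becomes the image under F of the bialgebra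
    -- axiom, the braiding being handled by the compatibility of μ with `tensorμ`.
    rw [← cancel_mono (μ F X X)]
    simp only [Functor.obj.μ_def, Functor.obj.Δ_def, Category.assoc, Functor.Monoidal.δ_μ,
      Category.comp_id, ← tensorHom_comp_tensorHom, μ_natural,
      tensorμ_comp_μ_tensorHom_μ_comp_μ_assoc]
    simp only [tensorHom_comp_tensorHom_assoc, Functor.Monoidal.δ_μ, id_tensorHom_id,
      Category.id_comp, μ_natural_assoc, ← F.map_comp, BimonObj.mul_comul, Category.assoc]
  one_comul := by
    have h : (λ_ (𝟙_ D)).inv ≫ (ε F ⊗ₘ ε F) ≫ μ F (𝟙_ C) (𝟙_ C) =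
        ε F ≫ F.map (λ_ (𝟙_ C)).inv := by
      rw [tensorHom_def', Category.assoc, ← leftUnitor_inv_naturality_assoc,
        Functor.LaxMonoidal.left_unitality_inv]
    rw [← cancel_mono (μ F X X)]
    simp only [MonObj.tensorObj.one_def, Functor.obj.η_def, Functor.obj.Δ_def, Category.assoc,
      Functor.Monoidal.δ_μ, Category.comp_id, ← tensorHom_comp_tensorHom, μ_natural, reassoc_of% h,
      ← F.map_comp, BimonObj.one_comul]
  mul_counit := by
    have h : δ F (𝟙_ C) (𝟙_ C) ≫ (η F ⊗ₘ η F) ≫ (λ_ (𝟙_ D)).hom =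
        F.map (λ_ (𝟙_ C)).hom ≫ η F := by
      rw [MonoidalCategory.tensorHom_def, Category.assoc, leftUnitor_naturality,
        Functor.OplaxMonoidal.left_unitality_hom_assoc]
    rw [← cancel_epi (δ F X X)]
    simp only [Comon.tensorObj_counit, Functor.obj.μ_def, Functor.obj.ε_def, Category.assoc,
      Functor.Monoidal.δ_μ_assoc, ← tensorHom_comp_tensorHom, δ_natural_assoc, h, 
      ← F.map_comp_assoc, BimonObj.mul_counit]
  one_counit := by
    simp [← F.map_comp_assoc]
  antipode := F.map HopfObj.antipode
  antipode_left := by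
    simp only [Functor.obj.μ_def, Functor.obj.Δ_def, Functor.obj.ε_def, Functor.obj.η_def,
      Category.assoc, δ_natural_left_assoc, Functor.Monoidal.δ_μ_assoc, Functor.Monoidal.η_ε_assoc,
      ← F.map_comp, HopfObj.antipode_left]
  antipode_right := by
    simp only [Functor.obj.μ_def, Functor.obj.Δ_def, Functor.obj.ε_def, Functor.obj.η_def,
      Category.assoc, δ_natural_right_assoc, Functor.Monoidal.δ_μ_assoc, Functor.Monoidal.η_ε_assoc,
      ← F.map_comp, HopfObj.antipode_right]

end

/-! ### The transmutation as a Hopf monoid in comodules. -/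

namespace CQTStructure
section
variable {k A B C D : Type*} [Field k] [AddCommGroup A] [Module k A] [AddCommGroup B] [Module k B]
  [AddCommGroup C] [Module k C] [AddCommGroup D] [Module k D] {X Y : Type*} [AddCommGroup X]
  [Module k X] [AddCommGroup Y] [Module k Y]

lemma assoc_symm_braid_tmul (a : A) (d : D) (ρ : B ⊗[k] X) (τ : C ⊗[k] Y) (φ : X →ₗ[k] Y →ₗ[k] k) :
    (TensorProduct.assoc k A C (B ⊗[k] D)).symm (a ⊗ₜ[k] TensorProduct.assoc k C B D
      ((ts ρ fun b x => ts τ fun c y => φ x y • (c ⊗ₜ[k] b)) ⊗ₜ[k] d)) =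
    ts ρ fun b x => ts τ fun c y => φ x y • ((a ⊗ₜ[k] c) ⊗ₜ[k] (b ⊗ₜ[k] d)) := by
  simp only [ts_tmul_left, map_ts_equiv, tmul_ts, ← smul_tmul', map_smul, tmul_smul,
    TensorProduct.assoc_tmul, TensorProduct.assoc_symm_tmul]

end

section
variable {k X : Type u} [Field k] [Ring X] [HopfAlgebra k X] (s : CQTStructure k X)

/-- `tensorμ` is the middle exchange built from associators and one braiding; only the two inner
factors see σ. -/
lemma tensorμ_lin_tmul (M N P Q : RightComod k X) (a : M.V) (b : N.V) (c : P.V) (d : Q.V) :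
    letI := RightComod.braided s
    RightComod.Hom.lin (tensorμ M N P Q)
      ((a ⊗ₜ[k] b : M.V ⊗[k] N.V) ⊗ₜ[k] (c ⊗ₜ[k] d : P.V ⊗[k] Q.V)) =
      ts (N.str.coact b) fun b x => ts (P.str.coact c) fun c y =>
        s.form x y • ((a ⊗ₜ[k] c : M.V ⊗[k] P.V) ⊗ₜ[k] (b ⊗ₜ[k] d : N.V ⊗[k] Q.V)) := by
  refine Eq.trans ?_ (assoc_symm_braid_tmul a d (N.str.coact b) (P.str.coact c) s.form)
  exact congrArg (fun t => (TensorProduct.assoc k M.V P.V (N.V ⊗[k] Q.V)).symm (a ⊗ₜ[k]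
    TensorProduct.assoc k P.V N.V Q.V (t ⊗ₜ[k] d))) (RightComod.braidLin_tmul s N P b c)

lemma transMul_rTensor_transAntipode_comul (x : X) :
    s.transMul (TensorProduct.map s.transAntipode LinearMap.id (comul (R := k) x)) =
      algebraMap k X (counit (R := k) x) := by
  rw [Algebra.algebraMap_eq_smul_one, ← s.transMul_transAntipode_left x]
  conv_lhs => rw [← ts_self (comul (R := k) x)]
  simp only [map_ts, TensorProduct.map_tmul, LinearMap.id_apply]

lemma transMul_lTensor_transAntipode_comul (x : X) :
    s.transMul (TensorProduct.map LinearMap.id s.transAntipode (comul (R := k) x)) =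
      algebraMap k X (counit (R := k) x) := by
  rw [Algebra.algebraMap_eq_smul_one, ← s.transMul_transAntipode_right x]
  conv_lhs => rw [← ts_self (comul (R := k) x)]
  simp only [map_ts, TensorProduct.map_tmul, LinearMap.id_apply]

lemma comul_colin (x : X) : ((adCoaction k X).tensor (adCoaction k X)).coact (comul (R := k) x) =
    (comul (R := k)).rTensor X ((adCoaction k X).coact x) := by
  have h := ts_ad_comul (k := k) x fun a b c => (a ⊗ₜ[k] b) ⊗ₜ[k] c
  conv_lhs => rw [← ts_self (comul (R := k) x)]
  simp only [map_ts, RightCoaction.tensor_coact_eq, rTensor_eq_ts]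
  rw [← h]
  refine ts_congr fun a b => ?_
  conv_rhs => rw [← ts_self (comul (R := k) a), ts_tmul_left]

lemma counit_colin (x : X) : (RightCoaction.triv k X).coact (counit (R := k) x) =
    (counit (R := k)).rTensor X ((adCoaction k X).coact x) := by
  have h := ts_ad_counit (k := k) x fun c => (1 : k) ⊗ₜ[k] c
  rw [rTensor_eq_ts]
  refine Eq.trans ?_ (h.symm.trans (ts_congr fun a b => ?_))
  · simp [RightCoaction.triv, smul_tmul']
  · rw [smul_tmul', smul_eq_mul, mul_one]

lemma unit_colin (r : k) : (adCoaction k X).coact (Algebra.linearMap k X r) =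
    (Algebra.linearMap k X).rTensor X ((RightCoaction.triv k X).coact r) := by
  have h := ts_ad_one (k := k) (X := X) fun a b => a ⊗ₜ[k] b
  rw [ts_self] at h
  rw [Algebra.linearMap_apply, Algebra.algebraMap_eq_smul_one, map_smul, h]
  simp [RightCoaction.triv, smul_tmul', Algebra.algebraMap_eq_smul_one]

variable (k X) in
/-- The right comodule `X` with the adjoint coaction. -/
noncomputable abbrev adComod : RightComod k X := RightComod.mk (ModuleCat.of k X) (adCoaction k X)

lemma transMul_algebraMap_tmul (r : k) (x : X) :
    s.transMul (algebraMap k X r ⊗ₜ[k] x) = r • x := by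
  rw [Algebra.algebraMap_eq_smul_one, ← smul_tmul', map_smul, one_transMul]

lemma transMul_tmul_algebraMap (x : X) (r : k) :
    s.transMul (x ⊗ₜ[k] algebraMap k X r) = r • x := by
  rw [Algebra.algebraMap_eq_smul_one, tmul_smul, map_smul, transMul_one]

lemma counit_algebraMap_one : counit (R := k) (algebraMap k X 1) = 1 := by simp

lemma comul_algebraMap_one : comul (R := k) (algebraMap k X 1) =
    algebraMap k X 1 ⊗ₜ[k] algebraMap k X 1 := by
  rw [map_one, Bialgebra.comul_one]; rfl

/-- Identifies the sum in `comul_transMul` with the product of the braided tensor square, the form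
in which the Hopf monoid axiom asks for it. -/
lemma comul_transMul_eq_tensorμ (x y : X) :
    letI := RightComod.braided s
    comul (R := k) (s.transMul (x ⊗ₜ y)) = TensorProduct.map s.transMul s.transMul
      (RightComod.Hom.lin (tensorμ (adComod k X) (adComod k X) (adComod k X) (adComod k X))
        (comul (R := k) x ⊗ₜ[k] comul (R := k) y)) := by
  let _ := RightComod.braided s
  let L : (X ⊗[k] X) ⊗[k] (X ⊗[k] X) →ₗ[k] (X ⊗[k] X) ⊗[k] (X ⊗[k] X) :=
    RightComod.Hom.lin (tensorμ (adComod k X) (adComod k X) (adComod k X) (adComod k X))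
  have hL (a b c d : X) : L ((a ⊗ₜ b) ⊗ₜ (c ⊗ₜ d)) = ts ((adCoaction k X).coact b) fun b x =>
      ts ((adCoaction k X).coact c) fun c y => s.form x y • ((a ⊗ₜ c) ⊗ₜ (b ⊗ₜ d)) :=
    s.tensorμ_lin_tmul (adComod k X) (adComod k X) (adComod k X) (adComod k X) a b c d
  change _ = TensorProduct.map s.transMul s.transMul (L (comul (R := k) x ⊗ₜ comul (R := k) y))
  rw [comul_transMul]
  conv_rhs => rw [← ts_self (comul (R := k) x), ← ts_self (comul (R := k) y)]
  simp only [ts_tmul_left, tmul_ts, map_ts, hL, map_smul, TensorProduct.map_tmul]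
  rw [ts_comm]

/-- The transmutation of `X`. -/
@[reducible] noncomputable def transHopf : @HopfObj _ _ _ (RightComod.braided s) (adComod k X) :=
  letI := RightComod.braided s
  { mul := ⟨s.transMul, LinearMap.congr_fun (TensorProduct.ext' s.transMul_colin :
      (adCoaction k X).coact ∘ₗ s.transMul = s.transMul.rTensor X ∘ₗ
        ((adCoaction k X).tensor (adCoaction k X)).coact)⟩
    one := ⟨Algebra.linearMap k X, unit_colin⟩
    comul := ⟨comul (R := k) (A := X), comul_colin⟩
    counit := ⟨counit (R := k) (A := X), counit_colin⟩
    antipode := ⟨s.transAntipode, s.transAntipode_colin⟩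
    one_mul := RightComod.hom_ext (TensorProduct.ext' fun r x => s.transMul_algebraMap_tmul r x)
    mul_one := RightComod.hom_ext (TensorProduct.ext' fun x r => s.transMul_tmul_algebraMap x r)
    mul_assoc := RightComod.hom_ext (TensorProduct.ext_threefold fun x y z => s.transMul_assoc x y z)
    counit_comul := RightComod.hom_ext (LinearMap.ext fun x => rTensor_counit_comul x)
    comul_counit := RightComod.hom_ext (LinearMap.ext fun x => lTensor_counit_comul x)
    comul_assoc := RightComod.hom_ext (LinearMap.ext fun x => (coassoc_apply x).symm)
    mul_comul := RightComod.hom_ext (TensorProduct.ext' fun x y => s.comul_transMul_eq_tensorμ x y)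
    one_comul := RightComod.hom_ext (LinearMap.ext_ring comul_algebraMap_one)
    mul_counit := RightComod.hom_ext (TensorProduct.ext' fun x y => s.counit_transMul x y)
    one_counit := RightComod.hom_ext (LinearMap.ext_ring counit_algebraMap_one)
    antipode_left :=
      RightComod.hom_ext (LinearMap.ext fun x => s.transMul_rTensor_transAntipode_comul x)
    antipode_right :=
      RightComod.hom_ext (LinearMap.ext fun x => s.transMul_lTensor_transAntipode_comul x) }

end
end CQTStructure

/-! ### The generalized quantum double in Sweedler form. -/

lemma convMul_apply_eq_ts {k B C : Type*} [Field k] [Ring B] [Algebra k B] [AddCommGroup C]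
    [Module k C] [Coalgebra k C] (F G : WithConv (C →ₗ[k] B)) (x : C) :
    (F * G).ofConv x = ts (comul (R := k) x) fun a b => F.ofConv a * G.ofConv b := by
  rw [LinearMap.convMul_apply, map_eq_ts, map_ts]
  rfl

namespace GenDouble
variable {k K V : Type*} [Field k] [Ring K] [HopfAlgebra k K] [Ring V] [HopfAlgebra k V]
  (p p' : K →ₗ[k] V →ₗ[k] k)

lemma cocycle_tmul (f g : K) (h y : V) : cocycle p ((f ⊗ₜ h) ⊗ₜ (g ⊗ₜ y)) =
    counit (R := k) f * counit (R := k) y * p g h := by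
  simp [cocycle]
  ring

lemma cocycle_convMul_tmul (f g : K) (h y : V) :
    (WithConv.toConv (Algebra.linearMap k (K ⊗[k] V) ∘ₗ cocycle p) *
      WithConv.toConv (LinearMap.mul' k (K ⊗[k] V))).ofConv ((f ⊗ₜ h) ⊗ₜ (g ⊗ₜ y)) =
    ts (comul (R := k) g) fun a b => ts (comul (R := k) h) fun c d =>
      p a c • ((f * b) ⊗ₜ[k] (d * y)) := by
  refine (convMul_apply_eq_ts _ _ _).trans ?_
  simp only [comul_tmul_eq_ts, ts_ts, ts_tmul, LinearMap.comp_apply, cocycle_tmul,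
    Algebra.linearMap_apply, ← Algebra.smul_def,
    LinearMap.mul'_apply, Algebra.TensorProduct.tmul_mul_tmul, mul_smul]
  simp only [← smul_ts, ts_counit_left]
  rw [ts_comm]

/-- The counits in the two cocycles remove all legs of f and y but one, so the double convolution
reduces to three legs each of g and h. -/
lemma mul_tmul (f g : K) (h y : V) : mul p p' ((f ⊗ₜ h) ⊗ₜ (g ⊗ₜ y)) =
    ts (comul (R := k) g) fun a b => ts (comul (R := k) b) fun b c =>
      ts (comul (R := k) h) fun d e => ts (comul (R := k) e) fun e l =>
        p a d • p' c l • ((f * b) ⊗ₜ[k] (e * y)) := by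
  refine (convMul_apply_eq_ts _ _ _).trans ?_
  simp only [comul_tmul_eq_ts, ts_ts, ts_tmul, LinearMap.comp_apply, cocycle_tmul,
    cocycle_convMul_tmul,
    Algebra.linearMap_apply, ← Algebra.commutes, ← Algebra.smul_def, mul_smul]
  simp only [← smul_ts, ts_counit_right]
  rw [ts_comm]
  simp only [smul_ts]
  refine (ts_congr fun a b => ts_comm _ _ _).trans ?_
  simp only [ts_coassoc]
  exact ts_congr fun _ _ => ts_congr fun _ _ => ts_congr fun _ _ => ts_congr fun _ _ =>
    smul_comm _ _ _

/-- For h = 1 both pairings become counits: left multiplication by K ⊗ 1 is untwisted. -/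
lemma mul_tmul_one (hp : ∀ g, p g 1 = counit (R := k) g) (hp' : ∀ g, p' g 1 = counit (R := k) g)
    (f g : K) (y : V) : mul p p' ((f ⊗ₜ 1) ⊗ₜ (g ⊗ₜ y)) = (f * g) ⊗ₜ y := by
  simp only [mul_tmul, ts_comul_one, hp, hp', one_mul, ← smul_ts, ts_counit_left, ts_counit_right]

lemma proj_tmul (γ : V →ₗ[k] K) (f : K) (y : V) : proj γ (f ⊗ₜ y) = f * γ y := rfl

lemma projCoinv_tmul (γ : V →ₗ[k] K) (f : K) (y : V) : projCoinv p p' γ (f ⊗ₜ y) =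
    ts (comul (R := k) f) fun a b => ts (comul (R := k) y) fun c d =>
      mul p p' ((a ⊗ₜ c) ⊗ₜ (antipode k (b * γ d) ⊗ₜ 1)) := by
  simp only [projCoinv, LinearMap.comp_apply, comul_tmul_eq_ts, map_ts, LinearMap.lTensor_tmul,
    proj_tmul, incl, LinearMap.flip_apply, TensorProduct.mk_apply]

lemma anti_tmul (f : K) (y : V) : anti p p' (f ⊗ₜ y) =
    mul p p' ((1 ⊗ₜ antipode k y) ⊗ₜ (antipode k f ⊗ₜ 1)) := rfl

lemma braidedAnti_tmul (γ : V →ₗ[k] K) (f : K) (y : V) : braidedAnti p p' γ (f ⊗ₜ y) =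
    ts (comul (R := k) f) fun a b => ts (comul (R := k) y) fun c d =>
      mul p p' (((a * γ c) ⊗ₜ 1) ⊗ₜ mul p p' ((1 ⊗ₜ antipode k d) ⊗ₜ (antipode k b ⊗ₜ 1))) := by
  simp only [braidedAnti, LinearMap.comp_apply, comul_tmul_eq_ts, map_ts, TensorProduct.map_tmul,
    proj_tmul, incl, LinearMap.flip_apply, TensorProduct.mk_apply, anti_tmul]

lemma adj_tmul (κ : K) (d : K ⊗[k] V) : adj p p' (κ ⊗ₜ d) =
    ts (comul (R := k) κ) fun a b =>
      mul p p' (mul p p' ((a ⊗ₜ 1) ⊗ₜ d) ⊗ₜ (antipode k b ⊗ₜ 1)) := by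
  exact lin_eq_ts (mul p p' ∘ₗ (mul p p').rTensor (K ⊗[k] V) ∘ₗ
    TensorProduct.map (TensorProduct.map (incl k K V) LinearMap.id)
      (incl k K V ∘ₗ antipode k) ∘ₗ
    (TensorProduct.rightComm k K K (K ⊗[k] V)).toLinearMap ∘ₗ
    (TensorProduct.mk k (K ⊗[k] K) (K ⊗[k] V)).flip d) (comul (R := k) κ)

end GenDouble

lemma ts_smul_left {k U V W : Type*} [Field k] [AddCommGroup U] [Module k U] [AddCommGroup V]
    [Module k V] [AddCommGroup W] [Module k W] (r : k) (t : V ⊗[k] W) (f : V → W → U)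
    [∀ b, LinFun k fun a => f a b] [∀ a, LinFun k fun b => f a b] :
    ts (r • t) f = r • ts t f := by
  simp only [ts_eq_lift (f := f), map_smul]

/-! ### The product of F of the transmutation, and the evaluated product of the double. -/

namespace CQTStructure
section
variable {k U X : Type*} [Field k] [AddCommGroup U] [Module k U] [Ring X] [HopfAlgebra k X]
  (s : CQTStructure k X)

/-- The commutation rule for σ⁻¹. It is `inv_comm` on the two middle legs of x, multiplied by x₁ on
the left and x₄ on the right; on each side one antipode cancels against its neighbour. -/
lemma inv_mul_comm_aux (x y : X) (f : X →ₗ[k] U) :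
    (ts (comul (R := k) x) fun a b => ts (comul (R := k) y) fun c d => s.inv b d • f (a * c)) =
    ts (comul (R := k) x) fun a b => ts (comul (R := k) y) fun c d => s.inv a c • f (d * b) := by
  have e : (ts (comul (R := k) x) fun a x => ts (comul (R := k) x) fun x e =>
      ts (comul (R := k) x) fun b c => ts (comul (R := k) y) fun p q =>
        s.inv b q • f (a * (p * antipode k c) * e)) =
      ts (comul (R := k) x) fun a x => ts (comul (R := k) x) fun x e =>
      ts (comul (R := k) x) fun b c => ts (comul (R := k) y) fun p q =>
        s.inv c p • f (a * (antipode k b * q) * e) :=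
    ts_congr fun a x => ts_congr fun x e => s.inv_comm x y fun t => f (a * t * e)
  refine (Eq.trans ?_ e).trans ?_
  · refine ts_congr fun a x => ?_
    simp only [ts_coassoc, mul_assoc]
    symm
    refine (ts_congr fun b x => ts_comm _ _ _).trans ?_
    simp only [← smul_ts]
    refine (ts_congr fun b x => ts_congr fun p q => congrArg (s.inv b q • ·)
      (ts_antipode_left x fun u => f (a * (p * u)))).trans ?_
    simp only [mul_one, smul_comm _ (counit (R := k) _), ← smul_ts, ts_counit_right]
  · have h := ts_mul_antipode_cancel (k := k) x fun u d => ts (comul (R := k) d) fun c e =>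
      ts (comul (R := k) y) fun p q => s.inv c p • f (u * (q * e))
    simp only [one_mul, mul_assoc] at h
    simp only [ts_coassoc, mul_assoc]
    exact h

lemma inv_mul_comm (x y : X) (f : X → U) [h : LinFun k f] :
    (ts (comul (R := k) x) fun a b => ts (comul (R := k) y) fun c d => s.inv b d • f (a * c)) =
    ts (comul (R := k) x) fun a b => ts (comul (R := k) y) fun c d => s.inv a c • f (d * b) :=
  s.inv_mul_comm_aux x y ⟨⟨f, h.map_add⟩, h.map_smul⟩

lemma inv_form_smul (x y : X) (u : U) :
    (ts (comul (R := k) x) fun a b => ts (comul (R := k) y) fun c d =>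
      s.inv a c • s.form b d • u) = counit (R := k) x • counit (R := k) y • u := by
  simp only [smul_smul, ← ts_smul, inv_form]

lemma inv_mul_l (x y g : X) : s.inv (x * y) g = ts (comul (R := k) g) fun a b =>
    s.inv y a * s.inv x b := by
  simp only [inv_apply, antipode_mul_antidistrib, form_mul_l]

/-- Twisting the right-hand map by σ gives back the transmuted product: the values of σ⁻¹ and σ on y
cancel. Composing with the inverse twist then gives the claim. -/
lemma transMul_twist_inv {k X : Type u} [Field k] [Ring X] [HopfAlgebra k X] (s : CQTStructure k X)
    (x y : X) : s.transMul (RightComod.twist s.inv (adComod k X) (adComod k X) (x ⊗ₜ[k] y)) =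
      ts ((adCoaction k X).coact x) fun a b => ts (comul (R := k) y) fun c d =>
        s.inv b d • (a * c) := by
  let m : X ⊗[k] X →ₗ[k] X := LinFun.lift fun x y => ts ((adCoaction k X).coact x) fun a b =>
    ts (comul (R := k) y) fun c d => s.inv b d • (a * c)
  have hm (x y : X) : m (x ⊗ₜ y) = ts ((adCoaction k X).coact x) fun a b =>
    ts (comul (R := k) y) fun c d => s.inv b d • (a * c) := rfl
  have e : m ∘ₗ RightComod.twist s.form (adComod k X) (adComod k X) = s.transMul := by
    refine TensorProduct.ext' fun x y => ?_
    refine (congrArg m (RightComod.twist_tmul s.form (adComod k X) (adComod k X) x y)).trans ?_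
    rw [transMul_tmul]
    simp only [map_ts, map_smul, hm, smul_ts]
    refine (ts_congr fun a b => ts_comm _ _ _).trans ?_
    refine (ts_coact (adCoaction k X) x fun a b b' => ts ((adCoaction k X).coact y) fun c d =>
      ts (comul (R := k) c) fun c d' => s.form b' d • s.inv b d' • (a * c)).trans ?_
    refine ts_congr fun a b => ?_
    simp only [ts_ad, ts_coassoc, form_mul_r, ts_smul]
    refine (ts_comm₂ _ _ _ _).trans ?_
    refine (ts_congr fun p y => ts_congr fun m y => (ts_congr fun c d => ts_comm _ _ _).trans
      (ts_coassoc b fun c g h => ts (comul (R := k) y) fun e n =>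
        (s.form g n * s.form h (antipode k p)) • s.inv c e • (a * m)).symm).trans ?_
    simp only [mul_smul, smul_comm (s.form _ _) (s.inv _ _), inv_form_smul]
    simp only [← smul_ts, ts_counit_left, ts_counit_right]
  have h := LinearMap.congr_fun e (RightComod.twist s.inv (adComod k X) (adComod k X) (x ⊗ₜ y))
  refine h.symm.trans (congrArg m (RightComod.twist_form_inv s (adComod k X) (adComod k X) _))
end
section
variable {k H A X : Type u} [Field k] [Ring H] [HopfAlgebra k H] [Ring A] [HopfAlgebra k A]
  [Ring X] [HopfAlgebra k X] (s : CQTStructure k H) (ιX : X →ₐc[k] H) (ιA : A →ₐc[k] H)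
  (hX : Function.Injective ιX) {U : Type*} [AddCommGroup U] [Module k U]

lemma ts_comul_ev_smul₃ (f : s.HXAcop ιX ιA) (x y z : H) (v : U) :
    (ts (comul (R := k) f) fun a b => ts (comul (R := k) b) fun b c =>
      s.ev ιX ιA a x • s.ev ιX ιA b y • s.ev ιX ιA c z • v) = s.ev ιX ιA f (z * y * x) • v := by
  simp only [← smul_ts, ts_comul_ev_smul]

/-- The three legs of g are evaluated at h₁, at w₂ and, through the antipode of K, at S⁻¹(h₃). Since
K is co-opposite they merge into one evaluation at S⁻¹(h₃)w₂h₁. -/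
lemma ev_double_mul (f g : s.HXAcop ιX ιA) (h y : X) (w : H) :
    (ts (GenDouble.mul (s.pairing ιX ιA) (s.pairingInv ιX ιA) ((f ⊗ₜ h) ⊗ₜ (g ⊗ₜ y)))
      fun a v => s.ev ιX ιA a w • v) =
    ts (comul (R := k) h) fun c d => ts (comul (R := k) d) fun d e => ts (comul (R := k) w)
      fun a b => s.ev ιX ιA f a • s.ev ιX ιA g (s.antipodeInv (ιX e) * b * ιX c) • (d * y) := by
  have e (c d e : X) : (ts (comul (R := k) g) fun a g => ts (comul (R := k) g) fun b c' =>
      s.ev ιX ιA a (ιX c) • s.ev ιX ιA c' (s.antipodeInv (ιX e)) • s.ev ιX ιA (f * b) w • d) =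
      ts (comul (R := k) w)
      fun a b => s.ev ιX ιA f a • s.ev ιX ιA g (s.antipodeInv (ιX e) * b * ιX c) • d := by
    simp only [ev_mul, ts_smul, smul_ts, mul_smul]
    refine (ts_congr fun a g => ts_comm _ _ _).trans ((ts_comm _ _ _).trans (ts_congr fun u v => ?_))
    simp only [smul_comm _ (s.ev ιX ιA f u), ← smul_ts]
    rw [← ts_comul_ev_smul₃]
    simp only [smul_ts]
    refine ts_congr fun a _ => ts_congr fun b c' => ?_
    exact congrArg (fun v => s.ev ιX ιA f u • s.ev ιX ιA a (ιX c) • v)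
      (smul_comm (s.ev ιX ιA c' (s.antipodeInv (ιX e))) (s.ev ιX ιA b v) d)
  simp only [GenDouble.mul_tmul, ts_ts, ts_smul_left, ts_tmul, pairing_apply]
  refine (ts_congr fun a g => ts_comm₂ _ _ _ _).trans ((ts_comm₂ _ _ _ _).trans ?_)
  exact ts_congr fun c _ => ts_congr fun d b => e c (d * y) b

lemma theta_apply (y : X) : GenDouble.theta (s.gamma ιX ιA hX) (s.comap ιX hX).antipodeInv y =
    ts (comul (R := k) y) fun a b => s.lInvSq ιX ιA hX b ⊗ₜ[k] a := by
  simp only [GenDouble.theta, LinearMap.comp_apply, LinearEquiv.coe_coe]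
  rw [comm_eq_ts, map_ts]
  rfl

end
end CQTStructure

/-! ### The embedding θ: image, coaction and product. -/

namespace CQTStructure
section
variable {k H A X : Type u} [Field k] [Ring H] [HopfAlgebra k H] [Ring A] [HopfAlgebra k A]
  [Ring X] [HopfAlgebra k X] (s : CQTStructure k H) (ιX : X →ₐc[k] H) (ιA : A →ₐc[k] H)
  (hX : Function.Injective ιX) {U : Type*} [AddCommGroup U] [Module k U]

/-- The embedding `y ↦ l_{S⁻²(y₂)} ⊗ y₁` of `X` into the double. -/
noncomputable abbrev theta : X →ₗ[k] s.HXAcop ιX ιA ⊗[k] X :=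
  GenDouble.theta (s.gamma ιX ιA hX) (s.comap ιX hX).antipodeInv

/-- The multiplication of the double. -/
noncomputable abbrev doubleMul : (s.HXAcop ιX ιA ⊗[k] X) ⊗[k] (s.HXAcop ιX ιA ⊗[k] X) →ₗ[k]
    s.HXAcop ιX ιA ⊗[k] X :=
  GenDouble.mul (s.pairing ιX ιA) (s.pairingInv ιX ιA)

lemma ts_theta (y : X) (f : s.HXAcop ιX ιA → X → U) [∀ b, LinFun k fun a => f a b]
    [∀ a, LinFun k fun b => f a b] : ts (s.theta ιX ιA hX y) f =
      ts (comul (R := k) y) fun a b => f (s.lInvSq ιX ιA hX b) a := by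
  rw [theta_apply, ts_ts]
  simp only [ts_tmul]

/-- With S⁻¹ = S⁻² ∘ S, both γ and θ are expressed by the one antimultiplicative map `lInvSq`, so
products in K turn into products in X. -/
lemma gamma_eq (y : X) : s.gamma ιX ιA hX y = s.lInvSq ιX ιA hX (antipode k y) := by
  simp only [gamma, lInvSq, invSq, LinearMap.comp_apply, antipodeInv_antipode]

lemma comul_theta (y : X) : comul (R := k) (s.theta ιX ιA hX y) =
    ts (comul (R := k) y) fun a b => ts (comul (R := k) b) fun b c => ts (comul (R := k) c)
      fun c d => (s.lInvSq ιX ιA hX d ⊗ₜ[k] a) ⊗ₜ[k] (s.lInvSq ιX ιA hX c ⊗ₜ[k] b) := by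
  simp only [theta_apply, map_ts, comul_tmul_eq_ts, ts_comul_lInvSq]
  refine (ts_congr fun a b => ts_comm _ _ _).trans ?_
  exact ts_coassoc y fun a c b => ts (comul (R := k) b) fun b d =>
    (s.lInvSq ιX ιA hX d ⊗ₜ[k] a) ⊗ₜ[k] (s.lInvSq ιX ιA hX b ⊗ₜ[k] c)

lemma counit_theta (y : X) :
    counit (R := k) (s.theta ιX ιA hX y) = counit (R := k) y := by
  simp only [theta_apply, map_ts, TensorProduct.counit_tmul, counit_lInvSq]
  exact ts_counit_left (k := k) y fun a => counit (R := k) a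

lemma theta_one : s.theta ιX ιA hX 1 = 1 ⊗ₜ 1 := by
  rw [theta_apply, ts_comul_one, lInvSq_one]

/-- Applying ε to the K-leg is a left inverse. -/
lemma theta_injective : Function.Injective (s.theta ιX ιA hX) := by
  refine Function.LeftInverse.injective
    (g := fun t => ts t fun f x => counit (R := k) f • x) fun y => ?_
  simp only [ts_theta, counit_lInvSq]
  exact ts_counit_right y fun a => a

lemma ydOf_theta_coact (y : X) :
    (s.theta ιX ιA hX).lTensor _ ((s.ydOf ιX ιA hX (adCoaction k X)).coact y) =
      (GenDouble.proj (s.gamma ιX ιA hX)).rTensor _ (comul (R := k) (s.theta ιX ιA hX y)) := by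
  simp only [comul_theta, ydOf_coact, ts_ad, map_ts, LinearMap.lTensor_tmul, LinearMap.rTensor_tmul,
    GenDouble.proj_tmul, gamma_eq, lInvSq_mul]
  simp only [theta_apply, tmul_ts, ts_coassoc]

/-- In θ(y)₁ ⊗ π(θ(y)₂) the last leg is l of S⁻² of S(y₂)y₃, which cancels. -/
lemma theta_mem_coinv (y : X) : s.theta ιX ιA hX y ∈ GenDouble.coinv (s.gamma ιX ιA hX) := by
  refine LinearMap.mem_eqLocus.2 ?_
  simp only [LinearMap.comp_apply, comul_theta, map_ts, LinearMap.lTensor_tmul, gamma_eq,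
    GenDouble.proj_tmul, lInvSq_mul, LinearMap.flip_apply, TensorProduct.mk_apply]
  rw [theta_apply, ts_tmul_left]
  refine ts_congr fun a x => ?_
  refine (ts_antipode_mul_cancel x fun u d => (s.lInvSq ιX ιA hX d ⊗ₜ[k] a) ⊗ₜ[k]
    s.lInvSq ιX ιA hX u).trans ?_
  rw [lInvSq_one]

/-- The map `L` applies ε to the K-leg of d and multiplies g into the K-leg of θ of what is left. It
recovers d from d₁ ⊗ π(d₂), because γ(y₃) and l_{S⁻²(y₂)} multiply to l of S⁻² of y₂S(y₃); it sends
d ⊗ 1 to a value of θ. For coinvariant d the two arguments agree. -/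
lemma eq_theta_of_mem_coinv (d : s.HXAcop ιX ιA ⊗[k] X)
    (hd : d ∈ GenDouble.coinv (s.gamma ιX ιA hX)) : 
    d = s.theta ιX ιA hX (ts d fun f x => counit (R := k) f • x) := by
  let L : (s.HXAcop ιX ιA ⊗[k] X) ⊗[k] s.HXAcop ιX ιA →ₗ[k] s.HXAcop ιX ιA ⊗[k] X :=
    LinFun.lift fun (d : s.HXAcop ιX ιA ⊗[k] X) (g : s.HXAcop ιX ιA) =>
      ts d fun f y => counit (R := k) f • ts (comul (R := k) y) fun a b =>
        (g * s.lInvSq ιX ιA hX b) ⊗ₜ[k] a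
  have hL (f g : s.HXAcop ιX ιA) (y : X) : L ((f ⊗ₜ y) ⊗ₜ g) =
      counit (R := k) f • ts (comul (R := k) y) fun a b => (g * s.lInvSq ιX ιA hX b) ⊗ₜ[k] a :=
    ts_tmul f y fun f y => counit (R := k) f • ts (comul (R := k) y) fun a b =>
      (g * s.lInvSq ιX ιA hX b) ⊗ₜ[k] a
  have h1 : L (d ⊗ₜ 1) = s.theta ιX ιA hX (ts d fun f x => counit (R := k) f • x) := by
    conv_lhs => rw [← ts_self d]
    simp only [ts_tmul_left, map_ts, hL, map_smul, theta_apply, one_mul]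
  have h2 : L ∘ₗ ((GenDouble.proj (s.gamma ιX ιA hX)).lTensor (s.HXAcop ιX ιA ⊗[k] X) ∘ₗ
      (comul (R := k) (A := s.HXAcop ιX ιA ⊗[k] X))) = LinearMap.id := by
    refine TensorProduct.ext' fun f y => ?_
    simp only [LinearMap.comp_apply, comul_tmul_eq_ts, map_ts, LinearMap.lTensor_tmul, hL,
      GenDouble.proj_tmul, gamma_eq, mul_assoc, lInvSq_mul, ← smul_ts, ts_counit_left,
      LinearMap.id_apply]
    refine (ts_coassoc y fun a b c => (f * s.lInvSq ιX ιA hX (b * antipode k c)) ⊗ₜ[k] a).trans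
      ((ts_congr fun a x => ts_antipode_right x fun u =>
        (f * s.lInvSq ιX ιA hX u) ⊗ₜ[k] a).trans ?_)
    rw [lInvSq_one, mul_one]
    exact ts_counit_right y fun a => f ⊗ₜ[k] a
  rw [← h1]
  exact (LinearMap.congr_fun h2 d).symm.trans (congrArg L (LinearMap.mem_eqLocus.1 hd))

lemma range_theta :
    LinearMap.range (s.theta ιX ιA hX) = GenDouble.coinv (s.gamma ιX ιA hX) :=
  le_antisymm (LinearMap.range_le_iff_comap.2 (eq_top_iff.2 fun y _ => s.theta_mem_coinv ιX ιA hX y))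
    fun d hd => ⟨_, (s.eq_theta_of_mem_coinv ιX ιA hX d hd).symm⟩

lemma doubleMul_tmul_one (f g : s.HXAcop ιX ιA) (y : X) :
    s.doubleMul ιX ιA ((f ⊗ₜ 1) ⊗ₜ (g ⊗ₜ y)) = (f * g) ⊗ₜ y :=
  GenDouble.mul_tmul_one _ _ (fun g => by rw [pairing_apply, map_one, counit_eq_ev])
    (fun g => (congrArg (fun h => s.ev ιX ιA g (s.antipodeInv h)) (map_one ιX)).trans
      ((congrArg (s.ev ιX ιA g) s.antipodeInv_one).trans (s.counit_eq_ev ιX ιA g).symm)) f g y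

/-- Moving S⁻² across σ as S² turns the values of σ met in the double into values of the form of X
and of its inverse, as in the next two lemmas. -/
lemma form_invSqH_right (h : H) (y : X) : s.form h (s.invSqH ιX hX y) =
    s.form (antipode k (antipode k h)) (ιX y) := by
  rw [← s.form_antipode_antipode, ← s.form_antipode_antipode, invSqH_eq, s.antipode_antipodeInv,
    s.antipode_antipodeInv]

lemma form_antipodeInv_invSqH (x y : X) : s.form (s.antipodeInv (ιX x)) (s.invSqH ιX hX y) =
    (s.comap ιX hX).inv x y := by
  rw [form_invSqH_right, s.antipode_antipodeInv, ← inv_apply]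
  rfl

lemma form_map_invSqH (x y : X) : s.form (ιX x) (s.invSqH ιX hX y) =
    (s.comap ιX hX).inv (antipode k x) y := by
  rw [form_invSqH_right, inv_apply, ← map_antipode', ← map_antipode']
  rfl

/-- Computes the two evaluations in a product θ(x)θ(y) at the conjugated argument of
`ev_double_mul`: the conjugating factors split off as σ⁻¹, and the rest recombines into one value at
w. -/
lemma ts_form_conj (h₁ h₃ b d : X) (w : H) (t : U) :
    (ts (comul (R := k) w) fun u v => s.form u (s.invSqH ιX hX b) •
      s.form (s.antipodeInv (ιX h₃) * v * ιX h₁) (s.invSqH ιX hX d) • t) =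
    ts (comul (R := k) d) fun d e => ts (comul (R := k) d) fun c d =>
      (s.comap ιX hX).inv h₃ c • (s.comap ιX hX).inv (antipode k h₁) e •
        s.form w (s.invSqH ιX hX (d * b)) • t := by
  simp only [form_mul_l, ts_comul_invSqH, form_antipodeInv_invSqH, form_map_invSqH, invSqH_mul,
    form_mul_r, ts_smul, smul_ts, mul_smul, ts_mul]
  refine (ts_comm _ _ _).trans (ts_congr fun d e => (ts_comm _ _ _).trans ?_)
  refine ts_congr fun c d => ts_congr fun u v => ?_
  rw [smul_comm, smul_comm (s.form v _), smul_comm (s.form u _)]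

/-- After evaluation at w both sides have the same outer factors. The middle factors are
σ⁻¹(x₂,y₂)x₁y₁ and σ⁻¹(x₁,y₁)y₂x₂ for middle legs of x and y, which agree by `inv_mul_comm`. -/
lemma theta_transMul (x y : X) :
    s.theta ιX ιA hX ((s.comap ιX hX).transMul
      (RightComod.twist (s.comap ιX hX).inv (adComod k X) (adComod k X) (x ⊗ₜ[k] y))) =
    s.doubleMul ιX ιA (s.theta ιX ιA hX x ⊗ₜ s.theta ιX ιA hX y) := by
  -- The common frame: σ⁻¹(S(x₁),y₃) and x₂y₁ are fixed, and `g` receives the remaining legs of x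
  -- and the middle legs of y.
  let E (w : H) (g : X → X → X → X → k) : X := ts (comul (R := k) x) fun p x =>
    ts (comul (R := k) x) fun a x => ts (comul (R := k) y) fun c y => ts (comul (R := k) y)
      fun y e => (ts (comul (R := k) x) fun a' n => ts (comul (R := k) y) fun c' d => 
        g a' n c' d) • (s.comap ιX hX).inv (antipode k p) e • (a * c)
  refine ev_tensor_ext s ιX ιA fun w => ?_
  refine Eq.trans (b := E w fun a' n c' d => (s.comap ιX hX).inv n d *
    s.form w (s.invSqH ιX hX (a' * c'))) ?_ (Eq.trans (b := E w fun a' n c' d =>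
      (s.comap ιX hX).inv a' c' * s.form w (s.invSqH ιX hX (d * n))) ?_ ?_)
  · rw [transMul_twist_inv]
    simp only [E, map_ts, map_smul, ts_ts, ts_smul_left, ts_theta, ts_comul_mul, ev_lInvSq, ts_ad,
      inv_mul_l, ts_smul, mul_smul, smul_ts]
    refine ts_congr fun p q => ?_
    refine (ts_congr fun a n => (ts_comm₂ (comul a) (comul y) (fun _ b => comul b) _).symm).trans ?_
    refine Eq.trans ?_ (ts_congr fun a x =>
      (ts_comm₂ (comul x) (comul y) (fun _ b => comul b) _))
    rw [ts_coassoc]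
    refine ts_congr fun a x => ts_congr fun b n => ?_
    refine (ts_congr fun a b => ts_comm _ _ _).trans ?_
    simp only [ts_coassoc]
    refine ts_congr fun c y => ts_congr fun d y => ts_congr fun u e => ?_
    rw [smul_comm ((s.comap ιX hX).inv (antipode k p) _)]
  · exact ts_congr fun p x => ts_congr fun a x => ts_congr fun c y => ts_congr fun y e =>
      congrArg (fun r : k => r • (s.comap ιX hX).inv (antipode k p) e • (a * c))
        ((s.comap ιX hX).inv_mul_comm x y fun t => s.form w (s.invSqH ιX hX t))
  · simp only [theta_apply, ts_tmul_left, tmul_ts, map_ts, ts_ts, ev_double_mul, ev_lInvSq]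
    simp only [ts_form_conj, E, ts_smul, mul_smul]
    symm
    refine (ts_congr fun c y => ?_).trans ((ts_comm₂ (comul y) (comul x) (fun _ b => comul b)
      fun c y p x a x' => ts (comul (R := k) x') fun a' n => ts (comul (R := k) y) fun y e =>
        ts (comul (R := k) y) fun c' d => (s.comap ιX hX).inv a' c' •
          (s.comap ιX hX).inv (antipode k p) e • s.form w (s.invSqH ιX hX (d * n)) •
            (a * c)).trans ?_)
    · simp only [ts_coassoc]
    · refine ts_congr fun p x => ts_congr fun a x => ts_congr fun c y => ?_
      refine (ts_comm _ _ _).trans ?_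
      refine ts_congr fun y e => ts_congr fun a' n => ts_congr fun c' d => ?_
      rw [smul_comm ((s.comap ιX hX).inv (antipode k p) _)]

end
end CQTStructure

/-! ### The embedding θ: action, comultiplication and antipode. -/

namespace CQTStructure
section
variable {k H A X : Type u} [Field k] [Ring H] [HopfAlgebra k H] [Ring A] [HopfAlgebra k A]
  [Ring X] [HopfAlgebra k X] (s : CQTStructure k H) (ιX : X →ₐc[k] H) (ιA : A →ₐc[k] H)
  (hX : Function.Injective ιX) {U : Type*} [AddCommGroup U] [Module k U]

/-- The commutation rule for a part of w and S⁻²(x) brings two legs of w next to each other, where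
they cancel in S⁻¹(w₃)w₂. -/
lemma ts_form_antipodeInv_conj_aux (x : X) (w : H) (f : H →ₗ[k] U) :
    (ts (comul (R := k) x) fun c d => ts (comul (R := k) w) fun u v => ts (comul (R := k) u)
      fun a b => s.form b (s.invSqH ιX hX d) • f (s.antipodeInv v * (s.invSqH ιX hX c * a))) =
    ts (comul (R := k) x) fun c d => s.form w (s.invSqH ιX hX c) • f (s.invSqH ιX hX d) := by
  have h (u v : H) : (ts (comul (R := k) u) fun a b => ts (comul (R := k) x) fun c d =>
      s.form a (s.invSqH ιX hX c) • f (s.antipodeInv v * (b * s.invSqH ιX hX d))) =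
      ts (comul (R := k) u) fun a b => ts (comul (R := k) x) fun c d =>
      s.form b (s.invSqH ιX hX d) • f (s.antipodeInv v * (s.invSqH ιX hX c * a)) := by
    have e := s.form_comm u (s.invSqH ιX hX x) fun t => f (s.antipodeInv v * t)
    simpa only [ts_comul_invSqH] using e
  refine (ts_comm₂ _ _ _ _).trans ((ts_congr fun u v => (h u v).symm).trans ?_)
  simp only [ts_coassoc]
  refine (ts_comm₂ _ _ _ _).symm.trans (ts_congr fun c d => ?_)
  simp only [← smul_ts, ← mul_assoc]
  refine (ts_congr fun a v => congrArg (s.form a (s.invSqH ιX hX c) • ·)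
    (s.ts_antipodeInv_mul v fun t => f (t * s.invSqH ιX hX d))).trans ?_
  simp only [one_mul, smul_comm (s.form _ _) (counit (R := k) _)]
  exact ts_counit_right w fun a => s.form a (s.invSqH ιX hX c) • f (s.invSqH ιX hX d)

lemma ts_form_antipodeInv_conj (x : X) (w : H) (f : H → U) [h : LinFun k f] :
    (ts (comul (R := k) x) fun c d => ts (comul (R := k) w) fun a b => ts (comul (R := k) b)
      fun b v => s.form b (s.invSqH ιX hX d) • f (s.antipodeInv v * (s.invSqH ιX hX c * a))) =
    ts (comul (R := k) x) fun c d => s.form w (s.invSqH ιX hX c) • f (s.invSqH ιX hX d) := by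
  let F : H →ₗ[k] U := ⟨⟨f, h.map_add⟩, h.map_smul⟩
  exact (ts_congr fun c d => (ts_coassoc w fun a b v => s.form b (s.invSqH ιX hX d) •
    F (s.antipodeInv v * (s.invSqH ιX hX c * a))).symm).trans
    (s.ts_form_antipodeInv_conj_aux ιX hX x w F)

lemma antipodeInv_conj (a b : X) (v : H) :
    s.antipodeInv (s.antipodeInv (ιX b) * v * ιX a) =
      s.invSqH ιX hX (antipode k a) * (s.antipodeInv v * s.invSqH ιX hX b) := by
  rw [antipodeInv_mul, antipodeInv_mul, invSqH_eq, invSqH_eq, map_antipode', antipodeInv_antipode]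

/-- Evaluated at w, the adjoint action involves f through two legs, which merge into f at S⁻²(S(y₁))
times an element conjugated by w. `ts_form_antipodeInv_conj` removes the conjugation and leaves the
adjoint coaction of y. -/
lemma theta_ydOf_act (f : s.HXAcop ιX ιA) (y : X) :
    s.theta ιX ιA hX ((s.ydOf ιX ιA hX (adCoaction k X)).act f y) =
      GenDouble.adj (s.pairing ιX ιA) (s.pairingInv ιX ιA) (f ⊗ₜ s.theta ιX ιA hX y) := by
  refine ev_tensor_ext s ιX ιA fun w => ?_
  simp only [GenDouble.adj_tmul, ydOf_act, map_ts, map_smul, ts_ts, ts_smul_left, ts_theta, ts_ad,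
    smul_ts, ev_lInvSq]
  simp only [theta_apply, tmul_ts, map_ts, ts_tmul_left, doubleMul_tmul_one, ev_double_mul, ts_ts,
    mul_one, ev_antipode, antipodeInv_conj s ιX hX]
  simp only [ev_mul, ev_lInvSq, ts_smul, mul_smul]
  symm
  refine (ts_comm₃ _ _ _ _ _).trans ((ts_congr fun a b => ts_congr fun c d => ts_congr fun d e =>
    (ts_comm₂ _ _ _ _).trans (ts_congr fun u v => ts_congr fun u₁ u₂ =>
      Eq.trans (b := s.form u₂ (s.invSqH ιX hX b) • s.ev ιX ιA f (s.invSqH ιX hX (antipode k c) *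
        (s.antipodeInv v * (s.invSqH ιX hX e * u₁))) • d) ?_ rfl)).trans ?_)
  · simp only [smul_comm (s.ev ιX ιA _ u₁) (s.form _ _), ← smul_ts, ts_comul_ev_smul, mul_assoc]
  simp only [ts_coassoc]
  refine ts_congr fun p y => ts_congr fun q y => ?_
  refine (s.ts_form_antipodeInv_conj ιX hX y w fun t => s.ev ιX ιA f (s.invSqH ιX hX (antipode k p) *
    t) • q).trans ?_
  simp only [invSqH_mul]
  exact ts_congr fun _ _ => smul_comm _ _ _

/-- The reversal by the antipode and the reversal by the co-opposite compensate each other. -/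
lemma ts_comul_gamma (y : X) (f : s.HXAcop ιX ιA → s.HXAcop ιX ιA → U)
    [∀ b, LinFun k (fun a => f a b)] [∀ a, LinFun k (fun b => f a b)] :
    ts (comul (R := k) (s.gamma ιX ιA hX y)) f = ts (comul (R := k) y) fun a b =>
      f (s.gamma ιX ιA hX a) (s.gamma ιX ιA hX b) := by
  have (b : s.HXAcop ιX ιA) := LinFun.comp (k := k) (fun a => f a b) (fun x => s.lInvSq ιX ιA hX x)
  have (b : s.HXAcop ιX ιA) := LinFun.comp (k := k) (fun a => f b a) (fun x => s.lInvSq ιX ιA hX x)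
  simp only [gamma_eq]
  rw [ts_comul_lInvSq, ts_comul_antipode]

/-- The map `f ⊗ y ↦ f γ(y₂) ▷ y₁` from the double to `X`. -/
noncomputable def thetaRetract : s.HXAcop ιX ιA ⊗[k] X →ₗ[k] X :=
  LinFun.lift fun f y => ts (comul (R := k) y) fun a b =>
    (s.ydOf ιX ιA hX (adCoaction k X)).act (f * s.gamma ιX ιA hX b) a

lemma thetaRetract_tmul (f : s.HXAcop ιX ιA) (y : X) : s.thetaRetract ιX ιA hX (f ⊗ₜ y) =
    ts (comul (R := k) y) fun a b =>
      (s.ydOf ιX ιA hX (adCoaction k X)).act (f * s.gamma ιX ιA hX b) a := rfl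

/-- Π(f ⊗ y) is the adjoint action of fγ(y₂) on θ(y₁): expanding that action, the factor y₂S(y₃)
cancels. Hence Π can be studied through a map with values in X. -/
lemma theta_thetaRetract (d : s.HXAcop ιX ιA ⊗[k] X) :
    s.theta ιX ιA hX (s.thetaRetract ιX ιA hX d) =
      GenDouble.projCoinv (s.pairing ιX ιA) (s.pairingInv ιX ιA) (s.gamma ιX ιA hX) d := by
  refine LinearMap.congr_fun (f := s.theta ιX ιA hX ∘ₗ s.thetaRetract ιX ιA hX)
    (TensorProduct.ext' fun f y => ?_) d
  simp only [LinearMap.comp_apply, thetaRetract_tmul, map_ts, theta_ydOf_act, GenDouble.adj_tmul,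
    GenDouble.projCoinv_tmul, ts_comul_mul, ts_comul_gamma]
  simp only [theta_apply, tmul_ts, map_ts, ts_tmul_left, doubleMul_tmul_one, gamma_eq, mul_assoc,
    lInvSq_mul]
  rw [ts_comm]
  refine ts_congr fun f g => ?_
  refine (ts_congr fun a b => ts_comm _ _ _).trans ?_
  simp only [ts_coassoc]
  refine ts_congr fun a x => ?_
  refine (ts_mul_antipode_cancel x fun u d => s.doubleMul ιX ιA (((f * s.lInvSq ιX ιA hX u) ⊗ₜ[k] a)
    ⊗ₜ[k] (antipode k (g * s.lInvSq ιX ιA hX (antipode k d)) ⊗ₜ[k] 1))).trans ?_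
  rw [lInvSq_one, mul_one]

/-- The comultiplication of `X` as a braided Hopf algebra in Yetter-Drinfeld modules. -/
noncomputable abbrev ydComul : X →ₗ[k] X ⊗[k] X :=
  (s.comap ιX hX).formTwist (adCoaction k X) (adCoaction k X) ∘ₗ comul (R := k)

/-- Both factors are morphisms: the comultiplication of X is colinear, hence preserved by F, and the
twist by σ is φ₂⁻¹. -/
lemma ydComul_act (f : s.HXAcop ιX ιA) (y : X) :
    s.ydComul ιX hX ((s.ydOf ιX ιA hX (adCoaction k X)).act f y) =
    ((s.ydOf ιX ιA hX (adCoaction k X)).tensor (s.ydOf ιX ιA hX (adCoaction k X))).act f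
      (s.ydComul ιX hX y) :=
  (congrArg _ ((s.isHom_ydOf ιX ιA hX (adCoaction k X) ((adCoaction k X).tensor (adCoaction k X))
    (comul (R := k)) comul_colin).map_act f y)).trans
    ((s.isHom_formTwist ιX ιA hX (adCoaction k X) (adCoaction k X)).map_act f _)

lemma ydComul_apply (y : X) : s.ydComul ιX hX y = ts (comul (R := k) y) fun a b =>
    ts ((adCoaction k X).coact b) fun b c =>
      (s.ydOf ιX ιA hX (adCoaction k X)).act (s.lInvSq ιX ιA hX c) a ⊗ₜ[k] b := by
  rw [LinearMap.comp_apply]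
  conv_lhs => rw [← ts_self (comul (R := k) y), map_ts]
  simp only [formTwist_tmul, ydOf_act, ev_lInvSq, form_invSqH, ts_tmul_left, ← smul_tmul']
  exact ts_congr fun a b => ts_comm _ _ _

/-- By K-linearity the comultiplication passes the action of fγ(y₂). The action of l that comes from
the braided comultiplication then multiplies with γ, and one product of a leg of y with the antipode
of the next cancels. -/
lemma ydComul_thetaRetract (d : s.HXAcop ιX ιA ⊗[k] X) :
    s.ydComul ιX hX (s.thetaRetract ιX ιA hX d) =
      TensorProduct.map (s.thetaRetract ιX ιA hX) (s.thetaRetract ιX ιA hX)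
        (comul (R := k) d) := by
  refine LinearMap.congr_fun (f := s.ydComul ιX hX ∘ₗ s.thetaRetract ιX ιA hX)
    (g := TensorProduct.map (s.thetaRetract ιX ιA hX) (s.thetaRetract ιX ιA hX) ∘ₗ comul (R := k))
    (TensorProduct.ext' fun f y => ?_) d
  rw [LinearMap.comp_apply, thetaRetract_tmul, map_ts]
  simp only [ydComul_act]
  simp only [ydComul_apply s ιX ιA, map_ts, YDStruct.tensor_act_eq, ts_comul_mul, ts_comul_gamma,
    LinearMap.comp_apply, comul_tmul_eq_ts, TensorProduct.map_tmul, thetaRetract_tmul, ts_tmul_left,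
    tmul_ts, ts_ad, ← YDStruct.mul_act, mul_assoc]
  simp only [gamma_eq, lInvSq_mul]
  refine (ts_congr fun a b => (ts_comm₃ (comul f) (comul a) (fun _ x => comul x)
    (fun _ _ _ x => comul x) _).symm).trans ((ts_comm _ _ _).trans (ts_congr fun f g => ?_))
  symm
  refine (ts_congr fun c d => ts_comm _ _ _).trans ?_
  symm
  simp only [ts_coassoc]
  refine ts_congr fun a y => ts_congr fun p y => ts_congr fun v y => ?_
  let M := s.ydOf ιX ιA hX (adCoaction k X)
  have h := ts_mul_antipode_cancel (k := k) y fun u d =>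
    M.act (f * s.lInvSq ιX ιA hX (antipode k p * u)) a ⊗ₜ[k]
      M.act (g * s.lInvSq ιX ιA hX (antipode k d)) v
  simp only [← mul_assoc (antipode k p), mul_one] at h
  exact h

/-- By injectivity of θ the preimage of Π(d) is the retract of d, so the claim is the image of
`ydComul_thetaRetract` under θ ⊗ θ. -/
lemma map_theta_ydComul (d : s.HXAcop ιX ιA ⊗[k] X) (v : X) (h : s.theta ιX ιA hX v =
      GenDouble.projCoinv (s.pairing ιX ιA) (s.pairingInv ιX ιA) (s.gamma ιX ιA hX) d) :
    TensorProduct.map (s.theta ιX ιA hX) (s.theta ιX ιA hX) (s.ydComul ιX hX v) =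
    TensorProduct.map (GenDouble.projCoinv (s.pairing ιX ιA) (s.pairingInv ιX ιA) (s.gamma ιX ιA hX))
      (GenDouble.projCoinv (s.pairing ιX ιA) (s.pairingInv ιX ιA) (s.gamma ιX ιA hX))
      (comul (R := k) d) := by
  rw [← theta_thetaRetract] at h
  rw [s.theta_injective ιX ιA hX h, s.ydComul_thetaRetract ιX ιA hX, ← LinearMap.comp_apply,
    ← TensorProduct.map_comp]
  exact congrArg (fun P => TensorProduct.map P P (comul (R := k) d))
    (LinearMap.ext (s.theta_thetaRetract ιX ιA hX))

lemma ev_doubleMul_left (f : s.HXAcop ιX ιA) (t : s.HXAcop ιX ιA ⊗[k] X) (w : H) :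
    (ts (s.doubleMul ιX ιA ((f ⊗ₜ 1) ⊗ₜ t)) fun a v => s.ev ιX ιA a w • v) =
    ts (comul (R := k) w) fun a b => s.ev ιX ιA f a • ts t fun g v => s.ev ιX ιA g b • v := by
  conv_lhs => rw [← ts_self t]
  simp only [tmul_ts, map_ts, doubleMul_tmul_one, ts_ts, ts_tmul, ev_mul, ts_smul, mul_smul, smul_ts]
  rw [ts_comm]

lemma antipode_lInvSq (x : X) :
    antipode k (s.lInvSq ιX ιA hX x) = s.lInvSq ιX ιA hX (antipode k x) := by
  simp only [lInvSq, LinearMap.comp_apply, antipode_lCop, invSq, antipode_antipodeInv,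
    antipodeInv_antipode]

/-- The counterpart of `ts_form_conj` for the antipode. The factor σ(S²(c),b) split off here becomes
w once c and b are neighbouring legs. -/
lemma ts_form_conj_antipode (a b c r : X) (w : H) (t : U) :
    (ts (comul (R := k) w) fun u v => s.form u (s.invSqH ιX hX r) •
      s.form (ιX a * v * antipode k (ιX c)) (s.invSqH ιX hX (antipode k b)) • t) =
    ts (comul (R := k) b) fun b p => ts (comul (R := k) p) fun m n =>
      (s.comap ιX hX).form (antipode k (antipode k c)) b • (s.comap ιX hX).inv a n •
        s.form w (s.invSqH ιX hX (antipode k m * r)) • t := by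
  have e1 (x y : X) : s.form (antipode k (ιX x)) (s.invSqH ιX hX (antipode k y)) =
      (s.comap ιX hX).form (antipode k (antipode k x)) y := by
    rw [form_invSqH_right, map_antipode', form_antipode_antipode, ← map_antipode', ← map_antipode']
    rfl
  have e2 (x y : X) : s.form (ιX x) (s.invSqH ιX hX (antipode k y)) = (s.comap ιX hX).inv x y := by
    rw [form_map_invSqH, inv_apply, inv_apply, form_antipode_antipode]
  simp only [form_mul_l, ts_comul_invSqH, ts_comul_antipode, e1, e2, invSqH_mul,
    form_mul_r, ts_smul, smul_ts, mul_smul, ts_mul]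
  refine (ts_comm _ _ _).trans (ts_congr fun b p => (ts_comm _ _ _).trans ?_)
  refine ts_congr fun m n => ts_congr fun u v => ?_
  simp only [smul_smul]
  congr 1
  ring

lemma ts_coassoc_pair (x : X) (f : X → X → X → X → X → X → X → X → U)
    [∀ b c d e g h i, LinFun k fun a => f a b c d e g h i]
    [∀ a c d e g h i, LinFun k fun b => f a b c d e g h i]
    [∀ a b d e g h i, LinFun k fun c => f a b c d e g h i]
    [∀ a b c e g h i, LinFun k fun d => f a b c d e g h i]
    [∀ a b c d g h i, LinFun k fun e => f a b c d e g h i]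
    [∀ a b c d e h i, LinFun k fun g => f a b c d e g h i]
    [∀ a b c d e g i, LinFun k fun h => f a b c d e g h i]
    [∀ a b c d e g h, LinFun k fun i => f a b c d e g h i] :
    (ts (comul (R := k) x) fun u v => ts (comul (R := k) v) fun v i => ts (comul (R := k) u)
      fun a u => ts (comul (R := k) u) fun u d => ts (comul (R := k) u) fun b c =>
      ts (comul (R := k) v) fun e v => ts (comul (R := k) v) fun g h => f a b c d e g h i) =
    ts (comul (R := k) x) fun u x => ts (comul (R := k) u) fun a b => ts (comul (R := k) x)
      fun c x => ts (comul (R := k) x) fun v x => ts (comul (R := k) v) fun d e =>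
      ts (comul (R := k) x) fun u i => ts (comul (R := k) u) fun g h => f a b c d e g h i := by
  refine (ts_congr fun u v => ts_comm₃ (comul v) (comul u) (fun _ u => comul u)
    (fun _ _ u _ => comul u) _).trans ?_
  simp only [ts_coassoc]

/-- Under the antipode, `inv_mul_comm` moves σ⁻¹ to the first legs and brings an antipode next to
the last leg q, where it cancels. -/
lemma ts_inv_antipode_cancel (t : CQTStructure k X) (y : X) (F : X → X → X → U)
    [∀ b c, LinFun k fun a => F a b c] [∀ a c, LinFun k fun b => F a b c]
    [∀ a b, LinFun k fun c => F a b c] :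
    (ts (comul (R := k) y) fun u x => ts (comul (R := k) u) fun a b => ts (comul (R := k) x)
      fun c x => ts (comul (R := k) x) fun v x => ts (comul (R := k) x) fun p q =>
      ts (comul (R := k) p) fun m n => t.inv b n •
        F v (antipode k m * (antipode k a * q)) c) =
    ts (comul (R := k) y) fun a b => ts (comul (R := k) b) fun a₁ b => ts (comul (R := k) b)
      fun v b => ts (comul (R := k) a₁) fun d c => t.inv a b • F v (antipode k d) c := by
  have i (v c : X) (g : X → X) [LinFun k g] : LinFun k fun z => F v (g z) c :=
    LinFun.comp (fun b => F v b c) g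
  have e (u c v p q : X) : (ts (comul (R := k) u) fun a b => ts (comul (R := k) p) fun m n =>
      t.inv b n • F v (antipode k m * (antipode k a * q)) c) =
      ts (comul (R := k) u) fun a b => ts (comul (R := k) p) fun m n =>
        t.inv a m • F v (antipode k b * (antipode k n * q)) c := by
    have h := t.inv_mul_comm u p fun z => F v (antipode k z * q) c
    simpa only [antipode_mul_antidistrib, mul_assoc] using h
  have e₂ (a b c v x : X) : (ts (comul (R := k) x) fun p q => ts (comul (R := k) p) fun m n =>
      t.inv a m • F v (antipode k b * (antipode k n * q)) c) =
      t.inv a x • F v (antipode k b) c := by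
    rw [ts_coassoc]
    simp only [← smul_ts]
    refine (ts_congr fun m r => congrArg (t.inv a m • ·)
      (ts_antipode_left r fun z => F v (antipode k b * z) c)).trans ?_
    simp only [mul_one]
    simp only [smul_comm (t.inv _ _) (counit (R := k) _)]
    exact ts_counit_right x fun z => t.inv a z • F v (antipode k b) c
  refine (ts_congr fun u x => (ts_comm₃ (comul u) (comul x) (fun _ x => comul x)
    (fun _ _ _ x => comul x) _).trans (ts_congr fun c x => ts_congr fun v x => ts_congr fun p q =>
      e u c v p q)).trans ?_
  refine (ts_congr fun u x => (ts_comm₃ (comul u) (comul x) (fun _ x => comul x)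
    (fun _ _ _ x => comul x) _).symm.trans (ts_congr fun a b => ts_congr fun c x =>
      ts_congr fun v x => e₂ a b c v x)).trans ?_
  rw [ts_coassoc]
  refine ts_congr fun a b => (ts_coassoc b fun d c x => ts (comul (R := k) x) fun v x =>
    t.inv a x • F v (antipode k d) c).symm.trans (ts_congr fun a₁ b => ts_comm _ _ _)

/-- Evaluated at w, the right side contains σ(S²(c),b), which is the functional w of the transmuted
antipode, and a surplus of antipodes removed by `ts_inv_antipode_cancel`. What is left is θ of the
formula in `transAntipode_apply`. -/
lemma theta_transAntipode (y : X) :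
    s.theta ιX ιA hX ((s.comap ιX hX).transAntipode y) =
      GenDouble.braidedAnti (s.pairing ιX ιA) (s.pairingInv ιX ιA) (s.gamma ιX ιA hX)
        (s.theta ιX ιA hX y) := by
  refine ev_tensor_ext s ιX ιA fun w => ?_
  simp only [transAntipode_apply, map_ts, map_smul, ts_ts, ts_smul_left, ts_theta, ts_comul_antipode,
    ev_lInvSq]
  conv_rhs => rw [theta_apply]
  simp only [map_ts, GenDouble.braidedAnti_tmul, ts_ts, ev_doubleMul_left, ts_comul_lInvSq,
    antipode_lInvSq, gamma_eq, lInvSq_mul, ev_double_mul, ts_comul_antipode, ev_one, ev_lInvSq,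
    map_antipode', antipodeInv_antipode, mul_one, smul_ts]
  simp only [smul_comm (s.form _ _) (counit (R := k) _), ← smul_ts, ts_counit_left]
  simp only [smul_ts]
  symm
  refine (ts_congr fun a b => ts_congr fun b b₄ => ts_congr fun a₁ a => (ts_comm₂ (comul w) (comul a)
    (fun a _ => comul a) _).trans (ts_congr fun a c => ts_congr fun a₂ a₃ =>
      s.ts_form_conj_antipode ιX hX a₂ b c _ w (antipode k a₃))).trans ?_
  refine (ts_coassoc_pair y fun a₁ a₂ a₃ c b m n b₄ => (s.comap ιX hX).form (antipode k (antipode k c))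
    b • (s.comap ιX hX).inv a₂ n • s.form w (s.invSqH ιX hX (antipode k m * (antipode k a₁ * b₄))) •
      antipode k a₃).trans ?_
  simp only [← smul_ts, ← ts_smul, ← dw_apply]
  simp only [smul_ts, smul_comm ((s.comap ιX hX).dw _) ((s.comap ιX hX).inv _ _)]
  exact ts_inv_antipode_cancel (s.comap ιX hX) y fun v t c =>
    (s.comap ιX hX).dw v • s.form w (s.invSqH ιX hX t) • antipode k c

end
end CQTStructure

/-! ### Assembly of the theorem. -/

namespace CQTStructure
section
variable {k H A X : Type u} [Field k] [Ring H] [HopfAlgebra k H] [Ring A] [HopfAlgebra k A]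
  [Ring X] [HopfAlgebra k X] (s : CQTStructure k H) (ιX : X →ₐc[k] H) (ιA : A →ₐc[k] H)
  (hX : Function.Injective ιX)

lemma isInduced_transmutation :
    GenDouble.IsInduced (s.pairing ιX ιA) (s.pairingInv ιX ιA) (s.gamma ιX ιA hX)
      (GenDouble.theta (s.gamma ιX ιA hX) (s.comap ιX hX).antipodeInv)
      (s.ydOf ιX ιA hX (adCoaction k X))
      ((s.comap ιX hX).transMul ∘ₗ RightComod.twist (s.comap ιX hX).inv (adComod k X) (adComod k X))
      (Algebra.linearMap k X)
      ((s.comap ιX hX).formTwist (adCoaction k X) (adCoaction k X) ∘ₗ comul (R := k))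
      (counit (R := k)) (s.comap ιX hX).transAntipode where
  injective := s.theta_injective ιX ιA hX
  range_eq := s.range_theta ιX ιA hX
  act := s.theta_ydOf_act ιX ιA hX
  coact := s.ydOf_theta_coact ιX ιA hX
  mul := s.theta_transMul ιX ιA hX
  one := by
    simpa only [Algebra.linearMap_apply, map_one] using s.theta_one ιX ιA hX
  comul := fun a v h => s.map_theta_ydComul ιX ιA hX a v h
  counit := fun v => (s.counit_theta ιX ιA hX v).symm
  antipode := s.theta_transAntipode ιX ιA hX

end
end CQTStructure

theorem mainTheorem4 {k H A X : Type u} [Field k] [Ring H] [HopfAlgebra k H]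
    [Ring A] [HopfAlgebra k A] [Ring X] [HopfAlgebra k X]
    -- a coquasitriangular Hopf algebra `H` with sub-Hopf algebras `X` and `A`
    (s : CQTStructure k H)
    (ιX : X →ₐc[k] H) (hX : Function.Injective ιX)
    (ιA : A →ₐc[k] H) (hA : Function.Injective ιA) :
    -- `H_{X,A}` is the product of the images of `x ↦ l_x` and `a ↦ r_a`, in either order
    Subalgebra.toSubmodule (s.subalg ιX ιA) =
      LinearMap.range (s.lMap ιX) * LinearMap.range (s.rMap ιA) ∧
    Subalgebra.toSubmodule (s.subalg ιX ιA) =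
      LinearMap.range (s.rMap ιA) * LinearMap.range (s.lMap ιX) ∧
    ∃ (bX : BraidedCategory (RightComod k X))
      (bK : BraidedCategory (YD k (s.HXAcop ιX ιA)))
      (yd : ∀ M : RightComod k X, YDStruct k (s.HXAcop ιX ιA) M.V)
      (hyd : ∀ (M N : RightComod k X) (f : M ⟶ N),
        YDStruct.IsHom (yd M) (yd N) (RightComod.Hom.lin f))
      (hF : (ydFunctor yd hyd).Braided)
      (ad : RightCoaction k X X)
      (hXX : HopfObj (RightComod.mk (ModuleCat.of k X) ad))
      (hFX : HopfObj ((ydFunctor yd hyd).obj (RightComod.mk (ModuleCat.of k X) ad))),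
      let F := ydFunctor yd hyd
      let XX := RightComod.mk (ModuleCat.of k X) ad
      -- the braidings
      (∀ M N : RightComod k X,
        RightComod.Hom.lin (bX.braiding M N).hom = RightComod.braidLin (s.comap ιX hX) M N) ∧
      (∀ M N : YD k (s.HXAcop ιX ιA), YD.Hom.lin (bK.braiding M N).hom = YD.braidLin M N) ∧
      -- the functor and its monoidal structure
      (∀ M f, (yd M).act f = s.actLin ιX ιA hX M f) ∧
      (∀ M, (yd M).coact = s.coactLin ιX ιA hX M) ∧
      YD.Hom.lin hF.ε = (LinearMap.id : k →ₗ[k] k) ∧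
      (∀ M N : RightComod k X,
        YD.Hom.lin (hF.μ M N) = RightComod.twist (s.comap ιX hX).inv M N) ∧
      -- the transmutation of `X`
      ad.coact = CQTStructure.adCoact k X ∧
      RightComod.Hom.lin hXX.mul = (s.comap ιX hX).transMul ∧
      RightComod.Hom.lin hXX.one = Algebra.linearMap k X ∧
      RightComod.Hom.lin hXX.comul = Coalgebra.comul (R := k) (A := X) ∧
      RightComod.Hom.lin hXX.counit = Coalgebra.counit (R := k) (A := X) ∧
      RightComod.Hom.lin hXX.antipode = (s.comap ιX hX).transAntipode ∧
      -- its image under `F`, with the Hopf algebra structure transported by `F`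
      hFX.mul = hF.μ XX XX ≫ F.map hXX.mul ∧
      hFX.one = hF.ε ≫ F.map hXX.one ∧
      hFX.comul = F.map hXX.comul ≫ hF.δ XX XX ∧
      hFX.counit = F.map hXX.counit ≫ hF.η ∧
      hFX.antipode = F.map hXX.antipode ∧
      -- is the braided Hopf algebra induced from the biproduct decomposition of the double
      GenDouble.IsInduced (s.pairing ιX ιA) (s.pairingInv ιX ιA) (s.gamma ιX ιA hX)
        (GenDouble.theta (s.gamma ιX ιA hX) (s.comap ιX hX).antipodeInv) (F.obj XX).str
        (YD.Hom.lin hFX.mul) (YD.Hom.lin hFX.one) (YD.Hom.lin hFX.comul)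
        (YD.Hom.lin hFX.counit) (YD.Hom.lin hFX.antipode) := by
  refine ⟨s.subalg_eq ιX ιA, (s.subalg_eq ιX ιA).trans (s.range_mul_range_comm ιX ιA).symm, ?_⟩
  let bX := RightComod.braided (s.comap ιX hX)
  let bK := YD.braided (s.copAntipodeInv ιX ιA hX hA) (s.antipode_copAntipodeInv ιX ιA hX hA)
    (s.copAntipodeInv_antipode ιX ιA hX hA)
  let hF : (s.toYD ιX ιA hX).Braided := s.toYDBraided ιX ιA hX hA
  let hXX := (s.comap ιX hX).transHopf
  -- The monoidal structure of F is by construction the inverse twist, and the Hopf structure on the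
  -- image is transported along F, so these clauses hold by definition. Only the braiding of
  -- Yetter–Drinfeld modules, the action, the coaction and the comparison with the double need their
  -- lemmas.
  refine ⟨bX, bK, fun M => s.ydOf ιX ιA hX M.str, _, hF, CQTStructure.adCoaction k X, hXX,
    (s.toYD ιX ιA hX).hopfObjObj (CQTStructure.adComod k X), fun _ _ => rfl,
    fun M N => (YD.braidLin_eq_braid M N).symm,
    fun M f => s.ydOf_act_eq ιX ιA hX M f, fun M => s.ydOf_coact_eq ιX ιA hX M, rfl, fun _ _ => rfl,
    rfl, rfl, rfl, rfl, rfl, rfl, rfl, rfl, rfl, rfl, rfl,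
    s.isInduced_transmutation ιX ιA hX⟩
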